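/- A pointed graph $Z$ is a finite directed multigraph (multiple edges and loops allowed) with a distinguished vertex $\bullet$; the other vertices are called ordinary. It is semistable if every ordinary vertex $v$ satisfies $\deg^-(v)\ge 1$, $\deg^+(v)\ge 1$, $\deg^-(v)+\deg^+(v)\ge 3$, and stable if every ordinary vertex satisfies $\deg^-(v)\ge 2$, $\deg^+(v)\ge 2$. Write $V(Z)$ for the set of all vertices (including $\bullet$), $\mathrm{Aut}(Z)$ for the group of automorphisms (of vertices and edges) fixing $\bullet$, and consider pointed graphs up to isomorphism. An edge from $u$ to $v$ is contractible if $u\ne v$ and either $u$ is ordinary with $\deg^+(u)=1$ or $v$ is ordinary with $\deg^-(v)=1$. A semistable pointed graph $Z$ is stabilizable if successively contracting finitely many (possibly no) contractible edges leads to a stable pointed graph, which is called the stabilization graph of $Z$. A pointed graph $Z$ that is semistable defines, for every Kähler metric $(g_{i\bar j})$ on an open set $U\subset\mathbb C^n$, $n\ge 0$, a linear differential operator on $C^\infty(U,\mathbb C)$, also denoted $Z$: to each edge attach an unbarred index $i$ at its tail and a barred index $\bar j$ at its head, to each ordinary vertex the partial derivative $g_{i_1\bar j_1 i_2\cdots i_k\bar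 j_2\cdots\bar j_m}$ of the metric and to $\bullet$ the partial derivative $f_{i_1\cdots i_k\bar j_1\cdots\bar j_m}$ of the function $f$, with the indices of the half-edges at that vertex; multiply these by $g^{i\bar j}$ for every edge and sum over all indices. A family of linear operators on $C^\infty(U,\mathbb C)$, one for every Kähler metric on an open subset of $\mathbb C^n$ and every $n\geq 0$, is called invariant if it commutes with pullback along every biholomorphic change of coordinates (the metric being transformed accordingly), for every $n$. A covariant differential operator is a finite linear combination, with complex coefficients, of operators $Z$ of semistable pointed graphs that is invariant; two such operators are identified if they agree for all metrics in all dimensions, and they are multiplied by composition. (1) Let $c$ be a finitely supported complex-valued function on the set of stabilizable semistable pointed graphs. Then $$\sum_{Z}c(Z)\,\frac{(-1)^{|V(Z)|}}{|\mathrm{Aut}(Z)|}\,Z ,$$ where $Z$ runs over stabilizable semistable pointed graphs, is a covariant differential operator, i.e. is invariant under coordinate transformations, if and only if $c(Z_1)=c(Z_2)$ whenever $Z_1$ and $Z_2$ have the same stabilization graph. (2) Consequently, the stable pointed graphs give a canonical basis of the algebra of covariant differential operators: for every stable pointed graph $\Gamma$ there are only finitely many stabilizable semistable pointed graphs $Z$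 with stabilization graph $\Gamma$, the covariant differential operators form a (unital) algebra under composition, and the operators $$D(\Gamma)=\sum_{Z:\ Z^s=\Gamma}\frac{(-1)^{|V(Z)|-|V(\Gamma)|}\,|\mathrm{Aut}(\Gamma)|}{|\mathrm{Aut}(Z)|}\,Z ,$$ where $\Gamma$ runs over the stable pointed graphs and $Z^s$ denotes the stabilization graph of $Z$, form a basis of it as a complex vector space. -/

import Mathlib

open scoped ContDiff ComplexOrder

noncomputable section

/-! ## Pointed graphs -/

/-- A pointed graph: a finite directed multigraph (multiple edges and loops allowed) with
ordinary vertices `some v`, `v : Fin nV`, one distinguished vertex `none` (labelled by `f`),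
and edges `e : Fin nE` directed from `src e` to `tgt e`. -/
structure PointedGraph where
  nV : ℕ
  nE : ℕ
  src : Fin nE → Option (Fin nV)
  tgt : Fin nE → Option (Fin nV)

namespace PointedGraph

/-- Outward degree (a loop counts once as outward). -/
def outDeg (G : PointedGraph) (v : Option (Fin G.nV)) : ℕ :=
  (Finset.univ.filter fun e => G.src e = v).card

/-- Inward degree (a loop counts once as inward). -/
def inDeg (G : PointedGraph) (v : Option (Fin G.nV)) : ℕ :=
  (Finset.univ.filter fun e => G.tgt e = v).card

/-- Every ordinary vertex is semistable. -/
def IsSemistable (G : PointedGraph) : Prop :=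
  ∀ v : Fin G.nV, 1 ≤ G.inDeg (some v) ∧ 1 ≤ G.outDeg (some v) ∧
    3 ≤ G.inDeg (some v) + G.outDeg (some v)

/-- Every ordinary vertex is stable. -/
def IsStable (G : PointedGraph) : Prop :=
  ∀ v : Fin G.nV, 2 ≤ G.inDeg (some v) ∧ 2 ≤ G.outDeg (some v)

/-- Isomorphisms: bijections of ordinary vertices and of edges compatible with tails and heads;
the distinguished vertex goes to the distinguished vertex. -/
def Iso (G H : PointedGraph) : Type :=
  {p : (Fin G.nV ≃ Fin H.nV) × (Fin G.nE ≃ Fin H.nE) //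
    ∀ e, H.src (p.2 e) = (G.src e).map p.1 ∧ H.tgt (p.2 e) = (G.tgt e).map p.1}

/-- The order of the automorphism group. -/
def autCard (G : PointedGraph) : ℕ := Nat.card (Iso G G)

/-- A directed edge `uv` is contractible if `u ≠ v` and either `u` is ordinary of outward
degree `1` or `v` is ordinary of inward degree `1`. -/
def IsContractible (G : PointedGraph) (e : Fin G.nE) : Prop :=
  G.src e ≠ G.tgt e ∧
    ((G.src e ≠ none ∧ G.outDeg (G.src e) = 1) ∨ (G.tgt e ≠ none ∧ G.inDeg (G.tgt e) = 1))

/-- `G'` is (a copy of) the graph obtained from `G` by contracting the edge `e`: the edge `e` is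
deleted, its two end points, and no others, are identified, and the remaining edges are kept.
If one of the end points is the distinguished vertex, so is the merged vertex. -/
def IsContraction (G : PointedGraph) (e : Fin G.nE) (G' : PointedGraph) : Prop :=
  ∃ (π : Option (Fin G.nV) → Option (Fin G'.nV)) (τ : {x : Fin G.nE // x ≠ e} ≃ Fin G'.nE),
    π none = none ∧ Function.Surjective π ∧
    (∀ x y, π x = π y ↔
      x = y ∨ (x = G.src e ∧ y = G.tgt e) ∨ (x = G.tgt e ∧ y = G.src e)) ∧
    ∀ a, G'.src (τ a) = π (G.src a) ∧ G'.tgt (τ a) = π (G.tgt a)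

/-- `G'` arises from `G` by contracting one contractible edge. -/
def ContractStep (G G' : PointedGraph) : Prop :=
  ∃ e, G.IsContractible e ∧ G.IsContraction e G'

/-- `Γ` is, up to isomorphism, a stable graph reached from `G` by successively contracting
finitely many (possibly no) contractible edges. -/
def StabilizesTo (G Γ : PointedGraph) : Prop :=
  Γ.IsStable ∧ ∃ Γ', Relation.ReflTransGen ContractStep G Γ' ∧ Nonempty (Iso Γ' Γ)

/-- Isomorphism as an equivalence relation. -/
instance isoSetoid : Setoid PointedGraph where
  r G H := Nonempty (Iso G H)
  iseqv :=
    { refl := fun _ => ⟨⟨(Equiv.refl _, Equiv.refl _), by simp⟩⟩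
      symm := by
        rintro G H ⟨⟨⟨p, q⟩, h⟩⟩
        refine ⟨⟨(p.symm, q.symm), fun e => ?_⟩⟩
        have h1 := h (q.symm e)
        simp only [Equiv.apply_symm_apply] at h1
        simp [h1.1, h1.2]
      trans := by
        rintro G H K ⟨⟨⟨p, q⟩, h⟩⟩ ⟨⟨⟨p', q'⟩, h'⟩⟩
        refine ⟨⟨(p.trans p', q.trans q'), fun e => ?_⟩⟩
        have h1 := h e
        have h2 := h' (q e)
        simp only at h1 h2
        simp [h1.1, h1.2, h2.1, h2.2] }

end PointedGraph

/-- Isomorphism classes of pointed graphs. The notions below are invariant under isomorphism,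
and are evaluated on a representative. -/
abbrev PGraph : Type := Quotient PointedGraph.isoSetoid

namespace PGraph

/-- The number of vertices, the distinguished vertex included. -/
def numV (Z : PGraph) : ℕ := Z.out.nV + 1

/-- The order of the automorphism group (automorphisms fix the distinguished vertex). -/
def autCard (Z : PGraph) : ℕ := Z.out.autCard

def IsSemistable (Z : PGraph) : Prop := Z.out.IsSemistable

def IsStable (Z : PGraph) : Prop := Z.out.IsStable

/-- `Γ` is the stabilization graph of `Z`. -/
def StabilizesTo (Z Γ : PGraph) : Prop := Z.out.StabilizesTo Γ.out

/-- A semistable pointed graph is stabilizable if it has a stabilization graph. -/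
def IsStabilizable (Z : PGraph) : Prop := Z.IsSemistable ∧ ∃ Γ, Z.StabilizesTo Γ

end PGraph

/-- Stable pointed graphs, up to isomorphism. -/
abbrev StableGraph : Type := {Z : PGraph // Z.IsStable}

/-- Stabilizable semistable pointed graphs, up to isomorphism. -/
abbrev StabilizableGraph : Type := {Z : PGraph // Z.IsStabilizable}

/-! ## Kähler metrics in local coordinates -/

/-- The Wirtinger derivative `∂h/∂z_k`. -/
def dz {n : ℕ} (k : Fin n) (h : (Fin n → ℂ) → ℂ) : (Fin n → ℂ) → ℂ := fun z =>
  (1 / 2 : ℂ) * (fderiv ℝ h z (Pi.single k 1) - Complex.I * fderiv ℝ h z (Pi.single k Complex.I))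

/-- The Wirtinger derivative `∂h/∂z̄_k`. -/
def dzbar {n : ℕ} (k : Fin n) (h : (Fin n → ℂ) → ℂ) : (Fin n → ℂ) → ℂ := fun z =>
  (1 / 2 : ℂ) * (fderiv ℝ h z (Pi.single k 1) + Complex.I * fderiv ℝ h z (Pi.single k Complex.I))

/-- The iterated derivative of `h` with unbarred indices `I` and barred indices `J`. -/
def wirtinger {n : ℕ} (I J : List (Fin n)) (h : (Fin n → ℂ) → ℂ) : (Fin n → ℂ) → ℂ :=
  I.foldr dz (J.foldr dzbar h)

/-- A coordinate domain of dimension `n` with a (smooth) Kähler metric: `g z i j` is the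
coefficient `g_{i j̄}` at `z`; only its values on `U` matter. The last two fields say that the
Kähler form `(√-1 / 2π) ∑ g_{i j̄} dz_i ∧ dz̄_j` is closed. -/
structure KahlerChart (n : ℕ) where
  U : Set (Fin n → ℂ)
  isOpen : IsOpen U
  g : (Fin n → ℂ) → Matrix (Fin n) (Fin n) ℂ
  smooth_g : ∀ i j, ContDiffOn ℝ ∞ (fun z => g z i j) U
  posDef : ∀ z ∈ U, (g z).PosDef
  closed : ∀ z ∈ U, ∀ i j k, dz k (fun w => g w i j) z = dz i (fun w => g w k j) z
  closed' : ∀ z ∈ U, ∀ i j k, dzbar k (fun w => g w i j) z = dzbar j (fun w => g w i k) z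

namespace KahlerChart

variable {n : ℕ}

/-- The space `C^∞(U, ℂ)`; its elements are extended by zero to the whole space. -/
def smooth (X : KahlerChart n) : Submodule ℂ ((Fin n → ℂ) → ℂ) where
  carrier := {h | ContDiffOn ℝ ∞ h X.U ∧ ∀ z ∉ X.U, h z = 0}
  add_mem' := fun ha hb => ⟨ha.1.add hb.1, fun z hz => by simp [ha.2 z hz, hb.2 z hz]⟩
  zero_mem' := ⟨contDiffOn_const, fun _ _ => rfl⟩
  smul_mem' := fun c _ h => ⟨contDiffOn_const.smul h.1, fun z hz => by simp [h.2 z hz]⟩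

/-- The inverse metric `g^{i j̄}`, normalised by `∑_j g^{i j̄} g_{k j̄} = δ_{ik}`. -/
def gInv (X : KahlerChart n) (i j : Fin n) : (Fin n → ℂ) → ℂ := fun z => (X.g z)⁻¹ j i

/-- The derivative `g_{i₁ j̄₁ i₂ ⋯ i_k j̄₂ ⋯ j̄_m}` of the metric, for `k, m ≥ 1`. By closedness
of the Kähler form it is symmetric in the `i`'s and in the `j̄`'s, so it depends only on the two
multisets of indices. (The value `0` for an empty multiset is never used.) -/
def gJet (X : KahlerChart n) (I J : Multiset (Fin n)) : (Fin n → ℂ) → ℂ :=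
  match I.sort, J.sort with
  | i :: I', j :: J' => wirtinger I' J' (fun z => X.g z i j)
  | _, _ => 0

end KahlerChart

/-- The derivative `f_{i₁ ⋯ i_k j̄₁ ⋯ j̄_m}`, `k, m ≥ 0`. -/
def fJet {n : ℕ} (I J : Multiset (Fin n)) (f : (Fin n → ℂ) → ℂ) : (Fin n → ℂ) → ℂ :=
  wirtinger I.sort J.sort f

/-! ## The differential operator of a pointed graph -/

namespace PointedGraph

variable {n : ℕ}

/-- Indices on the outward half-edges at `v`. -/
def outIdx (G : PointedGraph) (i : Fin G.nE → Fin n) (v : Option (Fin G.nV)) :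
    Multiset (Fin n) :=
  (Finset.univ.filter fun e => G.src e = v).val.map i

/-- Indices on the inward half-edges at `v`. -/
def inIdx (G : PointedGraph) (j : Fin G.nE → Fin n) (v : Option (Fin G.nV)) :
    Multiset (Fin n) :=
  (Finset.univ.filter fun e => G.tgt e = v).val.map j

/-- The expression encoded by a pointed graph: an edge `e` carries an unbarred index `i e` at its
tail and a barred index `j e` at its head, contracted with `g^{i j̄}`; an ordinary vertex is the
partial derivative of the metric, and the distinguished vertex the partial derivative of `f`, with
the indices on the half-edges at it. -/
def eval (G : PointedGraph) (X : KahlerChart n) (f : (Fin n → ℂ) → ℂ) : (Fin n → ℂ) → ℂ :=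
  fun z => ∑ i : Fin G.nE → Fin n, ∑ j : Fin G.nE → Fin n,
    (∏ e, X.gInv (i e) (j e) z) *
      (∏ v : Fin G.nV, X.gJet (G.outIdx i (some v)) (G.inIdx j (some v)) z) *
      fJet (G.outIdx i none) (G.inIdx j none) f z

end PointedGraph

section smoothness

variable {n : ℕ} {U : Set (Fin n → ℂ)}

theorem contDiffOn_fderiv_apply (hU : IsOpen U) {h : (Fin n → ℂ) → ℂ}
    (hh : ContDiffOn ℝ ∞ h U) (v : Fin n → ℂ) :
    ContDiffOn ℝ ∞ (fun z => fderiv ℝ h z v) U :=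
  (hh.fderiv_of_isOpen hU (by simp)).clm_apply contDiffOn_const

theorem contDiffOn_dz (hU : IsOpen U) {h : (Fin n → ℂ) → ℂ}
    (hh : ContDiffOn ℝ ∞ h U) (k : Fin n) : ContDiffOn ℝ ∞ (dz k h) U :=
  contDiffOn_const.mul ((contDiffOn_fderiv_apply hU hh _).sub
    (contDiffOn_const.mul (contDiffOn_fderiv_apply hU hh _)))

theorem contDiffOn_dzbar (hU : IsOpen U) {h : (Fin n → ℂ) → ℂ}
    (hh : ContDiffOn ℝ ∞ h U) (k : Fin n) : ContDiffOn ℝ ∞ (dzbar k h) U :=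
  contDiffOn_const.mul ((contDiffOn_fderiv_apply hU hh _).add
    (contDiffOn_const.mul (contDiffOn_fderiv_apply hU hh _)))

theorem contDiffOn_wirtinger (hU : IsOpen U) {h : (Fin n → ℂ) → ℂ}
    (hh : ContDiffOn ℝ ∞ h U) (I J : List (Fin n)) :
    ContDiffOn ℝ ∞ (wirtinger I J h) U := by
  have hJ : ContDiffOn ℝ ∞ (J.foldr dzbar h) U := by
    induction J with
    | nil => exact hh
    | cons k J ih => exact contDiffOn_dzbar hU ih k
  unfold wirtinger
  induction I with
  | nil => exact hJ
  | cons k I ih => exact contDiffOn_dz hU ih k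

theorem KahlerChart.contDiffOn_gJet (X : KahlerChart n) (I J : Multiset (Fin n)) :
    ContDiffOn ℝ ∞ (X.gJet I J) X.U := by
  unfold KahlerChart.gJet
  split
  · exact contDiffOn_wirtinger X.isOpen (X.smooth_g _ _) _ _
  · exact contDiffOn_const

theorem KahlerChart.contDiffOn_gInv (X : KahlerChart n) (i j : Fin n) :
    ContDiffOn ℝ ∞ (X.gInv i j) X.U := by
  have hdet : ∀ A : (Fin n → ℂ) → Matrix (Fin n) (Fin n) ℂ,
      (∀ a b, ContDiffOn ℝ ∞ (fun z => A z a b) X.U) →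
      ContDiffOn ℝ ∞ (fun z => (A z).det) X.U := by
    intro A hA
    simp only [Matrix.det_apply']
    exact ContDiffOn.sum fun σ _ => contDiffOn_const.mul (contDiffOn_prod fun a _ => hA _ _)
  have hne : ∀ z ∈ X.U, (X.g z).det ≠ 0 := fun z hz => (X.posDef z hz).det_pos.ne'
  have hadj : ContDiffOn ℝ ∞ (fun z => (X.g z).adjugate j i) X.U := by
    simp only [Matrix.adjugate_apply]
    refine hdet _ fun a b => ?_
    by_cases h : a = i
    · subst h
      simpa only [Matrix.updateRow_self] using contDiffOn_const
    · simpa only [Matrix.updateRow_ne h] using X.smooth_g a b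
  have : X.gInv i j = fun z => ((X.g z).det)⁻¹ * (X.g z).adjugate j i := by
    funext z
    simp [KahlerChart.gInv, Matrix.inv_def]
  rw [this]
  exact ((hdet _ X.smooth_g).inv hne).mul hadj

theorem PointedGraph.contDiffOn_eval (G : PointedGraph) (X : KahlerChart n)
    {f : (Fin n → ℂ) → ℂ} (hf : ContDiffOn ℝ ∞ f X.U) :
    ContDiffOn ℝ ∞ (G.eval X f) X.U :=
  ContDiffOn.sum fun _ _ => ContDiffOn.sum fun _ _ =>
    ((contDiffOn_prod fun _ _ => X.contDiffOn_gInv _ _).mul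
      (contDiffOn_prod fun _ _ => X.contDiffOn_gJet _ _)).mul
      (contDiffOn_wirtinger X.isOpen hf _ _)

theorem fderiv_congr_open (hU : IsOpen U) {h h' : (Fin n → ℂ) → ℂ} (e : Set.EqOn h h' U)
    {z : Fin n → ℂ} (hz : z ∈ U) : fderiv ℝ h z = fderiv ℝ h' z :=
  (Filter.eventuallyEq_of_mem (hU.mem_nhds hz) e).fderiv_eq

theorem wirtinger_linear (hU : IsOpen U) {h h' : (Fin n → ℂ) → ℂ}
    (hh : ContDiffOn ℝ ∞ h U) (hh' : ContDiffOn ℝ ∞ h' U) (a : ℂ) (I J : List (Fin n)) :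
    Set.EqOn (wirtinger I J (fun w => a * h w + h' w))
      (fun w => a * wirtinger I J h w + wirtinger I J h' w) U := by
  have key : ∀ (F p q : (Fin n → ℂ) → ℂ), ContDiffOn ℝ ∞ p U → ContDiffOn ℝ ∞ q U →
      Set.EqOn F (fun w => a * p w + q w) U → ∀ z ∈ U, ∀ v,
      fderiv ℝ F z v = a * fderiv ℝ p z v + fderiv ℝ q z v := by
    intro F p q hp hq hF z hz v
    have dp := (hp.differentiableOn (by simp)).differentiableAt (hU.mem_nhds hz)
    have dq := (hq.differentiableOn (by simp)).differentiableAt (hU.mem_nhds hz)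
    have := ((dp.hasFDerivAt.const_mul a).add dq.hasFDerivAt).fderiv
    rw [fderiv_congr_open hU hF hz]
    erw [this]
    simp
  have hbar : Set.EqOn (J.foldr dzbar (fun w => a * h w + h' w))
      (fun w => a * J.foldr dzbar h w + J.foldr dzbar h' w) U := by
    induction J with
    | nil => exact fun z _ => rfl
    | cons k J ih =>
      intro z hz
      have := key _ _ _ (contDiffOn_wirtinger hU hh [] J) (contDiffOn_wirtinger hU hh' [] J) ih z hz
      simp only [wirtinger, List.foldr_nil] at this
      simp only [List.foldr_cons, dzbar, this]
      ring
  unfold wirtinger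
  induction I with
  | nil => exact hbar
  | cons k I ih =>
    intro z hz
    have := key _ _ _ (contDiffOn_wirtinger hU hh I J) (contDiffOn_wirtinger hU hh' I J) ih z hz
    simp only [wirtinger] at this
    simp only [List.foldr_cons, dz, this]
    ring

theorem PointedGraph.eval_linear (G : PointedGraph) (X : KahlerChart n)
    {h h' : (Fin n → ℂ) → ℂ} (hh : ContDiffOn ℝ ∞ h X.U) (hh' : ContDiffOn ℝ ∞ h' X.U) (a : ℂ) :
    Set.EqOn (G.eval X (fun w => a * h w + h' w))
      (fun w => a * G.eval X h w + G.eval X h' w) X.U := by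
  intro z hz
  simp only [PointedGraph.eval, fJet, wirtinger_linear X.isOpen hh hh' a _ _ hz,
    Finset.mul_sum, ← Finset.sum_add_distrib]
  refine Finset.sum_congr rfl fun i _ => Finset.sum_congr rfl fun j _ => ?_
  ring

end smoothness

/-- Universal linear operators: for every Kähler metric on a coordinate domain, of any dimension,
a linear operator on smooth functions. They form an algebra under composition. -/
abbrev Op : Type := ∀ (n : ℕ) (X : KahlerChart n), Module.End ℂ X.smooth

/-- The differential operator of a pointed graph. -/
def PointedGraph.op (G : PointedGraph) : Op := fun n X =>
  { toFun := fun f => ⟨X.U.indicator (G.eval X f),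
      (G.contDiffOn_eval X f.2.1).congr fun z hz => Set.indicator_of_mem hz _,
      fun z hz => Set.indicator_of_notMem hz _⟩
    map_add' := fun f f' => by
      ext z
      by_cases hz : z ∈ X.U
      · have h := G.eval_linear X f.2.1 f'.2.1 1 hz
        simp only [one_mul] at h
        change X.U.indicator (G.eval X fun w => f.1 w + f'.1 w) z =
          X.U.indicator (G.eval X f.1) z + X.U.indicator (G.eval X f'.1) z
        simpa [hz] using h
      · simp [hz]
    map_smul' := fun a f => by
      ext z
      by_cases hz : z ∈ X.U
      · have hc : ContDiffOn ℝ ∞ (fun _ : Fin n → ℂ => (0 : ℂ)) X.U := contDiffOn_const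
        have h := G.eval_linear X f.2.1 hc a hz
        have h0 := G.eval_linear X hc hc 1 hz
        simp only [add_zero, one_mul, mul_zero, left_eq_add] at h h0
        rw [h0, add_zero] at h
        change X.U.indicator (G.eval X fun w => a * f.1 w) z =
          a * X.U.indicator (G.eval X f.1) z
        simpa [hz] using h
      · simp [hz] }

/-- The differential operator of an isomorphism class of pointed graphs. -/
def PGraph.op (Z : PGraph) : Op := Z.out.op

/-! ## Covariance -/

/-- `φ` is a holomorphic change of coordinates with holomorphic inverse `ψ` between the domains of
`X` and `Y` under which the metric of `X` is the metric of `Y` written in the new coordinates: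
`g_{i j̄}(z) = ∑ g_{p q̄}(φ z) ∂_iφ_p conj(∂_jφ_q)`. -/
structure IsCoordChange {n : ℕ} (X Y : KahlerChart n) (φ ψ : (Fin n → ℂ) → (Fin n → ℂ)) :
    Prop where
  holo : AnalyticOnNhd ℂ φ X.U
  holo_inv : AnalyticOnNhd ℂ ψ Y.U
  mapsTo : Set.MapsTo φ X.U Y.U
  mapsTo_inv : Set.MapsTo ψ Y.U X.U
  left_inv : Set.LeftInvOn ψ φ X.U
  right_inv : Set.RightInvOn ψ φ Y.U
  pullback : ∀ z ∈ X.U, ∀ i j, X.g z i j = ∑ p, ∑ q, Y.g (φ z) p q *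
    fderiv ℂ φ z (Pi.single i 1) p * starRingEnd ℂ (fderiv ℂ φ z (Pi.single j 1) q)

/-- Invariance under coordinate transformations, in every dimension. -/
def IsCovariant (P : Op) : Prop :=
  ∀ (n : ℕ) (X Y : KahlerChart n) (φ ψ : (Fin n → ℂ) → (Fin n → ℂ)), IsCoordChange X Y φ ψ →
    ∀ (f : Y.smooth) (h : X.smooth), (∀ z ∈ X.U, h.1 z = f.1 (φ z)) →
      ∀ z ∈ X.U, (P n X h).1 z = (P n Y f).1 (φ z)

/-- The space of covariant differential operators: the linear combinations of semistable pointed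
graphs that are invariant under coordinate transformations. -/
def covariantOps : Submodule ℂ Op where
  carrier := {P | P ∈ Submodule.span ℂ (PGraph.op '' {Z | Z.IsSemistable}) ∧ IsCovariant P}
  add_mem' := fun ha hb => ⟨add_mem ha.1 hb.1, fun n X Y φ ψ hφ f h hfh z hz => by
    simp [ha.2 n X Y φ ψ hφ f h hfh z hz, hb.2 n X Y φ ψ hφ f h hfh z hz]⟩
  zero_mem' := ⟨zero_mem _, fun n X Y φ ψ hφ f h hfh z hz => by simp⟩
  smul_mem' := fun c P hP => ⟨Submodule.smul_mem _ c hP.1, fun n X Y φ ψ hφ f h hfh z hz => by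
    simp [hP.2 n X Y φ ψ hφ f h hfh z hz]⟩

/-- The linear combination `∑ c(Z) (-1)^{|V(Z)|} / |Aut(Z)| · Z`. -/
def graphSum (c : StabilizableGraph →₀ ℂ) : Op :=
  c.sum fun Z a => (a * (-1) ^ Z.1.numV / (Z.1.autCard : ℂ)) • Z.1.op

/-- The stabilizable semistable pointed graphs whose stabilization graph is `Γ`. -/
def stabFiber (Γ : StableGraph) : Set StabilizableGraph := {Z | Z.1.StabilizesTo Γ.1}

/-- `D(Γ) = ∑ (-1)^{|V(Z)| - |V(Γ)|} |Aut(Γ)| / |Aut(Z)| · Z` over the `Z` with stabilization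
graph `Γ`. -/
def stableOp (Γ : StableGraph) : Op :=
  ∑ᶠ Z ∈ stabFiber Γ, ((-1 : ℂ) ^ ((Z.1.numV : ℤ) - (Γ.1.numV : ℤ)) * (Γ.1.autCard : ℂ) /
    (Z.1.autCard : ℂ)) • Z.1.op

end

/-! Stabilization is well defined because contraction of edges is locally confluent on semistable
graphs (`contractStep_diamond`). A contraction keeps the number of edges minus the number of
vertices, and semistability bounds the vertices in terms of the edges, so every stable graph has
only finitely many preimages.

Sufficiency of the condition on `c`. By orbit counting, the sum over the graphs stabilizing to Γ
with weights ±1/|Aut| equals a sum over labelled graphs with weights ±1/(a! b!), for a ordinary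
vertices and b edges. Near a point z₀ a change of coordinates φ is joined to a translation by the
affine family (1-s)·translation + s·φ with complex s. Every member of the family sends z₀ to φ(z₀),
and the parameters with degenerate differential at z₀ form a finite set, which does not disconnect
ℂ. It remains to see that the derivative in s vanishes; this derivative is the variation under a
holomorphic vector field v that is zero at z₀. By the Leibniz rule the variation of the tensor at a
vertex x is a sum over sets S of outward half-edges at x whose derivatives fall on v. The empty set
gives zero, and the one-element sets cancel the variation of the inverse metric. A larger set S can
be moved to a new vertex of inward degree one, joined to x by a contractible edge; if x itself is
ordinary of inward degree one and S is everything that leaves it, x already plays the role of that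
new vertex. So the terms of a graph and of its contraction agree, with equal `c` and opposite signs,
and the sum telescopes in the number of vertices (`sum_dgev_eq_zero`, `labelledSum_coordChange`).
Conjugation, which reverses all edges, treats the antiholomorphic derivative.

Necessity and the basis rest on two facts. First, operators of non-isomorphic semistable graphs are
linearly independent (`linearIndependent_op`): the vertices of a graph are encoded as monomials of a
Kähler potential, in a space with one coordinate per edge. Second, in Bochner coordinates at a point
the derivatives of the metric with a single barred or a single unbarred index vanish to any
prescribed order (`exists_bochner_chart`), so a covariant combination without stable terms is zero
(`eq_zero_of_isCovariant_ofCoeff`). As D(Γ) has coefficient 1 at Γ and 0 at every other stable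
graph, subtracting suitable multiples of the D(Γ) from a covariant operator leaves zero. Comparison
of coefficients then gives linear independence of the D(Γ) and the necessity in the first statement.

For closure under composition, the derivatives of the expression of a semistable graph are expanded
into semistable graphs with legs (`legSpan_fJet_eval`), which are glued into the distinguished
vertex of the outer graph (`op_mul_op_mem_span`). -/

noncomputable section

/-! ## Wirtinger calculus -/

/-- The first order operator `½ (∂/∂x_k + ε ∂/∂y_k)`, which is `dz k` for `ε = -i` and `dzbar k` for
`ε = i`. -/
def wirt {n : ℕ} (ε : ℂ) (k : Fin n) (h : (Fin n → ℂ) → ℂ) : (Fin n → ℂ) → ℂ := fun z =>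
  (1 / 2 : ℂ) * (fderiv ℝ h z (Pi.single k 1) + ε * fderiv ℝ h z (Pi.single k Complex.I))

theorem dz_eq_wirt {n : ℕ} (k : Fin n) : dz k = wirt (-Complex.I) k := by
  funext h z; simp [dz, wirt, sub_eq_add_neg]

theorem dzbar_eq_wirt {n : ℕ} (k : Fin n) : dzbar k = wirt Complex.I k := by
  funext h z; simp [dzbar, wirt]

section wirt

variable {n : ℕ} {ε : ℂ} {k : Fin n} {h h' : (Fin n → ℂ) → ℂ} {z : Fin n → ℂ}
  {U : Set (Fin n → ℂ)}

theorem wirt_congr (e : h =ᶠ[nhds z] h') : wirt ε k h z = wirt ε k h' z := by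
  simp only [wirt, e.fderiv_eq]

theorem wirt_eqOn (hU : IsOpen U) (e : Set.EqOn h h' U) :
    Set.EqOn (wirt ε k h) (wirt ε k h') U := fun _ hz =>
  wirt_congr (Filter.eventuallyEq_of_mem (hU.mem_nhds hz) e)

theorem contDiffOn_wirt (hU : IsOpen U) (hh : ContDiffOn ℝ ∞ h U) (ε : ℂ) (k : Fin n) :
    ContDiffOn ℝ ∞ (wirt ε k h) U :=
  contDiffOn_const.mul ((contDiffOn_fderiv_apply hU hh _).add
    (contDiffOn_const.mul (contDiffOn_fderiv_apply hU hh _)))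

theorem diffAt_of_smooth (hU : IsOpen U) (hh : ContDiffOn ℝ ∞ h U) (hz : z ∈ U) :
    DifferentiableAt ℝ h z :=
  (hh.differentiableOn (by simp)).differentiableAt (hU.mem_nhds hz)

theorem wirt_const (c : ℂ) : wirt ε k (fun _ => c) z = 0 := by
  simp [wirt]

theorem wirt_add (hh : DifferentiableAt ℝ h z) (hh' : DifferentiableAt ℝ h' z) :
    wirt ε k (fun w => h w + h' w) z = wirt ε k h z + wirt ε k h' z := by
  simp only [wirt, fderiv_fun_add hh hh', add_apply]; ring

theorem wirt_sum {ι : Type*} (s : Finset ι) (F : ι → (Fin n → ℂ) → ℂ)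
    (hF : ∀ a ∈ s, DifferentiableAt ℝ (F a) z) :
    wirt ε k (fun w => ∑ a ∈ s, F a w) z = ∑ a ∈ s, wirt ε k (F a) z := by
  simp only [wirt, fderiv_fun_sum hF, sum_apply, Finset.mul_sum,
    ← Finset.sum_add_distrib]

theorem wirt_mul (hh : DifferentiableAt ℝ h z) (hh' : DifferentiableAt ℝ h' z) :
    wirt ε k (fun w => h w * h' w) z = wirt ε k h z * h' z + h z * wirt ε k h' z := by
  simp only [wirt, fderiv_fun_mul hh hh', add_apply,
    smul_apply, smul_eq_mul]; ring

theorem wirt_const_mul (c : ℂ) (hh : DifferentiableAt ℝ h z) :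
    wirt ε k (fun w => c * h w) z = c * wirt ε k h z := by
  rw [wirt_mul (differentiableAt_const c) hh, wirt_const, zero_mul, zero_add]

theorem wirt_prod {ι : Type*} [DecidableEq ι] (s : Finset ι) (F : ι → (Fin n → ℂ) → ℂ)
    (hF : ∀ a ∈ s, DifferentiableAt ℝ (F a) z) :
    wirt ε k (fun w => ∏ a ∈ s, F a w) z =
      ∑ a ∈ s, wirt ε k (F a) z * ∏ b ∈ s.erase a, F b z := by
  have hfd : fderiv ℝ (fun w => ∏ a ∈ s, F a w) z =
      ∑ a ∈ s, (∏ b ∈ s.erase a, F b z) • fderiv ℝ (F a) z :=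
    (HasFDerivAt.finsetProd fun a ha => (hF a ha).hasFDerivAt).fderiv
  simp only [wirt, hfd, sum_apply, smul_apply, smul_eq_mul,
    Finset.mul_sum, ← Finset.sum_add_distrib]
  refine Finset.sum_congr rfl fun a _ => ?_
  ring

/-- Both operators are combinations with constant coefficients of directional derivatives, so this
is the symmetry of the second real derivative. -/
theorem wirt_comm (hU : IsOpen U) (hh : ContDiffOn ℝ ∞ h U) (ε ε' : ℂ) (k l : Fin n) :
    Set.EqOn (wirt ε k (wirt ε' l h)) (wirt ε' l (wirt ε k h)) U := by
  intro z hz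
  have hd : DifferentiableAt ℝ (fderiv ℝ h) z :=
    ((hh.fderiv_of_isOpen hU (m := ∞) (by simp)).differentiableOn (by simp)).differentiableAt
      (hU.mem_nhds hz)
  have hsym : IsSymmSndFDerivAt ℝ h z :=
    ((hh.contDiffAt (hU.mem_nhds hz))).isSymmSndFDerivAt (by simp; exact WithTop.coe_le_coe.2 le_top)
  have key : ∀ (η : ℂ) (m : Fin n) (v : Fin n → ℂ), fderiv ℝ (wirt η m h) z v =
      (1 / 2 : ℂ) * (fderiv ℝ (fderiv ℝ h) z v (Pi.single m 1) +
        η * fderiv ℝ (fderiv ℝ h) z v (Pi.single m Complex.I)) := by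
    intro η m v
    have h1 : ∀ u, HasFDerivAt (fun w => fderiv ℝ h w u)
        ((fderiv ℝ (fderiv ℝ h) z).flip u) z := fun u => by
      have := hd.hasFDerivAt.clm_apply (hasFDerivAt_const u z)
      simpa using this
    have h2 := (((h1 (Pi.single m 1)).add ((h1 (Pi.single m Complex.I)).const_mul η)).const_mul
      (1 / 2 : ℂ)).fderiv
    have h3 : wirt η m h = fun w => (1 / 2 : ℂ) * (fderiv ℝ h w (Pi.single m 1) +
      η * fderiv ℝ h w (Pi.single m Complex.I)) := rfl
    rw [h3]
    erw [h2]
    simp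
    ring
  simp only [wirt] at key ⊢
  simp only [key]
  rw [hsym (Pi.single k 1) (Pi.single l 1), hsym (Pi.single k 1) (Pi.single l Complex.I),
    hsym (Pi.single k Complex.I) (Pi.single l 1),
    hsym (Pi.single k Complex.I) (Pi.single l Complex.I)]
  ring

theorem wirt_conj (hh : DifferentiableAt ℝ h z) :
    wirt ε k (fun w => starRingEnd ℂ (h w)) z =
      starRingEnd ℂ (wirt (starRingEnd ℂ ε) k h z) := by
  have : fderiv ℝ (fun w => starRingEnd ℂ (h w)) z =
      Complex.conjCLE.toContinuousLinearMap.comp (fderiv ℝ h z) :=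
    (Complex.conjCLE.toContinuousLinearMap.hasFDerivAt.comp z hh.hasFDerivAt).fderiv
  have h2 : (starRingEnd ℂ) 2 = 2 := map_ofNat _ 2
  simp [wirt, this, h2]

theorem contDiffOn_conj (hh : ContDiffOn ℝ ∞ h U) :
    ContDiffOn ℝ ∞ (fun w => starRingEnd ℂ (h w)) U :=
  Complex.conjCLE.contDiff.comp_contDiffOn hh

theorem dz_conj (hh : DifferentiableAt ℝ h z) :
    dz k (fun w => starRingEnd ℂ (h w)) z = starRingEnd ℂ (dzbar k h z) := by
  rw [dz_eq_wirt, dzbar_eq_wirt, wirt_conj hh]; simp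

theorem dzbar_conj (hh : DifferentiableAt ℝ h z) :
    dzbar k (fun w => starRingEnd ℂ (h w)) z = starRingEnd ℂ (dz k h z) := by
  rw [dz_eq_wirt, dzbar_eq_wirt, wirt_conj hh]; simp

end wirt

/-! ### Iterated derivatives -/

section fJet

variable {n : ℕ} {h h' : (Fin n → ℂ) → ℂ} {U : Set (Fin n → ℂ)}

theorem wirtinger_eq (I J : List (Fin n)) (h : (Fin n → ℂ) → ℂ) :
    wirtinger I J h = I.foldr (wirt (-Complex.I)) (J.foldr (wirt Complex.I) h) := by
  have h1 : (dz : Fin n → _) = wirt (-Complex.I) := funext dz_eq_wirt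
  have h2 : (dzbar : Fin n → _) = wirt Complex.I := funext dzbar_eq_wirt
  rw [wirtinger, h1, h2]

theorem contDiffOn_foldr_wirt (hU : IsOpen U) (hh : ContDiffOn ℝ ∞ h U) (ε : ℂ)
    (L : List (Fin n)) : ContDiffOn ℝ ∞ (L.foldr (wirt ε) h) U := by
  induction L with
  | nil => exact hh
  | cons k L ih => exact contDiffOn_wirt hU ih ε k

theorem foldr_wirt_eqOn (hU : IsOpen U) (e : Set.EqOn h h' U) (ε : ℂ) (L : List (Fin n)) :
    Set.EqOn (L.foldr (wirt ε) h) (L.foldr (wirt ε) h') U := by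
  induction L with
  | nil => exact e
  | cons k L ih => exact wirt_eqOn hU ih

theorem foldr_wirt_perm (hU : IsOpen U) (hh : ContDiffOn ℝ ∞ h U) (ε : ℂ)
    {L L' : List (Fin n)} (p : L.Perm L') :
    Set.EqOn (L.foldr (wirt ε) h) (L'.foldr (wirt ε) h) U := by
  induction p with
  | nil => exact fun _ _ => rfl
  | cons k _ ih => exact wirt_eqOn hU ih
  | swap k l L => exact wirt_comm hU (contDiffOn_foldr_wirt hU hh ε L) ε ε l k
  | trans _ _ ih ih' => exact ih.trans ih'

theorem wirt_foldr_wirt (hU : IsOpen U) (hh : ContDiffOn ℝ ∞ h U) (ε ε' : ℂ) (k : Fin n)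
    (L : List (Fin n)) :
    Set.EqOn (wirt ε k (L.foldr (wirt ε') h)) (L.foldr (wirt ε') (wirt ε k h)) U := by
  induction L with
  | nil => exact fun _ _ => rfl
  | cons l L ih =>
    exact (wirt_comm hU (contDiffOn_foldr_wirt hU hh ε' L) ε ε' k l).trans (wirt_eqOn hU ih)

theorem contDiffOn_fJet (hU : IsOpen U) (hh : ContDiffOn ℝ ∞ h U) (I J : Multiset (Fin n)) :
    ContDiffOn ℝ ∞ (fJet I J h) U :=
  contDiffOn_wirtinger hU hh _ _

theorem fJet_eqOn (hU : IsOpen U) (e : Set.EqOn h h' U) (I J : Multiset (Fin n)) :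
    Set.EqOn (fJet I J h) (fJet I J h') U := by
  simp only [fJet, wirtinger_eq]
  exact foldr_wirt_eqOn hU (foldr_wirt_eqOn hU e _ _) _ _

/-- `fJet` reads its multisets through `sort`. Since derivatives commute, the order is immaterial,
and this turns `fJet` into a recursion on `Multiset.cons`. -/
theorem wirtinger_eqOn_fJet (hU : IsOpen U) (hh : ContDiffOn ℝ ∞ h U) (I J : List (Fin n)) :
    Set.EqOn (wirtinger I J h) (fJet (I : Multiset (Fin n)) (J : Multiset (Fin n)) h) U := by
  have hp : ∀ L : List (Fin n), L.Perm (Multiset.sort (L : Multiset (Fin n))) := fun L => by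
    rw [← Multiset.coe_eq_coe, Multiset.sort_eq]
  simp only [fJet, wirtinger_eq]
  exact (foldr_wirt_perm hU (contDiffOn_foldr_wirt hU hh _ _) _ (hp I)).trans
    (foldr_wirt_eqOn hU (foldr_wirt_perm hU hh _ (hp J)) _ _)

@[simp] theorem fJet_zero : fJet (0 : Multiset (Fin n)) 0 h = h := by
  simp [fJet, wirtinger]

theorem fJet_cons_left (hU : IsOpen U) (hh : ContDiffOn ℝ ∞ h U) (k : Fin n)
    (I J : Multiset (Fin n)) : Set.EqOn (fJet (k ::ₘ I) J h) (dz k (fJet I J h)) U := by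
  have h1 := wirtinger_eqOn_fJet hU hh (k :: I.sort) J.sort
  have h2 : ((k :: I.sort : List (Fin n)) : Multiset (Fin n)) = k ::ₘ I := by
    rw [← Multiset.cons_coe, Multiset.sort_eq]
  rw [h2, Multiset.sort_eq] at h1
  exact h1.symm

theorem fJet_cons_right (hU : IsOpen U) (hh : ContDiffOn ℝ ∞ h U) (k : Fin n)
    (I J : Multiset (Fin n)) : Set.EqOn (fJet I (k ::ₘ J) h) (dzbar k (fJet I J h)) U := by
  have h1 := wirtinger_eqOn_fJet hU hh I.sort (k :: J.sort)
  have h2 : ((k :: J.sort : List (Fin n)) : Multiset (Fin n)) = k ::ₘ J := by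
    rw [← Multiset.cons_coe, Multiset.sort_eq]
  rw [h2, Multiset.sort_eq] at h1
  refine h1.symm.trans ?_
  simp only [fJet, wirtinger_eq, List.foldr_cons, dzbar_eq_wirt]
  exact (wirt_foldr_wirt hU (contDiffOn_foldr_wirt hU hh _ _) _ _ _ _).symm

/-- Here the extra derivative acts first instead of last. Closedness is a relation between first
derivatives of the metric, so it can be substituted only in this innermost position. -/
theorem fJet_cons_left' (hU : IsOpen U) (hh : ContDiffOn ℝ ∞ h U) (k : Fin n)
    (I J : Multiset (Fin n)) : Set.EqOn (fJet (k ::ₘ I) J h) (fJet I J (dz k h)) U := by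
  refine (fJet_cons_left hU hh k I J).trans ?_
  simp only [fJet, wirtinger_eq, dz_eq_wirt]
  exact (wirt_foldr_wirt hU (contDiffOn_foldr_wirt hU hh _ _) _ _ _ _).trans
    (foldr_wirt_eqOn hU (wirt_foldr_wirt hU hh _ _ _ _) _ _)

theorem fJet_cons_right' (hU : IsOpen U) (hh : ContDiffOn ℝ ∞ h U) (k : Fin n)
    (I J : Multiset (Fin n)) : Set.EqOn (fJet I (k ::ₘ J) h) (fJet I J (dzbar k h)) U := by
  refine (fJet_cons_right hU hh k I J).trans ?_
  simp only [fJet, wirtinger_eq, dzbar_eq_wirt]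
  exact (wirt_foldr_wirt hU (contDiffOn_foldr_wirt hU hh _ _) _ _ _ _).trans
    (foldr_wirt_eqOn hU (wirt_foldr_wirt hU hh _ _ _ _) _ _)

/-- Induction on the pair of multisets of indices of a jet. -/
theorem jet_induction {n : ℕ} {p : Multiset (Fin n) → Multiset (Fin n) → Prop} (h0 : p 0 0)
    (hl : ∀ k I J, p I J → p (k ::ₘ I) J) (hr : ∀ k J, p 0 J → p 0 (k ::ₘ J))
    (I J : Multiset (Fin n)) : p I J := by
  induction I using Multiset.induction with
  | empty =>
    induction J using Multiset.induction with
    | empty => exact h0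
    | cons k J ih => exact hr k J ih
  | cons k I ih => exact hl k I J ih

theorem fJet_sum {ι : Type*} (hU : IsOpen U) (s : Finset ι) (F : ι → (Fin n → ℂ) → ℂ)
    (hF : ∀ a ∈ s, ContDiffOn ℝ ∞ (F a) U) (I J : Multiset (Fin n)) :
    Set.EqOn (fJet I J (fun w => ∑ a ∈ s, F a w)) (fun w => ∑ a ∈ s, fJet I J (F a) w) U := by
  have hs : ContDiffOn ℝ ∞ (fun w => ∑ a ∈ s, F a w) U := ContDiffOn.sum hF
  refine jet_induction (p := fun I J => Set.EqOn (fJet I J (fun w => ∑ a ∈ s, F a w))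
    (fun w => ∑ a ∈ s, fJet I J (F a) w) U) (fun z _ => by simp) ?_ ?_ I J
  · intro k I J ih z hz
    simp only [fJet_cons_left hU hs k I J hz]
    rw [dz_eq_wirt, wirt_eqOn hU ih hz,
      wirt_sum s _ fun a ha => diffAt_of_smooth hU (contDiffOn_fJet hU (hF a ha) _ _) hz]
    exact Finset.sum_congr rfl fun a ha => by
      rw [fJet_cons_left hU (hF a ha) k I J hz, dz_eq_wirt]
  · intro k J ih z hz
    simp only [fJet_cons_right hU hs k 0 J hz]
    rw [dzbar_eq_wirt, wirt_eqOn hU ih hz,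
      wirt_sum s _ fun a ha => diffAt_of_smooth hU (contDiffOn_fJet hU (hF a ha) _ _) hz]
    exact Finset.sum_congr rfl fun a ha => by
      rw [fJet_cons_right hU (hF a ha) k 0 J hz, dzbar_eq_wirt]

theorem fJet_conj (hU : IsOpen U) (hh : ContDiffOn ℝ ∞ h U) (I J : Multiset (Fin n)) :
    Set.EqOn (fJet I J (fun w => starRingEnd ℂ (h w)))
      (fun w => starRingEnd ℂ (fJet J I h w)) U := by
  have hc := contDiffOn_conj hh
  refine jet_induction (p := fun I J => Set.EqOn (fJet I J (fun w => starRingEnd ℂ (h w)))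
      (fun w => starRingEnd ℂ (fJet J I h w)) U) (fun z _ => by simp) ?_ ?_ I J
  · intro k I J ih z hz
    simp only [fJet_cons_left hU hc k I J hz]
    rw [dz_eq_wirt, wirt_eqOn hU ih hz, ← dz_eq_wirt,
      dz_conj (diffAt_of_smooth hU (contDiffOn_fJet hU hh _ _) hz), fJet_cons_right hU hh k J I hz]
  · intro k J ih z hz
    simp only [fJet_cons_right hU hc k 0 J hz]
    rw [dzbar_eq_wirt, wirt_eqOn hU ih hz, ← dzbar_eq_wirt,
      dzbar_conj (diffAt_of_smooth hU (contDiffOn_fJet hU hh _ _) hz), fJet_cons_left hU hh k J 0 hz]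

end fJet

/-! ### Holomorphic functions -/

/-- Smooth solutions of the Cauchy–Riemann equations on `U`. -/
def Hol {n : ℕ} (U : Set (Fin n → ℂ)) (h : (Fin n → ℂ) → ℂ) : Prop :=
  ContDiffOn ℝ ∞ h U ∧ ∀ z ∈ U, ∀ k, dzbar k h z = 0

section Hol

variable {n : ℕ} {h h' : (Fin n → ℂ) → ℂ} {U : Set (Fin n → ℂ)}

theorem Hol.diffAt (hU : IsOpen U) (H : Hol U h) {z : Fin n → ℂ} (hz : z ∈ U) :
    DifferentiableAt ℝ h z := diffAt_of_smooth hU H.1 hz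

theorem hol_const (c : ℂ) : Hol U (fun _ => c) :=
  ⟨contDiffOn_const, fun z _ k => by rw [dzbar_eq_wirt, wirt_const]⟩

theorem Hol.congr (hU : IsOpen U) (H : Hol U h) (e : Set.EqOn h' h U) : Hol U h' :=
  ⟨H.1.congr e, fun z hz k => by
    rw [dzbar_eq_wirt, wirt_eqOn hU e hz, ← dzbar_eq_wirt, H.2 z hz]⟩

theorem Hol.mul (hU : IsOpen U) (H : Hol U h) (H' : Hol U h') : Hol U (fun w => h w * h' w) :=
  ⟨H.1.mul H'.1, fun z hz k => by
    have := H.2 z hz k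
    have := H'.2 z hz k
    rw [dzbar_eq_wirt] at *
    simp_all [wirt_mul (H.diffAt hU hz) (H'.diffAt hU hz)]⟩

theorem Hol.sum {ι : Type*} (hU : IsOpen U) (s : Finset ι) (F : ι → (Fin n → ℂ) → ℂ)
    (hF : ∀ a ∈ s, Hol U (F a)) : Hol U (fun w => ∑ a ∈ s, F a w) :=
  ⟨ContDiffOn.sum fun a ha => (hF a ha).1, fun z hz k => by
    rw [dzbar_eq_wirt, wirt_sum s F fun a ha => (hF a ha).diffAt hU hz]
    exact Finset.sum_eq_zero fun a ha => by rw [← dzbar_eq_wirt, (hF a ha).2 z hz]⟩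

theorem Hol.prod {ι : Type*} (hU : IsOpen U) (s : Finset ι) (F : ι → (Fin n → ℂ) → ℂ)
    (hF : ∀ a ∈ s, Hol U (F a)) : Hol U (fun w => ∏ a ∈ s, F a w) := by
  classical
  refine ⟨contDiffOn_prod fun a ha => (hF a ha).1, fun z hz k => ?_⟩
  rw [dzbar_eq_wirt, wirt_prod s F fun a ha => (hF a ha).diffAt hU hz]
  exact Finset.sum_eq_zero fun a ha => by rw [← dzbar_eq_wirt, (hF a ha).2 z hz, zero_mul]

theorem Hol.dz (hU : IsOpen U) (H : Hol U h) (l : Fin n) : Hol U (dz l h) :=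
  ⟨contDiffOn_dz hU H.1 l, fun z hz k => by
    rw [dzbar_eq_wirt, dz_eq_wirt, wirt_comm hU H.1 _ _ _ _ hz, ← dzbar_eq_wirt,
      wirt_eqOn hU (h' := fun _ => 0) (fun w hw => H.2 w hw k) hz, wirt_const]⟩

/-- Apply `dzbar` to the product of `h` and its inverse, which is constant. -/
theorem Hol.inv (hU : IsOpen U) (H : Hol U h) (h0 : ∀ z ∈ U, h z ≠ 0) :
    Hol U (fun w => (h w)⁻¹) := by
  have hs : ContDiffOn ℝ ∞ (fun w => (h w)⁻¹) U := H.1.inv h0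
  refine ⟨hs, fun z hz k => ?_⟩
  have h1 : Set.EqOn (fun w => h w * (h w)⁻¹) (fun _ => 1) U := fun w hw =>
    mul_inv_cancel₀ (h0 w hw)
  have h2 := wirt_eqOn (ε := Complex.I) (k := k) hU h1 hz
  rw [wirt_mul (H.diffAt hU hz) (diffAt_of_smooth hU hs hz), wirt_const, ← dzbar_eq_wirt,
    H.2 z hz, zero_mul, zero_add] at h2
  exact (mul_eq_zero.1 h2).resolve_left (h0 z hz)

theorem Hol.matrix_inv {m : ℕ} (hU : IsOpen U) (A : (Fin n → ℂ) → Matrix (Fin m) (Fin m) ℂ)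
    (hA : ∀ a b, Hol U (fun z => A z a b)) (h0 : ∀ z ∈ U, (A z).det ≠ 0) (i j : Fin m) :
    Hol U (fun z => (A z)⁻¹ i j) := by
  have hdet : ∀ A : (Fin n → ℂ) → Matrix (Fin m) (Fin m) ℂ,
      (∀ a b, Hol U (fun z => A z a b)) → Hol U (fun z => (A z).det) := by
    intro A hA
    simp only [Matrix.det_apply']
    exact Hol.sum hU _ _ fun σ _ => (hol_const _).mul hU (Hol.prod hU _ _ fun a _ => hA _ _)
  have hadj : Hol U (fun z => (A z).adjugate i j) := by
    simp only [Matrix.adjugate_apply]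
    refine hdet _ fun a b => ?_
    by_cases h : a = j
    · subst h
      simpa only [Matrix.updateRow_self] using hol_const _
    · simpa only [Matrix.updateRow_ne h] using hA a b
  refine ((hdet A hA).inv hU h0).mul hU hadj |>.congr hU fun z _ => ?_
  simp [Matrix.inv_def]

/-- The Leibniz rule for the product with a holomorphic function. -/
theorem fJet_hol_mul {E : Type*} [DecidableEq E] (hU : IsOpen U) (H : Hol U h)
    (hh' : ContDiffOn ℝ ∞ h' U) (i : E → Fin n) (S : Finset E) (J : Multiset (Fin n)) :
    Set.EqOn (fJet (S.val.map i) J (fun w => h w * h' w))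
      (fun w => ∑ R ∈ S.powerset, fJet (R.val.map i) 0 h w * fJet ((S \ R).val.map i) J h' w)
      U := by
  have hp : ContDiffOn ℝ ∞ (fun w => h w * h' w) U := H.1.mul hh'
  induction S using Finset.induction with
  | empty =>
    simp only [Finset.empty_val, Multiset.map_zero, Finset.powerset_empty, Finset.sum_singleton,
      fJet_zero, sdiff_self, Finset.bot_eq_empty]
    -- Barred derivatives annihilate the holomorphic factor, so all of `J` falls on `h'`.
    induction J using Multiset.induction with
    | empty => exact fun z _ => by simp
    | cons k J ih =>
      intro z hz
      have hk := H.2 z hz k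
      simp only [fJet_cons_right hU hp k 0 J hz, fJet_cons_right hU hh' k 0 J hz]
      rw [dzbar_eq_wirt] at *
      rw [wirt_eqOn hU ih hz, wirt_mul (H.diffAt hU hz)
        (diffAt_of_smooth hU (contDiffOn_fJet hU hh' _ _) hz), hk]
      simp
  | insert e S he ih =>
    intro z hz
    have hv : (insert e S).val.map i = i e ::ₘ S.val.map i := by
      simp [Finset.insert_val, Multiset.ndinsert_of_notMem (show e ∉ S.val from he)]
    have h1 : ∀ R : Finset E, DifferentiableAt ℝ (fJet (R.val.map i) 0 h) z := fun R =>
      diffAt_of_smooth hU (contDiffOn_fJet hU H.1 _ _) hz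
    have h2 : ∀ R : Finset E, DifferentiableAt ℝ (fJet (R.val.map i) J h') z := fun R =>
      diffAt_of_smooth hU (contDiffOn_fJet hU hh' _ _) hz
    simp only [hv, fJet_cons_left hU hp _ _ J hz]
    -- A subset of `insert e S` contains `e` when the new derivative falls on `h`, and omits it when
    -- the derivative falls on `h'`: these are the two terms of the product rule.
    rw [dz_eq_wirt, wirt_eqOn hU ih hz, wirt_sum _ _ fun R _ => (h1 R).fun_mul (h2 _),
      Finset.sum_powerset_insert he, ← Finset.sum_add_distrib]
    refine Finset.sum_congr rfl fun R hR => ?_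
    have hRe : e ∉ R := fun h => he (Finset.mem_powerset.1 hR h)
    have e1 : (insert e S \ R) = insert e (S \ R) := Finset.insert_sdiff_of_notMem _ hRe
    have e2 : (insert e S \ insert e R) = S \ R := by
      ext a; simp only [Finset.mem_sdiff, Finset.mem_insert]; grind
    have hv' : ∀ S : Finset E, e ∉ S → (insert e S).val.map i = i e ::ₘ S.val.map i := fun S he => by
      simp [Finset.insert_val, Multiset.ndinsert_of_notMem (show e ∉ S.val from he)]
    rw [wirt_mul (h1 R) (h2 _), e1, e2, hv' _ hRe, hv' _ (by simp [he]),
      fJet_cons_left hU H.1 _ _ _ hz, fJet_cons_left hU hh' _ _ _ hz, dz_eq_wirt]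
    ring

end Hol

/-! ### Jets of closed matrix functions -/

/-- The iterated derivative of a closed matrix-valued function, as in `KahlerChart.gJet`. -/
def mJet {n : ℕ} (g : (Fin n → ℂ) → Matrix (Fin n) (Fin n) ℂ) (I J : Multiset (Fin n)) :
    (Fin n → ℂ) → ℂ :=
  match I.sort, J.sort with
  | i :: I', j :: J' => wirtinger I' J' (fun z => g z i j)
  | _, _ => 0

/-- Smooth matrix functions whose associated `(1,1)`-form is closed. -/
structure IsClosedForm {n : ℕ} (U : Set (Fin n → ℂ))
    (g : (Fin n → ℂ) → Matrix (Fin n) (Fin n) ℂ) : Prop where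
  smooth : ∀ i j, ContDiffOn ℝ ∞ (fun z => g z i j) U
  closed : ∀ z ∈ U, ∀ i j k, dz k (fun w => g w i j) z = dz i (fun w => g w k j) z
  closed' : ∀ z ∈ U, ∀ i j k, dzbar k (fun w => g w i j) z = dzbar j (fun w => g w i k) z

theorem KahlerChart.isClosedForm {n : ℕ} (X : KahlerChart n) : IsClosedForm X.U X.g :=
  ⟨X.smooth_g, X.closed, X.closed'⟩

theorem KahlerChart.gJet_eq {n : ℕ} (X : KahlerChart n) (I J : Multiset (Fin n)) :
    X.gJet I J = mJet X.g I J := rfl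

section mJet

variable {n : ℕ} {g : (Fin n → ℂ) → Matrix (Fin n) (Fin n) ℂ} {U : Set (Fin n → ℂ)}

/-- Any unbarred index may serve as the matrix index of the metric: exchanging it with a
differentiation index is one application of closedness. -/
theorem fJet_closed_left (hU : IsOpen U) (hg : IsClosedForm U g) {i i' : Fin n}
    {I I' : Multiset (Fin n)} (e : i ::ₘ I = i' ::ₘ I') (j : Fin n) (J : Multiset (Fin n)) :
    Set.EqOn (fJet I J (fun z => g z i j)) (fJet I' J (fun z => g z i' j)) U := by
  rcases Multiset.cons_eq_cons.1 e with ⟨rfl, rfl⟩ | ⟨_, K, rfl, rfl⟩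
  · exact fun _ _ => rfl
  · refine (fJet_cons_left' hU (hg.smooth _ _) _ _ _).trans
      (Set.EqOn.trans ?_ (fJet_cons_left' hU (hg.smooth _ _) _ _ _).symm)
    exact fJet_eqOn hU (fun z hz => hg.closed z hz _ _ _) _ _

theorem fJet_closed_right (hU : IsOpen U) (hg : IsClosedForm U g) {j j' : Fin n}
    {J J' : Multiset (Fin n)} (e : j ::ₘ J = j' ::ₘ J') (i : Fin n) (I : Multiset (Fin n)) :
    Set.EqOn (fJet I J (fun z => g z i j)) (fJet I J' (fun z => g z i j')) U := by
  rcases Multiset.cons_eq_cons.1 e with ⟨rfl, rfl⟩ | ⟨_, K, rfl, rfl⟩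
  · exact fun _ _ => rfl
  · refine (fJet_cons_right' hU (hg.smooth _ _) _ _ _).trans
      (Set.EqOn.trans ?_ (fJet_cons_right' hU (hg.smooth _ _) _ _ _).symm)
    exact fJet_eqOn hU (fun z hz => hg.closed' z hz _ _ _) _ _

/-- The sorted lists in `mJet` make their heads the matrix indices; by `fJet_closed_left` and
`fJet_closed_right` every other choice gives the same value. -/
theorem mJet_cons_cons (hU : IsOpen U) (hg : IsClosedForm U g) (i j : Fin n)
    (I J : Multiset (Fin n)) :
    Set.EqOn (mJet g (i ::ₘ I) (j ::ₘ J)) (fJet I J (fun z => g z i j)) U := by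
  have hI : ((i ::ₘ I).sort : Multiset (Fin n)) = i ::ₘ I := Multiset.sort_eq _ _
  have hJ : ((j ::ₘ J).sort : Multiset (Fin n)) = j ::ₘ J := Multiset.sort_eq _ _
  unfold mJet
  generalize (i ::ₘ I).sort = LI at hI ⊢
  generalize (j ::ₘ J).sort = LJ at hJ ⊢
  match LI, LJ with
  | [], _ => simp at hI
  | _ :: _, [] => simp at hJ
  | i' :: I', j' :: J' =>
    rw [← Multiset.cons_coe] at hI hJ
    exact (wirtinger_eqOn_fJet hU (hg.smooth _ _) _ _).trans
      ((fJet_closed_left hU hg hI _ _).trans (fJet_closed_right hU hg hJ _ _))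

theorem mJet_singleton (i j : Fin n) (z : Fin n → ℂ) :
    mJet g {i} {j} z = g z i j := by
  simp [mJet, wirtinger]

@[simp] theorem mJet_zero_left (J : Multiset (Fin n)) : mJet g 0 J = 0 := by
  simp [mJet]

@[simp] theorem mJet_zero_right (I : Multiset (Fin n)) : mJet g I 0 = 0 := by
  unfold mJet
  simp

theorem contDiffOn_mJet (hU : IsOpen U) (hg : IsClosedForm U g) (I J : Multiset (Fin n)) :
    ContDiffOn ℝ ∞ (mJet g I J) U := by
  unfold mJet
  split
  · exact contDiffOn_wirtinger hU (hg.smooth _ _) _ _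
  · exact contDiffOn_const

/-- The hypotheses `I ≠ 0` and `J ≠ 0` exclude the default value: the jet of an empty multiset is
`0`, and a first index produces a metric coefficient, not a derivative. This is why semistability is
needed whenever vertices are differentiated. -/
theorem mJet_cons_left (hU : IsOpen U) (hg : IsClosedForm U g) (k : Fin n)
    {I J : Multiset (Fin n)} (hI : I ≠ 0) (hJ : J ≠ 0) :
    Set.EqOn (mJet g (k ::ₘ I) J) (dz k (mJet g I J)) U := by
  obtain ⟨i, hi⟩ := Multiset.exists_mem_of_ne_zero hI
  obtain ⟨j, hj⟩ := Multiset.exists_mem_of_ne_zero hJ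
  obtain ⟨I', rfl⟩ := Multiset.exists_cons_of_mem hi
  obtain ⟨J', rfl⟩ := Multiset.exists_cons_of_mem hj
  rw [Multiset.cons_swap]
  refine (mJet_cons_cons hU hg _ _ _ _).trans ((fJet_cons_left hU (hg.smooth _ _) _ _ _).trans ?_)
  rw [dz_eq_wirt]
  exact wirt_eqOn hU (mJet_cons_cons hU hg _ _ _ _).symm

theorem mJet_conj (hU : IsOpen U) (hg : IsClosedForm U g)
    (hH : ∀ z ∈ U, (g z).IsHermitian) (I J : Multiset (Fin n)) :
    Set.EqOn (mJet g I J) (fun z => starRingEnd ℂ (mJet g J I z)) U := by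
  induction I using Multiset.induction with
  | empty => intro z _; simp
  | cons i I _ =>
    induction J using Multiset.induction with
    | empty => intro z _; simp
    | cons j J _ =>
      intro z hz
      simp only [mJet_cons_cons hU hg _ _ _ _ hz]
      refine Eq.trans ?_ (fJet_conj hU (hg.smooth j i) I J hz)
      refine fJet_eqOn hU (fun w hw => ?_) _ _ hz
      exact ((hH w hw).apply i j).symm

end mJet

/-! ### The chain rule -/

/-- A real linear functional is the sum of a complex linear and an antilinear one. For a real
derivative the coefficients are the two kinds of Wirtinger derivatives. -/
theorem real_linear_decomp {n : ℕ} (D : (Fin n → ℂ) →L[ℝ] ℂ) (ξ : Fin n → ℂ) :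
    D ξ = ∑ p, ((1 / 2 : ℂ) * (D (Pi.single p 1) + -Complex.I * D (Pi.single p Complex.I)) * ξ p +
      (1 / 2 : ℂ) * (D (Pi.single p 1) + Complex.I * D (Pi.single p Complex.I)) *
        starRingEnd ℂ (ξ p)) := by
  have h1 : ξ = ∑ p, ((ξ p).re • Pi.single (M := fun _ => ℂ) p (1 : ℂ) +
      (ξ p).im • Pi.single (M := fun _ => ℂ) p Complex.I) := by
    funext q
    rw [Finset.sum_apply, Finset.sum_eq_single q]
    · simp [Complex.re_add_im]
    · intro p _ hp; simp [Pi.single_eq_of_ne hp.symm]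
    · simp
  conv_lhs => rw [h1]
  rw [map_sum]
  refine Finset.sum_congr rfl fun p _ => ?_
  rw [map_add, map_smul, map_smul]
  have h2 : ξ p = (ξ p).re + (ξ p).im * Complex.I := (Complex.re_add_im _).symm
  have h3 : starRingEnd ℂ (ξ p) = (ξ p).re - (ξ p).im * Complex.I := by
    apply Complex.ext <;> simp
  rw [h3]
  simp only [Complex.real_smul]
  conv_rhs => rw [h2]
  simp only [Complex.add_re, Complex.ofReal_re, Complex.mul_re, Complex.I_re, Complex.ofReal_im,
    Complex.I_im, Complex.add_im, Complex.mul_im]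
  ring_nf
  simp only [Complex.I_sq]
  ring

section chain

variable {m n : ℕ} {U : Set (Fin m → ℂ)} {W : Set (Fin n → ℂ)} {φ : (Fin m → ℂ) → (Fin n → ℂ)}
  {F : (Fin n → ℂ) → ℂ}

theorem Hol.fderiv_I {h : (Fin m → ℂ) → ℂ} (H : Hol U h) {z : Fin m → ℂ} (hz : z ∈ U)
    (k : Fin m) : fderiv ℝ h z (Pi.single k Complex.I) =
      Complex.I * fderiv ℝ h z (Pi.single k 1) := by
  have h1 := H.2 z hz k
  simp only [dzbar, mul_eq_zero, one_div, inv_eq_zero, OfNat.ofNat_ne_zero, false_or] at h1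
  linear_combination -Complex.I * h1 + (fderiv ℝ h z (Pi.single k Complex.I)) * Complex.I_sq

theorem Hol.dz_eq {h : (Fin m → ℂ) → ℂ} (H : Hol U h) {z : Fin m → ℂ} (hz : z ∈ U)
    (k : Fin m) : _root_.dz k h z = fderiv ℝ h z (Pi.single k 1) := by
  simp only [_root_.dz, H.fderiv_I hz]
  linear_combination -(1/2) * (fderiv ℝ h z (Pi.single k 1)) * Complex.I_sq

theorem fderiv_comp_hol (hU : IsOpen U) (hW : IsOpen W) (hφ : ∀ p, Hol U (fun z => φ z p))
    (hm : Set.MapsTo φ U W) (hF : ContDiffOn ℝ ∞ F W) {z : Fin m → ℂ} (hz : z ∈ U)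
    (u : Fin m → ℂ) : fderiv ℝ (fun w => F (φ w)) z u =
      fderiv ℝ F (φ z) (fun p => fderiv ℝ (fun w => φ w p) z u) := by
  have h1 : HasFDerivAt φ (ContinuousLinearMap.pi fun p => fderiv ℝ (fun w => φ w p) z) z :=
    hasFDerivAt_pi.2 fun p => ((hφ p).diffAt hU hz).hasFDerivAt
  have h2 := (diffAt_of_smooth hW hF (hm hz)).hasFDerivAt
  have h3 : HasFDerivAt (fun w => F (φ w)) _ z := h2.comp z h1
  rw [h3.fderiv]
  rfl

/-- The general chain rule has a second term with derivatives of the conjugates of the components;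
it is absent because the inner map is holomorphic. -/
theorem dz_comp_hol (hU : IsOpen U) (hW : IsOpen W) (hφ : ∀ p, Hol U (fun z => φ z p))
    (hm : Set.MapsTo φ U W) (hF : ContDiffOn ℝ ∞ F W) {z : Fin m → ℂ} (hz : z ∈ U) (a : Fin m) :
    dz a (fun w => F (φ w)) z = ∑ p, dz p F (φ z) * dz a (fun w => φ w p) z := by
  have e : dz a (fun w => F (φ w)) z = (1 / 2 : ℂ) * (fderiv ℝ (fun w => F (φ w)) z (Pi.single a 1) +
      -Complex.I * fderiv ℝ (fun w => F (φ w)) z (Pi.single a Complex.I)) := by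
    rw [dz_eq_wirt]; rfl
  rw [e, fderiv_comp_hol hU hW hφ hm hF hz, fderiv_comp_hol hU hW hφ hm hF hz,
    real_linear_decomp (fderiv ℝ F (φ z)), real_linear_decomp (fderiv ℝ F (φ z)), Finset.mul_sum,
    ← Finset.sum_add_distrib, Finset.mul_sum]
  refine Finset.sum_congr rfl fun p _ => ?_
  rw [(hφ p).fderiv_I hz, ← (hφ p).dz_eq hz, dz_eq_wirt p]
  simp only [wirt, map_mul, Complex.conj_I]
  ring_nf
  simp only [Complex.I_sq, Complex.I_pow_three]
  ring

theorem dzbar_comp_hol (hU : IsOpen U) (hW : IsOpen W) (hφ : ∀ p, Hol U (fun z => φ z p))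
    (hm : Set.MapsTo φ U W) (hF : ContDiffOn ℝ ∞ F W) {z : Fin m → ℂ} (hz : z ∈ U) (a : Fin m) :
    dzbar a (fun w => F (φ w)) z =
      ∑ p, dzbar p F (φ z) * starRingEnd ℂ (dz a (fun w => φ w p) z) := by
  have e : dzbar a (fun w => F (φ w)) z = (1 / 2 : ℂ) * (fderiv ℝ (fun w => F (φ w)) z (Pi.single a 1) +
      Complex.I * fderiv ℝ (fun w => F (φ w)) z (Pi.single a Complex.I)) := by
    rw [dzbar_eq_wirt]; rfl
  rw [e, fderiv_comp_hol hU hW hφ hm hF hz, fderiv_comp_hol hU hW hφ hm hF hz,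
    real_linear_decomp (fderiv ℝ F (φ z)), real_linear_decomp (fderiv ℝ F (φ z)), Finset.mul_sum,
    ← Finset.sum_add_distrib, Finset.mul_sum]
  refine Finset.sum_congr rfl fun p _ => ?_
  rw [(hφ p).fderiv_I hz, ← (hφ p).dz_eq hz, dzbar_eq_wirt p]
  simp only [wirt, map_mul, Complex.conj_I]
  ring_nf
  simp only [Complex.I_sq, Complex.I_pow_three]
  ring

theorem contDiffOn_comp_hol (hφ : ∀ p, Hol U (fun z => φ z p))
    (hm : Set.MapsTo φ U W) (hF : ContDiffOn ℝ ∞ F W) : ContDiffOn ℝ ∞ (fun w => F (φ w)) U :=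
  hF.comp (contDiffOn_pi.2 fun p => (hφ p).1) hm

/-- Jets of the composite with a map whose differential is the inclusion of coordinates `σ`. -/
theorem fJet_comp_affine (hU : IsOpen U) (hW : IsOpen W) (hφ : ∀ p, Hol U (fun z => φ z p))
    (hm : Set.MapsTo φ U W) (σ : Fin m → Fin n)
    (hσ : ∀ z ∈ U, ∀ a p, dz a (fun w => φ w p) z = if p = σ a then 1 else 0)
    (hF : ContDiffOn ℝ ∞ F W) (I J : Multiset (Fin m)) :
    Set.EqOn (fJet I J (fun w => F (φ w))) (fun w => fJet (I.map σ) (J.map σ) F (φ w)) U := by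
  have hc := contDiffOn_comp_hol hφ hm hF
  refine jet_induction (p := fun I J => Set.EqOn (fJet I J (fun w => F (φ w)))
    (fun w => fJet (I.map σ) (J.map σ) F (φ w)) U) (fun z _ => by simp) ?_ ?_ I J
  · intro k I J ih z hz
    have hJ := contDiffOn_fJet hW hF (I.map σ) (J.map σ)
    rw [fJet_cons_left hU hc k I J hz, dz_eq_wirt, wirt_eqOn hU ih hz, ← dz_eq_wirt,
      dz_comp_hol hU hW hφ hm hJ hz]
    simp only [hσ z hz, mul_ite, mul_one, mul_zero, Finset.sum_ite_eq', Finset.mem_univ, if_true,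
      Multiset.map_cons]
    rw [fJet_cons_left hW hF _ _ _ (hm hz)]
  · intro k J ih z hz
    have hJ := contDiffOn_fJet hW hF 0 (J.map σ)
    rw [fJet_cons_right hU hc k 0 J hz, dzbar_eq_wirt, wirt_eqOn hU ih hz, ← dzbar_eq_wirt]
    simp only [Multiset.map_zero]
    rw [dzbar_comp_hol hU hW hφ hm hJ hz]
    simp only [hσ z hz, apply_ite (starRingEnd ℂ), map_one, map_zero, mul_ite, mul_one, mul_zero,
      Finset.sum_ite_eq', Finset.mem_univ, if_true, Multiset.map_cons]
    rw [fJet_cons_right hW hF _ _ _ (hm hz)]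

end chain

/-! ### Inverse matrices -/

section inverse

variable {n m : ℕ} {U : Set (Fin n → ℂ)} {A : (Fin n → ℂ) → Matrix (Fin m) (Fin m) ℂ}

theorem contDiffOn_matrix_inv (hA : ∀ a b, ContDiffOn ℝ ∞ (fun z => A z a b) U)
    (h0 : ∀ z ∈ U, (A z).det ≠ 0) (i j : Fin m) : ContDiffOn ℝ ∞ (fun z => (A z)⁻¹ i j) U := by
  have hdet : ∀ A : (Fin n → ℂ) → Matrix (Fin m) (Fin m) ℂ,
      (∀ a b, ContDiffOn ℝ ∞ (fun z => A z a b) U) → ContDiffOn ℝ ∞ (fun z => (A z).det) U := by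
    intro A hA
    simp only [Matrix.det_apply']
    exact ContDiffOn.sum fun σ _ => contDiffOn_const.mul (contDiffOn_prod fun a _ => hA _ _)
  have hadj : ContDiffOn ℝ ∞ (fun z => (A z).adjugate i j) U := by
    simp only [Matrix.adjugate_apply]
    refine hdet _ fun a b => ?_
    by_cases h : a = j
    · subst h
      simpa only [Matrix.updateRow_self] using contDiffOn_const
    · simpa only [Matrix.updateRow_ne h] using hA a b
  refine (((hdet A hA).inv h0).mul hadj).congr fun z _ => ?_
  simp [Matrix.inv_def]

/-- Differentiate the product of the inverse matrix with `A`, which is constant, and multiply by the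
inverse on the right. -/
theorem wirt_matrix_inv (hU : IsOpen U) (hA : ∀ a b, ContDiffOn ℝ ∞ (fun z => A z a b) U)
    (h0 : ∀ z ∈ U, (A z).det ≠ 0) (ε : ℂ) (k : Fin n) (i j : Fin m) {z : Fin n → ℂ}
    (hz : z ∈ U) : wirt ε k (fun w => (A w)⁻¹ i j) z =
      -∑ p, ∑ q, (A z)⁻¹ i p * wirt ε k (fun w => A w p q) z * (A z)⁻¹ q j := by
  have hI := contDiffOn_matrix_inv hA h0
  set B : Matrix (Fin m) (Fin m) ℂ := Matrix.of fun i j => wirt ε k (fun w => (A w)⁻¹ i j) z with hB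
  set C : Matrix (Fin m) (Fin m) ℂ := Matrix.of fun i j => wirt ε k (fun w => A w i j) z with hC
  have h1 : B * A z + (A z)⁻¹ * C = 0 := by
    ext i j
    have e : Set.EqOn (fun w => ∑ p, (A w)⁻¹ i p * A w p j) (fun _ => (1 : Matrix _ _ ℂ) i j) U := by
      intro w hw
      simp only [← Matrix.mul_apply]
      rw [Matrix.nonsing_inv_mul _ (h0 w hw).isUnit]
    have := wirt_eqOn (ε := ε) (k := k) hU e hz
    rw [wirt_const, wirt_sum _ _ fun p _ => (diffAt_of_smooth hU (hI i p) hz).fun_mul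
      (diffAt_of_smooth hU (hA p j) hz)] at this
    simp only [wirt_mul (diffAt_of_smooth hU (hI i _) hz) (diffAt_of_smooth hU (hA _ j) hz),
      Finset.sum_add_distrib] at this
    simpa [Matrix.mul_apply, hB, hC] using this
  have h2 : B = -((A z)⁻¹ * C * (A z)⁻¹) := by
    have h3 : B * A z * (A z)⁻¹ = -((A z)⁻¹ * C) * (A z)⁻¹ := by rw [eq_neg_of_add_eq_zero_left h1]
    rwa [Matrix.mul_assoc, Matrix.mul_nonsing_inv _ (h0 z hz).isUnit, Matrix.mul_one,
      Matrix.neg_mul] at h3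
  have h4 := congrFun (congrFun h2 i) j
  simp only [hB, hC, Matrix.of_apply, Matrix.neg_apply, Matrix.mul_apply, Finset.sum_mul] at h4
  rw [h4, Finset.sum_comm]

end inverse

/-! ### Pullback of closed forms -/

/-- The pullback of a matrix function along a holomorphic map. -/
def pullbackForm {m n : ℕ} (φ : (Fin m → ℂ) → (Fin n → ℂ))
    (g : (Fin n → ℂ) → Matrix (Fin n) (Fin n) ℂ) (x : Fin m → ℂ) : Matrix (Fin m) (Fin m) ℂ :=
  Matrix.of fun a b => ∑ p, ∑ q, g (φ x) p q * dz a (fun w => φ w p) x *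
    starRingEnd ℂ (dz b (fun w => φ w q) x)

section pullback

variable {m n : ℕ} {U : Set (Fin m → ℂ)} {W : Set (Fin n → ℂ)} {φ : (Fin m → ℂ) → (Fin n → ℂ)}
  {g : (Fin n → ℂ) → Matrix (Fin n) (Fin n) ℂ}

theorem pullbackForm_smooth (hU : IsOpen U) (hφ : ∀ p, Hol U (fun z => φ z p))
    (hm : Set.MapsTo φ U W) (hg : ∀ p q, ContDiffOn ℝ ∞ (fun z => g z p q) W) (a b : Fin m) :
    ContDiffOn ℝ ∞ (fun x => pullbackForm φ g x a b) U := by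
  simp only [pullbackForm, Matrix.of_apply]
  exact ContDiffOn.sum fun p _ => ContDiffOn.sum fun q _ =>
    ((contDiffOn_comp_hol hφ hm (hg p q)).mul ((hφ p).dz hU a).1).mul
      (contDiffOn_conj ((hφ q).dz hU b).1)

/-- The derivative falls on `g` or on the holomorphic Jacobian; the conjugate Jacobian is
annihilated. The first kind of term is symmetric by closedness of `g`, the second by symmetry of the
second derivatives of `φ`. -/
theorem pullbackForm_closed (hU : IsOpen U) (hW : IsOpen W) (hφ : ∀ p, Hol U (fun z => φ z p))
    (hm : Set.MapsTo φ U W) (hg : ∀ p q, ContDiffOn ℝ ∞ (fun z => g z p q) W)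
    (hc : ∀ z ∈ W, ∀ i j k, dz k (fun w => g w i j) z = dz i (fun w => g w k j) z)
    {x : Fin m → ℂ} (hx : x ∈ U) (a b c : Fin m) :
    dz c (fun x => pullbackForm φ g x a b) x = dz a (fun x => pullbackForm φ g x c b) x := by
  have key : ∀ a c, dz c (fun x => pullbackForm φ g x a b) x = ∑ q, (∑ p, ∑ r,
      dz r (fun w => g w p q) (φ x) * dz c (fun w => φ w r) x * dz a (fun w => φ w p) x +
      ∑ p, g (φ x) p q * dz c (dz a (fun w => φ w p)) x) *
        starRingEnd ℂ (dz b (fun w => φ w q) x) := by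
    intro a c
    have s1 : ∀ p q, DifferentiableAt ℝ (fun x => g (φ x) p q) x := fun p q =>
      diffAt_of_smooth hU (contDiffOn_comp_hol hφ hm (hg p q)) hx
    have s2 : ∀ p, DifferentiableAt ℝ (dz a (fun w => φ w p)) x := fun p =>
      ((hφ p).dz hU a).diffAt hU hx
    have s3 : ∀ q, DifferentiableAt ℝ (fun x => starRingEnd ℂ (dz b (fun w => φ w q) x)) x :=
      fun q => diffAt_of_smooth hU (contDiffOn_conj ((hφ q).dz hU b).1) hx
    have s4 : ∀ q, dz c (fun x => starRingEnd ℂ (dz b (fun w => φ w q) x)) x = 0 := fun q => by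
      rw [dz_conj (((hφ q).dz hU b).diffAt hU hx), ((hφ q).dz hU b).2 x hx, map_zero]
    simp only [pullbackForm, Matrix.of_apply]
    rw [dz_eq_wirt, wirt_sum _ _ fun p _ => DifferentiableAt.fun_sum fun q _ =>
      ((s1 p q).fun_mul (s2 p)).fun_mul (s3 q)]
    simp only [Finset.sum_mul, ← Finset.sum_add_distrib]
    rw [Finset.sum_comm]
    refine Finset.sum_congr rfl fun p _ => ?_
    rw [wirt_sum _ _ fun q _ => ((s1 p q).fun_mul (s2 p)).fun_mul (s3 q)]
    refine Finset.sum_congr rfl fun q _ => ?_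
    rw [wirt_mul ((s1 p q).fun_mul (s2 p)) (s3 q), wirt_mul (s1 p q) (s2 p), ← dz_eq_wirt,
      s4, dz_comp_hol hU hW hφ hm (hg p q) hx, Finset.sum_mul, mul_zero, add_zero]
  rw [key, key]
  refine Finset.sum_congr rfl fun q _ => ?_
  congr 2
  · rw [Finset.sum_comm]
    refine Finset.sum_congr rfl fun p _ => Finset.sum_congr rfl fun r _ => ?_
    rw [hc _ (hm hx) r q p]
    ring
  · refine Finset.sum_congr rfl fun p _ => ?_
    rw [dz_eq_wirt, dz_eq_wirt, wirt_comm hU (hφ p).1 _ _ _ _ hx]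

theorem pullbackForm_conjTranspose (x : Fin m → ℂ) (a b : Fin m) :
    pullbackForm φ (fun z => (g z).conjTranspose) x a b =
      starRingEnd ℂ (pullbackForm φ g x b a) := by
  simp only [pullbackForm, Matrix.of_apply, map_sum, map_mul, Complex.conj_conj,
    Matrix.conjTranspose_apply]
  rw [Finset.sum_comm]
  refine Finset.sum_congr rfl fun p _ => Finset.sum_congr rfl fun q _ => ?_
  simp only [starRingEnd_apply]
  ring

theorem isClosedForm_pullbackForm (hU : IsOpen U) (hW : IsOpen W)
    (hφ : ∀ p, Hol U (fun z => φ z p)) (hm : Set.MapsTo φ U W) (hg : IsClosedForm W g) :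
    IsClosedForm U (pullbackForm φ g) where
  smooth := pullbackForm_smooth hU hφ hm hg.smooth
  closed x hx a b c := pullbackForm_closed hU hW hφ hm hg.smooth hg.closed hx a b c
  closed' x hx a b c := by
    have hs := pullbackForm_smooth hU hφ hm hg.smooth
    -- The barred relation is the unbarred one for the conjugate transpose of the form.
    have h1 := pullbackForm_closed (g := fun z => (g z).conjTranspose) hU hW hφ hm
      (fun p q => contDiffOn_conj (hg.smooth q p)) (fun z hz i j k => by
        simp only [Matrix.conjTranspose_apply, ← starRingEnd_apply]
        rw [dz_conj (diffAt_of_smooth hW (hg.smooth _ _) hz),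
          dz_conj (diffAt_of_smooth hW (hg.smooth _ _) hz), hg.closed' z hz]) hx b a c
    simp only [pullbackForm_conjTranspose] at h1
    rw [dz_conj (diffAt_of_smooth hU (hs _ _) hx), dz_conj (diffAt_of_smooth hU (hs _ _) hx)] at h1
    exact (starRingEnd ℂ).injective h1

theorem pullbackForm_isHermitian {x : Fin m → ℂ} (hH : (g (φ x)).IsHermitian) :
    (pullbackForm φ g x).IsHermitian := by
  ext a b
  rw [Matrix.conjTranspose_apply, ← starRingEnd_apply, ← pullbackForm_conjTranspose]
  simp only [pullbackForm, Matrix.of_apply]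
  rw [hH.eq]

end pullback

namespace PointedGraph

/-! ## Contraction of edges -/

/-- The graph with all edges reversed. -/
def rev (G : PointedGraph) : PointedGraph := ⟨G.nV, G.nE, G.tgt, G.src⟩

theorem Iso.outDeg_eq {G H : PointedGraph} (i : Iso G H) (v : Option (Fin G.nV)) :
    H.outDeg (v.map i.1.1) = G.outDeg v := by
  symm
  refine Finset.card_equiv i.1.2 fun e => ?_
  simp only [Finset.mem_filter, Finset.mem_univ, true_and, (i.2 e).1]
  exact (Option.map_injective i.1.1.injective).eq_iff.symm

theorem Iso.inDeg_eq {G H : PointedGraph} (i : Iso G H) (v : Option (Fin G.nV)) :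
    H.inDeg (v.map i.1.1) = G.inDeg v := by
  symm
  refine Finset.card_equiv i.1.2 fun e => ?_
  simp only [Finset.mem_filter, Finset.mem_univ, true_and, (i.2 e).2]
  exact (Option.map_injective i.1.1.injective).eq_iff.symm

theorem IsSemistable.of_iso {G H : PointedGraph} (i : Iso G H) (h : G.IsSemistable) :
    H.IsSemistable := by
  intro v
  have := h (i.1.1.symm v)
  rw [← i.outDeg_eq, ← i.inDeg_eq] at this
  simpa using this

theorem IsStable.of_iso {G H : PointedGraph} (i : Iso G H) (h : G.IsStable) :
    H.IsStable := by
  intro v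
  have := h (i.1.1.symm v)
  rw [← i.outDeg_eq, ← i.inDeg_eq] at this
  simpa using this

theorem IsStable.isSemistable {G : PointedGraph} (h : G.IsStable) : G.IsSemistable := fun v => by
  have := h v; omega

theorem IsSemistable.rev {G : PointedGraph} (h : G.IsSemistable) : G.rev.IsSemistable := fun v => by
  have h1 : G.rev.inDeg (some v) = G.outDeg (some v) := rfl
  have h2 : G.rev.outDeg (some v) = G.inDeg (some v) := rfl
  have := h v; omega

theorem IsStable.rev {G : PointedGraph} (h : G.IsStable) : G.rev.IsStable := fun v => by
  have h1 : G.rev.inDeg (some v) = G.outDeg (some v) := rfl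
  have h2 : G.rev.outDeg (some v) = G.inDeg (some v) := rfl
  have := h v; omega

theorem IsContractible.rev {G : PointedGraph} {e : Fin G.nE} (h : G.IsContractible e) :
    G.rev.IsContractible (e : Fin G.nE) :=
  ⟨h.1.symm, h.2.symm⟩

theorem IsContraction.rev {G G' : PointedGraph} {e : Fin G.nE} (h : G.IsContraction e G') :
    G.rev.IsContraction (e : Fin G.nE) G'.rev := by
  obtain ⟨π, τ, h0, hs, hk, hc⟩ := h
  exact ⟨π, τ, h0, hs, fun x y => (hk x y).trans (or_congr_right or_comm),
    fun a => (hc a).symm⟩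

theorem ContractStep.rev {G G' : PointedGraph} (h : ContractStep G G') :
    ContractStep G.rev G'.rev := by
  obtain ⟨e, he, hc⟩ := h
  exact ⟨e, he.rev, hc.rev⟩

/-- Reversing all edges preserves isomorphisms. -/
def Iso.rev {G H : PointedGraph} (i : Iso G H) : Iso G.rev H.rev :=
  ⟨i.1, fun e => (i.2 e).symm⟩

theorem IsContraction.of_iso_right {G G' G'' : PointedGraph} {e : Fin G.nE}
    (h : G.IsContraction e G') (i : Iso G' G'') : G.IsContraction e G'' := by
  obtain ⟨π, τ, h0, hs, hk, hc⟩ := h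
  have hinj := Option.map_injective i.1.1.injective
  refine ⟨fun x => (π x).map i.1.1, τ.trans i.1.2, by simp [h0], fun y => ?_, fun x y => ?_,
    fun a => ?_⟩
  · obtain ⟨x, hx⟩ := hs (y.map i.1.1.symm)
    exact ⟨x, by simp [hx, Function.comp_def]⟩
  · rw [hinj.eq_iff, hk]
  · simp [i.2, hc]

theorem IsContraction.of_iso_left {G H G' : PointedGraph} {e : Fin G.nE}
    (h : G.IsContraction e G') (i : Iso G H) : H.IsContraction (i.1.2 e) G' := by
  obtain ⟨π, τ, h0, hs, hk, hc⟩ := h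
  have hsrc : ∀ a, (H.src a).map i.1.1.symm = G.src (i.1.2.symm a) := fun a => by
    have := (i.2 (i.1.2.symm a)).1
    simp only [Equiv.apply_symm_apply] at this
    simp [this, Function.comp_def]
  have htgt : ∀ a, (H.tgt a).map i.1.1.symm = G.tgt (i.1.2.symm a) := fun a => by
    have := (i.2 (i.1.2.symm a)).2
    simp only [Equiv.apply_symm_apply] at this
    simp [this, Function.comp_def]
  have hx : ∀ (x : Option (Fin H.nV)) (y : Option (Fin G.nV)),
      x.map i.1.1.symm = y ↔ x = y.map i.1.1 := fun x y => by
    constructor <;> rintro rfl <;> simp [Function.comp_def]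
  refine ⟨fun x => π (x.map i.1.1.symm),
    (i.1.2.symm.subtypeEquiv fun a => by simp [Equiv.symm_apply_eq]).trans τ, by simp [h0],
    fun y => ?_, fun x y => ?_, fun a => ?_⟩
  · obtain ⟨x, hx⟩ := hs y
    exact ⟨x.map i.1.1, by simp [hx, Function.comp_def]⟩
  · rw [hk, (i.2 e).1, (i.2 e).2, hx, hx, hx, hx, hx]
    simp [Function.comp_def]
  · have := hc (i.1.2.symm.subtypeEquiv (p := fun x => x ≠ i.1.2 e) (q := fun x => x ≠ e)
      (fun a => by simp [Equiv.symm_apply_eq]) a)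
    simp only [Equiv.trans_apply, this, hsrc, htgt]
    simp

theorem IsContractible.of_iso {G H : PointedGraph} {e : Fin G.nE} (h : G.IsContractible e)
    (i : Iso G H) : H.IsContractible (i.1.2 e) := by
  have hinj := Option.map_injective i.1.1.injective
  unfold IsContractible
  rw [(i.2 e).1, (i.2 e).2, hinj.ne_iff, i.outDeg_eq, i.inDeg_eq]
  simpa [IsContractible] using h

theorem ContractStep.of_iso_left {G H G' : PointedGraph} (h : ContractStep G G') (i : Iso G H) :
    ContractStep H G' := by
  obtain ⟨e, he, hc⟩ := h
  exact ⟨_, he.of_iso i, hc.of_iso_left i⟩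

/-- Two pointed graphs presented as the same quotient are isomorphic. -/
theorem iso_of_quotient {G₁ G₂ : PointedGraph} {A E : Type} (π₁ : A → Option (Fin G₁.nV))
    (π₂ : A → Option (Fin G₂.nV)) (h₁ : Function.Surjective π₁) (h₂ : Function.Surjective π₂)
    (hk : ∀ x y, π₁ x = π₁ y ↔ π₂ x = π₂ y) (a₀ : A) (ha₁ : π₁ a₀ = none) (ha₂ : π₂ a₀ = none)
    (σ₁ : E ≃ Fin G₁.nE) (σ₂ : E ≃ Fin G₂.nE) (s t : E → A)
    (hs₁ : ∀ e, G₁.src (σ₁ e) = π₁ (s e)) (ht₁ : ∀ e, G₁.tgt (σ₁ e) = π₁ (t e))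
    (hs₂ : ∀ e, G₂.src (σ₂ e) = π₂ (s e)) (ht₂ : ∀ e, G₂.tgt (σ₂ e) = π₂ (t e)) :
    Nonempty (Iso G₁ G₂) := by
  set r₁ := Function.surjInv h₁
  set r₂ := Function.surjInv h₂
  have hr₁ : ∀ y, π₁ (r₁ y) = y := Function.surjInv_eq h₁
  have hr₂ : ∀ y, π₂ (r₂ y) = y := Function.surjInv_eq h₂
  let F : Option (Fin G₁.nV) ≃ Option (Fin G₂.nV) :=
    { toFun := fun y => π₂ (r₁ y)
      invFun := fun y => π₁ (r₂ y)
      left_inv := fun y => by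
        have : π₂ (r₂ (π₂ (r₁ y))) = π₂ (r₁ y) := hr₂ _
        change π₁ (r₂ (π₂ (r₁ y))) = y
        rw [(hk _ _).2 this, hr₁]
      right_inv := fun y => by
        have : π₁ (r₁ (π₁ (r₂ y))) = π₁ (r₂ y) := hr₁ _
        change π₂ (r₁ (π₁ (r₂ y))) = y
        rw [(hk _ _).1 this, hr₂] }
  have hF : ∀ a, F (π₁ a) = π₂ a := fun a => (hk _ _).1 (hr₁ _)
  have hF0 : F none = none := by rw [← ha₁, hF, ha₂]
  let p := F.removeNone
  have hp : ∀ y, y.map p = F y := by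
    intro y
    cases y with
    | none => simp [hF0]
    | some y =>
      rw [Option.map_some]
      refine Equiv.removeNone_some _ (Option.ne_none_iff_exists'.1 fun h => ?_)
      rw [← hF0] at h
      exact absurd (F.injective h) (by simp)
  refine ⟨⟨(p, σ₁.symm.trans σ₂), fun e => ?_⟩⟩
  obtain ⟨e, rfl⟩ := σ₁.surjective e
  simp only [Equiv.trans_apply, Equiv.symm_apply_apply, hp, hs₁, hs₂, ht₁, ht₂, hF, and_self]

theorem exists_pointed_equiv {Q : Type} [Fintype Q] [DecidableEq Q] (q : Q) :
    ∃ (m : ℕ) (f : Q ≃ Option (Fin m)), f q = none := by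
  refine ⟨Fintype.card {x // x ≠ q}, (Equiv.optionSubtypeNe q).symm.trans
    (Equiv.optionCongr (Fintype.equivFin _)), ?_⟩
  simp

theorem exists_isContraction (G : PointedGraph) (e : Fin G.nE) :
    ∃ G', G.IsContraction e G' := by
  classical
  let r : Setoid (Option (Fin G.nV)) :=
    { r := fun x y => x = y ∨ (x = G.src e ∧ y = G.tgt e) ∨ (x = G.tgt e ∧ y = G.src e)
      iseqv := ⟨fun x => Or.inl rfl, fun {x y} h => by grind, fun {x y z} h h' => by grind⟩ }
  obtain ⟨m, f, hf⟩ := exists_pointed_equiv (Quotient.mk r none)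
  let τ := Fintype.equivFin {x : Fin G.nE // x ≠ e}
  refine ⟨⟨m, Fintype.card {x : Fin G.nE // x ≠ e}, fun a => f (Quotient.mk r (G.src (τ.symm a))),
    fun a => f (Quotient.mk r (G.tgt (τ.symm a)))⟩, fun x => f (Quotient.mk r x), τ, hf,
    f.surjective.comp Quotient.mk_surjective, fun x y => ?_, fun a => ?_⟩
  · rw [f.injective.eq_iff]
    exact Quotient.eq (r := r)
  · simp

section degrees

variable {G G' : PointedGraph} {e : Fin G.nE}

theorem outDeg_contraction_of_ne {π : Option (Fin G.nV) → Option (Fin G'.nV)}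
    {τ : {x : Fin G.nE // x ≠ e} ≃ Fin G'.nE}
    (hk : ∀ x y, π x = π y ↔
      x = y ∨ (x = G.src e ∧ y = G.tgt e) ∨ (x = G.tgt e ∧ y = G.src e))
    (hc : ∀ a, G'.src (τ a) = π (G.src a)) {x : Option (Fin G.nV)} (h₁ : x ≠ G.src e)
    (h₂ : x ≠ G.tgt e) : G'.outDeg (π x) = G.outDeg x := by
  refine Finset.card_bij (fun a _ => ((τ.symm a : {x : Fin G.nE // x ≠ e}) : Fin G.nE)) ?_ ?_ ?_
  · intro a ha
    obtain ⟨a, rfl⟩ := τ.surjective a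
    simp only [Finset.mem_filter, Finset.mem_univ, true_and, hc, hk, Equiv.symm_apply_apply] at ha ⊢
    grind
  · intro a _ b _ hab
    exact τ.symm.injective (Subtype.ext hab)
  · intro b hb
    simp only [Finset.mem_filter, Finset.mem_univ, true_and] at hb
    have hbe : b ≠ e := by rintro rfl; exact h₁ hb.symm
    exact ⟨τ ⟨b, hbe⟩, by simp [hc, hb], by simp⟩

/-- The edges leaving the merged vertex are those leaving either end point, except `e` itself; the
two sets are disjoint since `e` is not a loop. -/
theorem outDeg_contraction_merged {π : Option (Fin G.nV) → Option (Fin G'.nV)}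
    {τ : {x : Fin G.nE // x ≠ e} ≃ Fin G'.nE}
    (hk : ∀ x y, π x = π y ↔
      x = y ∨ (x = G.src e ∧ y = G.tgt e) ∨ (x = G.tgt e ∧ y = G.src e))
    (hc : ∀ a, G'.src (τ a) = π (G.src a)) (hne : G.src e ≠ G.tgt e) :
    G'.outDeg (π (G.src e)) + 1 = G.outDeg (G.src e) + G.outDeg (G.tgt e) := by
  classical
  have h1 : G'.outDeg (π (G.src e)) =
      (((Finset.univ.filter fun a => G.src a = G.src e) ∪
        (Finset.univ.filter fun a => G.src a = G.tgt e)).erase e).card := by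
    refine Finset.card_bij (fun a _ => ((τ.symm a : {x : Fin G.nE // x ≠ e}) : Fin G.nE)) ?_ ?_ ?_
    · intro a ha
      obtain ⟨a, rfl⟩ := τ.surjective a
      simp only [Finset.mem_filter, Finset.mem_univ, true_and, hc, hk, Equiv.symm_apply_apply,
        Finset.mem_erase, Finset.mem_union] at ha ⊢
      have := a.2
      grind
    · intro a _ b _ hab
      exact τ.symm.injective (Subtype.ext hab)
    · intro b hb
      simp only [Finset.mem_filter, Finset.mem_univ, true_and, Finset.mem_erase,
        Finset.mem_union] at hb
      exact ⟨τ ⟨b, hb.1⟩, by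
        simp only [Finset.mem_filter, Finset.mem_univ, true_and, hc, hk]; grind, by simp⟩
  rw [h1, Finset.card_erase_add_one (by simp), Finset.card_union_of_disjoint]
  · rfl
  · rw [Finset.disjoint_filter]
    intro a _ h2 h3
    exact hne (h2.symm.trans h3)

end degrees

/-- Only the merged vertex needs attention, and only if both end points are ordinary. Its inward and
outward degrees are the sums of the old ones minus one each, so both stay positive and the total is
at least 3 + 3 - 2. -/
theorem IsContraction.isSemistable {G G' : PointedGraph} {e : Fin G.nE}
    (h : G.IsContraction e G') (hG : G.IsSemistable) (hne : G.src e ≠ G.tgt e) :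
    G'.IsSemistable := by
  have hr := h
  obtain ⟨π, τ, h0, hs, hk, hc⟩ := h
  have hkr : ∀ x y, π x = π y ↔ x = y ∨ (x = G.rev.src (e : Fin G.nE) ∧ y = G.rev.tgt (e : Fin G.nE)) ∨
      (x = G.rev.tgt (e : Fin G.nE) ∧ y = G.rev.src (e : Fin G.nE)) := fun x y =>
    (hk x y).trans (or_congr_right or_comm)
  intro w
  obtain ⟨x, hx⟩ := hs (some w)
  rw [← hx]
  by_cases hx' : x = G.src e ∨ x = G.tgt e
  · have hst : π (G.src e) = π (G.tgt e) := (hk _ _).2 (Or.inr (Or.inl ⟨rfl, rfl⟩))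
    have hxs : π x = π (G.src e) := by rcases hx' with rfl | rfl <;> simp [hst]
    have d1 := outDeg_contraction_merged hk (fun a => (hc a).1) hne
    have d2 := outDeg_contraction_merged (G := G.rev) (G' := G'.rev) (e := (e : Fin G.nE)) hkr
      (fun a => (hc a).2) hne.symm
    change G'.inDeg (π (G.tgt e)) + 1 = G.inDeg (G.tgt e) + G.inDeg (G.src e) at d2
    have hns : G.src e ≠ none := by
      intro hn; rw [hxs, hn, h0] at hx; simp at hx
    have hnt : G.tgt e ≠ none := by
      intro hn; rw [hxs, hst, hn, h0] at hx; simp at hx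
    obtain ⟨s, hs'⟩ := Option.ne_none_iff_exists'.1 hns
    obtain ⟨t, ht'⟩ := Option.ne_none_iff_exists'.1 hnt
    have a1 := hG s
    have a2 := hG t
    rw [← hs'] at a1
    rw [← ht'] at a2
    rw [← hst] at d2
    rw [hxs]
    omega
  · push Not at hx'
    have d1 := outDeg_contraction_of_ne hk (fun a => (hc a).1) hx'.1 hx'.2
    have d2 := outDeg_contraction_of_ne (G := G.rev) (G' := G'.rev) (e := (e : Fin G.nE)) hkr
      (fun a => (hc a).2) hx'.2 hx'.1
    change G'.inDeg (π x) = G.inDeg x at d2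
    have hn : x ≠ none := by rintro rfl; rw [h0] at hx; simp at hx
    obtain ⟨x', rfl⟩ := Option.ne_none_iff_exists'.1 hn
    rw [d1, d2]
    exact hG x'

theorem ContractStep.isSemistable {G G' : PointedGraph} (h : ContractStep G G')
    (hG : G.IsSemistable) : G'.IsSemistable := by
  obtain ⟨e, he, hc⟩ := h
  exact hc.isSemistable hG he.1

theorem IsStable.not_contractStep {G G' : PointedGraph} (hG : G.IsStable) :
    ¬ ContractStep G G' := by
  rintro ⟨e, ⟨_, ⟨hn, h1⟩ | ⟨hn, h1⟩⟩, _⟩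
  · obtain ⟨s, hs⟩ := Option.ne_none_iff_exists'.1 hn
    have := hG s; rw [← hs] at this; omega
  · obtain ⟨s, hs⟩ := Option.ne_none_iff_exists'.1 hn
    have := hG s; rw [← hs] at this; omega

theorem outDeg_eq_one_unique {G : PointedGraph} {e e' : Fin G.nE} (h : G.outDeg (G.src e) = 1)
    (h' : G.src e' = G.src e) : e' = e := by
  obtain ⟨a, ha⟩ := Finset.card_eq_one.1 h
  have h1 : e ∈ ({a} : Finset _) := ha ▸ by simp
  have h2 : e' ∈ ({a} : Finset _) := ha ▸ by simp [h']
  rw [Finset.mem_singleton] at h1 h2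
  rw [h1, h2]

/-- The tail of `e₂` has a single outward edge, so it is not the tail of `e₁`. If it is the head of
`e₁`, semistability gives it inward degree at least two; hence `e₁` is contractible through its own
tail, and the merged vertex is ordinary with outward degree 1 + 1 - 1. The excluded two-cycle is the
case in which `e₂` becomes a loop. -/
theorem isContractible_after_of_outDeg {G G' : PointedGraph} {e₁ e₂ : Fin G.nE}
    {π : Option (Fin G.nV) → Option (Fin G'.nV)} {τ : {x : Fin G.nE // x ≠ e₁} ≃ Fin G'.nE}
    (h0 : π none = none) (hk : ∀ x y, π x = π y ↔
      x = y ∨ (x = G.src e₁ ∧ y = G.tgt e₁) ∨ (x = G.tgt e₁ ∧ y = G.src e₁))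
    (hc : ∀ a, G'.src (τ a) = π (G.src a) ∧ G'.tgt (τ a) = π (G.tgt a))
    (hG : G.IsSemistable) (he₁ : G.IsContractible e₁) (hne : e₂ ≠ e₁)
    (hl : G.src e₂ ≠ G.tgt e₂) (hn : G.src e₂ ≠ none) (hd : G.outDeg (G.src e₂) = 1)
    (hcyc : ¬ (G.src e₂ = G.tgt e₁ ∧ G.tgt e₂ = G.src e₁)) :
    G'.src (τ ⟨e₂, hne⟩) ≠ G'.tgt (τ ⟨e₂, hne⟩) ∧ G'.src (τ ⟨e₂, hne⟩) ≠ none ∧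
      G'.outDeg (G'.src (τ ⟨e₂, hne⟩)) = 1 := by
  have hs : G.src e₂ ≠ G.src e₁ := fun h => hne.symm (outDeg_eq_one_unique hd h.symm)
  rw [(hc _).1, (hc _).2]
  refine ⟨?_, ?_, ?_⟩
  · rw [Ne, hk]; tauto
  · rw [← h0, Ne, hk]
    rintro (h | ⟨h, _⟩ | ⟨h, h'⟩)
    · exact hn h
    · exact hs h
    · obtain ⟨u, hu⟩ := Option.ne_none_iff_exists'.1 hn
      have := hG u
      rw [← hu] at this
      have h : G.src e₂ = G.tgt e₁ := h
      rcases he₁.2 with ⟨h2, _⟩ | ⟨_, h2⟩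
      · exact h2 h'.symm
      · rw [← h] at h2; omega
  · by_cases ht : G.src e₂ = G.tgt e₁
    · have hst : π (G.src e₂) = π (G.src e₁) := (hk _ _).2 (Or.inr (Or.inr ⟨ht, rfl⟩))
      have hm := outDeg_contraction_merged hk (fun a => (hc a).1) he₁.1
      obtain ⟨u, hu⟩ := Option.ne_none_iff_exists'.1 hn
      have := hG u
      rw [← hu] at this
      simp only at hst ⊢
      rw [hst]
      rw [← ht] at hm
      rcases he₁.2 with ⟨_, h2⟩ | ⟨_, h2⟩
      · omega
      · rw [← ht] at h2; omega
    · rw [outDeg_contraction_of_ne hk (fun a => (hc a).1) hs ht]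
      exact hd

theorem isContractible_after {G G' : PointedGraph} {e₁ e₂ : Fin G.nE}
    {π : Option (Fin G.nV) → Option (Fin G'.nV)} {τ : {x : Fin G.nE // x ≠ e₁} ≃ Fin G'.nE}
    (h0 : π none = none) (hk : ∀ x y, π x = π y ↔
      x = y ∨ (x = G.src e₁ ∧ y = G.tgt e₁) ∨ (x = G.tgt e₁ ∧ y = G.src e₁))
    (hc : ∀ a, G'.src (τ a) = π (G.src a) ∧ G'.tgt (τ a) = π (G.tgt a))
    (hG : G.IsSemistable) (he₁ : G.IsContractible e₁) (he₂ : G.IsContractible e₂) (hne : e₂ ≠ e₁)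
    (hcyc : ¬ (G.src e₂ = G.tgt e₁ ∧ G.tgt e₂ = G.src e₁)) :
    G'.IsContractible (τ ⟨e₂, hne⟩) := by
  rcases he₂.2 with ⟨hn, hd⟩ | ⟨hn, hd⟩
  · have := isContractible_after_of_outDeg h0 hk hc hG he₁ hne he₂.1 hn hd hcyc
    exact ⟨this.1, Or.inl this.2⟩
  · have := isContractible_after_of_outDeg (G := G.rev) (G' := G'.rev) (e₁ := (e₁ : Fin G.nE))
      (e₂ := (e₂ : Fin G.nE)) h0 (fun x y => (hk x y).trans (or_congr_right or_comm))
      (fun a => (hc a).symm) hG.rev he₁.rev hne he₂.1.symm hn hd (fun h => hcyc h.symm)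
    exact ⟨this.1.symm, Or.inr this.2⟩

/-- Local confluence of the contraction of edges. -/
theorem contractStep_diamond {G G₁ G₂ : PointedGraph} (hG : G.IsSemistable)
    (h₁ : ContractStep G G₁) (h₂ : ContractStep G G₂) :
    Nonempty (Iso G₁ G₂) ∨ ∃ H, ContractStep G₁ H ∧ ContractStep G₂ H := by
  obtain ⟨e₁, he₁, π₁, τ₁, h01, hs1, hk1, hc1⟩ := h₁
  obtain ⟨e₂, he₂, π₂, τ₂, h02, hs2, hk2, hc2⟩ := h₂
  by_cases hee : e₁ = e₂
  · subst hee
    left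
    exact iso_of_quotient π₁ π₂ hs1 hs2 (fun x y => by rw [hk1, hk2]) none h01 h02 τ₁ τ₂
      (fun a => G.src a) (fun a => G.tgt a) (fun a => (hc1 a).1) (fun a => (hc1 a).2)
      (fun a => (hc2 a).1) (fun a => (hc2 a).2)
  -- In a two-cycle each contraction turns the other edge into a loop. The results are isomorphic
  -- through the exchange of `e₁` and `e₂`.
  by_cases hcyc : G.src e₂ = G.tgt e₁ ∧ G.tgt e₂ = G.src e₁
  · left
    have hsw : ∀ a, a ≠ e₁ ↔ Equiv.swap e₁ e₂ a ≠ e₂ := fun a => by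
      rw [Ne, Ne, not_iff_not, Equiv.swap_apply_eq_iff, Equiv.swap_apply_right]
    refine iso_of_quotient π₁ π₂ hs1 hs2 (fun x y => by rw [hk1, hk2, hcyc.1, hcyc.2]; tauto)
      none h01 h02 τ₁ (((Equiv.swap e₁ e₂).subtypeEquiv hsw).trans τ₂)
      (fun a => G.src a) (fun a => G.tgt a) (fun a => (hc1 a).1) (fun a => (hc1 a).2) ?_ ?_
    · intro a
      rw [Equiv.trans_apply, (hc2 _).1, hk2]
      by_cases ha : (a : Fin G.nE) = e₂
      · simp [ha, hcyc]
      · simp [Equiv.swap_apply_of_ne_of_ne a.2 ha]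
    · intro a
      rw [Equiv.trans_apply, (hc2 _).2, hk2]
      by_cases ha : (a : Fin G.nE) = e₂
      · simp [ha, hcyc]
      · simp [Equiv.swap_apply_of_ne_of_ne a.2 ha]
  -- Otherwise each edge remains contractible after the other, and both orders give the quotient of
  -- `G` by the same identifications.
  right
  have c1 := isContractible_after h01 hk1 hc1 hG he₁ he₂ (Ne.symm hee) hcyc
  have c2 := isContractible_after h02 hk2 hc2 hG he₂ he₁ hee
    (fun h => hcyc ⟨h.2.symm, h.1.symm⟩)
  obtain ⟨H, hH⟩ := exists_isContraction G₁ (τ₁ ⟨e₂, Ne.symm hee⟩)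
  obtain ⟨K, hK⟩ := exists_isContraction G₂ (τ₂ ⟨e₁, hee⟩)
  refine ⟨H, ⟨_, c1, hH⟩, ⟨_, c2, ?_⟩⟩
  have hiso : Nonempty (Iso K H) := by
    obtain ⟨π₃, τ₃, h03, hs3, hk3, hc3⟩ := hH
    obtain ⟨π₄, τ₄, h04, hs4, hk4, hc4⟩ := hK
    rw [(hc1 _).1, (hc1 _).2] at hk3
    rw [(hc2 _).1, (hc2 _).2] at hk4
    let E := {a : Fin G.nE // a ≠ e₁ ∧ a ≠ e₂}
    let α : E ≃ {a : Fin G₁.nE // a ≠ τ₁ ⟨e₂, Ne.symm hee⟩} :=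
      (Equiv.subtypeSubtypeEquivSubtypeInter (fun a => a ≠ e₁) (fun a => a ≠ e₂)).symm.trans
        (τ₁.subtypeEquiv fun a => by
          rw [Ne, Ne, τ₁.injective.eq_iff, not_iff_not]; exact ⟨fun h => Subtype.ext h, fun h => congrArg Subtype.val h⟩)
    let β : E ≃ {a : Fin G₂.nE // a ≠ τ₂ ⟨e₁, hee⟩} :=
      ((Equiv.subtypeEquivRight fun a => and_comm).trans
        (Equiv.subtypeSubtypeEquivSubtypeInter (fun a => a ≠ e₂) (fun a => a ≠ e₁)).symm).trans
        (τ₂.subtypeEquiv fun a => by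
          rw [Ne, Ne, τ₂.injective.eq_iff, not_iff_not]; exact ⟨fun h => Subtype.ext h, fun h => congrArg Subtype.val h⟩)
    have hα : ∀ a : E, ((α a : {a : Fin G₁.nE // a ≠ τ₁ ⟨e₂, Ne.symm hee⟩}) : Fin G₁.nE) =
      τ₁ ⟨a.1, a.2.1⟩ := fun a => rfl
    have hβ : ∀ a : E, ((β a : {a : Fin G₂.nE // a ≠ τ₂ ⟨e₁, hee⟩}) : Fin G₂.nE) =
      τ₂ ⟨a.1, a.2.2⟩ := fun a => rfl
    refine iso_of_quotient (fun x => π₄ (π₂ x)) (fun x => π₃ (π₁ x)) (hs4.comp hs2)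
      (hs3.comp hs1) (fun x y => ?_) none (by rw [h02, h04]) (by rw [h01, h03])
      (β.trans τ₄) (α.trans τ₃) (fun a => G.src a.1) (fun a => G.tgt a.1) (fun a => ?_)
      (fun a => ?_) (fun a => ?_) (fun a => ?_)
    · simp only [hk3, hk4, hk1, hk2]
      have := he₁.1
      have := he₂.1
      grind
    · rw [Equiv.trans_apply, (hc4 _).1, hβ, (hc2 _).1]
    · rw [Equiv.trans_apply, (hc4 _).2, hβ, (hc2 _).2]
    · rw [Equiv.trans_apply, (hc3 _).1, hα, (hc1 _).1]
    · rw [Equiv.trans_apply, (hc3 _).2, hα, (hc1 _).2]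
  exact hK.of_iso_right hiso.some

/-! ## Stabilization -/

theorem Iso.nonempty_symm {G H : PointedGraph} (h : Nonempty (Iso G H)) : Nonempty (Iso H G) :=
  isoSetoid.iseqv.symm h

theorem Iso.nonempty_trans {G H K : PointedGraph} (h : Nonempty (Iso G H))
    (h' : Nonempty (Iso H K)) : Nonempty (Iso G K) := isoSetoid.iseqv.trans h h'

theorem Iso.nonempty_refl (G : PointedGraph) : Nonempty (Iso G G) := isoSetoid.iseqv.refl G

theorem reflTransGen_of_iso {G H Δ : PointedGraph} (h : Relation.ReflTransGen ContractStep G Δ)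
    (i : Nonempty (Iso G H)) :
    ∃ Δ', Relation.ReflTransGen ContractStep H Δ' ∧ Nonempty (Iso Δ' Δ) := by
  rcases Relation.ReflTransGen.cases_head h with rfl | ⟨G', h1, h2⟩
  · exact ⟨H, .refl, Iso.nonempty_symm i⟩
  · exact ⟨Δ, .head (h1.of_iso_left i.some) h2, Iso.nonempty_refl _⟩

theorem StabilizesTo.of_iso_left {G H Γ : PointedGraph} (h : G.StabilizesTo Γ)
    (i : Nonempty (Iso G H)) : H.StabilizesTo Γ := by
  obtain ⟨hs, Γ', h1, h2⟩ := h
  obtain ⟨Δ, h3, h4⟩ := reflTransGen_of_iso h1 i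
  exact ⟨hs, Δ, h3, Iso.nonempty_trans h4 h2⟩

theorem StabilizesTo.of_step {G G' Γ : PointedGraph} (h : G'.StabilizesTo Γ)
    (hs : ContractStep G G') : G.StabilizesTo Γ := by
  obtain ⟨h0, Δ, h1, h2⟩ := h
  exact ⟨h0, Δ, .head hs h1, h2⟩

/-- The diamond is pushed along the given finite contraction sequence. Termination is not an issue:
the sequence ends in a stable graph, which admits no further step. -/
theorem StabilizesTo.step {G G' Γ : PointedGraph} (h : G.StabilizesTo Γ) (hG : G.IsSemistable)
    (hs : ContractStep G G') : G'.StabilizesTo Γ := by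
  obtain ⟨h0, Δ, h1, h2⟩ := h
  have hΔ : Δ.IsStable := h0.of_iso (Iso.nonempty_symm h2).some
  suffices ∃ Δ', Relation.ReflTransGen ContractStep G' Δ' ∧ Nonempty (Iso Δ' Δ) by
    obtain ⟨Δ', h3, h4⟩ := this
    exact ⟨h0, Δ', h3, Iso.nonempty_trans h4 h2⟩
  clear h2 h0
  induction h1 using Relation.ReflTransGen.head_induction_on generalizing G' with
  | refl => exact absurd hs hΔ.not_contractStep
  | head ha hb ih =>
    rcases contractStep_diamond hG ha hs with hi | ⟨H, hH, hH'⟩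
    · exact reflTransGen_of_iso hb hi
    · obtain ⟨Δ', h3, h4⟩ := ih (ha.isSemistable hG) hH
      exact ⟨Δ', .head hH' h3, h4⟩

/-- By `StabilizesTo.step` the second stabilization survives every step of the first sequence. At
its end the graph is stable, so the remaining sequence is empty. -/
theorem StabilizesTo.unique {G Γ₁ Γ₂ : PointedGraph} (hG : G.IsSemistable)
    (h₁ : G.StabilizesTo Γ₁) (h₂ : G.StabilizesTo Γ₂) : Nonempty (Iso Γ₁ Γ₂) := by
  obtain ⟨h0, Δ, h1, hi⟩ := h₁
  have hΔ : Δ.IsStable := h0.of_iso (Iso.nonempty_symm hi).some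
  refine Iso.nonempty_trans (Iso.nonempty_symm hi) ?_
  clear hi h0
  induction h1 using Relation.ReflTransGen.head_induction_on with
  | refl =>
    obtain ⟨_, Δ', h3, h4⟩ := h₂
    rcases Relation.ReflTransGen.cases_head h3 with rfl | ⟨_, h5, _⟩
    · exact h4
    · exact absurd h5 hΔ.not_contractStep
  | head ha hb ih => exact ih (ha.isSemistable hG) (h₂.step hG ha)

theorem StabilizesTo.rev {G Γ : PointedGraph} (h : G.StabilizesTo Γ) :
    G.rev.StabilizesTo Γ.rev := by
  obtain ⟨h0, Δ, h1, h2⟩ := h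
  refine ⟨h0.rev, Δ.rev, ?_, ⟨h2.some.rev⟩⟩
  exact Relation.ReflTransGen.lift PointedGraph.rev (fun _ _ => ContractStep.rev) _ _ h1

theorem StabilizesTo.refl {Γ : PointedGraph} (h : Γ.IsStable) : Γ.StabilizesTo Γ :=
  ⟨h, Γ, .refl, Iso.nonempty_refl _⟩

/-! ## Sizes -/

theorem IsContraction.card {G G' : PointedGraph} {e : Fin G.nE} (h : G.IsContraction e G')
    (hne : G.src e ≠ G.tgt e) : G'.nV + 1 = G.nV ∧ G'.nE + 1 = G.nE := by
  classical
  obtain ⟨π, τ, h0, hs, hk, hc⟩ := h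
  constructor
  · have h1 : Function.Bijective (fun x : {x // x ≠ G.tgt e} => π x) := by
      constructor
      · intro x y hxy
        have := (hk _ _).1 hxy
        have := x.2
        have := y.2
        apply Subtype.ext
        tauto
      · intro y
        obtain ⟨x, hx⟩ := hs y
        by_cases hxt : x = G.tgt e
        · exact ⟨⟨G.src e, hne⟩, by
            simp only; rw [← hx, hk, hxt]; tauto⟩
        · exact ⟨⟨x, hxt⟩, hx⟩
    have h2 := Fintype.card_of_bijective h1
    rw [Fintype.card_subtype_compl, Fintype.card_subtype_eq] at h2
    simp at h2
    have h3 : G.nV ≠ 0 := by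
      intro h4
      have : ∀ x : Option (Fin G.nV), x = none := by
        rintro (_ | x)
        · rfl
        · exact absurd x.2 (by omega)
      exact hne ((this _).trans (this _).symm)
    omega
  · have h2 := Fintype.card_congr τ
    rw [Fintype.card_subtype_compl, Fintype.card_subtype_eq] at h2
    simp at h2
    have := e.2
    omega

theorem Iso.nV_eq {G H : PointedGraph} (i : Iso G H) : G.nV = H.nV := by
  simpa using Fintype.card_congr i.1.1

theorem Iso.nE_eq {G H : PointedGraph} (i : Iso G H) : G.nE = H.nE := by
  simpa using Fintype.card_congr i.1.2

theorem StabilizesTo.card {G Γ : PointedGraph} (h : G.StabilizesTo Γ) :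
    G.nE + Γ.nV = Γ.nE + G.nV := by
  obtain ⟨h0, Δ, h1, h2⟩ := h
  rw [← h2.some.nV_eq, ← h2.some.nE_eq]
  clear h2
  induction h1 using Relation.ReflTransGen.head_induction_on with
  | refl => omega
  | head ha _ ih =>
    obtain ⟨e, he, hc⟩ := ha
    have := hc.card he.1
    omega

theorem sum_outDeg (G : PointedGraph) : ∑ v, G.outDeg v = G.nE := by
  have := Finset.card_eq_sum_card_fiberwise (f := G.src) (s := Finset.univ) (t := Finset.univ)
    (fun _ _ => Finset.mem_univ _)
  simpa [outDeg] using this.symm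

theorem sum_inDeg (G : PointedGraph) : ∑ v, G.inDeg v = G.nE := G.rev.sum_outDeg

/-- There are two half-edges per edge, and at least three at every ordinary vertex. With the
invariance of edges minus vertices this bounds the size of the graphs with a given stabilization. -/
theorem IsSemistable.card_le {G : PointedGraph} (h : G.IsSemistable) : 3 * G.nV ≤ 2 * G.nE := by
  have h1 := G.sum_outDeg
  have h2 := G.sum_inDeg
  rw [Fintype.sum_option] at h1 h2
  have h3 : ∑ v : Fin G.nV, 3 ≤ ∑ v : Fin G.nV, (G.inDeg (some v) + G.outDeg (some v)) :=
    Finset.sum_le_sum fun v _ => (h v).2.2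
  rw [Finset.sum_add_distrib] at h3
  simp at h3
  omega

end PointedGraph

/-! ## Contraction of indices along a graph -/

section gev

variable {n : ℕ} {V E V' E' : Type} [Fintype V] [DecidableEq V] [Fintype E] [DecidableEq E]
  [Fintype V'] [DecidableEq V'] [Fintype E'] [DecidableEq E']

/-- The edges `e` with `s e = v`. -/
def edgesAt (s : E → V) (v : V) : Finset E := Finset.univ.filter fun e => s e = v

/-- The indices `i` carried by the half-edges at the vertex `v`. -/
def idxAt (s : E → V) (i : E → Fin n) (v : V) : Multiset (Fin n) := (edgesAt s v).val.map i

/-- The contraction of the tensors `T v` at the vertices of a graph along its edges. -/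
def gev (src tgt : E → V) (w : Fin n → Fin n → ℂ)
    (T : V → Multiset (Fin n) → Multiset (Fin n) → ℂ) : ℂ :=
  ∑ i : E → Fin n, ∑ j : E → Fin n,
    (∏ e, w (i e) (j e)) * ∏ v, T v (idxAt src i v) (idxAt tgt j v)

theorem idxAt_reindex (p : V ≃ V') (q : E ≃ E') {s : E → V} {s' : E' → V'}
    (h : ∀ e, s' (q e) = p (s e)) (i : E' → Fin n) (v : V) :
    idxAt s' i (p v) = idxAt s (fun e => i (q e)) v := by
  have : edgesAt s' (p v) = (edgesAt s v).map q.toEmbedding := by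
    ext e
    obtain ⟨e, rfl⟩ := q.surjective e
    simp [edgesAt, h]
  rw [idxAt, this, Finset.map_val, Multiset.map_map]
  rfl

theorem gev_reindex (p : V ≃ V') (q : E ≃ E') {src tgt : E → V} {src' tgt' : E' → V'}
    (hs : ∀ e, src' (q e) = p (src e)) (ht : ∀ e, tgt' (q e) = p (tgt e))
    (w : Fin n → Fin n → ℂ) {T : V → Multiset (Fin n) → Multiset (Fin n) → ℂ}
    {T' : V' → Multiset (Fin n) → Multiset (Fin n) → ℂ} (hT : ∀ v, T' (p v) = T v) :
    gev src' tgt' w T' = gev src tgt w T := by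
  unfold gev
  refine Fintype.sum_equiv (Equiv.arrowCongr q.symm (Equiv.refl _)) _ _ fun i => ?_
  refine Fintype.sum_equiv (Equiv.arrowCongr q.symm (Equiv.refl _)) _ _ fun j => ?_
  congr 1
  · refine (Fintype.prod_equiv q _ _ fun e => ?_).symm
    simp
  · refine (Fintype.prod_equiv p _ _ fun v => ?_).symm
    rw [hT, idxAt_reindex p q hs, idxAt_reindex p q ht]
    rfl

/-- The derivative of `gev` when the tensors `w`, `T` vary with derivatives `δw`, `δT`. -/
def dgev (src tgt : E → V) (w δw : Fin n → Fin n → ℂ)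
    (T δT : V → Multiset (Fin n) → Multiset (Fin n) → ℂ) : ℂ :=
  ∑ i : E → Fin n, ∑ j : E → Fin n,
    ((∑ e, δw (i e) (j e) * ∏ e' ∈ Finset.univ.erase e, w (i e') (j e')) *
        ∏ v, T v (idxAt src i v) (idxAt tgt j v) +
      (∏ e, w (i e) (j e)) * ∑ x, δT x (idxAt src i x) (idxAt tgt j x) *
        ∏ v ∈ Finset.univ.erase x, T v (idxAt src i v) (idxAt tgt j v))

/-- The contribution to `dgev` of the outward half-edges `S` at `x`, acted on by the jet `u` of a
holomorphic vector field. -/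
def splitTerm (src tgt : E → V) (w : Fin n → Fin n → ℂ)
    (T : V → Multiset (Fin n) → Multiset (Fin n) → ℂ) (u : Fin n → Multiset (Fin n) → ℂ)
    (x : V) (S : Finset E) : ℂ :=
  ∑ i : E → Fin n, ∑ j : E → Fin n, (∏ e, w (i e) (j e)) *
    ((∑ k, u k (S.val.map i) * T x (k ::ₘ ((edgesAt src x \ S).val.map i)) (idxAt tgt j x)) *
      ∏ v ∈ Finset.univ.erase x, T v (idxAt src i v) (idxAt tgt j v))

/-- Exchanging the index `i e` with the dummy index `k` is an involution on pairs. This renaming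
moves a contraction from a vertex to the inverse metric on an adjacent edge. -/
theorem sum_update_swap (e : E) (Φ : (E → Fin n) → Fin n → ℂ) :
    ∑ i, ∑ k, Φ i k = ∑ i, ∑ k, Φ (Function.update i e k) (i e) := by
  rw [← Fintype.sum_prod_type', ← Fintype.sum_prod_type']
  have hinv : Function.Involutive
      (fun x : (E → Fin n) × Fin n => (Function.update x.1 e x.2, x.1 e)) := fun x => by simp
  exact (Fintype.sum_equiv hinv.toPerm _ _ fun x => rfl).symm

theorem val_map_update (S : Finset E) {e : E} (he : e ∉ S) (i : E → Fin n) (k : Fin n) :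
    S.val.map (Function.update i e k) = S.val.map i :=
  Multiset.map_congr rfl fun a ha =>
    Function.update_of_ne (fun h => he (by rw [← h]; exact ha)) _ _

theorem insert_val_map (S : Finset E) {e : E} (he : e ∉ S) (i : E → Fin n) :
    (insert e S).val.map i = i e ::ₘ S.val.map i := by
  simp [Finset.insert_val, Multiset.ndinsert_of_notMem (show e ∉ S.val from he)]

theorem idxAt_update_self (s : E → V) (i : E → Fin n) (e : E) (k : Fin n) :
    idxAt s (Function.update i e k) (s e) = k ::ₘ ((edgesAt s (s e) \ {e}).val.map i) := by
  have h : edgesAt s (s e) = insert e (edgesAt s (s e) \ {e}) := by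
    ext a; simp only [edgesAt, Finset.mem_filter, Finset.mem_univ, true_and, Finset.mem_insert,
      Finset.mem_sdiff, Finset.mem_singleton]; grind
  conv_lhs => rw [idxAt, h]
  rw [insert_val_map _ (by simp), val_map_update _ (by simp), Function.update_self]

theorem idxAt_update_of_ne (s : E → V) (i : E → Fin n) (e : E) (k : Fin n) {v : V}
    (hv : s e ≠ v) : idxAt s (Function.update i e k) v = idxAt s i v :=
  val_map_update _ (by simp [edgesAt, hv]) _ _

/-- For a single half-edge the linear part of the field is contracted into the tensor at the tail of
`e`. After renaming the index there, it acts on the inverse metric of `e` instead, giving minus the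
variation `δw`. -/
theorem splitTerm_singleton (src tgt : E → V) {w δw : Fin n → Fin n → ℂ}
    (T : V → Multiset (Fin n) → Multiset (Fin n) → ℂ) {u : Fin n → Multiset (Fin n) → ℂ}
    (hw : ∀ a b, δw a b = -∑ k, u a {k} * w k b) (e : E) :
    splitTerm src tgt w T u (src e) {e} = -∑ i : E → Fin n, ∑ j : E → Fin n,
      (δw (i e) (j e) * ∏ e' ∈ Finset.univ.erase e, w (i e') (j e')) *
        ∏ v, T v (idxAt src i v) (idxAt tgt j v) := by
  unfold splitTerm
  rw [Finset.sum_comm]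
  conv_rhs => rw [Finset.sum_comm, ← Finset.sum_neg_distrib]
  refine Finset.sum_congr rfl fun j _ => ?_
  have h1 : ∀ i : E → Fin n, (∏ e, w (i e) (j e)) *
      ((∑ k, u k (({e} : Finset E).val.map i) *
          T (src e) (k ::ₘ ((edgesAt src (src e) \ {e}).val.map i)) (idxAt tgt j (src e))) *
        ∏ v ∈ Finset.univ.erase (src e), T v (idxAt src i v) (idxAt tgt j v)) =
      ∑ k, (∏ e, w (i e) (j e)) * u k {i e} *
        ∏ v, T v (idxAt src (Function.update i e k) v) (idxAt tgt j v) := by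
    intro i
    rw [Finset.sum_mul, Finset.mul_sum]
    refine Finset.sum_congr rfl fun k _ => ?_
    have h : ∏ v ∈ Finset.univ.erase (src e),
        T v (idxAt src (Function.update i e k) v) (idxAt tgt j v) =
        ∏ v ∈ Finset.univ.erase (src e), T v (idxAt src i v) (idxAt tgt j v) :=
      Finset.prod_congr rfl fun v hv => by
        rw [idxAt_update_of_ne src i e k (Finset.ne_of_mem_erase hv).symm]
    rw [← Finset.mul_prod_erase Finset.univ _ (Finset.mem_univ (src e)), idxAt_update_self, h]
    simp only [Finset.singleton_val, Multiset.map_singleton]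
    ring
  simp only [h1]
  rw [sum_update_swap e, ← Finset.sum_neg_distrib]
  refine Finset.sum_congr rfl fun i _ => ?_
  rw [hw]
  simp only [Function.update_idem, Function.update_eq_self, Function.update_self]
  rw [neg_mul, neg_mul, neg_neg, Finset.sum_mul, Finset.sum_mul]
  refine Finset.sum_congr rfl fun k _ => ?_
  rw [← Finset.mul_prod_erase Finset.univ _ (Finset.mem_univ e)]
  rw [Finset.prod_congr rfl fun e' he' => by
      rw [Function.update_of_ne (Finset.ne_of_mem_erase he')]]
  simp only [Function.update_self]
  ring

/-- The linear part of a holomorphic vector field vanishing at the point does not contribute to the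
derivative of the contraction. -/
theorem dgev_eq_sum_splitTerm (src tgt : E → V) {w δw : Fin n → Fin n → ℂ}
    {T δT : V → Multiset (Fin n) → Multiset (Fin n) → ℂ} {u : Fin n → Multiset (Fin n) → ℂ}
    (hu : ∀ k, u k 0 = 0) (hw : ∀ a b, δw a b = -∑ k, u a {k} * w k b)
    (hT : ∀ x i j, δT x (idxAt src i x) (idxAt tgt j x) = ∑ S ∈ (edgesAt src x).powerset,
      ∑ k, u k (S.val.map i) * T x (k ::ₘ ((edgesAt src x \ S).val.map i)) (idxAt tgt j x)) :
    dgev src tgt w δw T δT = ∑ x, ∑ S ∈ (edgesAt src x).powerset.filter (fun S => 2 ≤ S.card),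
      splitTerm src tgt w T u x S := by
  have h1 : dgev src tgt w δw T δT = (∑ e, ∑ i : E → Fin n, ∑ j : E → Fin n,
      (δw (i e) (j e) * ∏ e' ∈ Finset.univ.erase e, w (i e') (j e')) *
        ∏ v, T v (idxAt src i v) (idxAt tgt j v)) +
      ∑ x, ∑ S ∈ (edgesAt src x).powerset, splitTerm src tgt w T u x S := by
    unfold dgev splitTerm
    simp only [hT, Finset.sum_add_distrib, Finset.sum_mul, Finset.mul_sum]
    congr 1
    · rw [Finset.sum_comm]
      conv_lhs => enter [2, j]; rw [Finset.sum_comm]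
      rw [Finset.sum_comm]
      refine Finset.sum_congr rfl fun e _ => ?_
      rw [Finset.sum_comm]
    · conv_lhs =>
        enter [2, i]
        rw [Finset.sum_comm]
      rw [Finset.sum_comm]
      refine Finset.sum_congr rfl fun x _ => ?_
      conv_lhs =>
        enter [2, i]
        rw [Finset.sum_comm]
      rw [Finset.sum_comm]
  -- The empty set contributes nothing because the field vanishes at the point. The singletons
  -- cancel the variation of the inverse metric, edge by edge.
  have h2 : ∀ x, ∑ S ∈ (edgesAt src x).powerset, splitTerm src tgt w T u x S =
      (∑ S ∈ (edgesAt src x).powerset.filter (fun S => 2 ≤ S.card), splitTerm src tgt w T u x S) +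
      ∑ e ∈ edgesAt src x, splitTerm src tgt w T u x {e} := by
    intro x
    rw [← Finset.sum_filter_add_sum_filter_not _ (fun S : Finset E => 2 ≤ S.card)]
    congr 1
    have h3 : (edgesAt src x).powerset.filter (fun S => ¬ 2 ≤ S.card) =
        insert ∅ ((edgesAt src x).map ⟨fun e => ({e} : Finset E), Finset.singleton_injective⟩) := by
      ext S
      simp only [Finset.mem_filter, Finset.mem_powerset, Finset.mem_insert, Finset.mem_map,
        Function.Embedding.coeFn_mk]
      constructor
      · rintro ⟨hS, hc⟩
        have : S.card = 0 ∨ S.card = 1 := by omega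
        rcases this with h | h
        · exact Or.inl (Finset.card_eq_zero.1 h)
        · obtain ⟨e, rfl⟩ := Finset.card_eq_one.1 h
          exact Or.inr ⟨e, by simpa using hS, rfl⟩
      · rintro (rfl | ⟨e, he, rfl⟩)
        · simp
        · simpa using he
    rw [h3, Finset.sum_insert (by simp), Finset.sum_map]
    simp [splitTerm, hu]
  have h4 : ∑ x, ∑ e ∈ edgesAt src x, splitTerm src tgt w T u x {e} =
      ∑ e, splitTerm src tgt w T u (src e) {e} := by
    rw [← Finset.sum_fiberwise_of_maps_to (g := src) (t := Finset.univ)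
      (fun _ _ => Finset.mem_univ _)]
    refine Finset.sum_congr rfl fun x _ => Finset.sum_congr rfl fun e he => ?_
    rw [(Finset.mem_filter.1 he).2]
  simp only [h1, h2, Finset.sum_add_distrib, h4, splitTerm_singleton src tgt T hw]
  rw [Finset.sum_neg_distrib]
  ring

/-- The tensor at the vertex created by splitting off half-edges. -/
def splitTensor (T₀ : Multiset (Fin n) → Multiset (Fin n) → ℂ)
    (u : Fin n → Multiset (Fin n) → ℂ) (I J : Multiset (Fin n)) : ℂ :=
  ∑ k, u k I * T₀ {k} J

/-- Splitting off half-edges creates a new vertex, joined by a new edge. -/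
theorem splitTerm_eq_gev (src tgt : E → V) {w : Fin n → Fin n → ℂ}
    (T : V → Multiset (Fin n) → Multiset (Fin n) → ℂ) (u : Fin n → Multiset (Fin n) → ℂ)
    {T₀ : Multiset (Fin n) → Multiset (Fin n) → ℂ}
    (hw : ∀ a k, ∑ l, w a l * T₀ {k} {l} = if a = k then 1 else 0) {x : V} {S : Finset E}
    (hS : S ⊆ edgesAt src x) :
    splitTerm src tgt w T u x S = gev (V := Option V) (E := Option E)
      (fun e => e.elim (some x) fun e => if e ∈ S then none else some (src e))
      (fun e => e.elim none fun e => some (tgt e)) w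
      (fun v => v.elim (splitTensor T₀ u) T) := by
  have hsum : ∀ Φ : (Option E → Fin n) → ℂ, ∑ i, Φ i =
      ∑ i : E → Fin n, ∑ i₀ : Fin n, Φ (fun e => e.elim i₀ i) := by
    intro Φ
    rw [← Fintype.sum_prod_type']
    refine Fintype.sum_equiv ((Equiv.piOptionEquivProd (β := fun _ => Fin n)).trans
      (Equiv.prodComm _ _)) _ _ fun i => ?_
    congr 1
    funext e
    cases e <;> rfl
  have hsomemap : ∀ (A : Finset E) (i : E → Fin n) (i₀ : Fin n),
      (A.map Function.Embedding.some).val.map (fun e : Option E => e.elim i₀ i) = A.val.map i := by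
    intro A i i₀
    rw [Finset.map_val, Multiset.map_map]
    rfl
  set src' : Option E → Option V :=
    fun e => e.elim (some x) fun e => if e ∈ S then none else some (src e) with hsrc'
  set tgt' : Option E → Option V := fun e => e.elim none fun e => some (tgt e) with htgt'
  have s1 : ∀ i i₀, idxAt src' (fun e => e.elim i₀ i) none = S.val.map i := fun i i₀ => by
    rw [← hsomemap S i i₀, idxAt]
    congr 2
    ext e
    cases e <;> simp [edgesAt, hsrc']
  have s2 : ∀ i i₀, idxAt src' (fun e => e.elim i₀ i) (some x) =
      i₀ ::ₘ (edgesAt src x \ S).val.map i := fun i i₀ => by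
    have : edgesAt src' (some x) =
        insert none ((edgesAt src x \ S).map Function.Embedding.some) := by
      ext e
      cases e <;> simp [edgesAt, hsrc']
      tauto
    rw [idxAt, this, insert_val_map _ (by simp), hsomemap]
    rfl
  have s3 : ∀ i i₀ v, v ≠ x → idxAt src' (fun e => e.elim i₀ i) (some v) = idxAt src i v :=
    fun i i₀ v hv => by
      rw [idxAt, idxAt, ← hsomemap _ i i₀]
      congr 2
      ext e
      cases e with
      | none => simp [edgesAt, hsrc', hv.symm]
      | some e =>
        have := @hS e
        simp only [edgesAt, Finset.mem_filter, Finset.mem_univ, true_and, hsrc', Option.elim_some,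
          Finset.mem_map, Function.Embedding.some_apply, Option.some.injEq, exists_eq_right] at this ⊢
        by_cases he : e ∈ S
        · simp only [he, if_true, reduceCtorEq, false_iff, this he]
          exact hv.symm
        · simp [he]
  have t1 : ∀ (j : E → Fin n) (j₀ : Fin n), idxAt tgt' (fun e => e.elim j₀ j) none = {j₀} := fun j j₀ => by
    have : edgesAt tgt' none = {none} := by
      ext e
      cases e <;> simp [edgesAt, htgt']
    rw [idxAt, this]
    rfl
  have t2 : ∀ (j : E → Fin n) (j₀ : Fin n) v, idxAt tgt' (fun e => e.elim j₀ j) (some v) = idxAt tgt j v :=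
    fun j j₀ v => by
      rw [idxAt, idxAt, ← hsomemap _ j j₀]
      congr 2
      ext e
      cases e <;> simp [edgesAt, htgt']
  unfold gev splitTerm
  rw [hsum]
  simp only [hsum (fun j => _ * _)]
  refine Finset.sum_congr rfl fun i _ => ?_
  rw [Finset.sum_comm]
  refine Finset.sum_congr rfl fun j _ => ?_
  have h1 : ∀ i₀ j₀ : Fin n, (∏ e : Option E, w (e.elim i₀ i) (e.elim j₀ j)) *
      ∏ v : Option V, (v.elim (splitTensor T₀ u) T : Multiset (Fin n) → Multiset (Fin n) → ℂ)
        (idxAt src' (fun e => e.elim i₀ i) v) (idxAt tgt' (fun e => e.elim j₀ j) v) =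
      (∏ e, w (i e) (j e)) * (∏ v ∈ Finset.univ.erase x, T v (idxAt src i v) (idxAt tgt j v)) *
        (∑ k, (w i₀ j₀ * T₀ {k} {j₀}) * (u k (S.val.map i) *
          T x (i₀ ::ₘ (edgesAt src x \ S).val.map i) (idxAt tgt j x))) := by
    intro i₀ j₀
    rw [Fintype.prod_option, Fintype.prod_option]
    simp only [Option.elim_none, Option.elim_some]
    rw [← Finset.mul_prod_erase Finset.univ _ (Finset.mem_univ x), s1, s2, t1, t2,
      Finset.prod_congr (s₁ := Finset.univ.erase x) rfl fun v hv => by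
        rw [s3 i i₀ v (Finset.ne_of_mem_erase hv), t2], splitTensor]
    simp only [Finset.mul_sum, Finset.sum_mul]
    refine Finset.sum_congr rfl fun k _ => ?_
    ring
  simp only [h1, ← Finset.mul_sum]
  rw [mul_assoc, mul_comm (∑ k, _)]
  congr 2
  rw [Finset.sum_comm (s := Finset.univ (α := Fin n)) (t := Finset.univ (α := Fin n))]
  -- On the new edge the inverse metric meets the metric `T₀ {k} {j₀}`; the sum over `j₀` is a
  -- Kronecker delta, which identifies `k` with the index `i₀` at `x`.
  have h2 : ∀ i₀, ∑ j₀, ∑ k, (w i₀ j₀ * T₀ {k} {j₀}) * (u k (S.val.map i) *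
      T x (i₀ ::ₘ (edgesAt src x \ S).val.map i) (idxAt tgt j x)) =
      u i₀ (S.val.map i) * T x (i₀ ::ₘ (edgesAt src x \ S).val.map i) (idxAt tgt j x) := by
    intro i₀
    rw [Finset.sum_comm]
    simp only [← Finset.sum_mul, hw]
    simp
  rw [Finset.sum_comm]
  exact Finset.sum_congr rfl fun k _ => (h2 k).symm

/-- If all outward half-edges at `x` are taken, only one unbarred index is left on the tensor at
`x`, so `x` itself carries a split tensor and no new vertex is required. These terms will cancel
against genuine splittings of graphs with one vertex less. -/
theorem splitTerm_edgesAt (src tgt : E → V) (w : Fin n → Fin n → ℂ)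
    (T : V → Multiset (Fin n) → Multiset (Fin n) → ℂ) (u : Fin n → Multiset (Fin n) → ℂ) (x : V) :
    splitTerm src tgt w T u x (edgesAt src x) =
      gev src tgt w (Function.update T x (splitTensor (T x) u)) := by
  unfold gev splitTerm
  refine Finset.sum_congr rfl fun i _ => Finset.sum_congr rfl fun j _ => ?_
  have h : ∏ v ∈ Finset.univ.erase x, Function.update T x (splitTensor (T x) u) v
      (idxAt src i v) (idxAt tgt j v) =
      ∏ v ∈ Finset.univ.erase x, T v (idxAt src i v) (idxAt tgt j v) :=
    Finset.prod_congr rfl fun v hv => by rw [Function.update_of_ne (Finset.ne_of_mem_erase hv)]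
  rw [← Finset.mul_prod_erase Finset.univ (fun v => Function.update T x _ v _ _)
    (Finset.mem_univ x), h]
  simp [splitTensor, idxAt]

end gev

@[simp] theorem mem_edgesAt {V E : Type} [Fintype E] [DecidableEq V] {s : E → V} {v : V} {e : E} :
    e ∈ edgesAt s v ↔ s e = v := by
  simp [edgesAt]

namespace PointedGraph

/-! ## Sums over labelled graphs -/

/-- Pointed graphs with vertices labelled by `Fin a` and edges labelled by `Fin b`. -/
abbrev Labelled (a b : ℕ) : Type := (Fin b → Option (Fin a)) × (Fin b → Option (Fin a))

/-- The pointed graph of a labelled graph. -/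
def ofLabelled {a b : ℕ} (p : Labelled a b) : PointedGraph := ⟨a, b, p.1, p.2⟩

/-- Weights that are unchanged when a contractible edge is contracted, and that vanish on graphs
which are not semistable or have a vertex whose only incoming edge is a loop. -/
structure IsContractionInvariant (c : PointedGraph → ℂ) : Prop where
  iso : ∀ {G H : PointedGraph}, Nonempty (Iso G H) → c G = c H
  semistable : ∀ {G : PointedGraph}, ¬ G.IsSemistable → c G = 0
  step : ∀ {G G' : PointedGraph}, G.IsSemistable → ContractStep G G' → c G = c G'
  loop : ∀ {G : PointedGraph} (s : Fin G.nV) (e : Fin G.nE), G.inDeg (some s) = 1 →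
    G.src e = some s → G.tgt e = some s → c G = 0

/-- The tensor `F` at the distinguished vertex and `T` at the ordinary ones. -/
def vertexTensor {a : ℕ} {A : Type} (T F : A) (v : Option (Fin a)) : A := v.elim F fun _ => T

/-- Inclusion of vertices that leaves room for a new ordinary vertex `0`. -/
def vsucc {a : ℕ} (y : Option (Fin a)) : Option (Fin (a + 1)) := y.map Fin.succ

/-- A left inverse of `vsucc`. -/
def vpred {a : ℕ} (y : Option (Fin (a + 1))) : Option (Fin a) :=
  y.elim none (Fin.cases none some)

@[simp] theorem vpred_vsucc {a : ℕ} (y : Option (Fin a)) : vpred (vsucc y) = y := by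
  cases y <;> rfl

theorem vsucc_injective {a : ℕ} : Function.Injective (vsucc (a := a)) :=
  Function.LeftInverse.injective vpred_vsucc

theorem vsucc_ne {a : ℕ} (y : Option (Fin a)) : vsucc y ≠ some 0 := by
  cases y with
  | none => simp [vsucc]
  | some v => simp [vsucc, Fin.succ_ne_zero]

theorem vsucc_vpred {a : ℕ} {y : Option (Fin (a + 1))} (h : y ≠ some 0) :
    vsucc (vpred y) = y := by
  rcases y with _ | v
  · rfl
  · have hv : v ≠ 0 := fun h' => h (by rw [h'])
    obtain ⟨v, rfl⟩ := Fin.exists_succ_eq.2 hv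
    rfl

/-- A new vertex `0` together with the old ones. -/
def vsuccEquiv (a : ℕ) : Option (Option (Fin a)) ≃ Option (Fin (a + 1)) where
  toFun y := y.elim (some 0) vsucc
  invFun y := if y = some 0 then none else some (vpred y)
  left_inv y := by
    cases y with
    | none => simp
    | some y => simp [vsucc_ne]
  right_inv y := by
    by_cases h : y = some 0
    · simp [h]
    · simp [h, vsucc_vpred h]

/-- The graph in which the outward half-edges `S` at `x` have been moved to a new vertex `0`, joined
to `x` by a new edge `0`. -/
def splitGraph {a b : ℕ} (p : Labelled a b) (x : Option (Fin a)) (S : Finset (Fin b)) :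
    Labelled (a + 1) (b + 1) :=
  (Fin.cons (vsucc x) fun e => if e ∈ S then some 0 else vsucc (p.1 e),
    Fin.cons (some 0) fun e => vsucc (p.2 e))

section split

variable {a b : ℕ} (p : Labelled a b) (x : Option (Fin a)) (S : Finset (Fin b))

theorem edgesAt_splitGraph_fst : edgesAt (splitGraph p x S).1 (some 0) = S.map (Fin.succEmb b) := by
  ext e
  rw [mem_edgesAt]
  refine Fin.cases ?_ (fun e => ?_) e
  · simp [splitGraph, vsucc_ne, Fin.succ_ne_zero]
  · by_cases he : e ∈ S <;> simp [splitGraph, he, vsucc_ne]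

theorem edgesAt_splitGraph_snd : edgesAt (splitGraph p x S).2 (some 0) = {0} := by
  ext e
  rw [mem_edgesAt]
  refine Fin.cases ?_ (fun e => ?_) e
  · simp [splitGraph]
  · simp [splitGraph, vsucc_ne, Fin.succ_ne_zero]

theorem card_edgesAt_splitGraph_snd (y : Option (Fin a)) :
    (edgesAt (splitGraph p x S).2 (vsucc y)).card = (edgesAt p.2 y).card := by
  rw [← Finset.card_map (Fin.succEmb b)]
  congr 1
  ext e
  rw [mem_edgesAt]
  refine Fin.cases ?_ (fun e => ?_) e
  · simp [splitGraph, (vsucc_ne y).symm, Fin.succ_ne_zero]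
  · simp [splitGraph, vsucc_injective.eq_iff]

variable {p x S} in
theorem card_edgesAt_splitGraph_of_ne (hS : S ⊆ edgesAt p.1 x) {y : Option (Fin a)} (hy : y ≠ x) :
    (edgesAt (splitGraph p x S).1 (vsucc y)).card = (edgesAt p.1 y).card := by
  rw [← Finset.card_map (Fin.succEmb b)]
  congr 1
  ext e
  rw [mem_edgesAt]
  refine Fin.cases ?_ (fun e => ?_) e
  · simp [splitGraph, vsucc_injective.eq_iff, hy.symm, Fin.succ_ne_zero]
  · by_cases he : e ∈ S
    · have := mem_edgesAt.1 (hS he)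
      simp [splitGraph, he, (vsucc_ne y).symm, this, hy.symm]
    · simp [splitGraph, he, vsucc_injective.eq_iff]

variable {p x S} in
theorem card_edgesAt_splitGraph_self (hS : S ⊆ edgesAt p.1 x) :
    (edgesAt (splitGraph p x S).1 (vsucc x)).card + S.card = (edgesAt p.1 x).card + 1 := by
  have : edgesAt (splitGraph p x S).1 (vsucc x) =
      insert 0 ((edgesAt p.1 x \ S).map (Fin.succEmb b)) := by
    ext e
    rw [mem_edgesAt]
    refine Fin.cases ?_ (fun e => ?_) e
    · simp [splitGraph]
    · by_cases he : e ∈ S <;>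
        simp [splitGraph, he, (vsucc_ne x).symm, vsucc_injective.eq_iff, Fin.succ_ne_zero]
  rw [this, Finset.card_insert_of_notMem (by simp [Fin.succ_ne_zero]), Finset.card_map]
  have := Finset.card_sdiff_add_card_eq_card hS
  omega

theorem splitGraph_fst_zero : (splitGraph p x S).1 0 ≠ some 0 := by
  simp [splitGraph, vsucc_ne]

variable {p x S}

theorem splitGraph_contraction (hS : S ⊆ edgesAt p.1 x) :
    ∃ (π : Option (Fin (a + 1)) → Option (Fin a))
      (τ : {e : Fin (b + 1) // e ≠ 0} ≃ Fin b), π none = none ∧ Function.Surjective π ∧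
      (∀ y, π (vsucc y) = y) ∧
      (∀ y z, π y = π z ↔ y = z ∨ (y = (splitGraph p x S).1 0 ∧ z = (splitGraph p x S).2 0) ∨
        (y = (splitGraph p x S).2 0 ∧ z = (splitGraph p x S).1 0)) ∧
      ∀ e, p.1 (τ e) = π ((splitGraph p x S).1 e) ∧ p.2 (τ e) = π ((splitGraph p x S).2 e) := by
  let π : Option (Fin (a + 1)) → Option (Fin a) := fun y => if y = some 0 then x else vpred y
  have h0 : π (some 0) = x := by simp [π]
  have h1 : ∀ y, π (vsucc y) = y := fun y => by simp [π, vsucc_ne]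
  have hcase : ∀ y : Option (Fin (a + 1)), y = some 0 ∨ ∃ z, y = vsucc z := fun y => by
    by_cases h : y = some 0
    · exact Or.inl h
    · exact Or.inr ⟨_, (vsucc_vpred h).symm⟩
  refine ⟨π, (finSuccAboveEquiv 0).symm, h1 none, fun y => ⟨_, h1 y⟩, h1, fun y z => ?_,
    fun e => ?_⟩
  · have e1 : (splitGraph p x S).1 0 = vsucc x := by simp [splitGraph]
    have e2 : (splitGraph p x S).2 0 = some 0 := by simp [splitGraph]
    rw [e1, e2]
    have hi : ∀ y z : Option (Fin a), vsucc y = vsucc z ↔ y = z := fun y z => vsucc_injective.eq_iff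
    have hn := @vsucc_ne a
    rcases hcase y with rfl | ⟨y, rfl⟩ <;> rcases hcase z with rfl | ⟨z, rfl⟩ <;>
      simp only [h0, h1, hi] <;> grind
  · obtain ⟨e, rfl⟩ := (finSuccAboveEquiv (0 : Fin (b + 1))).surjective e
    have he : (((finSuccAboveEquiv (0 : Fin (b + 1))) e : {e : Fin (b + 1) // e ≠ 0}) : Fin (b + 1)) =
      e.succ := by simp [finSuccAboveEquiv]
    have ht : (finSuccAboveEquiv (0 : Fin (b + 1))).symm (finSuccAboveEquiv 0 e) = e := by
      simp
    rw [ht, he]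
    simp only [splitGraph, Fin.cons_succ, h1, and_true]
    by_cases hS' : e ∈ S
    · simp only [hS', if_true, h0]
      exact mem_edgesAt.1 (hS hS')
    · simp only [hS', if_false, h1]

/-- The new edge is contractible since it is the only one that enters the new vertex, and
contracting it undoes the splitting. -/
theorem splitGraph_contractStep (hS : S ⊆ edgesAt p.1 x) :
    ContractStep (ofLabelled (splitGraph p x S)) (ofLabelled p) := by
  obtain ⟨π, τ, h0, h1, -, h2, h3⟩ := splitGraph_contraction hS
  refine ⟨(0 : Fin (b + 1)), ⟨?_, Or.inr ⟨?_, ?_⟩⟩, π, τ, h0, h1, h2, h3⟩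
  · have : (ofLabelled (splitGraph p x S)).tgt (0 : Fin (b + 1)) = some (0 : Fin (a + 1)) := rfl
    rw [this]
    exact splitGraph_fst_zero p x S
  · exact Option.some_ne_none _
  · exact congrArg Finset.card (edgesAt_splitGraph_snd p x S)

theorem isSemistable_ofLabelled {a b : ℕ} {p : Labelled a b} : (ofLabelled p).IsSemistable ↔
    ∀ v : Fin a, 1 ≤ (edgesAt p.2 (some v)).card ∧ 1 ≤ (edgesAt p.1 (some v)).card ∧
      3 ≤ (edgesAt p.2 (some v)).card + (edgesAt p.1 (some v)).card := Iff.rfl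

/-- The new vertex has degrees 1 and `S.card`. The vertex `x` keeps its inward degree and is left
with one more outward edge than lie outside `S`, so it can fail only with degrees 1 and 1, which is
the case excluded by `hB`. -/
theorem splitGraph_isSemistable (hS : S ⊆ edgesAt p.1 x) (h2 : 2 ≤ S.card)
    (hB : ¬ (x ≠ none ∧ (edgesAt p.2 x).card = 1 ∧ S = edgesAt p.1 x))
    (hp : (ofLabelled p).IsSemistable) : (ofLabelled (splitGraph p x S)).IsSemistable := by
  rw [isSemistable_ofLabelled] at hp ⊢
  intro w
  refine Fin.cases ?_ (fun v => ?_) w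
  · rw [edgesAt_splitGraph_fst, edgesAt_splitGraph_snd, Finset.card_map, Finset.card_singleton]
    omega
  · have hv : some v.succ = vsucc (some v) := rfl
    have hvp := hp v
    rw [hv, card_edgesAt_splitGraph_snd]
    by_cases hx : some v = x
    · have c0 := card_edgesAt_splitGraph_self hS
      have c1 : S.card ≤ (edgesAt p.1 x).card := Finset.card_le_card hS
      have c4 : x ≠ none := by rw [← hx]; simp
      rw [hx] at hvp ⊢
      by_cases c5 : S.card = (edgesAt p.1 x).card
      · have : (edgesAt p.2 x).card ≠ 1 := fun h =>
          hB ⟨c4, h, Finset.eq_of_subset_of_card_le hS c5.ge⟩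
        omega
      · omega
    · rw [card_edgesAt_splitGraph_of_ne hS hx]
      exact hvp

theorem IsContractionInvariant.splitGraph {c : PointedGraph → ℂ} (hc : IsContractionInvariant c)
    (hS : S ⊆ edgesAt p.1 x) : c (ofLabelled (splitGraph p x S)) =
      if 2 ≤ S.card ∧ ¬ (x ≠ none ∧ (edgesAt p.2 x).card = 1 ∧ S = edgesAt p.1 x) then
        c (ofLabelled p) else 0 := by
  have hstep := splitGraph_contractStep hS
  split_ifs with h
  · by_cases hp : (ofLabelled p).IsSemistable
    · exact hc.step (splitGraph_isSemistable hS h.1 h.2 hp) hstep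
    · rw [hc.semistable hp, hc.semistable]
      exact fun hH' => hp (hstep.isSemistable hH')
  · apply hc.semistable
    rw [isSemistable_ofLabelled]
    intro hss
    have h0 := hss 0
    rw [edgesAt_splitGraph_fst, edgesAt_splitGraph_snd, Finset.card_map, Finset.card_singleton] at h0
    apply h
    refine ⟨by omega, ?_⟩
    rintro ⟨hx, hi, hSx⟩
    obtain ⟨v, rfl⟩ := Option.ne_none_iff_exists'.1 hx
    have h3 := hss v.succ
    have hv : some v.succ = vsucc (some v) := rfl
    have c0 := card_edgesAt_splitGraph_self hS
    have c1 := congrArg Finset.card hSx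
    rw [hv, card_edgesAt_splitGraph_snd] at h3
    omega

end split

/-- Graphs with a vertex `0` whose only incoming edge is the edge `0`, not a loop, arise uniquely by
splitting. -/
theorem sum_splitGraph {a b : ℕ} (Q : Labelled (a + 1) (b + 1) → ℂ) :
    ∑ H with edgesAt H.2 (some 0) = {0} ∧ H.1 0 ≠ some 0, Q H =
      ∑ p : Labelled a b, ∑ x, ∑ S ∈ (edgesAt p.1 x).powerset, Q (splitGraph p x S) := by
  have h1 : ∑ p : Labelled a b, ∑ x, ∑ S ∈ (edgesAt p.1 x).powerset, Q (splitGraph p x S) =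
      ∑ t : Labelled a b × Option (Fin a) × Finset (Fin b) with t.2.2 ⊆ edgesAt t.1.1 t.2.1,
        Q (splitGraph t.1 t.2.1 t.2.2) := by
    rw [Finset.sum_filter]
    conv_rhs => rw [Fintype.sum_prod_type]
    refine Finset.sum_congr rfl fun p _ => ?_
    rw [Fintype.sum_prod_type]
    refine Finset.sum_congr rfl fun x _ => ?_
    have h2 : (edgesAt p.1 x).powerset = Finset.univ.filter fun S => S ⊆ edgesAt p.1 x := by
      ext S
      simp
    rw [h2, Finset.sum_filter]
  rw [h1]
  symm
  have hsplit : ∀ (t : Labelled a b × Option (Fin a) × Finset (Fin b)) (e : Fin b),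
      (splitGraph t.1 t.2.1 t.2.2).1 e.succ = some 0 ↔ e ∈ t.2.2 := fun t e => by
    by_cases he : e ∈ t.2.2 <;> simp [splitGraph, he, vsucc_ne]
  -- The inverse reads off `S` as the set of edges leaving the vertex `0` and contracts the edge
  -- `0`.
  refine Finset.sum_bij' (fun t _ => splitGraph t.1 t.2.1 t.2.2)
    (fun H _ => ((fun e => if H.1 e.succ = some 0 then vpred (H.1 0) else vpred (H.1 e.succ),
      fun e => vpred (H.2 e.succ)), vpred (H.1 0), Finset.univ.filter fun e => H.1 e.succ = some 0))
    ?_ ?_ ?_ ?_ ?_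
  · intro t _
    simp [edgesAt_splitGraph_snd, splitGraph_fst_zero]
  · intro H _
    simp only [Finset.mem_filter, Finset.mem_univ, true_and]
    intro e he
    simp only [Finset.mem_filter, Finset.mem_univ, true_and] at he
    simp [he]
  · intro t ht
    have ht := (Finset.mem_filter.1 ht).2
    obtain ⟨⟨s, t'⟩, x, S⟩ := t
    have e1 : (splitGraph (s, t') x S).1 0 = vsucc x := by simp [splitGraph]
    simp only [hsplit ⟨(s, t'), x, S⟩, e1, vpred_vsucc] at ht ⊢
    refine Prod.ext (Prod.ext ?_ ?_) (Prod.ext rfl ?_)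
    · funext e
      by_cases he : e ∈ S
      · have := mem_edgesAt.1 (ht he)
        simp only [he, if_true]
        exact this.symm
      · simp [he, splitGraph]
    · funext e
      simp [splitGraph]
    · ext e; simp
  · intro H hH
    obtain ⟨h1, h2⟩ := (Finset.mem_filter.1 hH).2
    have h3 : ∀ e, H.2 e = some 0 ↔ e = 0 := fun e => by
      have := Finset.ext_iff.1 h1 e
      simpa using this
    refine Prod.ext ?_ ?_
    · funext e
      refine Fin.cases ?_ (fun e => ?_) e
      · simp [splitGraph, vsucc_vpred h2]
      · by_cases he : H.1 e.succ = some 0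
        · simp [splitGraph, he]
        · simp [splitGraph, he, vsucc_vpred he]
    · funext e
      refine Fin.cases ?_ (fun e => ?_) e
      · simp [splitGraph, (h3 0).2 rfl]
      · have : H.2 e.succ ≠ some 0 := fun h => Fin.succ_ne_zero _ ((h3 _).1 h)
        simp [splitGraph, vsucc_vpred this]
  · intro t _
    rfl

/-- Relabelling of vertices and edges. -/
def relabel {a b : ℕ} (σ : Equiv.Perm (Fin a)) (τ : Equiv.Perm (Fin b)) :
    Labelled a b ≃ Labelled a b :=
  Equiv.prodCongr (Equiv.arrowCongr τ (Equiv.optionCongr σ)) (Equiv.arrowCongr τ (Equiv.optionCongr σ))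

theorem relabel_fst {a b : ℕ} (σ : Equiv.Perm (Fin a)) (τ : Equiv.Perm (Fin b)) (p : Labelled a b)
    (e : Fin b) : (relabel σ τ p).1 (τ e) = Equiv.optionCongr σ (p.1 e) := by
  simp [relabel]

theorem relabel_snd {a b : ℕ} (σ : Equiv.Perm (Fin a)) (τ : Equiv.Perm (Fin b)) (p : Labelled a b)
    (e : Fin b) : (relabel σ τ p).2 (τ e) = Equiv.optionCongr σ (p.2 e) := by
  simp [relabel]

theorem relabel_iso {a b : ℕ} (σ : Equiv.Perm (Fin a)) (τ : Equiv.Perm (Fin b)) (p : Labelled a b) :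
    Nonempty (Iso (ofLabelled p) (ofLabelled (relabel σ τ p))) :=
  ⟨⟨(σ, τ), fun e => ⟨relabel_fst σ τ p e, relabel_snd σ τ p e⟩⟩⟩

theorem edgesAt_relabel_snd {a b : ℕ} (σ : Equiv.Perm (Fin a)) (τ : Equiv.Perm (Fin b))
    (p : Labelled a b) (s : Fin a) :
    edgesAt (relabel σ τ p).2 (some (σ s)) = (edgesAt p.2 (some s)).map τ.toEmbedding := by
  ext e
  obtain ⟨e, rfl⟩ := τ.surjective e
  have h1 : some (σ s) = Equiv.optionCongr σ (some s) := rfl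
  simp only [edgesAt, Finset.mem_filter, Finset.mem_univ, true_and, relabel_snd, h1,
    Finset.mem_map_equiv, Equiv.symm_apply_apply]
  exact (Equiv.optionCongr σ).injective.eq_iff

/-- By symmetry, a sum over marked vertices and edges is a multiple of one where `0` is marked. -/
theorem sum_marked {a b : ℕ} (Q : Labelled (a + 1) (b + 1) → Fin (a + 1) → Fin (b + 1) → ℂ)
    (hQ : ∀ σ τ p s e, Q (relabel σ τ p) (σ s) (τ e) = Q p s e) :
    ∑ p, ∑ s, ∑ e, Q p s e = ((a + 1 : ℕ) : ℂ) * ((b + 1 : ℕ) : ℂ) * ∑ p, Q p 0 0 := by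
  have h1 : ∀ s e, ∑ p, Q p s e = ∑ p, Q p 0 0 := fun s e => by
    refine Fintype.sum_equiv (relabel (Equiv.swap s 0) (Equiv.swap e 0)) _ _ fun p => ?_
    rw [← hQ (Equiv.swap s 0) (Equiv.swap e 0) p s e, Equiv.swap_apply_left, Equiv.swap_apply_left]
  rw [Finset.sum_comm]
  have h2 : ∀ s, ∑ p, ∑ e, Q p s e = ((b + 1 : ℕ) : ℂ) * ∑ p, Q p 0 0 := fun s => by
    rw [Finset.sum_comm]
    simp only [h1]
    simp
  simp only [h2]
  simp
  ring

/-! ### Telescoping of the variation over the number of vertices -/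

section invariance

variable {n : ℕ} (w : Fin n → Fin n → ℂ) (T F : Multiset (Fin n) → Multiset (Fin n) → ℂ)
  (u : Fin n → Multiset (Fin n) → ℂ)

/-- The contraction along a graph with a split tensor at the vertex `s`. -/
def markedEval {a b : ℕ} (p : Labelled a b) (s : Fin a) : ℂ :=
  gev p.1 p.2 w (Function.update (vertexTensor T F) (some s) (splitTensor T u))

theorem markedEval_relabel {a b : ℕ} (σ : Equiv.Perm (Fin a)) (τ : Equiv.Perm (Fin b))
    (p : Labelled a b) (s : Fin a) :
    markedEval w T F u (relabel σ τ p) (σ s) = markedEval w T F u p s := by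
  refine gev_reindex (Equiv.optionCongr σ) τ (relabel_fst σ τ p) (relabel_snd σ τ p) w fun v => ?_
  by_cases h : v = some s
  · subst h
    have : Equiv.optionCongr σ (some s) = some (σ s) := rfl
    rw [this, Function.update_self, Function.update_self]
  · rw [Function.update_of_ne h, Function.update_of_ne]
    · cases v <;> rfl
    · exact fun h' => h ((Equiv.optionCongr σ).injective (h'.trans rfl))

variable {w T F u}

theorem splitTerm_eq_markedEval (hw : ∀ a k, ∑ l, w a l * T {k} {l} = if a = k then 1 else 0)
    {a b : ℕ} {p : Labelled a b} {x : Option (Fin a)} {S : Finset (Fin b)}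
    (hS : S ⊆ edgesAt p.1 x) :
    splitTerm p.1 p.2 w (vertexTensor T F) u x S = markedEval w T F u (splitGraph p x S) 0 := by
  rw [splitTerm_eq_gev _ _ _ _ hw hS]
  symm
  refine gev_reindex (vsuccEquiv a) (finSuccEquiv b).symm ?_ ?_ w ?_
  · rintro (_ | e)
    · simp [splitGraph, vsuccEquiv]
    · by_cases he : e ∈ S <;> simp [splitGraph, vsuccEquiv, he]
  · rintro (_ | e) <;> simp [splitGraph, vsuccEquiv]
  · rintro (_ | _ | v)
    · simp [vsuccEquiv]
    · simp [vsuccEquiv, vsucc, vertexTensor]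
    · simp [vsuccEquiv, vsucc, vertexTensor, Fin.succ_ne_zero]

variable {c : PointedGraph → ℂ}

/-- A vertex of inward degree one determines its inward edge, which is marked as well. If that edge
is a loop the weight vanishes by the `loop` field; the other marked pairs are moved to `(0, 0)` by
relabelling. -/
theorem sum_marked_loopless (hc : IsContractionInvariant c) (a b : ℕ) :
    ∑ p : Labelled (a + 1) (b + 1), ∑ s, (if (edgesAt p.2 (some s)).card = 1 then
        c (ofLabelled p) * markedEval w T F u p s else 0) =
      ((a + 1 : ℕ) : ℂ) * ((b + 1 : ℕ) : ℂ) *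
        ∑ p : Labelled (a + 1) (b + 1) with edgesAt p.2 (some 0) = {0} ∧ p.1 0 ≠ some 0,
          c (ofLabelled p) * markedEval w T F u p 0 := by
  rw [Finset.sum_filter, ← sum_marked (fun p s e =>
    if edgesAt p.2 (some s) = {e} ∧ p.1 e ≠ some s then
      c (ofLabelled p) * markedEval w T F u p s else 0)]
  · refine Finset.sum_congr rfl fun p _ => Finset.sum_congr rfl fun s _ => ?_
    by_cases h : (edgesAt p.2 (some s)).card = 1
    · obtain ⟨e, he⟩ := Finset.card_eq_one.1 h
      rw [if_pos h, Finset.sum_eq_single e]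
      · by_cases hl : p.1 e = some s
        · have ht : p.2 e = some s := by
            have : e ∈ edgesAt p.2 (some s) := by rw [he]; simp
            simpa using this
          rw [hc.loop (G := ofLabelled p) s e h hl ht]
          simp
        · simp [he, hl]
      · intro e' _ hne
        rw [if_neg]
        rintro ⟨h', _⟩
        exact hne (Finset.singleton_injective (h'.symm.trans he))
      · simp
    · rw [if_neg h, Finset.sum_eq_zero]
      intro e _
      rw [if_neg]
      rintro ⟨h', _⟩
      exact h (by rw [h']; simp)
  · intro σ τ p s e
    have h1 : edgesAt (relabel σ τ p).2 (some (σ s)) = {τ e} ↔ edgesAt p.2 (some s) = {e} := by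
      rw [edgesAt_relabel_snd, ← (Finset.map_injective τ.toEmbedding).eq_iff (a := edgesAt p.2 _)]
      simp
    have h2 : (relabel σ τ p).1 (τ e) ≠ some (σ s) ↔ p.1 e ≠ some s := by
      rw [relabel_fst, not_iff_not]
      exact (Equiv.optionCongr σ).injective.eq_iff (b := some s)
    simp only [h1, h2, markedEval_relabel, ← hc.iso (relabel_iso σ τ p)]

/-- The variation is a sum over pairs `(x, S)` with at least two half-edges in `S`. For most of them
the split graph is semistable and has the same weight, which gives the first sum. The exceptional
pairs, with `x` ordinary of inward degree one and `S` everything leaving `x`, give the second sum,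
through `splitTerm_edgesAt`; their split graphs are not semistable and have weight zero. -/
theorem mul_dgev_eq (hc : IsContractionInvariant c)
    (hw : ∀ a k, ∑ l, w a l * T {k} {l} = if a = k then 1 else 0)
    {δw : Fin n → Fin n → ℂ} {δT δF : Multiset (Fin n) → Multiset (Fin n) → ℂ}
    (hu : ∀ k, u k 0 = 0) (hδw : ∀ a b, δw a b = -∑ k, u a {k} * w k b)
    (hδT : ∀ (b : ℕ) (i : Fin b → Fin n) (S : Finset (Fin b)) (J : Multiset (Fin n)),
      S.Nonempty → J ≠ 0 → δT (S.val.map i) J = ∑ R ∈ S.powerset, ∑ k, u k (R.val.map i) *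
        T (k ::ₘ (S \ R).val.map i) J)
    (hδF : ∀ (b : ℕ) (i : Fin b → Fin n) (S : Finset (Fin b)) (J : Multiset (Fin n)),
      δF (S.val.map i) J = ∑ R ∈ S.powerset, ∑ k, u k (R.val.map i) *
        F (k ::ₘ (S \ R).val.map i) J) {a b : ℕ} (p : Labelled a b) :
    c (ofLabelled p) * dgev p.1 p.2 w δw (vertexTensor T F) (vertexTensor δT δF) =
      (∑ x, ∑ S ∈ (edgesAt p.1 x).powerset, c (ofLabelled (splitGraph p x S)) *
        markedEval w T F u (splitGraph p x S) 0) +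
      ∑ s, (if (edgesAt p.2 (some s)).card = 1 then
        c (ofLabelled p) * markedEval w T F u p s else 0) := by
  by_cases hp : (ofLabelled p).IsSemistable
  swap
  · have h0 := hc.semistable hp
    rw [h0, Finset.sum_eq_zero, Finset.sum_eq_zero] <;> simp
    intro x
    refine Finset.sum_eq_zero fun S hS => ?_
    rw [hc.splitGraph (Finset.mem_powerset.1 hS), h0]
    simp
  rw [dgev_eq_sum_splitTerm p.1 p.2 hu hδw]
  · have h1 : ∑ s, (if (edgesAt p.2 (some s)).card = 1 then
        c (ofLabelled p) * markedEval w T F u p s else 0) =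
        ∑ x, ∑ S ∈ (edgesAt p.1 x).powerset,
          if x ≠ none ∧ (edgesAt p.2 x).card = 1 ∧ S = edgesAt p.1 x then
            c (ofLabelled p) * splitTerm p.1 p.2 w (vertexTensor T F) u x S else 0 := by
      rw [Fintype.sum_option]
      simp only [ne_eq, not_true_eq_false, false_and, if_false, Finset.sum_const_zero, zero_add,
        reduceCtorEq, not_false_eq_true, true_and]
      refine Finset.sum_congr rfl fun s _ => ?_
      by_cases h : (edgesAt p.2 (some s)).card = 1
      · simp only [h, true_and, if_true]
        rw [Finset.sum_ite_eq' , if_pos (by simp), splitTerm_edgesAt]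
        rfl
      · simp [h]
    rw [h1, ← Finset.sum_add_distrib, Finset.mul_sum]
    refine Finset.sum_congr rfl fun x _ => ?_
    rw [← Finset.sum_add_distrib, Finset.mul_sum, Finset.sum_filter]
    refine Finset.sum_congr rfl fun S hS => ?_
    have hS' := Finset.mem_powerset.1 hS
    rw [hc.splitGraph hS', ← splitTerm_eq_markedEval hw hS']
    by_cases hB : x ≠ none ∧ (edgesAt p.2 x).card = 1 ∧ S = edgesAt p.1 x
    · have h2 : 2 ≤ S.card := by
        obtain ⟨hx, hi, hSx⟩ := hB
        obtain ⟨v, rfl⟩ := Option.ne_none_iff_exists'.1 hx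
        have h3 := hp v
        have c1 : S.card = (ofLabelled p).outDeg (some v) := congrArg Finset.card hSx
        have c2 : (ofLabelled p).inDeg (some v) = 1 := hi
        change 1 ≤ (ofLabelled p).inDeg (some (v : Fin a)) ∧ 1 ≤ (ofLabelled p).outDeg (some (v : Fin a)) ∧
          3 ≤ (ofLabelled p).inDeg (some (v : Fin a)) + (ofLabelled p).outDeg (some (v : Fin a)) at h3
        omega
      rw [if_pos h2, if_neg (fun h => h.2 hB), if_pos hB, zero_mul, zero_add]
    · by_cases h2 : 2 ≤ S.card
      · rw [if_pos h2, if_pos ⟨h2, hB⟩, if_neg hB, add_zero]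
      · rw [if_neg h2, if_neg (fun h => h2 h.1), if_neg hB, zero_mul, add_zero]
  · rintro (_ | v) i j
    · exact hδF _ _ _ _
    · have h3 := hp v
      refine hδT _ _ _ _ ?_ ?_
      · rw [← Finset.card_pos]
        exact h3.2.1
      · rw [← Multiset.card_pos, idxAt, Multiset.card_map]
        exact h3.1

/-- Infinitesimal invariance of the sum over labelled graphs with contraction invariant weights. -/
theorem sum_dgev_eq_zero (hc : IsContractionInvariant c)
    (hw : ∀ a k, ∑ l, w a l * T {k} {l} = if a = k then 1 else 0)
    {δw : Fin n → Fin n → ℂ} {δT δF : Multiset (Fin n) → Multiset (Fin n) → ℂ}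
    (hu : ∀ k, u k 0 = 0) (hδw : ∀ a b, δw a b = -∑ k, u a {k} * w k b)
    (hδT : ∀ (b : ℕ) (i : Fin b → Fin n) (S : Finset (Fin b)) (J : Multiset (Fin n)),
      S.Nonempty → J ≠ 0 → δT (S.val.map i) J = ∑ R ∈ S.powerset, ∑ k, u k (R.val.map i) *
        T (k ::ₘ (S \ R).val.map i) J)
    (hδF : ∀ (b : ℕ) (i : Fin b → Fin n) (S : Finset (Fin b)) (J : Multiset (Fin n)),
      δF (S.val.map i) J = ∑ R ∈ S.powerset, ∑ k, u k (R.val.map i) *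
        F (k ::ₘ (S \ R).val.map i) J) (d N : ℕ) (hN : ∀ G : PointedGraph, G.nV = N → c G = 0) :
    ∑ a ∈ Finset.range N, (-1 : ℂ) ^ a / (a.factorial * (a + d).factorial : ℕ) *
      ∑ p : Labelled a (a + d), c (ofLabelled p) *
        dgev p.1 p.2 w δw (vertexTensor T F) (vertexTensor δT δF) = 0 := by
  -- The contribution of the graphs with `a` ordinary vertices, one of which has inward degree one
  -- and carries the split tensor. The variation at level `a` is `β a + β (a + 1)`, so the
  -- alternating sum telescopes.
  let β : ℕ → ℂ := fun a => (∑ p : Labelled a (a + d), ∑ s,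
    (if (edgesAt p.2 (some s)).card = 1 then c (ofLabelled p) * markedEval w T F u p s else 0)) /
      (a.factorial * (a + d).factorial : ℕ)
  have h1 : ∀ a, (-1 : ℂ) ^ a / (a.factorial * (a + d).factorial : ℕ) *
      ∑ p : Labelled a (a + d), c (ofLabelled p) *
        dgev p.1 p.2 w δw (vertexTensor T F) (vertexTensor δT δF) =
      (-1) ^ a * β a - (-1) ^ (a + 1) * β (a + 1) := by
    intro a
    simp only [mul_dgev_eq hc hw hu hδw hδT hδF, Finset.sum_add_distrib]
    rw [← sum_splitGraph (fun H => c (ofLabelled H) * markedEval w T F u H 0)]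
    -- The `(a + 1)(a + d + 1)` choices of a marked vertex and edge account for the quotient of the
    -- factorial weights at levels `a + 1` and `a`.
    have h2 : β (a + 1) = (∑ H : Labelled (a + 1) (a + d + 1) with
        edgesAt H.2 (some 0) = {0} ∧ H.1 0 ≠ some 0,
        c (ofLabelled H) * markedEval w T F u H 0) / (a.factorial * (a + d).factorial : ℕ) := by
      have hb : a + 1 + d = a + d + 1 := by omega
      have h3 : β (a + 1) = (∑ p : Labelled (a + 1) (a + d + 1), ∑ s,
          (if (edgesAt p.2 (some s)).card = 1 then
            c (ofLabelled p) * markedEval w T F u p s else 0)) /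
          ((a + 1).factorial * (a + d + 1).factorial : ℕ) := by
        simp only [β]
        rw [hb]
      rw [h3, sum_marked_loopless hc, Nat.factorial_succ, Nat.factorial_succ]
      have n1 : ((a + 1 : ℕ) : ℂ) ≠ 0 := Nat.cast_ne_zero.2 (by omega)
      have n2 : ((a + d + 1 : ℕ) : ℂ) ≠ 0 := Nat.cast_ne_zero.2 (by omega)
      have n3 : (a.factorial : ℂ) ≠ 0 := Nat.cast_ne_zero.2 (Nat.factorial_ne_zero _)
      have n4 : ((a + d).factorial : ℂ) ≠ 0 := Nat.cast_ne_zero.2 (Nat.factorial_ne_zero _)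
      rw [Nat.cast_mul, Nat.cast_mul, Nat.cast_mul, Nat.cast_mul]
      field_simp
    rw [h2]
    simp only [β]
    ring
  rw [Finset.sum_congr rfl fun a _ => h1 a, Finset.sum_range_sub']
  -- Boundary terms: without ordinary vertices nothing can be marked, and at level `N` the weight
  -- vanishes by `hN`.
  have hb0 : β 0 = 0 := by simp [β]
  have hbN : β N = 0 := by
    simp only [β]
    rw [Finset.sum_eq_zero, zero_div]
    intro p _
    rw [hN (ofLabelled p) rfl]
    simp
  rw [hb0, hbN]
  simp

end invariance

end PointedGraph

namespace PointedGraph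

/-! ## Derivatives of contractions -/

section derivative

variable {m n : ℕ} {V E : Type} [Fintype V] [DecidableEq V] [Fintype E] [DecidableEq E]

theorem differentiableAt_prod {ι : Type} {s : Finset ι} (F : ι → (Fin m → ℂ) → ℂ)
    {x : Fin m → ℂ} (hF : ∀ i ∈ s, DifferentiableAt ℝ (F i) x) :
    DifferentiableAt ℝ (fun y => ∏ i ∈ s, F i y) x := by
  classical
  induction s using Finset.induction_on with
  | empty => simp
  | insert a s ha ih =>
    simp only [Finset.prod_insert ha]
    exact (hF a (by simp)).fun_mul (ih fun i hi => hF i (by simp [hi]))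

theorem differentiableAt_gev (src tgt : E → V) {w : (Fin m → ℂ) → Fin n → Fin n → ℂ}
    {T : (Fin m → ℂ) → V → Multiset (Fin n) → Multiset (Fin n) → ℂ} {x : Fin m → ℂ}
    (hw : ∀ a b, DifferentiableAt ℝ (fun y => w y a b) x)
    (hT : ∀ v I J, DifferentiableAt ℝ (fun y => T y v I J) x) :
    DifferentiableAt ℝ (fun y => gev src tgt (w y) (T y)) x :=
  DifferentiableAt.fun_sum fun i _ => DifferentiableAt.fun_sum fun j _ =>
    (differentiableAt_prod (fun e y => w y (i e) (j e)) fun _ _ => hw _ _).fun_mul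
      (differentiableAt_prod (fun v y => T y v (idxAt src i v) (idxAt tgt j v)) fun _ _ => hT _ _ _)

theorem wirt_gev (ε : ℂ) (k : Fin m) (src tgt : E → V) {w : (Fin m → ℂ) → Fin n → Fin n → ℂ}
    {T : (Fin m → ℂ) → V → Multiset (Fin n) → Multiset (Fin n) → ℂ} {x : Fin m → ℂ}
    (hw : ∀ a b, DifferentiableAt ℝ (fun y => w y a b) x)
    (hT : ∀ v I J, DifferentiableAt ℝ (fun y => T y v I J) x) :
    wirt ε k (fun y => gev src tgt (w y) (T y)) x = dgev src tgt (w x)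
      (fun a b => wirt ε k (fun y => w y a b) x) (T x)
      (fun v I J => wirt ε k (fun y => T y v I J) x) := by
  have d1 : ∀ i j : E → Fin n, DifferentiableAt ℝ (fun y => ∏ e, w y (i e) (j e)) x := fun i j =>
    differentiableAt_prod (fun e y => w y (i e) (j e)) fun _ _ => hw _ _
  have d2 : ∀ i j : E → Fin n, DifferentiableAt ℝ
      (fun y => ∏ v, T y v (idxAt src i v) (idxAt tgt j v)) x := fun i j =>
    differentiableAt_prod (fun v y => T y v (idxAt src i v) (idxAt tgt j v)) fun _ _ => hT _ _ _
  unfold gev dgev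
  rw [wirt_sum _ _ fun i _ => DifferentiableAt.fun_sum fun j _ => (d1 i j).fun_mul (d2 i j)]
  refine Finset.sum_congr rfl fun i _ => ?_
  rw [wirt_sum _ _ fun j _ => (d1 i j).fun_mul (d2 i j)]
  refine Finset.sum_congr rfl fun j _ => ?_
  rw [wirt_mul (d1 i j) (d2 i j), wirt_prod _ (fun e y => w y (i e) (j e)) fun _ _ => hw _ _,
    wirt_prod _ (fun v y => T y v (idxAt src i v) (idxAt tgt j v)) fun _ _ => hT _ _ _]

theorem conj_gev (src tgt : E → V) {w w' : Fin n → Fin n → ℂ}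
    {T T' : V → Multiset (Fin n) → Multiset (Fin n) → ℂ}
    (hw : ∀ a b, starRingEnd ℂ (w a b) = w' b a)
    (hT : ∀ v I J, starRingEnd ℂ (T v I J) = T' v J I) :
    starRingEnd ℂ (gev src tgt w T) = gev tgt src w' T' := by
  unfold gev
  simp only [map_sum, map_mul, map_prod, hw, hT]
  rw [Finset.sum_comm]

end derivative

/-- The weighted sum of the contractions along the labelled graphs with fewer than `N` vertices
whose number of edges exceeds the number of vertices by `d`. -/
def labelledSum (c : PointedGraph → ℂ) (d N : ℕ) {n : ℕ} (w : Fin n → Fin n → ℂ)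
    (T F : Multiset (Fin n) → Multiset (Fin n) → ℂ) : ℂ :=
  ∑ a ∈ Finset.range N, (-1 : ℂ) ^ a / (a.factorial * (a + d).factorial : ℕ) *
    ∑ p : Labelled a (a + d), c (ofLabelled p) * gev p.1 p.2 w (vertexTensor T F)

theorem sum_rev {a b : ℕ} (Q : Labelled a b → ℂ) :
    ∑ p : Labelled a b, Q (p.2, p.1) = ∑ p : Labelled a b, Q p :=
  Fintype.sum_equiv (Equiv.prodComm _ _) _ _ fun _ => rfl

theorem conj_labelledSum (c : PointedGraph → ℂ) (d N : ℕ) {n : ℕ} {w w' : Fin n → Fin n → ℂ}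
    {T F T' F' : Multiset (Fin n) → Multiset (Fin n) → ℂ}
    (hw : ∀ a b, starRingEnd ℂ (w a b) = w' b a) (hT : ∀ I J, starRingEnd ℂ (T I J) = T' J I)
    (hF : ∀ I J, starRingEnd ℂ (F I J) = F' J I) :
    starRingEnd ℂ (labelledSum c d N w T F) =
      labelledSum (fun G => starRingEnd ℂ (c G.rev)) d N w' T' F' := by
  unfold labelledSum
  simp only [map_sum, map_mul, map_div₀, map_pow, map_neg, map_one, Complex.conj_natCast]
  refine Finset.sum_congr rfl fun a _ => ?_
  congr 1
  rw [← sum_rev fun p => starRingEnd ℂ (c (ofLabelled p)) *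
    starRingEnd ℂ (gev p.1 p.2 w (vertexTensor T F))]
  refine Finset.sum_congr rfl fun p _ => ?_
  rw [conj_gev p.2 p.1 hw (T' := vertexTensor T' F') (fun v I J => by
    cases v
    · exact hF _ _
    · exact hT _ _)]
  rfl

/-! ### Variation along a complex parameter, carried by the coordinate `0` -/

section infinitesimal

variable {n : ℕ} {Ω : Set (Fin (n + 1) → ℂ)}
  {g : (Fin (n + 1) → ℂ) → Matrix (Fin (n + 1)) (Fin (n + 1)) ℂ} {h : (Fin (n + 1) → ℂ) → ℂ}
  {v : Fin n → (Fin (n + 1) → ℂ) → ℂ} {x₀ : Fin (n + 1) → ℂ}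

/-- The inverse metric in the directions `1, …, n`. -/
def sliceInv (g : (Fin (n + 1) → ℂ) → Matrix (Fin (n + 1)) (Fin (n + 1)) ℂ)
    (x : Fin (n + 1) → ℂ) (a b : Fin n) : ℂ := ((g x).submatrix Fin.succ Fin.succ)⁻¹ b a

/-- The jets of the metric in the directions `1, …, n`. -/
def sliceJet (g : (Fin (n + 1) → ℂ) → Matrix (Fin (n + 1)) (Fin (n + 1)) ℂ)
    (x : Fin (n + 1) → ℂ) (I J : Multiset (Fin n)) : ℂ :=
  mJet g (I.map Fin.succ) (J.map Fin.succ) x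

/-- The jets of a function in the directions `1, …, n`. -/
def sliceFun (h : (Fin (n + 1) → ℂ) → ℂ) (x : Fin (n + 1) → ℂ) (I J : Multiset (Fin n)) : ℂ :=
  fJet (I.map Fin.succ) (J.map Fin.succ) h x

theorem contDiffOn_sliceInv (hg : IsClosedForm Ω g)
    (hdet : ∀ x ∈ Ω, ((g x).submatrix Fin.succ Fin.succ).det ≠ 0) (a b : Fin n) :
    ContDiffOn ℝ ∞ (fun x => sliceInv g x a b) Ω :=
  contDiffOn_matrix_inv (A := fun x => (g x).submatrix Fin.succ Fin.succ)
    (fun a b => hg.smooth _ _) hdet b a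

theorem differentiableAt_vertexTensor (hΩ : IsOpen Ω) (hg : IsClosedForm Ω g)
    (hh : ContDiffOn ℝ ∞ h Ω) (hx : x₀ ∈ Ω) {a : ℕ} (y : Option (Fin a))
    (I J : Multiset (Fin n)) :
    DifferentiableAt ℝ (fun x => vertexTensor (sliceJet g x) (sliceFun h x) y I J) x₀ := by
  cases y with
  | none => exact diffAt_of_smooth hΩ (contDiffOn_fJet hΩ hh _ _) hx
  | some y => exact diffAt_of_smooth hΩ (contDiffOn_mJet hΩ hg _ _) hx

theorem differentiableAt_labelledSum (c : PointedGraph → ℂ) (d N : ℕ) (hΩ : IsOpen Ω)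
    (hg : IsClosedForm Ω g) (hdet : ∀ x ∈ Ω, ((g x).submatrix Fin.succ Fin.succ).det ≠ 0)
    (hh : ContDiffOn ℝ ∞ h Ω) (hx : x₀ ∈ Ω) :
    DifferentiableAt ℝ
      (fun x => labelledSum c d N (sliceInv g x) (sliceJet g x) (sliceFun h x)) x₀ := by
  refine DifferentiableAt.fun_sum fun a _ => DifferentiableAt.fun_mul (differentiableAt_const _) ?_
  refine DifferentiableAt.fun_sum fun p _ => DifferentiableAt.fun_mul (differentiableAt_const _) ?_
  exact differentiableAt_gev _ _
    (fun a b => diffAt_of_smooth hΩ (contDiffOn_sliceInv hg hdet a b) hx)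
    (fun y I J => differentiableAt_vertexTensor hΩ hg hh hx y I J)

/-- Invariance under the flow of a holomorphic vector field, infinitesimally. -/
theorem dz_labelledSum_eq_zero {c : PointedGraph → ℂ} (hc : IsContractionInvariant c) (d N : ℕ)
    (hN : ∀ G : PointedGraph, G.nV = N → c G = 0) (hΩ : IsOpen Ω) (hg : IsClosedForm Ω g)
    (hdet : ∀ x ∈ Ω, ((g x).submatrix Fin.succ Fin.succ).det ≠ 0) (hh : ContDiffOn ℝ ∞ h Ω)
    (hv : ∀ k, Hol Ω (v k)) (hx : x₀ ∈ Ω) (hv0 : ∀ k, v k x₀ = 0)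
    (hgv : ∀ x ∈ Ω, ∀ b : Fin n, g x 0 b.succ = ∑ k, v k x * g x k.succ b.succ)
    (hhv : ∀ x ∈ Ω, dz 0 h x = ∑ k, v k x * dz k.succ h x) :
    dz 0 (fun x => labelledSum c d N (sliceInv g x) (sliceJet g x) (sliceFun h x)) x₀ = 0 := by
  -- The holomorphic jets at `x₀` of the vector field play the role of `u` in the splitting
  -- formulas. By `hgv` and `hhv`, the parameter direction acts on the form and on the function like
  -- this field.
  set u : Fin n → Multiset (Fin n) → ℂ := fun k I => fJet (I.map Fin.succ) 0 (v k) x₀ with hu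
  have hgdiff : ∀ i j, DifferentiableAt ℝ (fun x => g x i j) x₀ := fun i j =>
    diffAt_of_smooth hΩ (hg.smooth i j) hx
  have e1 : ∀ (b : ℕ) (p : Labelled b (b + d)), dz 0 (fun x => gev p.1 p.2 (sliceInv g x)
      (vertexTensor (sliceJet g x) (sliceFun h x))) x₀ = dgev p.1 p.2 (sliceInv g x₀)
      (fun a b => dz 0 (fun x => sliceInv g x a b) x₀)
      (vertexTensor (sliceJet g x₀) (sliceFun h x₀))
      (vertexTensor (fun I J => dz 0 (fun x => sliceJet g x I J) x₀)
        (fun I J => dz 0 (fun x => sliceFun h x I J) x₀)) := by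
    intro b p
    rw [dz_eq_wirt, wirt_gev _ _ _ _
      (fun a b => diffAt_of_smooth hΩ (contDiffOn_sliceInv hg hdet a b) hx)
      (fun y I J => differentiableAt_vertexTensor hΩ hg hh hx y I J)]
    congr 1
    funext y
    cases y <;> rfl
  have e2 : dz 0 (fun x => labelledSum c d N (sliceInv g x) (sliceJet g x) (sliceFun h x)) x₀ =
      ∑ a ∈ Finset.range N, (-1 : ℂ) ^ a / (a.factorial * (a + d).factorial : ℕ) *
        ∑ p : Labelled a (a + d), c (ofLabelled p) * dz 0 (fun x => gev p.1 p.2 (sliceInv g x)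
          (vertexTensor (sliceJet g x) (sliceFun h x))) x₀ := by
    have hd : ∀ (a : ℕ) (p : Labelled a (a + d)), DifferentiableAt ℝ
        (fun x => gev p.1 p.2 (sliceInv g x) (vertexTensor (sliceJet g x) (sliceFun h x))) x₀ :=
      fun a p => differentiableAt_gev _ _
        (fun a b => diffAt_of_smooth hΩ (contDiffOn_sliceInv hg hdet a b) hx)
        (fun y I J => differentiableAt_vertexTensor hΩ hg hh hx y I J)
    unfold labelledSum
    rw [dz_eq_wirt, wirt_sum _ _ fun a _ => DifferentiableAt.fun_mul (differentiableAt_const _)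
      (DifferentiableAt.fun_sum fun p _ => DifferentiableAt.fun_mul (differentiableAt_const _)
        (hd a p))]
    refine Finset.sum_congr rfl fun a _ => ?_
    rw [wirt_const_mul _ (DifferentiableAt.fun_sum fun p _ =>
      DifferentiableAt.fun_mul (differentiableAt_const _) (hd a p)),
      wirt_sum _ _ fun p _ => DifferentiableAt.fun_mul (differentiableAt_const _) (hd a p)]
    congr 1
    refine Finset.sum_congr rfl fun p _ => ?_
    rw [wirt_const_mul _ (hd a p)]
  rw [e2]
  simp only [e1]
  have hleib : ∀ (b : ℕ) (i : Fin b → Fin n) (S : Finset (Fin b)) (J : Multiset (Fin (n + 1)))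
      (q : Fin n → (Fin (n + 1) → ℂ) → ℂ), (∀ k, ContDiffOn ℝ ∞ (q k) Ω) →
      fJet ((S.val.map i).map Fin.succ) J (fun x => ∑ k, v k x * q k x) x₀ =
      ∑ R ∈ S.powerset, ∑ k, u k (R.val.map i) *
        fJet (((S \ R).val.map i).map Fin.succ) J (q k) x₀ := by
    intro b i S J q hq
    rw [fJet_sum hΩ _ _ (fun k _ => (hv k).1.mul (hq k)) _ _ hx]
    simp only [Multiset.map_map]
    rw [Finset.sum_comm]
    refine Finset.sum_congr rfl fun k _ => ?_
    rw [fJet_hol_mul hΩ (hv k) (hq k) (Fin.succ ∘ i) S J hx]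
    simp only [hu, Multiset.map_map]
  refine sum_dgev_eq_zero hc (u := u) ?_ ?_ ?_ ?_ ?_ d N hN
  · intro a k
    simp only [sliceInv, sliceJet, Multiset.map_singleton, mJet_singleton]
    have := congrFun (congrFun (Matrix.mul_nonsing_inv _ (hdet x₀ hx).isUnit) k) a
    simp only [Matrix.mul_apply, Matrix.submatrix_apply, Matrix.one_apply] at this
    rw [Finset.sum_congr rfl fun l _ => mul_comm _ _, this]
    simp only [eq_comm]
  · intro k
    simp [hu, hv0]
  · intro a b
    -- Closedness trades the parameter derivative for a derivative of the coefficients with row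
    -- index `0`, which `hgv` expresses through `v`. Since `v` vanishes at `x₀`, only the derivative
    -- of `v` survives.
    have hd : ∀ p q : Fin n, dz 0 (fun x => g x p.succ q.succ) x₀ =
        ∑ k, u k {p} * g x₀ k.succ q.succ := by
      intro p q
      rw [hg.closed x₀ hx p.succ q.succ 0, dz_eq_wirt,
        wirt_eqOn hΩ (fun x hx => hgv x hx q) hx,
        wirt_sum _ _ fun k _ => ((hv k).diffAt hΩ hx).fun_mul (hgdiff _ _)]
      refine Finset.sum_congr rfl fun k _ => ?_
      rw [wirt_mul ((hv k).diffAt hΩ hx) (hgdiff _ _), hv0, zero_mul, add_zero, hu]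
      simp only [Multiset.map_singleton]
      rw [← Multiset.cons_zero, fJet_cons_left hΩ (hv k).1 _ _ _ hx, fJet_zero, dz_eq_wirt]
    simp only [sliceInv]
    rw [dz_eq_wirt, wirt_matrix_inv (A := fun x => (g x).submatrix Fin.succ Fin.succ) hΩ
      (fun a b => hg.smooth _ _) hdet _ _ _ _ hx]
    simp only [Matrix.submatrix_apply]
    rw [neg_inj]
    refine Finset.sum_congr rfl fun p _ => ?_
    simp only [← dz_eq_wirt, hd]
    have h1 : ∀ k, ∑ q : Fin n, g x₀ k.succ q.succ *
        ((g x₀).submatrix Fin.succ Fin.succ)⁻¹ q a = if k = a then 1 else 0 := fun k => by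
      have := congrFun (congrFun (Matrix.mul_nonsing_inv _ (hdet x₀ hx).isUnit) k) a
      simpa only [Matrix.mul_apply, Matrix.submatrix_apply, Matrix.one_apply] using this
    calc _ = ∑ k, ((g x₀).submatrix Fin.succ Fin.succ)⁻¹ b p * u k {p} *
          ∑ q : Fin n, g x₀ k.succ q.succ * ((g x₀).submatrix Fin.succ Fin.succ)⁻¹ q a := by
          simp only [Finset.mul_sum, Finset.sum_mul]
          rw [Finset.sum_comm]
          refine Finset.sum_congr rfl fun k _ => Finset.sum_congr rfl fun q _ => ?_
          ring
      _ = _ := by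
          simp only [h1, mul_ite, mul_one, mul_zero, Finset.sum_ite_eq', Finset.mem_univ, if_true]
          ring
  · intro b i S J hS hJ
    obtain ⟨e, he⟩ := hS
    obtain ⟨j, hj⟩ := Multiset.exists_mem_of_ne_zero hJ
    obtain ⟨J', rfl⟩ := Multiset.exists_cons_of_mem hj
    have hSe : S.val.map i = i e ::ₘ (S.erase e).val.map i := by
      conv_lhs => rw [← Finset.insert_erase he]
      exact insert_val_map _ (by simp) _
    have h1 : Set.EqOn (fun x => sliceJet g x (S.val.map i) (j ::ₘ J'))
        (fJet (((S.erase e).val.map i).map Fin.succ) (J'.map Fin.succ)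
          (fun x => g x (i e).succ j.succ)) Ω := by
      intro x hx
      simp only [sliceJet, hSe, Multiset.map_cons]
      exact mJet_cons_cons hΩ hg _ _ _ _ hx
    -- The parameter derivative is moved innermost and exchanged with the index `i e` by closedness.
    -- Then all derivatives in `S` act on `∑ k, v k * g k j`, where the Leibniz rule applies.
    rw [dz_eq_wirt, wirt_eqOn hΩ h1 hx, ← dz_eq_wirt,
      ← fJet_cons_left hΩ (hg.smooth _ _) _ _ _ hx, fJet_cons_left' hΩ (hg.smooth _ _) _ _ _ hx,
      fJet_eqOn hΩ (h' := dz (i e).succ (fun x => g x 0 j.succ))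
        (fun x hx => hg.closed x hx _ _ _) _ _ hx,
      ← fJet_cons_left' hΩ (hg.smooth _ _) _ _ _ hx, ← Multiset.map_cons, ← hSe,
      fJet_eqOn hΩ (fun x hx => hgv x hx j) _ _ hx, hleib b i S _ _ fun k => hg.smooth _ _]
    refine Finset.sum_congr rfl fun R _ => Finset.sum_congr rfl fun k _ => ?_
    congr 1
    simp only [sliceJet, Multiset.map_cons]
    exact (mJet_cons_cons hΩ hg _ _ _ _ hx).symm
  · intro b i S J
    have h1 : (fun x => sliceFun h x (S.val.map i) J) =
      fJet ((S.val.map i).map Fin.succ) (J.map Fin.succ) h := rfl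
    rw [h1, ← fJet_cons_left hΩ hh _ _ _ hx, fJet_cons_left' hΩ hh _ _ _ hx,
      fJet_eqOn hΩ hhv _ _ hx, hleib b i S _ _ fun k => contDiffOn_dz hΩ hh _]
    refine Finset.sum_congr rfl fun R _ => Finset.sum_congr rfl fun k _ => ?_
    congr 1
    simp only [sliceFun, Multiset.map_cons]
    exact (fJet_cons_left' hΩ hh _ _ _ hx).symm

theorem conj_sliceInv {x : Fin (n + 1) → ℂ} (hH : (g x).IsHermitian) (a b : Fin n) :
    starRingEnd ℂ (sliceInv g x a b) = sliceInv g x b a := by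
  have h1 : ((g x).submatrix Fin.succ Fin.succ : Matrix (Fin n) (Fin n) ℂ).IsHermitian :=
    hH.submatrix _
  exact h1.inv.apply a b

/-- The derivative of the labelled sum vanishes in the direction of the parameter. -/
theorem fderiv_labelledSum_eq_zero {c : PointedGraph → ℂ} (hc : IsContractionInvariant c)
    (hc' : IsContractionInvariant fun G => starRingEnd ℂ (c G.rev)) (d N : ℕ)
    (hN : ∀ G : PointedGraph, G.nV = N → c G = 0) (hΩ : IsOpen Ω) (hg : IsClosedForm Ω g)
    (hH : ∀ x ∈ Ω, (g x).IsHermitian)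
    (hdet : ∀ x ∈ Ω, ((g x).submatrix Fin.succ Fin.succ).det ≠ 0) (hh : ContDiffOn ℝ ∞ h Ω)
    (hv : ∀ k, Hol Ω (v k)) (hx : x₀ ∈ Ω) (hv0 : ∀ k, v k x₀ = 0)
    (hgv : ∀ x ∈ Ω, ∀ b : Fin n, g x 0 b.succ = ∑ k, v k x * g x k.succ b.succ)
    (hhv : ∀ x ∈ Ω, dz 0 h x = ∑ k, v k x * dz k.succ h x)
    (hhv' : ∀ x ∈ Ω, dzbar 0 h x = ∑ k, starRingEnd ℂ (v k x) * dzbar k.succ h x) (t : ℂ) :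
    fderiv ℝ (fun x => labelledSum c d N (sliceInv g x) (sliceJet g x) (sliceFun h x)) x₀
      (Pi.single 0 t) = 0 := by
  have hP := differentiableAt_labelledSum c d N hΩ hg hdet hh hx
  have h1 := dz_labelledSum_eq_zero hc d N hN hΩ hg hdet hh hv hx hv0 hgv hhv
  -- The antiholomorphic derivative is the conjugate of the holomorphic derivative of the conjugate
  -- sum, which is the sum for the reversed graphs and the conjugate function.
  have h2 := dz_labelledSum_eq_zero hc' d N (fun G hG => by rw [hN G.rev hG, map_zero]) hΩ hg hdet
    (contDiffOn_conj hh) hv hx hv0 hgv (fun x hx => by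
      have hd := diffAt_of_smooth hΩ hh hx
      rw [dz_conj hd, hhv' x hx, map_sum]
      refine Finset.sum_congr rfl fun k _ => ?_
      rw [dz_conj hd, map_mul, Complex.conj_conj])
  have h3 : Set.EqOn (fun x => labelledSum (fun G => starRingEnd ℂ (c G.rev)) d N (sliceInv g x)
      (sliceJet g x) (sliceFun (fun x => starRingEnd ℂ (h x)) x))
      (fun x => starRingEnd ℂ (labelledSum c d N (sliceInv g x) (sliceJet g x) (sliceFun h x)))
      Ω := by
    intro x hx
    refine (conj_labelledSum c d N (conj_sliceInv (hH x hx)) (fun I J => ?_) fun I J => ?_).symm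
    · exact (mJet_conj hΩ hg hH _ _ hx).symm
    · exact (fJet_conj hΩ hh _ _ hx).symm
  rw [dz_eq_wirt, wirt_eqOn hΩ h3 hx, ← dz_eq_wirt, dz_conj hP, map_eq_zero] at h2
  rw [real_linear_decomp]
  refine Finset.sum_eq_zero fun p _ => ?_
  by_cases hp : p = 0
  · subst hp
    rw [dz_eq_wirt] at h1
    rw [dzbar_eq_wirt] at h2
    simp only [wirt] at h1 h2
    rw [h1, h2]
    simp
  · simp [Pi.single_eq_of_ne hp]

end infinitesimal

end PointedGraph

/-! ### Complex differentiability and the deformation of a coordinate change to a translation -/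

section analytic

variable {n : ℕ} {U : Set (Fin n → ℂ)} {F : (Fin n → ℂ) → ℂ}

theorem dzbar_of_differentiableAt {z : Fin n → ℂ} (h : DifferentiableAt ℂ F z) (k : Fin n) :
    dzbar k F z = 0 := by
  have e : Pi.single (M := fun _ => ℂ) k Complex.I = Complex.I • Pi.single k (1 : ℂ) := by
    rw [← Pi.single_smul, smul_eq_mul, mul_one]
  rw [dzbar, h.fderiv_restrictScalars ℝ, e]
  simp only [ContinuousLinearMap.coe_restrictScalars', map_smul, smul_eq_mul]
  linear_combination (1/2) * (fderiv ℂ F z) (Pi.single k 1) * Complex.I_sq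

theorem dz_of_differentiableAt {z : Fin n → ℂ} (h : DifferentiableAt ℂ F z) (k : Fin n) :
    dz k F z = fderiv ℂ F z (Pi.single k 1) := by
  have e : Pi.single (M := fun _ => ℂ) k Complex.I = Complex.I • Pi.single k (1 : ℂ) := by
    rw [← Pi.single_smul, smul_eq_mul, mul_one]
  rw [dz, h.fderiv_restrictScalars ℝ, e]
  simp only [ContinuousLinearMap.coe_restrictScalars', map_smul, smul_eq_mul]
  linear_combination -(1/2) * (fderiv ℂ F z) (Pi.single k 1) * Complex.I_sq

theorem hol_of_analyticOnNhd (h : AnalyticOnNhd ℂ F U) : Hol U F :=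
  ⟨fun z hz => ((h z hz).restrictScalars (𝕜 := ℝ)).contDiffAt.contDiffWithinAt,
    fun z hz k => dzbar_of_differentiableAt (h z hz).differentiableAt k⟩

theorem hol_coord (k : Fin n) : Hol U fun z => z k :=
  hol_of_analyticOnNhd fun z _ =>
    (ContinuousLinearMap.proj (R := ℂ) (φ := fun _ : Fin n => ℂ) k).analyticAt z

theorem dz_coord (a k : Fin n) (z : Fin n → ℂ) :
    dz a (fun z => z k) z = if k = a then 1 else 0 := by
  have h := (ContinuousLinearMap.proj (R := ℂ) (φ := fun _ : Fin n => ℂ) k).hasFDerivAt (x := z)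
  have h' : HasFDerivAt (fun z : Fin n → ℂ => z k) _ z := h
  rw [dz_of_differentiableAt h'.differentiableAt, h'.fderiv]
  simp [Pi.single_apply]

theorem Hol.add {F' : (Fin n → ℂ) → ℂ} (hU : IsOpen U) (h : Hol U F) (h' : Hol U F') :
    Hol U fun z => F z + F' z := by
  refine ⟨h.1.add h'.1, fun z hz k => ?_⟩
  rw [dzbar_eq_wirt, wirt_add (h.diffAt hU hz) (h'.diffAt hU hz), ← dzbar_eq_wirt, h.2 z hz,
    h'.2 z hz, add_zero]

theorem Hol.comp {m : ℕ} {W : Set (Fin m → ℂ)} {φ : (Fin n → ℂ) → (Fin m → ℂ)}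
    {F : (Fin m → ℂ) → ℂ} (hU : IsOpen U) (hW : IsOpen W) (hF : Hol W F)
    (hφ : ∀ p, Hol U fun z => φ z p) (hm : Set.MapsTo φ U W) : Hol U fun z => F (φ z) :=
  ⟨contDiffOn_comp_hol hφ hm hF.1, fun z hz k => by
    rw [dzbar_comp_hol hU hW hφ hm hF.1 hz]
    exact Finset.sum_eq_zero fun p _ => by rw [hF.2 _ (hm hz), zero_mul]⟩

theorem IsClosedForm.mono {U' : Set (Fin n → ℂ)} {g : (Fin n → ℂ) → Matrix (Fin n) (Fin n) ℂ}
    (hg : IsClosedForm U g) (h : U' ⊆ U) : IsClosedForm U' g :=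
  ⟨fun i j => (hg.smooth i j).mono h, fun z hz => hg.closed z (h hz),
    fun z hz => hg.closed' z (h hz)⟩

end analytic

/-- The set of parameters where an affine pencil through the identity is invertible. -/
theorem isPreconnected_det_ne_zero {n : ℕ} (L : Matrix (Fin n) (Fin n) ℂ) :
    IsPreconnected {s : ℂ | ((1 + -1 * s) • (1 : Matrix (Fin n) (Fin n) ℂ) + s • L).det ≠ 0} := by
  -- The determinant is a polynomial in the parameter, with value 1 at 0. It therefore has finitely
  -- many roots, and the complement of a finite set in the real plane is connected.
  set P : Polynomial ℂ := ((1 - Polynomial.X : Polynomial ℂ) •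
    (1 : Matrix (Fin n) (Fin n) (Polynomial ℂ)) +
    (Polynomial.X : Polynomial ℂ) • L.map Polynomial.C).det with hP
  have h1 : ∀ s : ℂ, P.eval s = ((1 + -1 * s) • (1 : Matrix (Fin n) (Fin n) ℂ) + s • L).det := by
    intro s
    rw [hP, ← Polynomial.coe_evalRingHom, RingHom.map_det]
    congr 1
    ext i j
    by_cases hij : i = j
    · subst hij
      simp
      ring
    · simp [hij]
      ring
  have h0 : P ≠ 0 := by
    intro h
    have := h1 0
    rw [h] at this
    simp at this
  have h2 : {s : ℂ | ((1 + -1 * s) • (1 : Matrix (Fin n) (Fin n) ℂ) + s • L).det ≠ 0} =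
      (P.roots.toFinset : Set ℂ)ᶜ := by
    ext s
    simp only [Set.mem_ofPred_eq, ← h1, Set.mem_compl_iff, Finset.mem_coe, Multiset.mem_toFinset,
      Polynomial.mem_roots h0, Polynomial.IsRoot]
  rw [h2]
  refine (Set.Countable.isPathConnected_compl_of_one_lt_rank ?_
    (Finset.countable_toSet _)).isConnected.isPreconnected
  rw [Complex.rank_real_complex]
  exact_mod_cast one_lt_two

/-- The deformation of the translation matching `φ` at `z₀` to the map `φ`. -/
def linearHomotopy {n : ℕ} (φ : (Fin n → ℂ) → (Fin n → ℂ)) (z₀ : Fin n → ℂ)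
    (x : Fin (n + 1) → ℂ) (p : Fin n) : ℂ :=
  (1 + -1 * x 0) * ((φ z₀ p - z₀ p) + x p.succ) + x 0 * φ (fun q => x q.succ) p

section homotopy

variable {n : ℕ} {U : Set (Fin n → ℂ)} {φ : (Fin n → ℂ) → (Fin n → ℂ)} {z₀ : Fin n → ℂ}

theorem isOpen_tail (hU : IsOpen U) : IsOpen {x : Fin (n + 1) → ℂ | (fun q => x (Fin.succ q)) ∈ U} :=
  hU.preimage (by fun_prop)

theorem hol_linearHomotopy (hU : IsOpen U) (hφ : ∀ p, Hol U fun z => φ z p) (p : Fin n) :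
    Hol {x : Fin (n + 1) → ℂ | (fun q => x (Fin.succ q)) ∈ U}
      fun x => linearHomotopy φ z₀ x p := by
  have hU' := isOpen_tail hU
  have h1 := Hol.comp hU' hU (hφ p) (fun q => hol_coord (Fin.succ q)) (fun x hx => hx)
  exact Hol.add hU' (Hol.mul hU' (Hol.add hU' (hol_const _) (Hol.mul hU' (hol_const _)
    (hol_coord 0))) (Hol.add hU' (hol_const _) (hol_coord _))) (Hol.mul hU' (hol_coord 0) h1)

theorem dz_linearHomotopy (hU : IsOpen U) (hφ : ∀ p, Hol U fun z => φ z p)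
    {x : Fin (n + 1) → ℂ} (hx : (fun q => x (Fin.succ q)) ∈ U) (a : Fin (n + 1)) (p : Fin n) :
    dz a (fun x => linearHomotopy φ z₀ x p) x =
      (1 + -1 * x 0) * (if p.succ = a then 1 else 0) -
      (if 0 = a then 1 else 0) * ((φ z₀ p - z₀ p) + x p.succ) +
      (x 0 * ∑ q : Fin n, dz q (fun z => φ z p) (fun q => x q.succ) *
        (if q.succ = a then 1 else 0) +
      (if 0 = a then 1 else 0) * φ (fun q => x q.succ) p) := by
  have hU' := isOpen_tail hU
  have h1 := Hol.comp hU' hU (hφ p) (fun q => hol_coord (Fin.succ q)) (fun x hx => hx)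
  have c : ∀ b : ℂ, DifferentiableAt ℝ (fun _ : Fin (n + 1) → ℂ => b) x := fun b =>
    differentiableAt_const _
  have d0 : ∀ k : Fin (n + 1), DifferentiableAt ℝ (fun x : Fin (n + 1) → ℂ => x k) x := fun k =>
    by fun_prop
  have d1 := (c (-1)).fun_mul (d0 0)
  have d2 := (c 1).fun_add d1
  have d3 := (c (φ z₀ p - z₀ p)).fun_add (d0 p.succ)
  have d4 := h1.diffAt hU' hx
  unfold linearHomotopy
  rw [dz_eq_wirt, wirt_add (d2.fun_mul d3) ((d0 0).fun_mul d4), wirt_mul d2 d3, wirt_mul (d0 0) d4,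
    wirt_add (c _) d1, wirt_add (c _) (d0 _), wirt_const_mul _ (d0 0), wirt_const, wirt_const,
    ← dz_eq_wirt, dz_coord, dz_coord,
    dz_comp_hol (φ := fun (x : Fin (n + 1) → ℂ) q => x (Fin.succ q)) hU' hU
      (fun q => hol_coord (Fin.succ q)) (fun x hx => hx) (hφ p).1 hx]
  simp only [dz_coord]
  ring

theorem dz_succ_linearHomotopy (hU : IsOpen U) (hφ : ∀ p, Hol U fun z => φ z p)
    {x : Fin (n + 1) → ℂ} (hx : (fun q => x (Fin.succ q)) ∈ U) (a p : Fin n) :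
    dz a.succ (fun x => linearHomotopy φ z₀ x p) x =
      ((1 + -1 * x 0) • (1 : Matrix (Fin n) (Fin n) ℂ) +
        x 0 • Matrix.of fun a p => dz a (fun z => φ z p) (fun q => x q.succ)) a p := by
  rw [dz_linearHomotopy hU hφ hx]
  simp [Fin.succ_inj, Matrix.one_apply, (Fin.succ_ne_zero a).symm, eq_comm]

/-- All members of the family take the same value at `z₀`. This is what makes the generating vector
field vanish at the base point. -/
theorem dz_zero_linearHomotopy (hU : IsOpen U) (hφ : ∀ p, Hol U fun z => φ z p)
    {x : Fin (n + 1) → ℂ} (hx : (fun q => x (Fin.succ q)) = z₀) (hz : z₀ ∈ U) (p : Fin n) :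
    dz 0 (fun x => linearHomotopy φ z₀ x p) x = 0 := by
  rw [dz_linearHomotopy hU hφ (by rwa [hx]), hx, ← hx]
  simp [Fin.succ_ne_zero]

end homotopy

/-! ### Restriction of jets to slices of constant parameter -/

section slice

open PointedGraph

variable {n : ℕ} {U : Set (Fin n → ℂ)} {Ω : Set (Fin (n + 1) → ℂ)} {s : ℂ} {b : Fin n → ℂ}

theorem fJet_slice (hU : IsOpen U) (hΩ : IsOpen Ω) {h : (Fin (n + 1) → ℂ) → ℂ}
    (hh : ContDiffOn ℝ ∞ h Ω)
    (hm : ∀ w ∈ U, (Fin.cons s (w + b) : Fin (n + 1) → ℂ) ∈ Ω) (I J : Multiset (Fin n))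
    {w : Fin n → ℂ} (hw : w ∈ U) :
    fJet (I.map Fin.succ) (J.map Fin.succ) h (Fin.cons s (w + b)) =
      fJet I J (fun w => h (Fin.cons s (w + b))) w := by
  refine (fJet_comp_affine (φ := fun w => (Fin.cons s (w + b) : Fin (n + 1) → ℂ)) hU hΩ ?_ hm
    Fin.succ ?_ hh I J hw).symm
  · refine Fin.cases ?_ fun p => ?_
    · simpa using hol_const s
    · simpa using Hol.add hU (hol_coord p) (hol_const (b p))
  · intro z hz a
    refine Fin.cases ?_ fun p => ?_
    · simp only [Fin.cons_zero, (Fin.succ_ne_zero a).symm, if_false]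
      rw [dz_eq_wirt, wirt_const]
    · simp only [Fin.cons_succ, Pi.add_apply, Fin.succ_inj]
      rw [dz_eq_wirt, wirt_add ((hol_coord (U := U) p).diffAt hU hz) (differentiableAt_const _),
        wirt_const, add_zero, ← dz_eq_wirt, dz_coord]

theorem mJet_slice (hU : IsOpen U) (hΩ : IsOpen Ω)
    {g : (Fin (n + 1) → ℂ) → Matrix (Fin (n + 1)) (Fin (n + 1)) ℂ}
    {G : (Fin n → ℂ) → Matrix (Fin n) (Fin n) ℂ} (hg : IsClosedForm Ω g) (hG : IsClosedForm U G)
    (hm : ∀ w ∈ U, (Fin.cons s (w + b) : Fin (n + 1) → ℂ) ∈ Ω)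
    (e : ∀ w ∈ U, ∀ i j : Fin n, g (Fin.cons s (w + b)) i.succ j.succ = G w i j)
    (I J : Multiset (Fin n)) {w : Fin n → ℂ} (hw : w ∈ U) :
    sliceJet g (Fin.cons s (w + b)) I J = mJet G I J w := by
  unfold sliceJet
  induction I using Multiset.induction with
  | empty => simp
  | cons i I _ =>
    induction J using Multiset.induction with
    | empty => simp
    | cons j J _ =>
      simp only [Multiset.map_cons]
      rw [mJet_cons_cons hΩ hg _ _ _ _ (hm w hw), mJet_cons_cons hU hG _ _ _ _ hw,
        fJet_slice hU hΩ (hg.smooth _ _) hm I J hw]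
      exact fJet_eqOn hU (fun w hw => e w hw i j) _ _ hw

end slice

/-! ### Invariance under changes of coordinates -/

namespace PointedGraph

variable {n : ℕ} {X Y : KahlerChart n} {φ ψ : (Fin n → ℂ) → (Fin n → ℂ)}

theorem _root_.IsCoordChange.hol (H : IsCoordChange X Y φ ψ) (p : Fin n) :
    Hol X.U fun z => φ z p :=
  hol_of_analyticOnNhd fun z hz =>
    ((ContinuousLinearMap.proj (R := ℂ) (φ := fun _ : Fin n => ℂ) p).analyticAt _).comp (H.holo z hz)

theorem _root_.IsCoordChange.dz_eq (H : IsCoordChange X Y φ ψ) {z : Fin n → ℂ} (hz : z ∈ X.U)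
    (a p : Fin n) : dz a (fun z => φ z p) z = fderiv ℂ φ z (Pi.single a 1) p := by
  have h1 := (H.holo z hz).differentiableAt.hasFDerivAt
  have h2 := hasFDerivAt_pi'.1 h1 p
  rw [dz_of_differentiableAt h2.differentiableAt, h2.fderiv]
  rfl

theorem _root_.IsCoordChange.pullbackForm_eq (H : IsCoordChange X Y φ ψ) {z : Fin n → ℂ}
    (hz : z ∈ X.U) (i j : Fin n) : pullbackForm φ Y.g z i j = X.g z i j := by
  rw [H.pullback z hz]
  simp only [pullbackForm, Matrix.of_apply, H.dz_eq hz]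

theorem det_pullbackForm_ne_zero {m : ℕ} {Φ : (Fin m → ℂ) → (Fin n → ℂ)}
    {g : (Fin n → ℂ) → Matrix (Fin n) (Fin n) ℂ} {x : Fin m → ℂ} (σ : Fin n → Fin m)
    (hg : (g (Φ x)).det ≠ 0)
    (hN : (Matrix.of fun a p => dz (σ a) (fun x => Φ x p) x : Matrix (Fin n) (Fin n) ℂ).det ≠ 0) :
    ((pullbackForm Φ g x).submatrix σ σ).det ≠ 0 := by
  have h : (pullbackForm Φ g x).submatrix σ σ =
      (Matrix.of fun a p => dz (σ a) (fun x => Φ x p) x) * g (Φ x) *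
        (Matrix.of fun a p => dz (σ a) (fun x => Φ x p) x).conjTranspose := by
    ext a b
    simp only [pullbackForm, Matrix.submatrix_apply, Matrix.of_apply, Matrix.mul_apply,
      Matrix.conjTranspose_apply, Finset.sum_mul, starRingEnd_apply]
    rw [Finset.sum_comm]
    refine Finset.sum_congr rfl fun q _ => Finset.sum_congr rfl fun p _ => ?_
    ring
  rw [h, Matrix.det_mul, Matrix.det_mul, Matrix.det_conjTranspose]
  exact mul_ne_zero (mul_ne_zero hN hg) (star_ne_zero.2 hN)

theorem _root_.IsCoordChange.det_ne_zero (H : IsCoordChange X Y φ ψ) {z : Fin n → ℂ}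
    (hz : z ∈ X.U) :
    (Matrix.of fun a p => dz a (fun z => φ z p) z : Matrix (Fin n) (Fin n) ℂ).det ≠ 0 := by
  intro h0
  have h : X.g z = (Matrix.of fun a p => dz a (fun x => φ x p) z) * Y.g (φ z) *
        (Matrix.of fun a p => dz a (fun x => φ x p) z).conjTranspose := by
    ext a b
    rw [← H.pullbackForm_eq hz]
    simp only [pullbackForm, Matrix.of_apply, Matrix.mul_apply,
      Matrix.conjTranspose_apply, Finset.sum_mul, starRingEnd_apply]
    rw [Finset.sum_comm]
    refine Finset.sum_congr rfl fun q _ => Finset.sum_congr rfl fun p _ => ?_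
    ring
  refine (X.posDef z hz).det_pos.ne' ?_
  rw [h, Matrix.det_mul, Matrix.det_mul, h0, zero_mul, zero_mul]

/-- The labelled sums are invariant under changes of coordinates. -/
theorem labelledSum_coordChange {c : PointedGraph → ℂ} (hc : IsContractionInvariant c)
    (hc' : IsContractionInvariant fun G => starRingEnd ℂ (c G.rev)) (d N : ℕ)
    (hN : ∀ G : PointedGraph, G.nV = N → c G = 0) (H : IsCoordChange X Y φ ψ)
    {f h : (Fin n → ℂ) → ℂ} (hf : ContDiffOn ℝ ∞ f Y.U) (hh : ∀ z ∈ X.U, h z = f (φ z))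
    {z₀ : Fin n → ℂ} (hz₀ : z₀ ∈ X.U) :
    labelledSum c d N (fun i j => X.gInv i j z₀) (fun I J => X.gJet I J z₀)
      (fun I J => fJet I J h z₀) =
    labelledSum c d N (fun i j => Y.gInv i j (φ z₀)) (fun I J => Y.gJet I J (φ z₀))
      (fun I J => fJet I J f (φ z₀)) := by
  have hφ := H.hol
  set Φ : (Fin (n + 1) → ℂ) → (Fin n → ℂ) := linearHomotopy φ z₀ with hΦ
  set Ω₁ : Set (Fin (n + 1) → ℂ) := {x | (fun q => x (Fin.succ q)) ∈ X.U} with hΩ₁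
  have oΩ₁ : IsOpen Ω₁ := isOpen_tail X.isOpen
  have hol₁ : ∀ p, Hol Ω₁ fun x => Φ x p := hol_linearHomotopy X.isOpen hφ
  have cont₁ : ContinuousOn Φ Ω₁ := continuousOn_pi.2 fun p => (hol₁ p).1.continuousOn
  set Ω₂ : Set (Fin (n + 1) → ℂ) := Ω₁ ∩ Φ ⁻¹' Y.U with hΩ₂
  have oΩ₂ : IsOpen Ω₂ := cont₁.isOpen_inter_preimage oΩ₁ Y.isOpen
  set M : (Fin (n + 1) → ℂ) → Matrix (Fin n) (Fin n) ℂ :=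
    fun x => Matrix.of fun a p => dz a.succ (fun x => Φ x p) x with hM
  have holM : ∀ a p, Hol Ω₁ fun x => M x a p := fun a p => (hol₁ p).dz oΩ₁ _
  have contM : ContinuousOn (fun x => (M x).det) Ω₂ := by
    simp only [Matrix.det_apply']
    exact continuousOn_finsetSum _ fun σ _ => continuousOn_const.mul <|
      continuousOn_finsetProd _ fun a _ => ((holM _ _).1.continuousOn.mono Set.inter_subset_left)
  -- The points of the total space which the family maps into the target chart with invertible
  -- differential along the slice.
  set Ω : Set (Fin (n + 1) → ℂ) := Ω₂ ∩ (fun x => (M x).det) ⁻¹' {0}ᶜ with hΩ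
  have oΩ : IsOpen Ω := contM.isOpen_inter_preimage oΩ₂ isOpen_compl_singleton
  have sub₁ : Ω ⊆ Ω₁ := fun x hx => hx.1.1
  have hol : ∀ p, Hol Ω fun x => Φ x p := fun p => ⟨(hol₁ p).1.mono sub₁, fun x hx => (hol₁ p).2 x (sub₁ hx)⟩
  have maps : Set.MapsTo Φ Ω Y.U := fun x hx => hx.1.2
  have detM : ∀ x ∈ Ω, (M x).det ≠ 0 := fun x hx => hx.2
  have holM' : ∀ a p, Hol Ω fun x => M x a p := fun a p => (hol p).dz oΩ _
  set g := pullbackForm Φ Y.g with hg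
  have cg : IsClosedForm Ω g := isClosedForm_pullbackForm oΩ Y.isOpen hol maps Y.isClosedForm
  have hH : ∀ x ∈ Ω, (g x).IsHermitian := fun x hx =>
    pullbackForm_isHermitian (Y.posDef _ (maps hx)).isHermitian
  have hdet : ∀ x ∈ Ω, ((g x).submatrix Fin.succ Fin.succ).det ≠ 0 := fun x hx =>
    det_pullbackForm_ne_zero Fin.succ (Y.posDef _ (maps hx)).det_pos.ne' (detM x hx)
  have sh : ContDiffOn ℝ ∞ (fun x => f (Φ x)) Ω := contDiffOn_comp_hol hol maps hf
  -- The field is chosen so that the parameter direction minus `v` lies in the kernel of the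
  -- differential of `Φ`. Everything pulled back along `Φ` then satisfies the relations `hgv` and
  -- `hhv`.
  set v : Fin n → (Fin (n + 1) → ℂ) → ℂ :=
    fun k x => ∑ p, dz 0 (fun x => Φ x p) x * (M x)⁻¹ p k with hv
  have holv : ∀ k, Hol Ω (v k) := fun k => Hol.sum oΩ _ _ fun p _ =>
    Hol.mul oΩ ((hol p).dz oΩ 0) (Hol.matrix_inv oΩ M holM' detM p k)
  have hvM : ∀ x ∈ Ω, ∀ p, ∑ k, v k x * dz k.succ (fun x => Φ x p) x = dz 0 (fun x => Φ x p) x := by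
    intro x hx p
    have h1 := Matrix.nonsing_inv_mul (M x) (detM x hx).isUnit
    simp only [hv, Finset.sum_mul]
    rw [Finset.sum_comm]
    have h2 : ∀ q, ∑ k, dz 0 (fun x => Φ x q) x * (M x)⁻¹ q k * dz k.succ (fun x => Φ x p) x =
        dz 0 (fun x => Φ x q) x * (if q = p then 1 else 0) := fun q => by
      rw [← Matrix.one_apply, ← h1, Matrix.mul_apply, Finset.mul_sum]
      refine Finset.sum_congr rfl fun k _ => ?_
      rw [mul_assoc]
      rfl
    simp [h2]
  have hgv : ∀ x ∈ Ω, ∀ b : Fin n, g x 0 b.succ = ∑ k, v k x * g x k.succ b.succ := by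
    intro x hx b
    simp only [hg, pullbackForm, Matrix.of_apply, ← hvM x hx, Finset.mul_sum, Finset.sum_mul]
    rw [Finset.sum_congr rfl fun p _ => Finset.sum_comm, Finset.sum_comm]
    refine Finset.sum_congr rfl fun k _ => Finset.sum_congr rfl fun p _ =>
      Finset.sum_congr rfl fun q _ => ?_
    ring
  have hhv : ∀ x ∈ Ω, dz 0 (fun x => f (Φ x)) x = ∑ k, v k x * dz k.succ (fun x => f (Φ x)) x := by
    intro x hx
    simp only [dz_comp_hol oΩ Y.isOpen hol maps hf hx, ← hvM x hx, Finset.mul_sum]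
    rw [Finset.sum_comm]
    refine Finset.sum_congr rfl fun k _ => Finset.sum_congr rfl fun p _ => ?_
    ring
  have hhv' : ∀ x ∈ Ω, dzbar 0 (fun x => f (Φ x)) x =
      ∑ k, starRingEnd ℂ (v k x) * dzbar k.succ (fun x => f (Φ x)) x := by
    intro x hx
    simp only [dzbar_comp_hol oΩ Y.isOpen hol maps hf hx, ← hvM x hx, Finset.mul_sum, map_sum,
      map_mul]
    rw [Finset.sum_comm]
    refine Finset.sum_congr rfl fun k _ => Finset.sum_congr rfl fun p _ => ?_
    ring
  set L : Matrix (Fin n) (Fin n) ℂ := Matrix.of fun a p => dz a (fun z => φ z p) z₀ with hL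
  set S : Set ℂ := {s : ℂ | ((1 + -1 * s) • (1 : Matrix (Fin n) (Fin n) ℂ) + s • L).det ≠ 0} with hS
  have Φcons : ∀ (s : ℂ), Φ (Fin.cons s z₀) = φ z₀ := by
    intro s
    funext p
    simp only [hΦ, linearHomotopy, Fin.cons_zero, Fin.cons_succ]
    ring
  have mem : ∀ s ∈ S, (Fin.cons s z₀ : Fin (n + 1) → ℂ) ∈ Ω := by
    intro s hs
    have h1 : (Fin.cons s z₀ : Fin (n + 1) → ℂ) ∈ Ω₁ := by simpa [hΩ₁] using hz₀
    refine ⟨⟨h1, ?_⟩, ?_⟩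
    · change Φ _ ∈ Y.U
      rw [Φcons]
      exact H.mapsTo hz₀
    · have : M (Fin.cons s z₀) = (1 + -1 * s) • (1 : Matrix (Fin n) (Fin n) ℂ) + s • L := by
        ext a p
        exact dz_succ_linearHomotopy X.isOpen hφ h1 a p
      change (M _).det ≠ 0
      rw [this]
      exact hs
  set Q : (Fin (n + 1) → ℂ) → ℂ := fun x =>
    labelledSum c d N (sliceInv g x) (sliceJet g x) (sliceFun (fun x => f (Φ x)) x) with hQ
  have hQd : ∀ s ∈ S, HasFDerivAt (𝕜 := ℝ) (fun s : ℂ => Q (Fin.cons s z₀)) 0 s := by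
    intro s hs
    have h1 := (differentiableAt_labelledSum c d N oΩ cg hdet sh (mem s hs)).hasFDerivAt
    have h2 : HasFDerivAt (𝕜 := ℝ) (fun s : ℂ => (Fin.cons s z₀ : Fin (n + 1) → ℂ))
        (ContinuousLinearMap.single ℝ (fun _ : Fin (n + 1) => ℂ) 0) s := by
      rw [hasFDerivAt_pi']
      refine Fin.cases ?_ fun p => ?_
      · simp only [Fin.cons_zero]
        refine (hasFDerivAt_id s).congr_fderiv ?_
        ext t <;> simp
      · simp only [Fin.cons_succ]
        refine (hasFDerivAt_const _ s).congr_fderiv ?_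
        ext t <;> simp
    refine (h1.comp s h2).congr_fderiv ?_
    refine ContinuousLinearMap.ext fun t => ?_
    exact fderiv_labelledSum_eq_zero hc hc' d N hN oΩ cg hH hdet sh holv (mem s hs)
      (fun k => Finset.sum_eq_zero fun p _ => by
        rw [dz_zero_linearHomotopy X.isOpen hφ (by simp) hz₀, zero_mul]) hgv hhv hhv' t
  have oS : IsOpen S := by
    refine isOpen_compl_singleton.preimage (Continuous.matrix_det ?_)
    fun_prop
  have h1S : (1 : ℂ) ∈ S := by
    simpa [hS] using H.det_ne_zero hz₀
  have h0S : (0 : ℂ) ∈ S := by simp [hS]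
  -- Over the base point the sum is locally constant in the parameter, and the admissible parameters
  -- form a connected set containing 1, which gives `φ`, and 0, which gives the translation.
  have key : Q (Fin.cons 1 z₀) = Q (Fin.cons 0 z₀) :=
    oS.is_const_of_fderiv_eq_zero (isPreconnected_det_ne_zero L)
      (fun s hs => (hQd s hs).differentiableAt.differentiableWithinAt)
      (fun s hs => (hQd s hs).fderiv) h1S h0S
  have left : Q (Fin.cons 1 z₀) = labelledSum c d N (fun i j => X.gInv i j z₀)
      (fun I J => X.gJet I J z₀) (fun I J => fJet I J h z₀) := by
    set U' : Set (Fin n → ℂ) := X.U ∩ {w | (Fin.cons 1 (w + 0) : Fin (n + 1) → ℂ) ∈ Ω} with hU'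
    have oU' : IsOpen U' := X.isOpen.inter (oΩ.preimage (by fun_prop))
    have hz' : z₀ ∈ U' := ⟨hz₀, by simpa using mem 1 h1S⟩
    have hΦ1 : ∀ w, Φ (Fin.cons 1 (w + 0)) = φ w := by
      intro w
      funext p
      simp [hΦ, linearHomotopy]
    have e : ∀ w ∈ U', ∀ i j : Fin n, g (Fin.cons 1 (w + 0)) i.succ j.succ = X.g w i j := by
      intro w hw i j
      have hw1 : (fun q => (Fin.cons 1 (w + 0) : Fin (n + 1) → ℂ) (Fin.succ q)) ∈ X.U := by
        simpa using hw.1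
      rw [← H.pullbackForm_eq hw.1]
      simp only [hg, pullbackForm, Matrix.of_apply, hΦ1]
      simp only [hΦ, dz_succ_linearHomotopy X.isOpen hφ hw1]
      simp
    have hm : ∀ w ∈ U', (Fin.cons 1 (w + 0) : Fin (n + 1) → ℂ) ∈ Ω := fun w hw => hw.2
    have h1 := fun I J => mJet_slice oU' oΩ cg (X.isClosedForm.mono Set.inter_subset_left) hm e I J hz'
    have h2 := fun I J => fJet_slice oU' oΩ sh hm I J hz'
    have h3 := e z₀ hz'
    simp only [add_zero] at h1 h2 h3
    simp only [hQ]
    congr 1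
    · funext a b
      simp only [sliceInv, KahlerChart.gInv]
      rw [show (g (Fin.cons 1 z₀)).submatrix Fin.succ Fin.succ = X.g z₀ from
        Matrix.ext fun i j => h3 i j]
    · funext I J
      exact h1 I J
    · funext I J
      refine (h2 I J).trans (fJet_eqOn oU' (fun w hw => ?_) _ _ hz')
      have := hΦ1 w
      simp only [add_zero] at this
      simp only [this]
      exact (hh w hw.1).symm
  have right : Q (Fin.cons 0 z₀) = labelledSum c d N (fun i j => Y.gInv i j (φ z₀))
      (fun I J => Y.gJet I J (φ z₀)) (fun I J => fJet I J f (φ z₀)) := by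
    -- At parameter 0 the family is the translation by `φ z₀ - z₀`. Shifting the slice by its
    -- opposite makes the composite the identity.
    set b : Fin n → ℂ := z₀ - φ z₀ with hb
    set U' : Set (Fin n → ℂ) := Y.U ∩ {w | (Fin.cons 0 (w + b) : Fin (n + 1) → ℂ) ∈ Ω} with hU'
    have oU' : IsOpen U' := Y.isOpen.inter (oΩ.preimage (by fun_prop))
    have hz0 : φ z₀ + b = z₀ := by simp [hb]
    have hz' : φ z₀ ∈ U' := ⟨H.mapsTo hz₀, by
      simp only [Set.mem_ofPred_eq, hz0]; exact mem 0 h0S⟩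
    have hΦ1 : ∀ w, Φ (Fin.cons 0 (w + b)) = w := by
      intro w
      funext p
      simp only [hΦ, linearHomotopy, Fin.cons_zero, Fin.cons_succ, hb, Pi.add_apply, Pi.sub_apply]
      ring
    have e : ∀ w ∈ U', ∀ i j : Fin n, g (Fin.cons 0 (w + b)) i.succ j.succ = Y.g w i j := by
      intro w hw i j
      have hw1 := sub₁ hw.2
      simp only [hg, pullbackForm, Matrix.of_apply, hΦ1]
      simp only [hΦ, dz_succ_linearHomotopy X.isOpen hφ hw1]
      simp [Matrix.one_apply]
    have hm : ∀ w ∈ U', (Fin.cons 0 (w + b) : Fin (n + 1) → ℂ) ∈ Ω := fun w hw => hw.2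
    have h1 := fun I J => mJet_slice oU' oΩ cg (Y.isClosedForm.mono Set.inter_subset_left) hm e I J hz'
    have h2 := fun I J => fJet_slice oU' oΩ sh hm I J hz'
    have h3 := e _ hz'
    simp only [hz0] at h1 h2 h3
    simp only [hQ]
    congr 1
    · funext a b
      simp only [sliceInv, KahlerChart.gInv]
      rw [show (g (Fin.cons 0 z₀)).submatrix Fin.succ Fin.succ = Y.g (φ z₀) from
        Matrix.ext fun i j => h3 i j]
    · funext I J
      exact h1 I J
    · funext I J
      refine (h2 I J).trans (fJet_eqOn oU' (fun w hw => ?_) _ _ hz')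
      simp only [hΦ1]
  rw [← left, ← right, key]

end PointedGraph

namespace PointedGraph

/-! ## The indicator of the graphs with a given stabilization -/

/-- A loop which is the only inward edge at its vertex. -/
def HasIsolatedLoop (G : PointedGraph) : Prop :=
  ∃ (s : Fin G.nV) (e : Fin G.nE), G.inDeg (some s) = 1 ∧ G.src e = some s ∧ G.tgt e = some s

theorem inDeg_eq_one_unique {G : PointedGraph} {v : Option (Fin G.nV)} {e e' : Fin G.nE}
    (h : G.inDeg v = 1) (he : G.tgt e = v) (he' : G.tgt e' = v) : e' = e := by
  obtain ⟨a, ha⟩ := Finset.card_eq_one.1 h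
  have h1 : e ∈ ({a} : Finset _) := ha ▸ by simp [he]
  have h2 : e' ∈ ({a} : Finset _) := ha ▸ by simp [he']
  rw [Finset.mem_singleton] at h1 h2
  rw [h1, h2]

/-- No edge except the loop enters `s`, so a contracted edge either avoids `s` or leaves it. In the
latter case `s` has a second outward edge, the loop, and contractibility must come from an ordinary
head of inward degree one. That head brings no further inward edge to the merged vertex, so the loop
stays isolated. -/
theorem HasIsolatedLoop.step {G G' : PointedGraph} (h : G.HasIsolatedLoop)
    (hs : ContractStep G G') : G'.HasIsolatedLoop := by
  obtain ⟨s, e, hin, hsrc, htgt⟩ := h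
  obtain ⟨e', ⟨hne, hcon⟩, π, τ, h0, -, hk, hc⟩ := hs
  have hee : e ≠ e' := by
    rintro rfl
    exact hne (hsrc.trans htgt.symm)
  have hts : G.tgt e' ≠ some s := fun h => hee (inDeg_eq_one_unique hin h htgt)
  have hout : G.src e' = some s → G.tgt e' ≠ none ∧ G.inDeg (G.tgt e') = 1 := by
    intro h
    rcases hcon with ⟨_, h1⟩ | h1
    · exact absurd (outDeg_eq_one_unique h1 (hsrc.trans h.symm)) hee
    · exact h1
  have hπ : π (some s) ≠ none := by
    intro h
    rw [← h0, hk] at h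
    rcases h with h | ⟨h1, h2⟩ | ⟨h1, h2⟩
    · simp at h
    · exact (hout h1.symm).1 h2.symm
    · exact hts h1.symm
  obtain ⟨s', hs'⟩ := Option.ne_none_iff_exists'.1 hπ
  refine ⟨s', τ ⟨e, hee⟩, ?_, by rw [(hc _).1, hsrc, hs'], by rw [(hc _).2, htgt, hs']⟩
  rw [inDeg, Finset.card_eq_one]
  refine ⟨τ ⟨e, hee⟩, ?_⟩
  ext a
  obtain ⟨a, rfl⟩ := τ.surjective a
  simp only [Finset.mem_filter, Finset.mem_univ, true_and, Finset.mem_singleton,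
    EmbeddingLike.apply_eq_iff_eq, (hc _).2, ← hs', hk]
  constructor
  · rintro (h | ⟨h1, h2⟩ | ⟨h1, h2⟩)
    · exact Subtype.ext (inDeg_eq_one_unique hin htgt h)
    · exact absurd h2.symm hts
    · exact absurd (inDeg_eq_one_unique (hout h2.symm).2 rfl h1) a.2
  · rintro rfl
    exact Or.inl htgt

/-- An isolated loop would persist in the stable graph at the end, where every ordinary vertex has
inward degree at least two. This supplies the `loop` field for `stabInd`. -/
theorem HasIsolatedLoop.not_stabilizesTo {G Γ : PointedGraph} (h : G.HasIsolatedLoop) :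
    ¬ G.StabilizesTo Γ := by
  rintro ⟨hΓ, Δ, h1, h2⟩
  have hΔ : Δ.IsStable := hΓ.of_iso (Iso.nonempty_symm h2).some
  have : Δ.HasIsolatedLoop := by
    clear h2 hΔ
    induction h1 with
    | refl => exact h
    | tail _ hs ih => exact ih.step hs
  obtain ⟨s, _, h3, _⟩ := this
  have := hΔ s
  omega

open Classical in
/-- The indicator function of the semistable graphs with stabilization graph `Γ`. -/
def stabInd (Γ G : PointedGraph) : ℂ := if G.IsSemistable ∧ G.StabilizesTo Γ then 1 else 0

theorem stabInd_congr {Γ Γ' G G' : PointedGraph}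
    (h : G.IsSemistable ∧ G.StabilizesTo Γ ↔ G'.IsSemistable ∧ G'.StabilizesTo Γ') :
    stabInd Γ G = stabInd Γ' G' := by
  unfold stabInd
  by_cases h1 : G.IsSemistable ∧ G.StabilizesTo Γ
  · rw [if_pos h1, if_pos (h.1 h1)]
  · rw [if_neg h1, if_neg fun h2 => h1 (h.2 h2)]

theorem isContractionInvariant_stabInd (Γ : PointedGraph) :
    IsContractionInvariant (stabInd Γ) where
  iso h := stabInd_congr ⟨fun ⟨h1, h2⟩ => ⟨h1.of_iso h.some, h2.of_iso_left h⟩, fun ⟨h1, h2⟩ =>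
    ⟨h1.of_iso (Iso.nonempty_symm h).some, h2.of_iso_left (Iso.nonempty_symm h)⟩⟩
  semistable h := if_neg fun h' => h h'.1
  step hG hs := stabInd_congr ⟨fun ⟨h1, h2⟩ => ⟨hs.isSemistable h1, h2.step h1 hs⟩,
    fun ⟨_, h2⟩ => ⟨hG, h2.of_step hs⟩⟩
  loop s e h1 h2 h3 := if_neg fun h =>
    HasIsolatedLoop.not_stabilizesTo ⟨s, e, h1, h2, h3⟩ h.2

theorem conj_stabInd_rev (Γ : PointedGraph) :
    (fun G => starRingEnd ℂ (stabInd Γ (rev G))) = stabInd Γ.rev := by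
  funext G
  have h : stabInd Γ G.rev = stabInd Γ.rev G :=
    stabInd_congr ⟨fun ⟨h1, h2⟩ => ⟨h1.rev, h2.rev⟩, fun ⟨h1, h2⟩ => ⟨h1.rev, h2.rev⟩⟩
  rw [h, stabInd]
  split <;> simp

/-- The truncated subtraction loses nothing, because a stable graph has at least as many edges as
ordinary vertices. -/
theorem StabilizesTo.nE_eq {G Γ : PointedGraph} (h : G.StabilizesTo Γ) :
    G.nE = G.nV + (Γ.nE - Γ.nV) := by
  have h1 := h.card
  have h2 := h.1.isSemistable.card_le
  omega

/-- With `d` the excess of edges over ordinary vertices, three times the number of vertices is at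
most twice the number of edges, so there are at most `2 * d` ordinary vertices. -/
theorem StabilizesTo.nV_lt {G Γ : PointedGraph} (hG : G.IsSemistable) (h : G.StabilizesTo Γ) :
    G.nV < 2 * (Γ.nE - Γ.nV) + 1 := by
  have h1 := h.nE_eq
  have h2 := hG.card_le
  omega

/-! ## Isomorphism classes and labelled graphs -/

/-- Relabelling the vertices and edges of a labelled graph. -/
def permLabelled {a b : ℕ} (p : Labelled a b) :
    Equiv.Perm (Fin a) × Equiv.Perm (Fin b) ≃
      Σ q : Labelled a b, Iso (ofLabelled p) (ofLabelled q) where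
  toFun σ := ⟨(fun e => (p.1 (σ.2.symm e)).map σ.1, fun e => (p.2 (σ.2.symm e)).map σ.1),
    ⟨σ, fun e => ⟨congrArg (fun x => (p.1 x).map σ.1) (σ.2.symm_apply_apply e),
      congrArg (fun x => (p.2 x).map σ.1) (σ.2.symm_apply_apply e)⟩⟩⟩
  invFun q := q.2.1
  left_inv σ := rfl
  right_inv := by
    suffices h : ∀ (σ : Equiv.Perm (Fin a) × Equiv.Perm (Fin b)) (q : Labelled a b)
        (h : ∀ e : Fin b, q.1 (σ.2 e) = (p.1 e).map σ.1 ∧ q.2 (σ.2 e) = (p.2 e).map σ.1),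
        (⟨(fun e => (p.1 (σ.2.symm e)).map σ.1, fun e => (p.2 (σ.2.symm e)).map σ.1),
          ⟨σ, fun e => ⟨congrArg (fun x => (p.1 x).map σ.1) (σ.2.symm_apply_apply e),
            congrArg (fun x => (p.2 x).map σ.1) (σ.2.symm_apply_apply e)⟩⟩⟩ :
          Σ q : Labelled a b, Iso (ofLabelled p) (ofLabelled q)) = ⟨q, ⟨σ, h⟩⟩ from
      fun ⟨q, i, hi⟩ => h i q hi
    rintro σ ⟨q₁, q₂⟩ h
    obtain rfl : q₁ = fun e => (p.1 (σ.2.symm e)).map σ.1 := funext fun e => by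
      rw [← (h _).1, Equiv.apply_symm_apply]
    obtain rfl : q₂ = fun e => (p.2 (σ.2.symm e)).map σ.1 := funext fun e => by
      rw [← (h _).2, Equiv.apply_symm_apply]
    rfl

instance (G H : PointedGraph) : Finite (Iso G H) := Subtype.finite

theorem card_iso {G H K : PointedGraph} (h : Nonempty (Iso H K)) :
    Nat.card (Iso G H) = Nat.card (Iso G K) := by
  obtain ⟨⟨⟨p, q⟩, h⟩⟩ := h
  refine Nat.card_congr ⟨fun i => ⟨(i.1.1.trans p, i.1.2.trans q), fun e => ?_⟩,
    fun i => ⟨(i.1.1.trans p.symm, i.1.2.trans q.symm), fun e => ?_⟩, fun i => ?_, fun i => ?_⟩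
  · have h1 := h (i.1.2 e)
    have h2 := i.2 e
    simp only at h1
    simp [h1, h2]
  · have h1 := h (q.symm (i.1.2 e))
    have h2 := i.2 e
    simp only [Equiv.apply_symm_apply, h2] at h1
    have h3 := congrArg (Option.map p.symm) h1.1
    have h4 := congrArg (Option.map p.symm) h1.2
    simp only [Option.map_map, Equiv.symm_comp_self, Option.map_id_fun, id] at h3 h4
    exact ⟨by simpa using h3.symm, by simpa using h4.symm⟩
  · apply Subtype.ext; ext <;> simp
  · apply Subtype.ext; ext <;> simp

theorem card_iso_symm (G H : PointedGraph) : Nat.card (Iso G H) = Nat.card (Iso H G) := by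
  have key : ∀ {G H : PointedGraph} (i : Iso G H) (e : Fin H.nE),
      G.src (i.1.2.symm e) = (H.src e).map i.1.1.symm ∧
      G.tgt (i.1.2.symm e) = (H.tgt e).map i.1.1.symm := by
    intro G H i e
    have h := i.2 (i.1.2.symm e)
    rw [Equiv.apply_symm_apply] at h
    rw [h.1, h.2]
    simp
  exact Nat.card_congr ⟨fun i => ⟨(i.1.1.symm, i.1.2.symm), key i⟩,
    fun i => ⟨(i.1.1.symm, i.1.2.symm), key i⟩, fun i => rfl, fun i => rfl⟩

theorem autCard_of_iso {G H : PointedGraph} (h : Nonempty (Iso G H)) : G.autCard = H.autCard := by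
  unfold autCard
  rw [card_iso h, card_iso_symm, card_iso h]

/-- Orbit counting: a pair of permutations of the labels is the same as a labelled graph together
with an isomorphism onto it from `p`, and over each graph isomorphic to `p` there are `autCard`
isomorphisms. -/
theorem card_fiber {a b : ℕ} (p : Labelled a b) :
    open Classical in
    (Finset.univ.filter fun q : Labelled a b => Nonempty (Iso (ofLabelled p) (ofLabelled q))).card *
      (ofLabelled p).autCard = a.factorial * b.factorial := by
  classical
  have h1 := Nat.card_congr (permLabelled p)
  rw [Nat.card_sigma, Nat.card_prod, Nat.card_perm, Nat.card_perm, Nat.card_fin, Nat.card_fin] at h1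
  rw [h1, Finset.card_eq_sum_ones, Finset.sum_mul, Finset.sum_filter]
  refine Finset.sum_congr rfl fun q _ => ?_
  split_ifs with h
  · rw [one_mul]
    exact card_iso h
  · haveI : IsEmpty (Iso (ofLabelled p) (ofLabelled q)) := not_nonempty_iff.1 h
    exact Nat.card_of_isEmpty.symm

theorem autCard_pos (G : PointedGraph) : 0 < G.autCard :=
  haveI := Iso.nonempty_refl G
  Nat.card_pos

theorem out_mk (G : PointedGraph) : Nonempty (Iso (⟦G⟧ : PGraph).out G) :=
  Quotient.mk_out G

theorem exists_ofLabelled (G : PointedGraph) {a b : ℕ} (ha : G.nV = a) (hb : G.nE = b) :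
    ∃ p : Labelled a b, ofLabelled p = G := by
  subst ha hb
  exact ⟨(G.src, G.tgt), rfl⟩

theorem sum_labelled [DecidableEq PGraph] (a b : ℕ) (F : PGraph → ℂ) :
    ∑ p : Labelled a b, F ⟦ofLabelled p⟧ =
      ∑ Z ∈ Finset.univ.image (fun p : Labelled a b => (⟦ofLabelled p⟧ : PGraph)),
        ((a.factorial * b.factorial : ℕ) : ℂ) / PGraph.autCard Z * F Z := by
  classical
  rw [Finset.sum_comp F (fun p : Labelled a b => (⟦ofLabelled p⟧ : PGraph))]
  refine Finset.sum_congr rfl fun Z hZ => ?_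
  obtain ⟨p, -, rfl⟩ := Finset.mem_image.1 hZ
  have h1 : PGraph.autCard ⟦ofLabelled p⟧ = (ofLabelled p).autCard := autCard_of_iso (out_mk _)
  have h2 : (Finset.univ.filter fun q : Labelled a b => (⟦ofLabelled q⟧ : PGraph) = ⟦ofLabelled p⟧) =
      Finset.univ.filter fun q => Nonempty (Iso (ofLabelled p) (ofLabelled q)) :=
    Finset.filter_congr fun q _ => eq_comm.trans Quotient.eq
  rw [h1, h2, ← card_fiber p, nsmul_eq_mul, Nat.cast_mul,
    mul_div_cancel_right₀ _ (Nat.cast_ne_zero.2 (autCard_pos _).ne')]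

/-! ## The operators as contractions -/

variable {n : ℕ}

theorem eval_eq_gev (G : PointedGraph) (X : KahlerChart n) (f : (Fin n → ℂ) → ℂ) (z : Fin n → ℂ) :
    G.eval X f z = gev G.src G.tgt (fun i j => X.gInv i j z)
      (vertexTensor (fun I J => X.gJet I J z) (fun I J => fJet I J f z)) := by
  unfold eval gev
  refine Finset.sum_congr rfl fun i _ => Finset.sum_congr rfl fun j _ => ?_
  rw [Fintype.prod_option, mul_assoc, mul_comm (∏ v : Fin G.nV, _)]
  rfl

theorem eval_of_iso {G H : PointedGraph} (h : Nonempty (Iso G H)) (X : KahlerChart n)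
    (f : (Fin n → ℂ) → ℂ) (z : Fin n → ℂ) : G.eval X f z = H.eval X f z := by
  obtain ⟨⟨⟨p, q⟩, h⟩⟩ := h
  rw [eval_eq_gev, eval_eq_gev]
  refine (gev_reindex (Equiv.optionCongr p) q (fun e => (h e).1) (fun e => (h e).2) _ fun v => ?_).symm
  cases v <;> rfl

theorem op_apply (G : PointedGraph) (X : KahlerChart n) (f : X.smooth) {z : Fin n → ℂ}
    (hz : z ∈ X.U) : (G.op n X f).1 z = G.eval X f.1 z :=
  Set.indicator_of_mem hz _

theorem op_of_iso {G H : PointedGraph} (h : Nonempty (Iso G H)) : G.op = H.op := by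
  funext n X
  refine LinearMap.ext fun f => Subtype.ext (funext fun z => ?_)
  change X.U.indicator _ z = X.U.indicator _ z
  congr 1
  funext z
  exact eval_of_iso h X f.1 z

/-- Each class is represented by `a! * b! / |Aut|` labelled graphs, so the factorial weights become
the weights `1 / |Aut|`. The set `A` only has to contain the support of the weight and to respect
the bounds. -/
theorem labelledSum_eq_sum {c : PointedGraph → ℂ}
    (hc : ∀ {G H : PointedGraph}, Nonempty (Iso G H) → c G = c H) (d N : ℕ) (A : Finset PGraph)
    (hA : ∀ Z : PGraph, c Z.out ≠ 0 → Z ∈ A)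
    (hA' : ∀ Z ∈ A, Z.out.nV < N ∧ Z.out.nE = Z.out.nV + d)
    (X : KahlerChart n) (f : (Fin n → ℂ) → ℂ) (z : Fin n → ℂ) :
    labelledSum c d N (fun i j => X.gInv i j z) (fun I J => X.gJet I J z)
      (fun I J => fJet I J f z) =
    ∑ Z ∈ A, c Z.out * ((-1) ^ Z.out.nV / Z.autCard) * Z.out.eval X f z := by
  classical
  rw [← Finset.sum_fiberwise_of_maps_to (s := A) (t := Finset.range N) (g := fun Z => Z.out.nV)
    fun Z hZ => Finset.mem_range.2 (hA' Z hZ).1]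
  refine Finset.sum_congr rfl fun a _ => ?_
  have h1 : ∀ p : Labelled a (a + d), c (ofLabelled p) * gev p.1 p.2 (fun i j => X.gInv i j z)
      (vertexTensor (fun I J => X.gJet I J z) (fun I J => fJet I J f z)) =
      (fun Z : PGraph => c Z.out * Z.out.eval X f z) ⟦ofLabelled p⟧ := by
    intro p
    simp only
    rw [hc (out_mk _), eval_of_iso (out_mk _), eval_eq_gev]
    rfl
  rw [Finset.sum_congr rfl fun p _ => h1 p, sum_labelled _ _ fun Z : PGraph => c Z.out * Z.out.eval X f z,
    Finset.mul_sum]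
  symm
  have hsub : A.filter (fun Z => Z.out.nV = a) ⊆
      Finset.univ.image (fun p : Labelled a (a + d) => (⟦ofLabelled p⟧ : PGraph)) := by
    intro Z hZ
    obtain ⟨h2, h3⟩ := Finset.mem_filter.1 hZ
    obtain ⟨p, hp⟩ := exists_ofLabelled Z.out h3 (by rw [(hA' Z h2).2, h3])
    exact Finset.mem_image.2 ⟨p, Finset.mem_univ _, by rw [hp, Quotient.out_eq]⟩
  refine Finset.sum_subset_zero_on_sdiff hsub (fun Z hZ => ?_) fun Z hZ => ?_
  · obtain ⟨h2, h3⟩ := Finset.mem_sdiff.1 hZ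
    obtain ⟨p, -, rfl⟩ := Finset.mem_image.1 h2
    by_cases h4 : c (⟦ofLabelled p⟧ : PGraph).out = 0
    · simp [h4]
    · exact absurd (Finset.mem_filter.2 ⟨hA _ h4, (out_mk (ofLabelled p)).some.nV_eq⟩) h3
  · rw [(Finset.mem_filter.1 hZ).2]
    have : ((a.factorial * (a + d).factorial : ℕ) : ℂ) ≠ 0 :=
      Nat.cast_ne_zero.2 (Nat.mul_ne_zero (Nat.factorial_ne_zero _) (Nat.factorial_ne_zero _))
    field_simp

end PointedGraph

open PointedGraph

/-- The semistable graphs with stabilization graph `Γ` form a finite set. -/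
theorem finite_setOf_stabilizesTo (Γ : PGraph) :
    {Z : PGraph | Z.IsSemistable ∧ Z.StabilizesTo Γ}.Finite := by
  refine Set.Finite.subset (Set.finite_range fun x : Σ a : Fin (2 * (Γ.out.nE - Γ.out.nV) + 1),
    Labelled (a : ℕ) (a + (Γ.out.nE - Γ.out.nV)) => (⟦ofLabelled x.2⟧ : PGraph)) ?_
  rintro Z ⟨h1, h2⟩
  obtain ⟨p, hp⟩ := exists_ofLabelled Z.out rfl (StabilizesTo.nE_eq h2)
  exact ⟨⟨⟨Z.out.nV, StabilizesTo.nV_lt h1 h2⟩, p⟩, by simp only [hp, Quotient.out_eq]⟩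

theorem finite_stabFiber (Γ : StableGraph) : (stabFiber Γ).Finite :=
  Set.Finite.of_finite_image (f := Subtype.val) ((finite_setOf_stabilizesTo Γ.1).subset (by
    rintro _ ⟨Z, hZ, rfl⟩
    exact ⟨Z.2.1, hZ⟩)) Subtype.val_injective.injOn

/-- The value of the function obtained by applying an operator. -/
def evalOp {n : ℕ} (X : KahlerChart n) (f : X.smooth) (z : Fin n → ℂ) : Op →ₗ[ℂ] ℂ where
  toFun P := (P n X f).1 z
  map_add' _ _ := rfl
  map_smul' _ _ := rfl

/-- The signed operator of a graph, divided by the order of the automorphism group. -/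
def PGraph.signedOp (Z : PGraph) : Op := ((-1) ^ Z.numV / (Z.autCard : ℂ)) • Z.op

theorem PGraph.signedOp_apply (Z : PGraph) {n : ℕ} (X : KahlerChart n) (f : X.smooth)
    {z : Fin n → ℂ} (hz : z ∈ X.U) : (Z.signedOp n X f).1 z =
      (-1) ^ Z.numV / (Z.autCard : ℂ) * Z.out.eval X f.1 z := by
  rw [← op_apply _ _ _ hz]
  rfl

theorem graphSum_eq (c : StabilizableGraph →₀ ℂ) :
    graphSum c = c.sum fun Z a => a • Z.1.signedOp := by
  unfold graphSum PGraph.signedOp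
  refine Finsupp.sum_congr fun Z _ => ?_
  rw [smul_smul, mul_div_assoc]

theorem stableOp_eq (Γ : StableGraph) :
    stableOp Γ = ((-1) ^ Γ.1.numV * (Γ.1.autCard : ℂ)) •
      ∑ Z ∈ (finite_stabFiber Γ).toFinset, Z.1.signedOp := by
  unfold stableOp
  rw [finsum_mem_eq_finite_toFinset_sum _ (finite_stabFiber Γ), Finset.smul_sum]
  refine Finset.sum_congr rfl fun Z _ => ?_
  rw [PGraph.signedOp, smul_smul, zpow_sub₀ (by norm_num), zpow_natCast, zpow_natCast]
  congr 1
  have : ((-1 : ℂ) ^ Γ.1.numV)⁻¹ = (-1) ^ Γ.1.numV := by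
    rw [← inv_pow]; norm_num
  rw [div_eq_mul_inv ((-1 : ℂ) ^ Z.1.numV), this]
  ring

/-- The minus sign appears because `numV` also counts the distinguished vertex, while `labelledSum`
takes its sign from the ordinary ones. -/
theorem sum_signedOp_apply (Γ : StableGraph) {n : ℕ} (X : KahlerChart n) (f : X.smooth)
    {z : Fin n → ℂ} (hz : z ∈ X.U) :
    ((∑ Z ∈ (finite_stabFiber Γ).toFinset, Z.1.signedOp : Op) n X f).1 z =
      -labelledSum (stabInd Γ.1.out) (Γ.1.out.nE - Γ.1.out.nV) (2 * (Γ.1.out.nE - Γ.1.out.nV) + 1)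
        (fun i j => X.gInv i j z) (fun I J => X.gJet I J z) (fun I J => fJet I J f.1 z) := by
  have h1 : ((∑ Z ∈ (finite_stabFiber Γ).toFinset, Z.1.signedOp : Op) n X f).1 z =
      ∑ Z ∈ (finite_stabFiber Γ).toFinset, (Z.1.signedOp n X f).1 z :=
    map_sum (evalOp X f z) _ _
  rw [h1, labelledSum_eq_sum (isContractionInvariant_stabInd _).iso _ _
    (finite_setOf_stabilizesTo Γ.1).toFinset (fun Z hZ => ?_) (fun Z hZ => ?_),
    ← Finset.sum_neg_distrib]
  · refine Finset.sum_bij (fun Z _ => Z.1) (fun Z hZ => ?_) (fun _ _ _ _ => Subtype.ext)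
      (fun Z hZ => ?_) fun Z hZ => ?_
    · rw [Set.Finite.mem_toFinset] at hZ ⊢
      exact ⟨Z.2.1, hZ⟩
    · rw [Set.Finite.mem_toFinset] at hZ
      exact ⟨⟨Z, hZ.1, _, hZ.2⟩, (Set.Finite.mem_toFinset _).2 hZ.2, rfl⟩
    · rw [Set.Finite.mem_toFinset] at hZ
      rw [PGraph.signedOp_apply _ _ _ hz, stabInd, if_pos ⟨Z.2.1, hZ⟩, PGraph.numV]
      ring
  · rw [Set.Finite.mem_toFinset]
    by_contra h1
    exact hZ (if_neg h1)
  · rw [Set.Finite.mem_toFinset] at hZ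
    exact ⟨StabilizesTo.nV_lt hZ.1 hZ.2, StabilizesTo.nE_eq hZ.2⟩

theorem isCovariant_sum_signedOp (Γ : StableGraph) :
    IsCovariant (∑ Z ∈ (finite_stabFiber Γ).toFinset, Z.1.signedOp) := by
  intro n X Y φ ψ H f h hh z hz
  have h2 := labelledSum_coordChange (isContractionInvariant_stabInd Γ.1.out)
    (by rw [conj_stabInd_rev]; exact isContractionInvariant_stabInd _)
    (Γ.1.out.nE - Γ.1.out.nV) (2 * (Γ.1.out.nE - Γ.1.out.nV) + 1) (fun G hG => by
      refine if_neg fun h1 => ?_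
      have := StabilizesTo.nV_lt h1.1 h1.2
      omega) H f.2.1 hh hz
  rw [sum_signedOp_apply Γ X h hz, sum_signedOp_apply Γ Y f (H.mapsTo hz), h2]

theorem isCovariant_stableOp (Γ : StableGraph) : IsCovariant (stableOp Γ) := by
  intro n X Y φ ψ H f h hh z hz
  rw [stableOp_eq]
  have h1 := isCovariant_sum_signedOp Γ n X Y φ ψ H f h hh z hz
  have h2 := map_smul (evalOp X h z) ((-1) ^ Γ.1.numV * (Γ.1.autCard : ℂ))
    (∑ Z ∈ (finite_stabFiber Γ).toFinset, Z.1.signedOp)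
  have h3 := map_smul (evalOp Y f (φ z)) ((-1) ^ Γ.1.numV * (Γ.1.autCard : ℂ))
    (∑ Z ∈ (finite_stabFiber Γ).toFinset, Z.1.signedOp)
  exact h2.trans ((congrArg _ h1).trans h3.symm)

/-! ## Monomials -/

section monomial

variable {n : ℕ}

/-- The square-free monomial in the coordinates `A` and the conjugate coordinates `B`. -/
def sqfreeMonomial (A B : Finset (Fin n)) (z : Fin n → ℂ) : ℂ :=
  (∏ e ∈ A, z e) * ∏ e ∈ B, starRingEnd ℂ (z e)

theorem contDiff_coord (e : Fin n) : ContDiffOn ℝ ∞ (fun z : Fin n → ℂ => z e) Set.univ :=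
  (hol_coord e).1

theorem contDiffOn_sqfreeMonomial (A B : Finset (Fin n)) :
    ContDiffOn ℝ ∞ (sqfreeMonomial A B) Set.univ :=
  (contDiffOn_prod fun e _ => contDiff_coord e).mul
    (contDiffOn_prod fun e _ => contDiffOn_conj (contDiff_coord e))

theorem conj_sqfreeMonomial (A B : Finset (Fin n)) :
    (fun z => starRingEnd ℂ (sqfreeMonomial A B z)) = sqfreeMonomial B A := by
  funext z
  simp only [sqfreeMonomial, map_mul, map_prod, Complex.conj_conj]
  exact mul_comm _ _

theorem dz_sqfreeMonomial (k : Fin n) (A B : Finset (Fin n)) :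
    dz k (sqfreeMonomial A B) = if k ∈ A then sqfreeMonomial (A.erase k) B else 0 := by
  funext z
  have d1 : ∀ e : Fin n, DifferentiableAt ℝ (fun z : Fin n → ℂ => z e) z := fun e =>
    diffAt_of_smooth isOpen_univ (contDiff_coord e) (Set.mem_univ z)
  have d2 : ∀ e : Fin n, DifferentiableAt ℝ (fun z : Fin n → ℂ => starRingEnd ℂ (z e)) z := fun e =>
    diffAt_of_smooth isOpen_univ (contDiffOn_conj (contDiff_coord e)) (Set.mem_univ z)
  have h2 : ∀ e : Fin n, wirt (-Complex.I) k (fun z : Fin n → ℂ => starRingEnd ℂ (z e)) z = 0 := by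
    intro e
    rw [← dz_eq_wirt, dz_conj (d1 e), (hol_coord e).2 z (Set.mem_univ z), map_zero]
  have h1 : ∀ e : Fin n, wirt (-Complex.I) k (fun z : Fin n → ℂ => z e) z =
      if e = k then 1 else 0 := fun e => by
    rw [← dz_eq_wirt, dz_coord]
  change dz k (fun z => (∏ e ∈ A, z e) * ∏ e ∈ B, starRingEnd ℂ (z e)) z = _
  rw [dz_eq_wirt, wirt_mul (PointedGraph.differentiableAt_prod _ fun e _ => d1 e)
    (PointedGraph.differentiableAt_prod _ fun e _ => d2 e),
    wirt_prod A (fun e z => z e) fun e _ => d1 e,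
    wirt_prod B (fun e z => starRingEnd ℂ (z e)) fun e _ => d2 e]
  simp only [h1, h2, zero_mul, Finset.sum_const_zero, mul_zero, add_zero, ite_mul, one_mul,
    Finset.sum_ite_eq']
  split_ifs with h
  · rfl
  · simp

theorem dzbar_sqfreeMonomial (k : Fin n) (A B : Finset (Fin n)) :
    dzbar k (sqfreeMonomial A B) = if k ∈ B then sqfreeMonomial A (B.erase k) else 0 := by
  funext z
  have hd := diffAt_of_smooth isOpen_univ (contDiffOn_sqfreeMonomial B A) (Set.mem_univ z)
  rw [← conj_sqfreeMonomial B A, dzbar_conj hd, dz_sqfreeMonomial]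
  split_ifs with h
  · exact congrFun (conj_sqfreeMonomial _ _) z
  · simp

theorem cons_eq_val_iff {k : Fin n} {I : Multiset (Fin n)} {A : Finset (Fin n)} :
    k ::ₘ I = A.val ↔ k ∈ A ∧ I = (A.erase k).val := by
  constructor
  · intro h
    have hk : k ∈ A := by
      rw [← Finset.mem_val, ← h]
      exact Multiset.mem_cons_self _ _
    refine ⟨hk, ?_⟩
    rw [Finset.erase_val, ← h, Multiset.erase_cons_head]
  · rintro ⟨hk, rfl⟩
    rw [Finset.erase_val, Multiset.cons_erase hk]

theorem fJet_zero_fun (I J : Multiset (Fin n)) (z : Fin n → ℂ) :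
    fJet I J (0 : (Fin n → ℂ) → ℂ) z = 0 := by
  have h := fJet_sum (U := Set.univ) isOpen_univ (∅ : Finset ℕ) (fun _ => (0 : (Fin n → ℂ) → ℂ))
    (by simp) I J (Set.mem_univ z)
  simp only [Finset.sum_empty] at h
  exact h

-- For square-free monomials all nonzero jets at the origin are equal to 1, so no factorials enter
-- the incidence counts below.
open Classical in
theorem fJet_sqfreeMonomial (I J : Multiset (Fin n)) (A B : Finset (Fin n)) :
    fJet I J (sqfreeMonomial A B) 0 = if I = A.val ∧ J = B.val then 1 else 0 := by
  revert A B
  refine jet_induction (p := fun I J => ∀ A B : Finset (Fin n),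
    fJet I J (sqfreeMonomial A B) 0 = if I = A.val ∧ J = B.val then 1 else 0) ?_ ?_ ?_ I J
  · intro A B
    rw [fJet_zero]
    have key : ∀ A : Finset (Fin n), (∏ e ∈ A, (0 : Fin n → ℂ) e) = if 0 = A.val then 1 else 0 := by
      intro A
      rcases A.eq_empty_or_nonempty with rfl | ⟨e, he⟩
      · simp
      · rw [Finset.prod_eq_zero he rfl, if_neg]
        intro h
        rw [← Finset.mem_val, ← h] at he
        simp at he
    have h2 := key B
    simp only [sqfreeMonomial, key A]
    simp only [Pi.zero_apply, map_zero] at h2 ⊢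
    rw [h2, ite_and]
    split_ifs <;> simp
  · intro k I J ih A B
    rw [fJet_cons_left' isOpen_univ (contDiffOn_sqfreeMonomial A B) k I J (Set.mem_univ 0),
      dz_sqfreeMonomial]
    simp only [cons_eq_val_iff]
    split_ifs with h h1 h1
    · rw [ih, if_pos ⟨h1.1.2, h1.2⟩]
    · rw [ih, if_neg fun h2 => h1 ⟨⟨h, h2.1⟩, h2.2⟩]
    · exact absurd h1.1.1 h
    · exact fJet_zero_fun _ _ _
  · intro k J ih A B
    rw [fJet_cons_right' isOpen_univ (contDiffOn_sqfreeMonomial A B) k 0 J (Set.mem_univ 0),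
      dzbar_sqfreeMonomial]
    simp only [cons_eq_val_iff]
    split_ifs with h h1 h1
    · rw [ih, if_pos ⟨h1.1, h1.2.2⟩]
    · rw [ih, if_neg fun h2 => h1 ⟨h2.1, h, h2.2⟩]
    · exact absurd h1.2.1 h
    · exact fJet_zero_fun _ _ _

end monomial

/-! ## Metrics from potentials -/

section potential

variable {n : ℕ} {ρ : (Fin n → ℂ) → ℂ}

/-- By the Cauchy–Schwarz inequality the perturbation `M - 1` contributes at most `n / (n + 1)`
times the squared norm of the vector. The denominator `n + 1` makes this factor less than one, also
for `n = 0`. -/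
theorem posDef_of_near_one {M : Matrix (Fin n) (Fin n) ℂ} (hM : M.IsHermitian)
    (h : ∀ i j, ‖M i j - (1 : Matrix (Fin n) (Fin n) ℂ) i j‖ < 1 / (n + 1)) : M.PosDef := by
  refine Matrix.PosDef.of_dotProduct_mulVec_pos hM fun x hx => ?_
  have him : (star x ⬝ᵥ M.mulVec x).im = 0 := hM.im_star_dotProduct_mulVec_self x
  have hpos : 0 < ∑ i, ‖x i‖ ^ 2 := by
    obtain ⟨i, hi⟩ := Function.ne_iff.1 hx
    exact Finset.sum_pos' (fun _ _ => by positivity) ⟨i, Finset.mem_univ _, by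
      have : 0 < ‖x i‖ := norm_pos_iff.2 hi
      positivity⟩
  have h1 : star x ⬝ᵥ M.mulVec x = ((∑ i, ‖x i‖ ^ 2 : ℝ) : ℂ) +
      ∑ i, ∑ j, star (x i) * (M i j - (1 : Matrix (Fin n) (Fin n) ℂ) i j) * x j := by
    have h2 : M.mulVec x = x + (M - 1).mulVec x := by
      rw [Matrix.sub_mulVec, Matrix.one_mulVec]; abel
    rw [h2, dotProduct_add]
    congr 1
    · simp only [dotProduct, Pi.star_apply, Complex.ofReal_sum]
      refine Finset.sum_congr rfl fun i _ => ?_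
      rw [Complex.star_def, Complex.conj_mul']
      push_cast
      rfl
    · simp only [dotProduct, Matrix.mulVec, Pi.star_apply, Finset.mul_sum, Matrix.sub_apply,
        mul_assoc]
  have h3 : ‖∑ i, ∑ j, star (x i) * (M i j - (1 : Matrix (Fin n) (Fin n) ℂ) i j) * x j‖ ≤
      1 / (n + 1) * (n * ∑ i, ‖x i‖ ^ 2) := by
    calc _ ≤ ∑ i, ∑ j, ‖x i‖ * (1 / (n + 1)) * ‖x j‖ := by
          refine (norm_sum_le _ _).trans (Finset.sum_le_sum fun i _ =>
            (norm_sum_le _ _).trans (Finset.sum_le_sum fun j _ => ?_))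
          rw [norm_mul, norm_mul, norm_star]
          gcongr
          exact (h i j).le
      _ = 1 / (n + 1) * (∑ i, ‖x i‖) ^ 2 := by
          rw [sq, Finset.sum_mul_sum, Finset.mul_sum]
          refine Finset.sum_congr rfl fun i _ => ?_
          rw [Finset.mul_sum]
          exact Finset.sum_congr rfl fun j _ => by ring
      _ ≤ _ := by
          gcongr
          have := sq_sum_le_card_mul_sum_sq (s := Finset.univ) (f := fun i => ‖x i‖)
          simpa using this
  have h4 : 0 < (star x ⬝ᵥ M.mulVec x).re := by
    rw [h1, Complex.add_re, Complex.ofReal_re]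
    have h5 := (Complex.abs_re_le_norm _).trans h3
    have h6 := (abs_le.1 h5).1
    have h7 : 1 / ((n : ℝ) + 1) * (n * ∑ i, ‖x i‖ ^ 2) < ∑ i, ‖x i‖ ^ 2 := by
      rw [← mul_assoc]
      have : 1 / ((n : ℝ) + 1) * n < 1 := by
        rw [one_div_mul_eq_div, div_lt_one (by positivity)]
        linarith
      nlinarith
    linarith
  rw [Complex.lt_def]
  exact ⟨h4, him.symm⟩

theorem dz_const_add {k : Fin n} (c : ℂ) {z : Fin n → ℂ} (h : DifferentiableAt ℝ ρ z) :
    dz k (fun w => c + ρ w) z = dz k ρ z := by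
  rw [dz_eq_wirt, wirt_add (differentiableAt_const c) h, wirt_const, zero_add]

theorem dzbar_const_add {k : Fin n} (c : ℂ) {z : Fin n → ℂ} (h : DifferentiableAt ℝ ρ z) :
    dzbar k (fun w => c + ρ w) z = dzbar k ρ z := by
  rw [dzbar_eq_wirt, wirt_add (differentiableAt_const c) h, wirt_const, zero_add]

theorem dz_dz_comm (hρ : ContDiffOn ℝ ∞ ρ Set.univ) (i j : Fin n) :
    dz i (dz j ρ) = dz j (dz i ρ) := by
  funext z
  simp only [dz_eq_wirt]
  exact wirt_comm isOpen_univ hρ _ _ _ _ (Set.mem_univ z)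

theorem dz_dzbar_comm (hρ : ContDiffOn ℝ ∞ ρ Set.univ) (i j : Fin n) :
    dz i (dzbar j ρ) = dzbar j (dz i ρ) := by
  funext z
  simp only [dz_eq_wirt, dzbar_eq_wirt]
  exact wirt_comm isOpen_univ hρ _ _ _ _ (Set.mem_univ z)

theorem dzbar_dzbar_comm (hρ : ContDiffOn ℝ ∞ ρ Set.univ) (i j : Fin n) :
    dzbar i (dzbar j ρ) = dzbar j (dzbar i ρ) := by
  funext z
  simp only [dzbar_eq_wirt]
  exact wirt_comm isOpen_univ hρ _ _ _ _ (Set.mem_univ z)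

/-- The metric with potential `|z|² + ρ`. -/
def potentialForm (ρ : (Fin n → ℂ) → ℂ) (z : Fin n → ℂ) : Matrix (Fin n) (Fin n) ℂ :=
  Matrix.of fun i j => (if i = j then 1 else 0) + dz i (dzbar j ρ) z

theorem contDiffOn_potentialForm (hρ : ContDiffOn ℝ ∞ ρ Set.univ) (i j : Fin n) :
    ContDiffOn ℝ ∞ (fun z => potentialForm ρ z i j) Set.univ :=
  contDiffOn_const.add (contDiffOn_dz isOpen_univ (contDiffOn_dzbar isOpen_univ hρ j) i)

theorem isClosedForm_potentialForm (hρ : ContDiffOn ℝ ∞ ρ Set.univ) :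
    IsClosedForm Set.univ (potentialForm ρ) where
  smooth := contDiffOn_potentialForm hρ
  closed z hz i j k := by
    have hj := contDiffOn_dzbar isOpen_univ hρ j
    have hd : ∀ i, DifferentiableAt ℝ (dz i (dzbar j ρ)) z := fun i =>
      diffAt_of_smooth isOpen_univ (contDiffOn_dz isOpen_univ hj i) hz
    simp only [potentialForm, Matrix.of_apply]
    rw [dz_const_add _ (hd i), dz_const_add _ (hd k), dz_dz_comm hj]
  closed' z hz i j k := by
    have hd : ∀ j, DifferentiableAt ℝ (dz i (dzbar j ρ)) z := fun j =>
      diffAt_of_smooth isOpen_univ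
        (contDiffOn_dz isOpen_univ (contDiffOn_dzbar isOpen_univ hρ j) i) hz
    simp only [potentialForm, Matrix.of_apply]
    rw [dzbar_const_add _ (hd j), dzbar_const_add _ (hd k),
      ← dz_dzbar_comm (contDiffOn_dzbar isOpen_univ hρ j),
      ← dz_dzbar_comm (contDiffOn_dzbar isOpen_univ hρ k), dzbar_dzbar_comm hρ]

theorem potentialForm_isHermitian (hρ : ContDiffOn ℝ ∞ ρ Set.univ)
    (hr : ∀ z, starRingEnd ℂ (ρ z) = ρ z) (z : Fin n → ℂ) : (potentialForm ρ z).IsHermitian := by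
  ext i j
  rw [Matrix.conjTranspose_apply, ← starRingEnd_apply]
  simp only [potentialForm, Matrix.of_apply, map_add]
  congr 1
  · simp [eq_comm, apply_ite]
  · have hz := Set.mem_univ z
    have h1 := diffAt_of_smooth isOpen_univ (contDiffOn_dzbar isOpen_univ hρ i) hz
    rw [← dzbar_conj h1]
    have h2 : Set.EqOn (fun w => starRingEnd ℂ (dzbar i ρ w)) (dz i ρ) Set.univ := fun w hw => by
      have := dz_conj (k := i) (diffAt_of_smooth isOpen_univ hρ hw)
      simp only [hr] at this
      exact this.symm
    rw [dzbar_eq_wirt, wirt_eqOn isOpen_univ h2 hz, ← dzbar_eq_wirt, dz_dzbar_comm hρ]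

/-- The chart around the origin with potential `|z|² + ρ`. -/
theorem exists_chart_of_potential (hρ : ContDiffOn ℝ ∞ ρ Set.univ)
    (hr : ∀ z, starRingEnd ℂ (ρ z) = ρ z) (h0 : ∀ i j, dz i (dzbar j ρ) 0 = 0) :
    ∃ X : KahlerChart n, 0 ∈ X.U ∧ X.g = potentialForm ρ := by
  have hc : ∀ i j, Continuous fun z => potentialForm ρ z i j := fun i j =>
    continuousOn_univ.1 (contDiffOn_potentialForm hρ i j).continuousOn
  set U : Set (Fin n → ℂ) := {z | ∀ i j, ‖potentialForm ρ z i j -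
    (1 : Matrix (Fin n) (Fin n) ℂ) i j‖ < 1 / (n + 1)} with hU
  have oU : IsOpen U := by
    simp only [hU, Set.ofPred_forall]
    exact isOpen_iInter_of_finite fun i => isOpen_iInter_of_finite fun j =>
      isOpen_lt ((hc i j).sub continuous_const).norm continuous_const
  have cf := (isClosedForm_potentialForm hρ).mono (Set.subset_univ U)
  refine ⟨⟨U, oU, potentialForm ρ, cf.smooth, fun z hz =>
    posDef_of_near_one (potentialForm_isHermitian hρ hr z) hz, cf.closed, cf.closed'⟩, ?_, rfl⟩
  intro i j
  simp only [potentialForm, Matrix.of_apply, h0, Matrix.one_apply, add_zero, sub_self, norm_zero]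
  positivity

theorem fJet_pair (hρ : ContDiffOn ℝ ∞ ρ Set.univ) (i j : Fin n)
    (z : Fin n → ℂ) : fJet {i} {j} ρ z = dz i (dzbar j ρ) z := by
  have hz := Set.mem_univ z
  rw [← Multiset.cons_zero, ← Multiset.cons_zero,
    fJet_cons_right' isOpen_univ hρ _ _ _ hz,
    fJet_cons_left' isOpen_univ (contDiffOn_dzbar isOpen_univ hρ _) _ _ _ hz, fJet_zero]

theorem fJet_const {I J : Multiset (Fin n)} (h : 0 < I.card + J.card) (c : ℂ) (z : Fin n → ℂ) :
    fJet I J (fun _ => c) z = 0 := by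
  have hz := Set.mem_univ z
  induction I using Multiset.induction with
  | cons k I _ =>
    rw [fJet_cons_left' (U := Set.univ) isOpen_univ contDiffOn_const _ _ _ hz]
    have : dz k (fun _ : Fin n → ℂ => c) = 0 := by
      funext w; rw [dz_eq_wirt, wirt_const]; rfl
    rw [this, fJet_zero_fun]
  | empty =>
    induction J using Multiset.induction with
    | cons k J _ =>
      rw [fJet_cons_right' (U := Set.univ) isOpen_univ contDiffOn_const _ _ _ hz]
      have : dzbar k (fun _ : Fin n → ℂ => c) = 0 := by
        funext w; rw [dzbar_eq_wirt, wirt_const]; rfl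
      rw [this, fJet_zero_fun]
    | empty => simp at h

/-- With three or more indices at least one derivative acts on the matrix coefficients, and this
removes the constant identity part. -/
theorem mJet_potentialForm (hρ : ContDiffOn ℝ ∞ ρ Set.univ) {I J : Multiset (Fin n)} (hI : I ≠ 0)
    (hJ : J ≠ 0) (h : 3 ≤ I.card + J.card) (z : Fin n → ℂ) :
    mJet (potentialForm ρ) I J z = fJet I J ρ z := by
  have hz := Set.mem_univ z
  obtain ⟨i, hi⟩ := Multiset.exists_mem_of_ne_zero hI
  obtain ⟨j, hj⟩ := Multiset.exists_mem_of_ne_zero hJ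
  obtain ⟨I, rfl⟩ := Multiset.exists_cons_of_mem hi
  obtain ⟨J, rfl⟩ := Multiset.exists_cons_of_mem hj
  have hj := contDiffOn_dzbar isOpen_univ hρ j
  have hij := contDiffOn_dz isOpen_univ hj i
  rw [mJet_cons_cons isOpen_univ (isClosedForm_potentialForm hρ) _ _ _ _ hz,
    fJet_cons_right' isOpen_univ hρ _ _ _ hz, fJet_cons_left' isOpen_univ hj _ _ _ hz]
  have h1 := fJet_sum (U := Set.univ) isOpen_univ (Finset.univ : Finset Bool)
    (fun b => if b then (fun _ => if i = j then 1 else 0) else dz i (dzbar j ρ))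
    (fun b _ => by cases b <;> simp [contDiffOn_const, hij]) I J hz
  simp only [Fintype.sum_bool, if_true, Bool.false_eq_true, if_false] at h1
  rw [fJet_const (by simp only [Multiset.card_cons] at h; omega), zero_add] at h1
  exact h1

end potential

namespace PointedGraph

variable {n : ℕ}

open Classical in
/-- The jet at the origin of the square-free monomial of `A` and `B`. -/
def jetDelta (A B : Finset (Fin n)) (I J : Multiset (Fin n)) : ℂ :=
  if I = A.val ∧ J = B.val then 1 else 0

theorem fJet_const_mul {U : Set (Fin n → ℂ)} (hU : IsOpen U) {h : (Fin n → ℂ) → ℂ}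
    (hh : ContDiffOn ℝ ∞ h U) (a : ℂ) (I J : Multiset (Fin n)) {z : Fin n → ℂ} (hz : z ∈ U) :
    fJet I J (fun w => a * h w) z = a * fJet I J h z := by
  have h1 := wirtinger_linear hU hh (h' := 0) contDiffOn_const a I.sort J.sort hz
  have h2 := fJet_zero_fun I J z
  simp only [Pi.zero_apply, add_zero] at h1
  unfold fJet at h2 ⊢
  rw [h1, h2, add_zero]

/-- The coefficient of a vertex monomial or of its conjugate. -/
def phase {m : ℕ} (t : Fin m → ℂ) (y : Fin m × Bool) : ℂ :=
  if y.2 then t y.1 else starRingEnd ℂ (t y.1)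

/-- The jets of the monomial of a vertex, or of its conjugate. -/
def vertexDelta (G : PointedGraph) (y : Fin G.nV × Bool) (I J : Multiset (Fin G.nE)) : ℂ :=
  if y.2 then jetDelta (edgesAt G.src (some y.1)) (edgesAt G.tgt (some y.1)) I J
  else jetDelta (edgesAt G.tgt (some y.1)) (edgesAt G.src (some y.1)) I J

/-- The monomial of a vertex, or its conjugate. -/
def vertexMonomial (G : PointedGraph) (y : Fin G.nV × Bool) : (Fin G.nE → ℂ) → ℂ :=
  if y.2 then sqfreeMonomial (edgesAt G.src (some y.1)) (edgesAt G.tgt (some y.1))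
  else sqfreeMonomial (edgesAt G.tgt (some y.1)) (edgesAt G.src (some y.1))

theorem contDiffOn_vertexMonomial (G : PointedGraph) (y : Fin G.nV × Bool) :
    ContDiffOn ℝ ∞ (G.vertexMonomial y) Set.univ := by
  unfold vertexMonomial
  split <;> exact contDiffOn_sqfreeMonomial _ _

theorem fJet_vertexMonomial (G : PointedGraph) (y : Fin G.nV × Bool) (I J : Multiset (Fin G.nE)) :
    fJet I J (G.vertexMonomial y) 0 = G.vertexDelta y I J := by
  unfold vertexMonomial vertexDelta
  split <;> exact fJet_sqfreeMonomial _ _ _ _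

/-- A potential with the monomials of the vertices of `G` as terms. -/
def graphPotential (G : PointedGraph) (t : Fin G.nV → ℂ) (z : Fin G.nE → ℂ) : ℂ :=
  ∑ y, phase t y * G.vertexMonomial y z

theorem fJet_graphPotential (G : PointedGraph) (t : Fin G.nV → ℂ) (I J : Multiset (Fin G.nE)) :
    fJet I J (G.graphPotential t) 0 = ∑ y, phase t y * G.vertexDelta y I J := by
  have h := fJet_sum (U := Set.univ) isOpen_univ Finset.univ
    (fun (y : Fin G.nV × Bool) z => phase t y * G.vertexMonomial y z)
    (fun y _ => contDiffOn_const.mul (G.contDiffOn_vertexMonomial y)) I J (Set.mem_univ 0)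
  refine h.trans (Finset.sum_congr rfl fun y _ => ?_)
  rw [fJet_const_mul isOpen_univ (G.contDiffOn_vertexMonomial y) _ _ _ (Set.mem_univ 0),
    fJet_vertexMonomial]

theorem conj_graphPotential (G : PointedGraph) (t : Fin G.nV → ℂ) (z : Fin G.nE → ℂ) :
    starRingEnd ℂ (G.graphPotential t z) = G.graphPotential t z := by
  unfold graphPotential
  rw [map_sum, Fintype.sum_prod_type, Fintype.sum_prod_type]
  refine Finset.sum_congr rfl fun u _ => ?_
  have h1 := congrFun (conj_sqfreeMonomial (edgesAt G.src (some u)) (edgesAt G.tgt (some u))) z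
  have h2 := congrFun (conj_sqfreeMonomial (edgesAt G.tgt (some u)) (edgesAt G.src (some u))) z
  simp only [Fintype.sum_bool, phase, vertexMonomial, if_true, Bool.false_eq_true, if_false, map_mul,
    Complex.conj_conj, h1, h2]
  ring

/-- There is one coordinate for each edge of `G`, and the monomial of a vertex records its outward
and inward edges. By semistability these monomials have degree at least three, so the metric is the
identity at the origin while its higher jets detect the vertices. -/
theorem exists_test_chart {G : PointedGraph} (hG : G.IsSemistable) (t : Fin G.nV → ℂ) :
    ∃ X : KahlerChart G.nE, 0 ∈ X.U ∧ (∀ i j, X.gInv i j 0 = if i = j then 1 else 0) ∧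
      ∀ I J : Multiset (Fin G.nE), I ≠ 0 → J ≠ 0 → 3 ≤ I.card + J.card →
        X.gJet I J 0 = ∑ y, phase t y * G.vertexDelta y I J := by
  have hρ : ContDiffOn ℝ ∞ (G.graphPotential t) Set.univ :=
    ContDiffOn.sum fun y _ => contDiffOn_const.mul (G.contDiffOn_vertexMonomial y)
  have hjet : ∀ (y : Fin G.nV × Bool) (i j : Fin G.nE), G.vertexDelta y {i} {j} = 0 := by
    intro y i j
    have h1 := (hG y.1).2.2
    have h2 : G.inDeg (some y.1) = (edgesAt G.tgt (some y.1)).val.card := rfl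
    have h3 : G.outDeg (some y.1) = (edgesAt G.src (some y.1)).val.card := rfl
    rw [h2, h3] at h1
    unfold vertexDelta jetDelta
    split <;> refine if_neg fun h => ?_ <;> rw [← h.1, ← h.2] at h1 <;> simp at h1
  have h0 : ∀ i j, dz i (dzbar j (G.graphPotential t)) 0 = 0 := by
    intro i j
    rw [← fJet_pair hρ, fJet_graphPotential]
    simp [hjet]
  obtain ⟨X, hX, hg⟩ := exists_chart_of_potential hρ (G.conj_graphPotential t) h0
  refine ⟨X, hX, fun i j => ?_, fun I J hI hJ h => ?_⟩
  · have : X.g 0 = 1 := by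
      rw [hg]
      ext i j
      simp [potentialForm, h0, Matrix.one_apply]
    rw [KahlerChart.gInv, this, inv_one, Matrix.one_apply]
    simp only [eq_comm]
  · rw [KahlerChart.gJet_eq, hg, mJet_potentialForm hρ hI hJ h, fJet_graphPotential]

/-- The value at the origin of the operator of `H` in the test chart of `G`. -/
def incidenceSum (G H : PointedGraph) (t : Fin G.nV → ℂ) : ℂ :=
  ∑ i : Fin H.nE → Fin G.nE, ∑ χ : Fin H.nV → Fin G.nV × Bool, (∏ v, phase t (χ v)) *
    ((∏ v, G.vertexDelta (χ v) (idxAt H.src i (some v)) (idxAt H.tgt i (some v))) *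
      jetDelta (edgesAt G.src none) (edgesAt G.tgt none) (idxAt H.src i none) (idxAt H.tgt i none))

/-- The inverse metric is the identity at the origin, so both halves of an edge of `H` carry the
same edge of `G`, and `i` becomes a map of edges. Expanding the product of the vertex jets yields
the sum over maps `χ` from vertices of `H` to vertex monomials or their conjugates. -/
theorem eval_test {G H : PointedGraph} (hH : H.IsSemistable) {t : Fin G.nV → ℂ}
    {X : KahlerChart G.nE} (h1 : ∀ i j, X.gInv i j 0 = if i = j then 1 else 0)
    (h2 : ∀ I J : Multiset (Fin G.nE), I ≠ 0 → J ≠ 0 → 3 ≤ I.card + J.card →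
      X.gJet I J 0 = ∑ y, phase t y * G.vertexDelta y I J) {f : (Fin G.nE → ℂ) → ℂ}
    (h3 : ∀ I J, fJet I J f 0 = jetDelta (edgesAt G.src none) (edgesAt G.tgt none) I J) :
    H.eval X f 0 = incidenceSum G H t := by
  unfold incidenceSum
  rw [eval_eq_gev, gev]
  refine Finset.sum_congr rfl fun i _ => ?_
  simp only [h1, Finset.prod_ite_zero, Finset.mem_univ, true_imp_iff, Finset.prod_const_one,
    ite_mul, one_mul, zero_mul]
  simp only [fun j : Fin H.nE → Fin G.nE => (funext_iff (f := i) (g := j)).symm]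
  rw [Finset.sum_ite_eq, if_pos (Finset.mem_univ _), Fintype.prod_option]
  simp only [vertexTensor, Option.elim, h3]
  have h4 : ∀ v : Fin H.nV, X.gJet (idxAt H.src i (some v)) (idxAt H.tgt i (some v)) 0 =
      ∑ y, phase t y * G.vertexDelta y (idxAt H.src i (some v)) (idxAt H.tgt i (some v)) := by
    intro v
    have h5 := hH v
    have h6 : G.inDeg = G.inDeg := rfl
    have h7 : (idxAt H.src i (some v)).card = H.outDeg (some v) := Multiset.card_map _ _
    have h8 : (idxAt H.tgt i (some v)).card = H.inDeg (some v) := Multiset.card_map _ _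
    refine h2 _ _ (fun h => ?_) (fun h => ?_) (by omega)
    · rw [h, Multiset.card_zero] at h7; omega
    · rw [h, Multiset.card_zero] at h8; omega
  rw [Finset.prod_congr rfl fun v _ => h4 v, Finset.prod_univ_sum, Fintype.piFinset_univ, mul_comm,
    Finset.sum_mul]
  refine Finset.sum_congr rfl fun χ _ => ?_
  rw [Finset.prod_mul_distrib, mul_assoc]

/-! ## Averaging over the phases -/

/-- The exponent of a phase. -/
def phaseSign (b : Bool) : ℤ := if b then 1 else -1

theorem sum_range_pow {ζ : ℂ} {N : ℕ} (hζ : IsPrimitiveRoot ζ N) (m : ℤ) :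
    ∑ k ∈ Finset.range N, (ζ ^ m) ^ k = if (N : ℤ) ∣ m then (N : ℂ) else 0 := by
  split_ifs with h
  · rw [(hζ.zpow_eq_one_iff_dvd m).2 h]
    simp
  · have h1 : ζ ^ m ≠ 1 := fun h' => h ((hζ.zpow_eq_one_iff_dvd m).1 h')
    rw [geom_sum_eq h1, ← zpow_natCast, ← zpow_mul, mul_comm, zpow_mul, zpow_natCast, hζ.pow_eq_one,
      one_zpow, sub_self, zero_div]

/-- The exponent of the phase of `u` is at most `a ≤ b` in absolute value, hence `exponent - 1` is
smaller than `N` in absolute value and divisibility forces the exponent to be 1. Summing over `u`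
gives total exponent `b` from `a ≤ b` signs, so all signs are positive, and each `u` is hit exactly
once. -/
theorem exponent_dvd {a b N : ℕ} (hab : a ≤ b) (hN : b + 1 < N) (χ : Fin a → Fin b × Bool) :
    (∀ u, (N : ℤ) ∣ (∑ v with (χ v).1 = u, phaseSign (χ v).2) - 1) ↔
      (∀ v, (χ v).2 = true) ∧ Function.Bijective fun v => (χ v).1 := by
  have habs : ∀ y : Bool, |phaseSign y| = 1 := fun y => by cases y <;> simp [phaseSign]
  have hle : ∀ y : Bool, phaseSign y ≤ 1 := fun y => by cases y <;> simp [phaseSign]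
  constructor
  · intro h
    have h1 : ∀ u, ∑ v with (χ v).1 = u, phaseSign (χ v).2 = 1 := by
      intro u
      have h2 : |∑ v with (χ v).1 = u, phaseSign (χ v).2| ≤ b := by
        refine (Finset.abs_sum_le_sum_abs _ _).trans ?_
        simp only [habs, Finset.sum_const, nsmul_eq_mul, mul_one]
        have h3 := Finset.card_filter_le (Finset.univ : Finset (Fin a)) fun v => (χ v).1 = u
        rw [Finset.card_univ, Fintype.card_fin] at h3
        exact_mod_cast h3.trans hab
      have h3 := Int.eq_zero_of_abs_lt_dvd (h u) (by
        rw [abs_lt]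
        have := abs_le.1 h2
        constructor <;> omega)
      omega
    have h2 : ∑ v, phaseSign (χ v).2 = b := by
      rw [← Finset.sum_fiberwise (Finset.univ) (fun v => (χ v).1)]
      simp [h1]
    have h3 : ∀ v, (χ v).2 = true := by
      by_contra! hne
      obtain ⟨v, hv⟩ := hne
      have h4 : ∑ v, phaseSign (χ v).2 < ∑ v : Fin a, 1 :=
        Finset.sum_lt_sum (fun v _ => hle _) ⟨v, Finset.mem_univ _, by
          have hv' : (χ v).2 = false := by simpa using hv
          simp [hv', phaseSign]⟩
      rw [h2] at h4
      simp at h4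
      omega
    refine ⟨h3, ?_⟩
    simp only [h3, phaseSign, if_true, Finset.sum_const, nsmul_eq_mul, mul_one] at h1
    have h5 : ∀ u, (Finset.univ.filter fun v => (χ v).1 = u).card = 1 := fun u => by
      exact_mod_cast h1 u
    constructor
    · intro v v' hvv
      exact Finset.card_le_one.1 (h5 (χ v).1).le v (by simp) v' (by simpa using hvv.symm)
    · intro u
      obtain ⟨v, hv⟩ := Finset.card_pos.1 (by rw [h5 u]; exact one_pos)
      exact ⟨v, (Finset.mem_filter.1 hv).2⟩
  · rintro ⟨h1, h2⟩ u
    obtain ⟨v, hv⟩ := h2.2 u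
    have h3 : (Finset.univ.filter fun v => (χ v).1 = u) = {v} := by
      ext v'
      simp only [Finset.mem_filter, Finset.mem_univ, true_and, Finset.mem_singleton]
      exact ⟨fun h => h2.1 (h.trans hv.symm), fun h => h ▸ hv⟩
    rw [h3, Finset.sum_singleton, h1]
    simp [phaseSign]

-- Discrete Fourier extraction: averaging against the inverse phases over `N`-th roots of unity
-- isolates the coefficient of the product of all `t u`. The conjugate monomials, needed for a real
-- potential, drop out.
open Classical in
theorem sum_phase {ζ : ℂ} {a b N : ℕ} (hζ : IsPrimitiveRoot ζ N) (hab : a ≤ b) (hN : b + 1 < N)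
    (χ : Fin a → Fin b × Bool) :
    ∑ κ ∈ Fintype.piFinset fun _ : Fin b => Finset.range N,
      (∏ u, (ζ ^ (-1 : ℤ)) ^ κ u) * ∏ v, phase (fun u => ζ ^ κ u) (χ v) =
    (N : ℂ) ^ b *
      if (∀ v, (χ v).2 = true) ∧ Function.Bijective (fun v => (χ v).1) then 1 else 0 := by
  have hN0 : N ≠ 0 := by omega
  have hne : ζ ≠ 0 := hζ.ne_zero hN0
  have hconj : ∀ k : ℕ, starRingEnd ℂ (ζ ^ k) = (ζ ^ (-1 : ℤ)) ^ k := fun k => by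
    have h1 : ‖ζ ^ k‖ = 1 := by rw [norm_pow, hζ.norm'_eq_one hN0, one_pow]
    rw [zpow_neg_one, inv_pow, Complex.inv_def, Complex.normSq_eq_norm_sq, h1]
    simp
  have h1 : ∀ κ : Fin b → ℕ, (∏ u, (ζ ^ (-1 : ℤ)) ^ κ u) * ∏ v, phase (fun u => ζ ^ κ u) (χ v) =
      ∏ u, (ζ ^ ((∑ v with (χ v).1 = u, phaseSign (χ v).2) - 1)) ^ κ u := by
    intro κ
    have h2 : ∀ v, phase (fun u => ζ ^ κ u) (χ v) = (ζ ^ phaseSign (χ v).2) ^ κ (χ v).1 := by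
      intro v
      unfold phase phaseSign
      split
      · rw [zpow_one]
      · rw [hconj]
    rw [Finset.prod_congr rfl fun v _ => h2 v,
      ← Finset.prod_fiberwise Finset.univ (fun v => (χ v).1), ← Finset.prod_mul_distrib]
    refine Finset.prod_congr rfl fun u _ => ?_
    have h3 : ∏ v with (χ v).1 = u, (ζ ^ phaseSign (χ v).2) ^ κ (χ v).1 =
        ∏ v with (χ v).1 = u, (ζ ^ phaseSign (χ v).2) ^ κ u :=
      Finset.prod_congr rfl fun v hv => by rw [(Finset.mem_filter.1 hv).2]
    have h4 : ∀ s : Finset (Fin a), ∏ v ∈ s, ζ ^ phaseSign (χ v).2 =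
        ζ ^ (∑ v ∈ s, phaseSign (χ v).2) := by
      intro s
      induction s using Finset.induction_on with
      | empty => simp
      | insert v s hv ih => rw [Finset.prod_insert hv, Finset.sum_insert hv, zpow_add₀ hne, ih]
    rw [h3, Finset.prod_pow, h4, ← mul_pow, ← zpow_add₀ hne, neg_add_eq_sub]
  rw [Finset.sum_congr rfl fun κ _ => h1 κ, ← Finset.prod_univ_sum]
  simp only [sum_range_pow hζ]
  rw [Finset.prod_ite_zero]
  simp only [Finset.mem_univ, true_imp_iff, Finset.prod_const, Finset.card_univ, Fintype.card_fin,
    exponent_dvd hab hN χ, mul_ite, mul_one, mul_zero]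

/-! ## Recovering isomorphisms -/

/-- The index multisets on the side of `G` have no repetitions, so `i` is injective on edges with a
common tail; tails are determined by their images, so it is injective throughout. It is onto because
every edge of `G` is listed at its tail. -/
theorem iso_of_idxAt {G H : PointedGraph} (p : Fin H.nV ≃ Fin G.nV) (i : Fin H.nE → Fin G.nE)
    (hs : ∀ x, idxAt H.src i x = (edgesAt G.src (x.map p)).val)
    (ht : ∀ x, idxAt H.tgt i x = (edgesAt G.tgt (x.map p)).val) : Nonempty (Iso H G) := by
  have key : ∀ {s : Fin H.nE → Option (Fin H.nV)} {s' : Fin G.nE → Option (Fin G.nV)},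
      (∀ x, idxAt s i x = (edgesAt s' (x.map p)).val) → ∀ e, s' (i e) = (s e).map p := by
    intro s s' h e
    have h1 : i e ∈ (edgesAt s' ((s e).map p)).val := by
      rw [← h]
      exact Multiset.mem_map_of_mem _ (by simp)
    simpa using h1
  have hinj : Function.Injective i := by
    intro e e' hee
    have h1 : H.src e = H.src e' := by
      apply Option.map_injective p.injective
      rw [← key hs, ← key hs, hee]
    have h2 : ((edgesAt H.src (H.src e')).val.map i).Nodup := by
      have := hs (H.src e')
      rw [idxAt] at this
      rw [this]
      exact Finset.nodup _
    exact Multiset.inj_on_of_nodup_map h2 e (by simp [h1]) e' (by simp) hee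
  have hsurj : Function.Surjective i := by
    intro e
    have h1 : e ∈ (edgesAt G.src (((G.src e).map p.symm).map p)).val := by simp
    rw [← hs] at h1
    obtain ⟨e', -, h2⟩ := Multiset.mem_map.1 h1
    exact ⟨e', h2⟩
  exact ⟨⟨(p, Equiv.ofBijective i ⟨hinj, hsurj⟩), fun e => ⟨key hs e, key ht e⟩⟩⟩

open Classical in
/-- The pairs of maps of edges and vertices that respect incidence. -/
def incidencePairs (H G : PointedGraph) :
    Finset ((Fin H.nE → Fin G.nE) × (Fin H.nV → Fin G.nV × Bool)) :=
  Finset.univ.filter fun q => ((∀ v, (q.2 v).2 = true) ∧ Function.Bijective fun v => (q.2 v).1) ∧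
    (∀ v, idxAt H.src q.1 (some v) = (edgesAt G.src (some (q.2 v).1)).val ∧
      idxAt H.tgt q.1 (some v) = (edgesAt G.tgt (some (q.2 v).1)).val) ∧
    idxAt H.src q.1 none = (edgesAt G.src none).val ∧
    idxAt H.tgt q.1 none = (edgesAt G.tgt none).val

theorem iso_of_incidencePairs {H G : PointedGraph} (h : (incidencePairs H G).Nonempty) :
    Nonempty (Iso H G) := by
  obtain ⟨⟨i, χ⟩, h⟩ := h
  simp only [incidencePairs, Finset.mem_filter, Finset.mem_univ, true_and] at h
  obtain ⟨⟨_, h2⟩, h3, h4⟩ := h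
  refine iso_of_idxAt (Equiv.ofBijective _ h2) i (fun x => ?_) fun x => ?_
  · cases x
    · exact h4.1
    · exact (h3 _).1
  · cases x
    · exact h4.2
    · exact (h3 _).2

theorem incidencePairs_self (G : PointedGraph) : (incidencePairs G G).Nonempty := by
  refine ⟨(id, fun v => (v, true)), ?_⟩
  simp only [incidencePairs, Finset.mem_filter, Finset.mem_univ, true_and]
  exact ⟨⟨fun _ => trivial, Function.bijective_id⟩, fun v => ⟨Multiset.map_id _, Multiset.map_id _⟩,
    Multiset.map_id _, Multiset.map_id _⟩

theorem sum_incidence {G H : PointedGraph} {ζ : ℂ} {N : ℕ} (hζ : IsPrimitiveRoot ζ N)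
    (hab : H.nV ≤ G.nV) (hN : G.nV + 1 < N) :
    ∑ κ ∈ Fintype.piFinset fun _ : Fin G.nV => Finset.range N, (∏ u, (ζ ^ (-1 : ℤ)) ^ κ u) *
      incidenceSum G H (fun u => ζ ^ κ u) = (N : ℂ) ^ G.nV * (incidencePairs H G).card := by
  unfold incidenceSum
  classical
  simp only [Finset.mul_sum]
  rw [Finset.sum_comm, Finset.sum_congr rfl fun i _ => Finset.sum_comm]
  simp only [← mul_assoc (∏ u, (ζ ^ (-1 : ℤ)) ^ _), ← Finset.sum_mul, sum_phase hζ hab hN]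
  rw [incidencePairs, Finset.card_filter, Nat.cast_sum, Finset.mul_sum, Fintype.sum_prod_type]
  refine Finset.sum_congr rfl fun i _ => Finset.sum_congr rfl fun χ _ => ?_
  rw [mul_assoc]
  congr 1
  by_cases h1 : (∀ v, (χ v).2 = true) ∧ Function.Bijective fun v => (χ v).1
  · simp only [h1, vertexDelta, jetDelta, if_true, Finset.prod_ite_zero]
    simp only [Finset.mem_univ, true_imp_iff, Finset.prod_const_one, one_mul, ← ite_and, ite_mul,
      zero_mul, Nat.cast_ite, Nat.cast_one, Nat.cast_zero, true_and, implies_true, and_self,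
      h1.1, h1.2]
  · rw [if_neg h1, zero_mul, if_neg fun h => h1 h.1, Nat.cast_zero]

end PointedGraph

open PointedGraph

/-- A linear relation between the values of the operators of semistable graphs is trivial. -/
theorem coeff_eq_zero_of_sum_eval (s : Finset {Z : PGraph // Z.IsSemistable})
    (g : {Z : PGraph // Z.IsSemistable} → ℂ)
    (hg : ∀ (n : ℕ) (X : KahlerChart n) (f : X.smooth), ∀ z ∈ X.U,
      ∑ Z ∈ s, g Z * Z.1.out.eval X f.1 z = 0) : ∀ Z ∈ s, g Z = 0 := by
  classical
  by_contra! hne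
  obtain ⟨Z₁, hZ₁, hgZ₁⟩ := hne
  set A := s.filter fun Z => g Z ≠ 0 with hA
  -- The test graph has the most vertices among the graphs with nonzero coefficient, as
  -- `sum_incidence` requires the tested graph to have no more vertices than the test graph.
  obtain ⟨Z₀, hZ₀, hmax⟩ := A.exists_max_image (fun Z => Z.1.out.nV)
    ⟨Z₁, Finset.mem_filter.2 ⟨hZ₁, hgZ₁⟩⟩
  obtain ⟨hs₀, hg₀⟩ := Finset.mem_filter.1 hZ₀
  set G := Z₀.1.out with hG
  have ssG : G.IsSemistable := Z₀.2
  set N := G.nV + 2 with hN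
  have hN0 : N ≠ 0 := by omega
  have hζ := Complex.isPrimitiveRoot_exp N hN0
  set ζ := Complex.exp (2 * Real.pi * Complex.I / N) with hζdef
  have hA0 : ∀ (n : ℕ) (X : KahlerChart n) (f : X.smooth), ∀ z ∈ X.U,
      ∑ Z ∈ A, g Z * Z.1.out.eval X f.1 z = 0 := by
    intro n X f z hz
    rw [← hg n X f z hz]
    refine Finset.sum_subset (Finset.filter_subset _ _) fun Z hZ hZ' => ?_
    have : g Z = 0 := by
      by_contra h
      exact hZ' (Finset.mem_filter.2 ⟨hZ, h⟩)
    rw [this, zero_mul]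
  have key : ∀ κ : Fin G.nV → ℕ,
      ∑ Z ∈ A, g Z * incidenceSum G Z.1.out (fun u => ζ ^ κ u) = 0 := by
    intro κ
    obtain ⟨X, hX, h1, h2⟩ := exists_test_chart ssG fun u => ζ ^ κ u
    set m := sqfreeMonomial (edgesAt G.src none) (edgesAt G.tgt none) with hm
    have hind : Set.EqOn (X.U.indicator m) m X.U := fun z hz => Set.indicator_of_mem hz _
    let f : X.smooth := ⟨X.U.indicator m,
      ((contDiffOn_sqfreeMonomial _ _).mono (Set.subset_univ _)).congr hind,
      fun z hz => Set.indicator_of_notMem hz _⟩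
    have h3 : ∀ I J, fJet I J f.1 0 = jetDelta (edgesAt G.src none) (edgesAt G.tgt none) I J := by
      intro I J
      rw [fJet_eqOn X.isOpen hind I J hX]
      exact fJet_sqfreeMonomial _ _ _ _
    rw [← hA0 _ X f 0 hX]
    refine Finset.sum_congr rfl fun Z _ => ?_
    rw [← eval_test Z.2 h1 h2 h3]
  have h5 : ∑ κ ∈ Fintype.piFinset fun _ : Fin G.nV => Finset.range N, (∏ u, (ζ ^ (-1 : ℤ)) ^ κ u) *
      ∑ Z ∈ A, g Z * incidenceSum G Z.1.out (fun u => ζ ^ κ u) =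
      ∑ Z ∈ A, g Z * ((N : ℂ) ^ G.nV * (incidencePairs Z.1.out G).card) := by
    simp only [Finset.mul_sum A]
    rw [Finset.sum_comm]
    refine Finset.sum_congr rfl fun Z hZ => ?_
    rw [← sum_incidence hζ (hmax Z hZ) (by omega), Finset.mul_sum]
    exact Finset.sum_congr rfl fun κ _ => mul_left_comm _ _ _
  rw [Finset.sum_congr rfl fun κ _ => by rw [key κ, mul_zero], Finset.sum_const_zero,
    Finset.sum_eq_single Z₀ (fun Z _ hZ => ?_) fun h => absurd hZ₀ h] at h5
  · have h6 : ((incidencePairs G G).card : ℂ) ≠ 0 :=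
      Nat.cast_ne_zero.2 (Finset.card_pos.2 G.incidencePairs_self).ne'
    exact mul_ne_zero hg₀ (mul_ne_zero (pow_ne_zero _ (Nat.cast_ne_zero.2 hN0)) h6) h5.symm
  · have : incidencePairs Z.1.out G = ∅ := by
      rw [← Finset.not_nonempty_iff_eq_empty]
      intro h
      refine hZ (Subtype.ext ?_)
      rw [← Quotient.out_eq Z.1, ← Quotient.out_eq Z₀.1]
      exact Quotient.sound (iso_of_incidencePairs h)
    rw [this]
    simp

/-- The operators of the semistable graphs are linearly independent. -/
theorem linearIndependent_op :
    LinearIndependent ℂ fun Z : {Z : PGraph // Z.IsSemistable} => Z.1.op := by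
  refine linearIndependent_iff'ₛ.2 fun s f g h Z hZ => ?_
  refine sub_eq_zero.1 (coeff_eq_zero_of_sum_eval s (fun Z => f Z - g Z) (fun n X q z hz => ?_) Z hZ)
  have h1 := congrArg (evalOp X q z) h
  rw [map_sum, map_sum] at h1
  simp only [sub_mul, Finset.sum_sub_distrib]
  rw [sub_eq_zero]
  have h2 : ∀ (a : ℂ) (Z : {Z : PGraph // Z.IsSemistable}),
      evalOp X q z (a • Z.1.op) = a * Z.1.out.eval X q.1 z := fun a Z => by
    rw [map_smul, smul_eq_mul]
    exact congrArg _ (op_apply _ _ q hz)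
  simpa only [h2] using h1

/-! ## Holomorphically flat functions -/

section flat

variable {n : ℕ} {U : Set (Fin n → ℂ)} {h h' : (Fin n → ℂ) → ℂ} {z₀ : Fin n → ℂ}

/-- The holomorphic derivatives of `h` of order at most `m` vanish at `z₀`. -/
def FlatAt (m : ℕ) (h : (Fin n → ℂ) → ℂ) (z₀ : Fin n → ℂ) : Prop :=
  ∀ I : Multiset (Fin n), I.card ≤ m → fJet I 0 h z₀ = 0

theorem flatAt_zero_iff : FlatAt 0 h z₀ ↔ h z₀ = 0 := by
  refine ⟨fun H => by simpa using H 0 (by simp), fun H I hI => ?_⟩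
  obtain rfl : I = 0 := Multiset.card_eq_zero.1 (by omega)
  simpa using H

theorem flatAt_succ_iff (hU : IsOpen U) (hh : ContDiffOn ℝ ∞ h U) (hz : z₀ ∈ U) {m : ℕ} :
    FlatAt (m + 1) h z₀ ↔ h z₀ = 0 ∧ ∀ k, FlatAt m (dz k h) z₀ := by
  constructor
  · intro H
    refine ⟨by simpa using H 0 (by simp), fun k I hI => ?_⟩
    rw [← fJet_cons_left' hU hh k I 0 hz]
    exact H _ (by simpa using hI)
  · rintro ⟨H0, H⟩ I hI
    induction I using Multiset.induction with
    | empty => simpa using H0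
    | cons k I _ =>
      rw [fJet_cons_left' hU hh k I 0 hz]
      exact H k I (by simpa using hI)

theorem FlatAt.mono {m m' : ℕ} (H : FlatAt m h z₀) (hm : m' ≤ m) : FlatAt m' h z₀ :=
  fun I hI => H I (hI.trans hm)

theorem FlatAt.congr (hU : IsOpen U) (e : Set.EqOn h h' U) (hz : z₀ ∈ U) {m : ℕ}
    (H : FlatAt m h z₀) : FlatAt m h' z₀ :=
  fun I hI => (fJet_eqOn hU e I 0 hz).symm.trans (H I hI)

theorem FlatAt.sum {ι : Type*} (hU : IsOpen U) (s : Finset ι) (F : ι → (Fin n → ℂ) → ℂ)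
    (hF : ∀ a ∈ s, ContDiffOn ℝ ∞ (F a) U) (hz : z₀ ∈ U) {m : ℕ}
    (H : ∀ a ∈ s, FlatAt m (F a) z₀) : FlatAt m (fun w => ∑ a ∈ s, F a w) z₀ :=
  fun I hI => (fJet_sum hU s F hF I 0 hz).trans (Finset.sum_eq_zero fun a ha => H a ha I hI)

theorem FlatAt.add (hU : IsOpen U) (hh : ContDiffOn ℝ ∞ h U) (hh' : ContDiffOn ℝ ∞ h' U)
    (hz : z₀ ∈ U) {m : ℕ} (H : FlatAt m h z₀) (H' : FlatAt m h' z₀) :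
    FlatAt m (fun w => h w + h' w) z₀ := by
  have := FlatAt.sum (z₀ := z₀) (m := m) hU Finset.univ (fun b : Bool => if b then h else h')
    (fun b _ => by cases b <;> simp [hh, hh']) hz (fun b _ => by cases b <;> simp [H, H'])
  simpa using this

theorem FlatAt.mul_left (hU : IsOpen U) {a : (Fin n → ℂ) → ℂ} (ha : Hol U a)
    (hh : ContDiffOn ℝ ∞ h U) (hz : z₀ ∈ U) {m : ℕ} (H : FlatAt m h z₀) :
    FlatAt m (fun w => a w * h w) z₀ := by
  induction m generalizing a h with
  | zero =>
    rw [flatAt_zero_iff] at H ⊢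
    rw [H, mul_zero]
  | succ m ih =>
    have H' := (flatAt_succ_iff hU hh hz).1 H
    rw [flatAt_succ_iff hU (ha.1.mul hh) hz]
    refine ⟨by rw [H'.1, mul_zero], fun k => ?_⟩
    have e : Set.EqOn (fun w => dz k a w * h w + a w * dz k h w) (dz k fun w => a w * h w) U := by
      intro w hw
      simp only [dz_eq_wirt]
      rw [wirt_mul (ha.diffAt hU hw) (diffAt_of_smooth hU hh hw)]
    exact ((ih (ha.dz hU k) hh (H.mono (Nat.le_succ m))).add hU ((ha.dz hU k).1.mul hh)
      (ha.1.mul (contDiffOn_dz hU hh k)) hz (ih ha (contDiffOn_dz hU hh k) (H'.2 k))).congr hU e hz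

/-- The conjugate of a holomorphic function is a constant for the operators `dz`. -/
theorem FlatAt.conj_mul_left (hU : IsOpen U) {a : (Fin n → ℂ) → ℂ} (ha : Hol U a)
    (hh : ContDiffOn ℝ ∞ h U) (hz : z₀ ∈ U) {m : ℕ} (H : FlatAt m h z₀) :
    FlatAt m (fun w => starRingEnd ℂ (a w) * h w) z₀ := by
  have hc := contDiffOn_conj ha.1
  induction m generalizing h with
  | zero =>
    rw [flatAt_zero_iff] at H ⊢
    rw [H, mul_zero]
  | succ m ih =>
    have H' := (flatAt_succ_iff hU hh hz).1 H
    rw [flatAt_succ_iff hU (hc.mul hh) hz]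
    refine ⟨by rw [H'.1, mul_zero], fun k => ?_⟩
    have e : Set.EqOn (fun w => starRingEnd ℂ (a w) * dz k h w)
        (dz k fun w => starRingEnd ℂ (a w) * h w) U := by
      intro w hw
      simp only [dz_eq_wirt]
      rw [wirt_mul (diffAt_of_smooth hU hc hw) (diffAt_of_smooth hU hh hw), ← dz_eq_wirt,
        dz_conj (ha.diffAt hU hw), ha.2 w hw, map_zero, zero_mul, zero_add]
    exact (ih (contDiffOn_dz hU hh k) (H'.2 k)).congr hU e hz

/-- This is the chain rule solved for the derivatives in the target coordinates by the inverse
Jacobian, whose entries are holomorphic. -/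
theorem dz_comp_inv {W : Set (Fin n → ℂ)} {φ : (Fin n → ℂ) → (Fin n → ℂ)} (hU : IsOpen U)
    (hW : IsOpen W) (hφ : ∀ p, Hol U fun z => φ z p) (hm : Set.MapsTo φ U W)
    (hdet : ∀ z ∈ U, (Matrix.of fun a p => dz a (fun z => φ z p) z).det ≠ 0)
    {F : (Fin n → ℂ) → ℂ} (hF : ContDiffOn ℝ ∞ F W) (r : Fin n) :
    Set.EqOn (fun z => ∑ a, (Matrix.of fun a p => dz a (fun z => φ z p) z)⁻¹ r a *
      dz a (fun z => F (φ z)) z) (fun z => dz r F (φ z)) U := by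
  intro z hz
  set A := Matrix.of fun a p => dz a (fun z => φ z p) z with hA
  have h1 := Matrix.nonsing_inv_mul A (hdet z hz).isUnit
  simp only [dz_comp_hol hU hW hφ hm hF hz, Finset.mul_sum]
  rw [Finset.sum_comm]
  have h2 : ∀ p, ∑ a, A⁻¹ r a * (dz p F (φ z) * dz a (fun w => φ w p) z) =
      dz p F (φ z) * (1 : Matrix (Fin n) (Fin n) ℂ) r p := fun p => by
    rw [← h1, Matrix.mul_apply, Finset.mul_sum]
    refine Finset.sum_congr rfl fun a _ => ?_
    rw [mul_left_comm]
    rfl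
  rw [Finset.sum_congr rfl fun p _ => h2 p]
  simp [Matrix.one_apply]

/-- By `dz_comp_inv` the derivatives in the target coordinates are combinations of those in the
source coordinates with holomorphic coefficients, and such combinations preserve flatness. -/
theorem FlatAt.of_comp {W : Set (Fin n → ℂ)} {φ : (Fin n → ℂ) → (Fin n → ℂ)} (hU : IsOpen U)
    (hW : IsOpen W) (hφ : ∀ p, Hol U fun z => φ z p) (hm : Set.MapsTo φ U W)
    (hdet : ∀ z ∈ U, (Matrix.of fun a p => dz a (fun z => φ z p) z).det ≠ 0) (hz : z₀ ∈ U)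
    {F : (Fin n → ℂ) → ℂ} (hF : ContDiffOn ℝ ∞ F W) {m : ℕ}
    (H : FlatAt m (fun z => F (φ z)) z₀) : FlatAt m F (φ z₀) := by
  induction m generalizing F with
  | zero => rwa [flatAt_zero_iff] at H ⊢
  | succ m ih =>
    have hc := contDiffOn_comp_hol hφ hm hF
    have H' := (flatAt_succ_iff hU hc hz).1 H
    refine (flatAt_succ_iff hW hF (hm hz)).2 ⟨H'.1, fun r => ih (contDiffOn_dz hW hF r) ?_⟩
    have hinv := fun a => Hol.matrix_inv hU _ (fun a p => (hφ p).dz hU a) hdet r a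
    exact (FlatAt.sum hU Finset.univ _ (fun a _ => (hinv a).1.mul (contDiffOn_dz hU hc a)) hz
      fun a _ => FlatAt.mul_left hU (hinv a) (contDiffOn_dz hU hc a) hz (H'.2 a)).congr hU
      (dz_comp_inv hU hW hφ hm hdet hF r) hz

end flat

/-! ## Holomorphic functions with given jets -/

section jets

variable {n : ℕ}

/-- The monomial of a multiset of indices, centred at `z₀`. -/
def centredMonomial (z₀ : Fin n → ℂ) (K : Multiset (Fin n)) (z : Fin n → ℂ) : ℂ :=
  (K.map fun k => z k - z₀ k).prod

theorem analyticOnNhd_centredMonomial (z₀ : Fin n → ℂ) (K : Multiset (Fin n)) :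
    AnalyticOnNhd ℂ (centredMonomial z₀ K) Set.univ := by
  intro z _
  induction K using Multiset.induction with
  | empty =>
    have : centredMonomial z₀ 0 = fun _ => 1 := by funext z; simp [centredMonomial]
    rw [this]
    exact analyticAt_const
  | cons k K ih =>
    have : centredMonomial z₀ (k ::ₘ K) = fun z => (z k - z₀ k) * centredMonomial z₀ K z := by
      funext z; simp [centredMonomial]
    rw [this]
    exact (((ContinuousLinearMap.proj (R := ℂ) (φ := fun _ : Fin n => ℂ) k).analyticAt z).sub
      analyticAt_const).mul ih

theorem dz_centredMonomial (z₀ : Fin n → ℂ) (K : Multiset (Fin n)) (i : Fin n) :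
    dz i (centredMonomial z₀ K) = fun z => (K.count i : ℂ) * centredMonomial z₀ (K.erase i) z := by
  funext z
  induction K using Multiset.induction with
  | empty =>
    have : centredMonomial z₀ 0 = fun _ => 1 := by funext z; simp [centredMonomial]
    rw [this, dz_eq_wirt, wirt_const]
    simp
  | cons k K ih =>
    have e : ∀ k K, centredMonomial z₀ (k ::ₘ K) =
        fun z => (-z₀ k + z k) * centredMonomial z₀ K z := by
      intro k K
      funext z
      simp [centredMonomial, sub_eq_neg_add]
    have d0 : DifferentiableAt ℝ (fun z : Fin n → ℂ => z k) z :=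
      (hol_coord k).diffAt isOpen_univ (Set.mem_univ z)
    have d1 := (hol_of_analyticOnNhd (analyticOnNhd_centredMonomial z₀ K)).diffAt isOpen_univ
      (Set.mem_univ z)
    rw [e, dz_eq_wirt, wirt_mul ((differentiableAt_const _).fun_add d0) d1, ← dz_eq_wirt, ih,
      dz_const_add _ d0, dz_coord]
    by_cases hk : k = i
    · subst hk
      rw [if_pos rfl, Multiset.erase_cons_head, Multiset.count_cons_self]
      by_cases hm : k ∈ K
      · have h1 := congrFun (e k (K.erase k)) z
        rw [Multiset.cons_erase hm] at h1
        push_cast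
        rw [h1]
        ring
      · rw [Multiset.count_eq_zero_of_notMem hm]
        simp
    · rw [if_neg hk, Multiset.erase_cons_tail _ hk, Multiset.count_cons_of_ne (Ne.symm hk), e]
      ring

theorem fJet_centredMonomial (z₀ : Fin n → ℂ) (I K : Multiset (Fin n)) :
    (I = K → fJet I 0 (centredMonomial z₀ K) z₀ ≠ 0) ∧
      (I ≠ K → fJet I 0 (centredMonomial z₀ K) z₀ = 0) := by
  have hs : ∀ K, ContDiffOn ℝ ∞ (centredMonomial z₀ K) Set.univ := fun K =>
    (hol_of_analyticOnNhd (analyticOnNhd_centredMonomial z₀ K)).1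
  induction I using Multiset.induction generalizing K with
  | empty =>
    rw [fJet_zero]
    constructor
    · rintro rfl
      simp [centredMonomial]
    · intro h
      obtain ⟨k, hk⟩ := Multiset.exists_mem_of_ne_zero h.symm
      obtain ⟨K, rfl⟩ := Multiset.exists_cons_of_mem hk
      simp [centredMonomial]
  | cons i I ih =>
    rw [fJet_cons_left' isOpen_univ (hs K) i I 0 (Set.mem_univ _), dz_centredMonomial,
      PointedGraph.fJet_const_mul isOpen_univ (hs _) _ _ _ (Set.mem_univ _)]
    constructor
    · rintro rfl
      rw [Multiset.erase_cons_head, Multiset.count_cons_self]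
      exact mul_ne_zero (Nat.cast_ne_zero.2 (Nat.succ_ne_zero _)) ((ih I).1 rfl)
    · intro h
      by_cases hi : i ∈ K
      · rw [(ih _).2 fun h' => h (by rw [h', Multiset.cons_erase hi]), mul_zero]
      · rw [Multiset.count_eq_zero_of_notMem hi, Nat.cast_zero, zero_mul]

theorem exists_analytic_jet (z₀ : Fin n → ℂ) (m : ℕ) (c : Multiset (Fin n) → ℂ) :
    ∃ h : (Fin n → ℂ) → ℂ, AnalyticOnNhd ℂ h Set.univ ∧
      ∀ I : Multiset (Fin n), I.card ≤ m → fJet I 0 h z₀ = c I := by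
  classical
  -- A finite set large enough to contain every multiset of at most `m` indices, since no
  -- multiplicity in it exceeds `m`.
  set S : Finset (Multiset (Fin n)) :=
    (Multiset.powerset (m • (Finset.univ : Finset (Fin n)).val)).toFinset with hS
  have hmem : ∀ I : Multiset (Fin n), I.card ≤ m → I ∈ S := by
    intro I hI
    rw [hS, Multiset.mem_toFinset, Multiset.mem_powerset, Multiset.le_iff_count]
    intro a
    rw [Multiset.count_nsmul, Multiset.count_univ, mul_one]
    exact (Multiset.count_le_card _ _).trans hI
  refine ⟨fun z => ∑ K ∈ S, (c K / fJet K 0 (centredMonomial z₀ K) z₀) * centredMonomial z₀ K z,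
    fun z hz => ?_, fun I hI => ?_⟩
  · exact Finset.analyticAt_fun_sum _ fun K _ =>
      analyticAt_const.mul (analyticOnNhd_centredMonomial z₀ K z hz)
  · have hs : ∀ K, ContDiffOn ℝ ∞ (centredMonomial z₀ K) Set.univ := fun K =>
      (hol_of_analyticOnNhd (analyticOnNhd_centredMonomial z₀ K)).1
    rw [fJet_sum isOpen_univ S _ (fun K _ => contDiffOn_const.mul (hs K)) I 0 (Set.mem_univ _)]
    simp only
    rw [Finset.sum_congr rfl fun K _ => PointedGraph.fJet_const_mul isOpen_univ (hs K) _ _ _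
      (Set.mem_univ _), Finset.sum_eq_single I]
    · exact div_mul_cancel₀ _ ((fJet_centredMonomial z₀ I I).1 rfl)
    · intro K _ hK
      rw [(fJet_centredMonomial z₀ I K).2 hK.symm, mul_zero]
    · intro h
      exact absurd (hmem I hI) h

end jets

/-! ## Local biholomorphisms -/

section inverse

variable {n : ℕ} {φ : (Fin n → ℂ) → (Fin n → ℂ)}

theorem exists_equiv_of_det_ne_zero (L : (Fin n → ℂ) →L[ℂ] (Fin n → ℂ))
    (h : (Matrix.of fun i p => L (Pi.single i 1) p).det ≠ 0) :
    ∃ e : (Fin n → ℂ) ≃L[ℂ] (Fin n → ℂ), (e : (Fin n → ℂ) →L[ℂ] (Fin n → ℂ)) = L := by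
  set A : Matrix (Fin n) (Fin n) ℂ := Matrix.of fun i p => L (Pi.single i 1) p with hA
  have h1 : ∀ v, L v = Matrix.vecMul v A := by
    intro v
    conv_lhs => rw [pi_eq_sum_univ' v, map_sum]
    funext p
    simp only [map_smul, Finset.sum_apply, Pi.smul_apply, smul_eq_mul, Matrix.vecMul, dotProduct]
    rfl
  have hinj : Function.Injective (L : (Fin n → ℂ) →ₗ[ℂ] (Fin n → ℂ)) := by
    intro v w hvw
    refine Matrix.vecMul_injective_of_isUnit (A := A)
      ((Matrix.isUnit_iff_isUnit_det A).2 h.isUnit) ?_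
    exact (h1 v).symm.trans (Eq.trans hvw (h1 w))
  refine ⟨(LinearEquiv.ofInjectiveEndo _ hinj).toContinuousLinearEquiv, ?_⟩
  ext v
  rfl

theorem AnalyticOnNhd.hol_apply {U : Set (Fin n → ℂ)} (hφ : AnalyticOnNhd ℂ φ U) (p : Fin n) :
    Hol U fun z => φ z p :=
  hol_of_analyticOnNhd fun z hz =>
    ((ContinuousLinearMap.proj (R := ℂ) (φ := fun _ : Fin n => ℂ) p).analyticAt _).comp (hφ z hz)

theorem AnalyticAt.dz_apply {z : Fin n → ℂ} (hφ : AnalyticAt ℂ φ z) (a p : Fin n) :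
    dz a (fun z => φ z p) z = fderiv ℂ φ z (Pi.single a 1) p := by
  have h1 := hφ.differentiableAt.hasFDerivAt
  have h2 := hasFDerivAt_pi'.1 h1 p
  rw [dz_of_differentiableAt h2.differentiableAt, h2.fderiv]
  rfl

/-- The inverse function theorem, with the neighbourhood shrunk so that it lies in `W` and the
Jacobian is invertible throughout. -/
theorem exists_local_inverse (hφ : AnalyticOnNhd ℂ φ Set.univ) {W : Set (Fin n → ℂ)}
    (hW : IsOpen W) {z₀ : Fin n → ℂ} (hz₀ : z₀ ∈ W)
    (hdet : (Matrix.of fun a p => dz a (fun z => φ z p) z₀).det ≠ 0) :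
    ∃ V ⊆ W, IsOpen V ∧ z₀ ∈ V ∧ IsOpen (φ '' V) ∧
      (∀ z ∈ V, (Matrix.of fun a p => dz a (fun z => φ z p) z).det ≠ 0) ∧
      ∃ ψ : (Fin n → ℂ) → (Fin n → ℂ), AnalyticOnNhd ℂ ψ (φ '' V) ∧ Set.LeftInvOn ψ φ V := by
  have he : ∀ z, (Matrix.of fun a p => dz a (fun z => φ z p) z).det ≠ 0 →
      ∃ e : (Fin n → ℂ) ≃L[ℂ] (Fin n → ℂ),
        (e : (Fin n → ℂ) →L[ℂ] (Fin n → ℂ)) = fderiv ℂ φ z := by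
    intro z hz
    refine exists_equiv_of_det_ne_zero _ ?_
    simpa only [(hφ z (Set.mem_univ z)).dz_apply] using hz
  obtain ⟨e, hez⟩ := he z₀ hdet
  have hstrict : HasStrictFDerivAt φ (e : (Fin n → ℂ) →L[ℂ] (Fin n → ℂ)) z₀ := by
    rw [hez]
    exact (hφ z₀ (Set.mem_univ _)).hasStrictFDerivAt
  set Φ := hstrict.toOpenPartialHomeomorph φ with hΦ
  have hcoe : (Φ : (Fin n → ℂ) → (Fin n → ℂ)) = φ := hstrict.toOpenPartialHomeomorph_coe
  have hcont : Continuous fun z => (Matrix.of fun a p => dz a (fun z => φ z p) z).det := by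
    refine Continuous.matrix_det (continuous_matrix fun a p => ?_)
    exact continuousOn_univ.1 ((hφ.hol_apply p).dz isOpen_univ a).1.continuousOn
  set V := Φ.source ∩ (W ∩ {z | (Matrix.of fun a p => dz a (fun z => φ z p) z).det ≠ 0}) with hV
  have oV : IsOpen V := Φ.open_source.inter
    (hW.inter (isOpen_compl_singleton.preimage hcont))
  refine ⟨V, fun z hz => hz.2.1, oV, ⟨hstrict.mem_toOpenPartialHomeomorph_source, hz₀, hdet⟩, ?_,
    fun z hz => hz.2.2, Φ.symm, ?_, ?_⟩
  · rw [← hcoe]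
    exact Φ.isOpen_image_of_subset_source oV Set.inter_subset_left
  · rintro _ ⟨z, hz, rfl⟩
    obtain ⟨e', he'⟩ := he z hz.2.2
    have := Φ.analyticAt_symm' (i := e') hz.1 (hφ z (Set.mem_univ z)) he'.symm
    rwa [hcoe] at this
  · intro z hz
    have := Φ.left_inv hz.1
    rwa [hcoe] at this

end inverse

/-! ## Transport of a metric to new coordinates -/

section transport

variable {n : ℕ}

theorem pullbackForm_eq_mul {m : ℕ} (φ : (Fin m → ℂ) → (Fin n → ℂ))
    (g : (Fin n → ℂ) → Matrix (Fin n) (Fin n) ℂ) (x : Fin m → ℂ) :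
    pullbackForm φ g x = (Matrix.of fun a p => dz a (fun z => φ z p) x) * g (φ x) *
      (Matrix.of fun a p => dz a (fun z => φ z p) x).conjTranspose := by
  ext a b
  simp only [pullbackForm, Matrix.of_apply, Matrix.mul_apply, Matrix.conjTranspose_apply,
    Finset.sum_mul, starRingEnd_apply]
  rw [Finset.sum_comm]
  refine Finset.sum_congr rfl fun q _ => Finset.sum_congr rfl fun p _ => ?_
  ring

theorem jacobian_mul_inverse {U W : Set (Fin n → ℂ)} (hU : IsOpen U) (hW : IsOpen W)
    {φ ψ : (Fin n → ℂ) → (Fin n → ℂ)} (hφ : ∀ p, Hol U fun z => φ z p)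
    (hψ : ∀ p, Hol W fun z => ψ z p) (hm : Set.MapsTo φ U W) (hl : Set.LeftInvOn ψ φ U)
    {z : Fin n → ℂ} (hz : z ∈ U) :
    (Matrix.of fun a p => dz a (fun z => φ z p) z) *
      (Matrix.of fun a p => dz a (fun z => ψ z p) (φ z)) = 1 := by
  ext a p
  have h1 := dz_comp_hol hU hW hφ hm (hψ p).1 hz a
  have h2 : dz a (fun w => ψ (φ w) p) z = dz a (fun w => w p) z := by
    simp only [dz_eq_wirt]
    exact wirt_eqOn hU (fun w hw => by rw [hl hw]) hz
  rw [h2, dz_coord] at h1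
  rw [Matrix.mul_apply, Matrix.one_apply]
  simp only [Matrix.of_apply]
  rw [Finset.sum_congr rfl fun q _ => mul_comm _ _, ← h1]
  simp only [eq_comm]

/-- A metric can be written in new coordinates. -/
theorem exists_transported_chart (X : KahlerChart n) {V : Set (Fin n → ℂ)} (hV : IsOpen V)
    (hVX : V ⊆ X.U) {φ ψ : (Fin n → ℂ) → (Fin n → ℂ)} (hφ : AnalyticOnNhd ℂ φ V)
    (hφV : IsOpen (φ '' V)) (hψ : AnalyticOnNhd ℂ ψ (φ '' V)) (hl : Set.LeftInvOn ψ φ V) :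
    ∃ X' Y : KahlerChart n, X'.U = V ∧ X'.g = X.g ∧ Y.U = φ '' V ∧ IsCoordChange X' Y φ ψ := by
  have mφ : Set.MapsTo φ V (φ '' V) := Set.mapsTo_image φ V
  have mψ : Set.MapsTo ψ (φ '' V) V := by
    rintro _ ⟨z, hz, rfl⟩
    rwa [hl hz]
  have hr : Set.RightInvOn ψ φ (φ '' V) := by
    rintro _ ⟨z, hz, rfl⟩
    rw [hl hz]
  have cX := X.isClosedForm.mono hVX
  have cY := isClosedForm_pullbackForm hφV hV hψ.hol_apply mψ cX
  have jinv : ∀ z ∈ V, _ := fun z hz =>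
    jacobian_mul_inverse hV hφV hφ.hol_apply hψ.hol_apply mφ hl hz
  let X' : KahlerChart n := ⟨V, hV, X.g, cX.smooth, fun z hz => X.posDef z (hVX hz), cX.closed,
    cX.closed'⟩
  let Y : KahlerChart n := ⟨φ '' V, hφV, pullbackForm ψ X.g, cY.smooth, by
    rintro _ ⟨z, hz, rfl⟩
    rw [pullbackForm_eq_mul]
    refine (X.posDef _ (hVX (mψ ⟨z, hz, rfl⟩))).mul_mul_conjTranspose_same ?_
    rw [Matrix.vecMul_injective_iff_isUnit]
    exact IsUnit.of_mul_eq_one_right _ (jinv z hz), cY.closed, cY.closed'⟩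
  refine ⟨X', Y, rfl, rfl, rfl, hφ, hψ, mφ, mψ, hl, hr, fun z hz i j => ?_⟩
  have h1 : pullbackForm φ (pullbackForm ψ X.g) z = X.g z := by
    rw [pullbackForm_eq_mul, pullbackForm_eq_mul, hl hz]
    have h2 := jinv z hz
    set A := Matrix.of fun a p => dz a (fun z => φ z p) z
    set B := Matrix.of fun a p => dz a (fun z => ψ z p) (φ z)
    calc A * (B * X.g z * B.conjTranspose) * A.conjTranspose =
        (A * B) * X.g z * (A * B).conjTranspose := by
          rw [Matrix.conjTranspose_mul]; simp only [Matrix.mul_assoc]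
      _ = _ := by rw [h2]; simp
  change X.g z i j = _
  rw [← h1]
  simp only [pullbackForm, Matrix.of_apply, (hφ z hz).dz_apply]
  rfl

end transport

/-! ## Bochner coordinates -/

section bochner

variable {n : ℕ}

/-- The coordinates are polynomials whose holomorphic jets at `z₀` are the metric jets with one
barred index. Their Jacobian `A` is then holomorphic and agrees with the metric in all pure
holomorphic derivatives of order at most `m`. In the new coordinates the metric is `A⁻¹ (g - A)
(A⁻¹)ᴴ + (A⁻¹)ᴴ`: the first term is flat and the second antiholomorphic, so no pure holomorphic
derivative of order between 1 and `m` survives. -/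
theorem exists_bochner_chart (X : KahlerChart n) {z₀ : Fin n → ℂ} (hz₀ : z₀ ∈ X.U) (m : ℕ) :
    ∃ (X' Y : KahlerChart n) (φ ψ : (Fin n → ℂ) → (Fin n → ℂ)), X'.U ⊆ X.U ∧ X'.g = X.g ∧
      z₀ ∈ X'.U ∧ IsCoordChange X' Y φ ψ ∧
      (∀ (I : Multiset (Fin n)) j, 2 ≤ I.card → I.card ≤ m + 1 → Y.gJet I {j} (φ z₀) = 0) ∧
      (∀ i (J : Multiset (Fin n)), 2 ≤ J.card → J.card ≤ m + 1 → Y.gJet {i} J (φ z₀) = 0) := by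
  choose F hF hFjet using fun q : Fin n => exists_analytic_jet z₀ (m + 1) fun I => X.gJet I {q} z₀
  set φ : (Fin n → ℂ) → (Fin n → ℂ) := fun z q => F q z with hφdef
  have hφ : AnalyticOnNhd ℂ φ Set.univ := fun z hz => analyticAt_pi_iff.2 fun q => hF q z hz
  have hJ : (Matrix.of fun a p => dz a (fun z => φ z p) z₀) = X.g z₀ := by
    ext a p
    -- The first order part of the prescribed jet is the metric itself, so the Jacobian at `z₀` is
    -- invertible.
    have h1 := hFjet p {a} (by simp)
    rw [X.gJet_eq, mJet_singleton, ← Multiset.cons_zero,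
      fJet_cons_left' isOpen_univ (hφ.hol_apply p).1 _ _ _ (Set.mem_univ _), fJet_zero] at h1
    exact h1
  obtain ⟨V, hVX, oV, hzV, oφV, hdet, ψ, hψ, hl⟩ := exists_local_inverse hφ X.isOpen hz₀
    (by rw [hJ]; exact (X.posDef z₀ hz₀).det_pos.ne')
  have hφV : AnalyticOnNhd ℂ φ V := hφ.mono (Set.subset_univ V)
  obtain ⟨X', Y, hX'U, hX'g, hYU, H⟩ := exists_transported_chart X oV hVX hφV oφV hψ hl
  have holφ : ∀ p, Hol V fun z => φ z p := hφV.hol_apply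
  have mφ : Set.MapsTo φ V Y.U := hX'U ▸ H.mapsTo
  set A : (Fin n → ℂ) → Matrix (Fin n) (Fin n) ℂ :=
    fun z => Matrix.of fun a p => dz a (fun z => φ z p) z with hA
  have holA : ∀ a p, Hol V fun z => A z a p := fun a p => (holφ p).dz oV a
  have holAi : ∀ a p, Hol V fun z => (A z)⁻¹ a p := fun a p => Hol.matrix_inv oV A holA hdet a p
  have sg : ∀ i j, ContDiffOn ℝ ∞ (fun z => X.g z i j) V := fun i j => (X.smooth_g i j).mono hVX
  -- the metric differs from a holomorphic one by a flat term
  have flat1 : ∀ i j, FlatAt m (fun z => X.g z i j + -1 * A z i j) z₀ := by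
    intro i j I hI
    have h1 := fJet_sum (U := V) oV Finset.univ
      (fun b : Bool => if b then (fun z => X.g z i j) else fun z => -1 * A z i j)
      (fun b _ => by
        cases b
        · exact contDiffOn_const.mul (holA i j).1
        · simpa using sg i j) I 0 hzV
    simp only [Fintype.sum_bool, if_true, Bool.false_eq_true, if_false] at h1
    rw [h1, PointedGraph.fJet_const_mul oV (holA i j).1 _ _ _ hzV,
      ← mJet_cons_cons X.isOpen X.isClosedForm i j I 0 hz₀]
    have h2 := hFjet j (i ::ₘ I) (by simpa using hI)
    rw [fJet_cons_left' isOpen_univ (hφ.hol_apply j).1 _ _ _ (Set.mem_univ _)] at h2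
    have h3 : fJet I 0 (fun z => A z i j) z₀ = X.gJet (i ::ₘ I) {j} z₀ := h2
    rw [h3, Multiset.cons_zero, X.gJet_eq]
    ring
  have hXY : ∀ z ∈ V, X.g z = A z * Y.g (φ z) * (A z).conjTranspose := by
    intro z hz
    rw [← hX'g, ← pullbackForm_eq_mul]
    ext i j
    exact (H.pullbackForm_eq (hX'U ▸ hz) i j).symm
  have hYX : ∀ z ∈ V, ∀ p q, ∑ j, starRingEnd ℂ ((A z)⁻¹ q j) * ∑ i, (A z)⁻¹ p i *
      (X.g z i j + -1 * A z i j) + starRingEnd ℂ ((A z)⁻¹ q p) = Y.g (φ z) p q := by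
    intro z hz p q
    have hu := (hdet z hz).isUnit
    have h1 : (A z)⁻¹ * (X.g z - A z) * ((A z)⁻¹).conjTranspose + ((A z)⁻¹).conjTranspose =
        Y.g (φ z) := by
      have h2 : (A z)⁻¹ * A z = 1 := Matrix.nonsing_inv_mul _ hu
      have h3 : (A z).conjTranspose * ((A z)⁻¹).conjTranspose = 1 := by
        rw [← Matrix.conjTranspose_mul, h2, Matrix.conjTranspose_one]
      rw [Matrix.mul_sub, Matrix.sub_mul, h2, Matrix.one_mul, sub_add_cancel, hXY z hz]
      calc (A z)⁻¹ * (A z * Y.g (φ z) * (A z).conjTranspose) * ((A z)⁻¹).conjTranspose =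
          ((A z)⁻¹ * A z) * Y.g (φ z) * ((A z).conjTranspose * ((A z)⁻¹).conjTranspose) := by
            simp only [Matrix.mul_assoc]
        _ = _ := by rw [h2, h3, Matrix.one_mul, Matrix.mul_one]
    rw [← h1, Matrix.add_apply, Matrix.mul_apply]
    congr 1
    refine Finset.sum_congr rfl fun j _ => ?_
    rw [Matrix.mul_apply, Matrix.conjTranspose_apply, mul_comm]
    simp only [Matrix.sub_apply, sub_eq_add_neg, neg_one_mul, starRingEnd_apply]
  have key : ∀ (p q r : Fin n) (I : Multiset (Fin n)), I.card + 1 ≤ m →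
      fJet (r ::ₘ I) 0 (fun z => Y.g z p q) (φ z₀) = 0 := by
    intro p q r I hI
    obtain ⟨m, rfl⟩ : ∃ k, m = k + 1 := ⟨m - 1, by omega⟩
    have s1 : ∀ i j, ContDiffOn ℝ ∞ (fun z => X.g z i j + -1 * A z i j) V := fun i j =>
      (sg i j).add (contDiffOn_const.mul (holA i j).1)
    have s2 : ∀ j, ContDiffOn ℝ ∞ (fun z => ∑ i, (A z)⁻¹ p i * (X.g z i j + -1 * A z i j)) V :=
      fun j => ContDiffOn.sum fun i _ => (holAi p i).1.mul (s1 i j)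
    have s3 : ∀ j, ContDiffOn ℝ ∞ (fun z => starRingEnd ℂ ((A z)⁻¹ q j) *
        ∑ i, (A z)⁻¹ p i * (X.g z i j + -1 * A z i j)) V :=
      fun j => (contDiffOn_conj (holAi q j).1).mul (s2 j)
    have s4 := ContDiffOn.sum (s := Finset.univ) fun j _ => s3 j
    have s5 : ContDiffOn ℝ ∞ (fun z => Y.g (φ z) p q) V :=
      contDiffOn_comp_hol holφ mφ (Y.smooth_g p q)
    have f1 : FlatAt (m + 1) (fun z => ∑ j, starRingEnd ℂ ((A z)⁻¹ q j) *
        ∑ i, (A z)⁻¹ p i * (X.g z i j + -1 * A z i j)) z₀ :=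
      FlatAt.sum oV _ _ (fun j _ => s3 j) hzV fun j _ =>
        FlatAt.conj_mul_left oV (holAi q j) (s2 j) hzV <|
          FlatAt.sum oV _ _ (fun i _ => (holAi p i).1.mul (s1 i j)) hzV fun i _ =>
            FlatAt.mul_left oV (holAi p i) (s1 i j) hzV (flat1 i j)
    -- One holomorphic derivative removes the antiholomorphic summand and costs one order of
    -- flatness.
    have f2 : ∀ a, FlatAt m (dz a fun z => Y.g (φ z) p q) z₀ := by
      intro a
      refine (((flatAt_succ_iff oV s4 hzV).1 f1).2 a).congr oV (fun z hz => ?_) hzV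
      have e : Set.EqOn (fun z => Y.g (φ z) p q) (fun z => (∑ j, starRingEnd ℂ ((A z)⁻¹ q j) *
        ∑ i, (A z)⁻¹ p i * (X.g z i j + -1 * A z i j)) + starRingEnd ℂ ((A z)⁻¹ q p)) V :=
        fun z hz => (hYX z hz p q).symm
      have d1 := diffAt_of_smooth oV s4 hz
      have d2 := (holAi q p).diffAt oV hz
      have d3 := diffAt_of_smooth oV (contDiffOn_conj (holAi q p).1) hz
      simp only [dz_eq_wirt]
      rw [wirt_eqOn oV e hz, wirt_add d1 d3, ← dz_eq_wirt, dz_conj d2, (holAi q p).2 z hz, map_zero,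
        add_zero]
    have f3 : FlatAt m (fun z => dz r (fun w => Y.g w p q) (φ z)) z₀ :=
      (FlatAt.sum oV Finset.univ _ (fun a _ => (holAi r a).1.mul (contDiffOn_dz oV s5 a)) hzV
        fun a _ => FlatAt.mul_left oV (holAi r a) (contDiffOn_dz oV s5 a) hzV (f2 a)).congr oV
        (dz_comp_inv oV Y.isOpen holφ mφ hdet (Y.smooth_g p q) r) hzV
    have f4 := FlatAt.of_comp oV Y.isOpen holφ mφ hdet hzV
      (contDiffOn_dz Y.isOpen (Y.smooth_g p q) r) f3
    rw [fJet_cons_left' Y.isOpen (Y.smooth_g p q) r I 0 (mφ hzV)]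
    exact f4 I (by omega)
  have left : ∀ (I : Multiset (Fin n)) j, 2 ≤ I.card → I.card ≤ m + 1 →
      Y.gJet I {j} (φ z₀) = 0 := by
    intro I j h2 hm
    obtain ⟨i, hi⟩ := Multiset.card_pos_iff_exists_mem.1 (show 0 < I.card by omega)
    obtain ⟨I, rfl⟩ := Multiset.exists_cons_of_mem hi
    rw [Multiset.card_cons] at h2 hm
    obtain ⟨r, hr⟩ := Multiset.card_pos_iff_exists_mem.1 (show 0 < I.card by omega)
    obtain ⟨I, rfl⟩ := Multiset.exists_cons_of_mem hr
    rw [Multiset.card_cons] at h2 hm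
    rw [Y.gJet_eq, ← Multiset.cons_zero, mJet_cons_cons Y.isOpen Y.isClosedForm _ _ _ _ (mφ hzV)]
    exact key i j r I (by omega)
  refine ⟨X', Y, φ, ψ, hX'U ▸ hVX, hX'g, hX'U ▸ hzV, H, left, fun i J h2 hm => ?_⟩
  -- The metric is Hermitian, so the jets with one unbarred index are conjugates of those with one
  -- barred index.
  rw [Y.gJet_eq, mJet_conj Y.isOpen Y.isClosedForm (fun z hz => (Y.posDef z hz).isHermitian) _ _
    (mφ hzV), ← Y.gJet_eq]
  simp only [left J i h2 hm, map_zero]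

end bochner

open PointedGraph

/-- In Bochner coordinates the semistable graphs that are not stable give zero. -/
theorem PointedGraph.eval_eq_zero_of_bochner {n : ℕ} {G : PointedGraph} (hG : G.IsSemistable)
    (hs : ¬ G.IsStable) {Y : KahlerChart n} {w : Fin n → ℂ} {m : ℕ} (hm : G.nE ≤ m + 1)
    (h1 : ∀ (I : Multiset (Fin n)) j, 2 ≤ I.card → I.card ≤ m + 1 → Y.gJet I {j} w = 0)
    (h2 : ∀ i (J : Multiset (Fin n)), 2 ≤ J.card → J.card ≤ m + 1 → Y.gJet {i} J w = 0)
    (f : (Fin n → ℂ) → ℂ) : G.eval Y f w = 0 := by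
  unfold IsStable at hs
  push Not at hs
  obtain ⟨v, hv⟩ := hs
  refine Finset.sum_eq_zero fun i _ => Finset.sum_eq_zero fun j _ => ?_
  suffices h : Y.gJet (G.outIdx i (some v)) (G.inIdx j (some v)) w = 0 by
    rw [Finset.prod_eq_zero (Finset.mem_univ v) h, mul_zero, zero_mul]
  have h3 : (G.outIdx i (some v)).card = G.outDeg (some v) := Multiset.card_map _ _
  have h4 : (G.inIdx j (some v)).card = G.inDeg (some v) := Multiset.card_map _ _
  have h5 := hG v
  have h6 : G.outDeg (some v) ≤ G.nE := (Finset.card_filter_le _ _).trans (by simp)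
  have h7 : G.inDeg (some v) ≤ G.nE := (Finset.card_filter_le _ _).trans (by simp)
  by_cases h8 : G.inDeg (some v) = 1
  · rw [h8] at h4
    obtain ⟨q, hq⟩ := Multiset.card_eq_one.1 h4
    rw [hq]
    exact h1 _ _ (by omega) (by omega)
  · have h9 : G.outDeg (some v) = 1 := by
      have := hv (by omega)
      omega
    rw [h9] at h3
    obtain ⟨q, hq⟩ := Multiset.card_eq_one.1 h3
    rw [hq]
    exact h2 _ _ (by omega) (by omega)

/-- A covariant combination of semistable graphs without stable terms vanishes. -/
theorem eval_eq_zero_of_isCovariant {P : Op} (hP : IsCovariant P)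
    (s : Finset {Z : PGraph // Z.IsSemistable}) (g : {Z : PGraph // Z.IsSemistable} → ℂ)
    (hPg : P = ∑ Z ∈ s, g Z • Z.1.op) (hg : ∀ Z ∈ s, Z.1.IsStable → g Z = 0) {n : ℕ}
    (X : KahlerChart n) (f : X.smooth) {z₀ : Fin n → ℂ} (hz₀ : z₀ ∈ X.U) :
    ∑ Z ∈ s, g Z * Z.1.out.eval X f.1 z₀ = 0 := by
  have hval : ∀ (X : KahlerChart n) (f : X.smooth) (z : Fin n → ℂ), z ∈ X.U →
      (P n X f).1 z = ∑ Z ∈ s, g Z * Z.1.out.eval X f.1 z := by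
    intro X f z hz
    have h1 := congrArg (evalOp X f z) hPg
    rw [map_sum] at h1
    refine h1.trans (Finset.sum_congr rfl fun Z _ => ?_)
    rw [map_smul, smul_eq_mul]
    exact congrArg _ (op_apply _ _ f hz)
  -- The order is the largest number of edges that occurs, which bounds the degree of every vertex.
  obtain ⟨X', Y, φ, ψ, hU, hXg, hzX', H, h1, h2⟩ :=
    exists_bochner_chart X hz₀ (s.sup fun Z => Z.1.out.nE)
  -- restrict `f` and transport it
  have hind : Set.EqOn (X'.U.indicator f.1) f.1 X'.U := fun z hz => Set.indicator_of_mem hz _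
  let f' : X'.smooth := ⟨X'.U.indicator f.1, (f.2.1.mono hU).congr hind,
    fun z hz => Set.indicator_of_notMem hz _⟩
  have holψ : ∀ p, Hol Y.U fun z => ψ z p := H.holo_inv.hol_apply
  have hindY : Set.EqOn (Y.U.indicator fun w => f.1 (ψ w)) (fun w => f.1 (ψ w)) Y.U :=
    fun z hz => Set.indicator_of_mem hz _
  let q : Y.smooth := ⟨Y.U.indicator fun w => f.1 (ψ w),
    (contDiffOn_comp_hol holψ H.mapsTo_inv (f.2.1.mono hU)).congr hindY,
    fun z hz => Set.indicator_of_notMem hz _⟩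
  have hcov := hP n X' Y φ ψ H q f' (fun z hz => by
    change X'.U.indicator f.1 z = Y.U.indicator (fun w => f.1 (ψ w)) (φ z)
    rw [hind hz, hindY (H.mapsTo hz)]
    simp only [H.left_inv hz]) z₀ hzX'
  rw [hval X' f' z₀ hzX', hval Y q _ (H.mapsTo hzX')] at hcov
  have hR : ∑ Z ∈ s, g Z * Z.1.out.eval Y q.1 (φ z₀) = 0 := by
    refine Finset.sum_eq_zero fun Z hZ => ?_
    by_cases hs : Z.1.IsStable
    · rw [hg Z hZ hs, zero_mul]
    · rw [eval_eq_zero_of_bochner Z.2 hs (m := s.sup fun Z => Z.1.out.nE)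
        ((Finset.le_sup (f := fun Z : {Z : PGraph // Z.IsSemistable} => Z.1.out.nE) hZ).trans
          (Nat.le_succ _)) h1 h2, mul_zero]
  rw [hR] at hcov
  rw [← hcov]
  refine Finset.sum_congr rfl fun Z _ => ?_
  congr 1
  simp only [PointedGraph.eval, KahlerChart.gInv, KahlerChart.gJet, hXg]
  refine Finset.sum_congr rfl fun i _ => Finset.sum_congr rfl fun j _ => ?_
  congr 1
  exact (fJet_eqOn X'.isOpen hind _ _ hzX').symm

/-! ## Indices at the vertices of compound graphs -/

section idxAt

variable {n : ℕ} {V V' E E' : Type} [Fintype V] [DecidableEq V] [Fintype V'] [DecidableEq V']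
  [Fintype E] [DecidableEq E] [Fintype E'] [DecidableEq E']

theorem idxAt_option (s : Option E → V) (i : Option E → Fin n) (x : V) :
    idxAt s i x = (if s none = x then {i none} else 0) +
      idxAt (fun e => s (some e)) (fun e => i (some e)) x := by
  have h : edgesAt s x = if s none = x then
      Finset.cons none ((edgesAt (fun e => s (some e)) x).map Function.Embedding.some) (by simp) else
      (edgesAt (fun e => s (some e)) x).map Function.Embedding.some := by
    ext o
    cases o <;> split_ifs <;> simp_all
  unfold idxAt
  rw [h]
  split_ifs
  · rw [Finset.cons_val, Multiset.map_cons, Finset.map_val, Multiset.map_map]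
    rfl
  · rw [Finset.map_val, Multiset.map_map, zero_add]
    rfl

theorem idxAt_fin_succ {p : ℕ} (s : Fin (p + 1) → V) (a : Fin (p + 1) → Fin n) (x : V) :
    idxAt s a x = (if s 0 = x then {a 0} else 0) +
      idxAt (fun e => s (Fin.succ e)) (fun e => a (Fin.succ e)) x := by
  have h1 := idxAt_option (fun o : Option (Fin p) => s ((finSuccEquiv p).symm o))
    (fun o => a ((finSuccEquiv p).symm o)) x
  have h2 := idxAt_reindex (Equiv.refl V) (finSuccEquiv p).symm
    (s := fun o => s ((finSuccEquiv p).symm o)) (s' := s) (fun _ => rfl) a x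
  rw [Equiv.refl_apply] at h2
  rw [h2, h1]
  simp

theorem idxAt_sum (s : E ⊕ E' → V) (i : E ⊕ E' → Fin n) (x : V) :
    idxAt s i x = idxAt (fun e => s (Sum.inl e)) (fun e => i (Sum.inl e)) x +
      idxAt (fun e => s (Sum.inr e)) (fun e => i (Sum.inr e)) x := by
  have h : edgesAt s x = (edgesAt (fun e => s (Sum.inl e)) x).disjSum
      (edgesAt (fun e => s (Sum.inr e)) x) := by
    ext o
    cases o <;> simp
  unfold idxAt
  rw [h, Finset.val_disjSum, Multiset.disjSum, Multiset.map_add, Multiset.map_map,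
    Multiset.map_map]
  rfl

theorem idxAt_comp {ι : V → V'} (hι : Function.Injective ι) (s : E → V) (i : E → Fin n) (x : V) :
    idxAt (fun e => ι (s e)) i (ι x) = idxAt s i x := by
  have h : edgesAt (fun e => ι (s e)) (ι x) = edgesAt s x := by
    ext e
    simp [hι.eq_iff]
  unfold idxAt
  rw [h]

theorem idxAt_eq_zero {s : E → V} {x : V} (h : ∀ e, s e ≠ x) (i : E → Fin n) :
    idxAt s i x = 0 := by
  have h : edgesAt s x = ∅ := by
    ext e
    simp [h]
  unfold idxAt
  rw [h]
  rfl

theorem card_idxAt (s : E → V) (i : E → Fin n) (x : V) :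
    (idxAt s i x).card = (edgesAt s x).card := Multiset.card_map _ _

end idxAt

/-! ## Graphs with legs -/

section legs

/-- A tensor with `p` unbarred and `q` barred indices, for every metric and every function. -/
abbrev LegTensor (p q : ℕ) : Type := ∀ n : ℕ, KahlerChart n → ((Fin n → ℂ) → ℂ) → (Fin n → ℂ) →
  (Fin p → Fin n) → (Fin q → Fin n) → ℂ

variable {n p q : ℕ} {V E : Type} [Fintype V] [DecidableEq V] [Fintype E] [DecidableEq E]

/-- The tensor `F` at the distinguished vertex and `T` at the ordinary ones. -/
def optTensor {A : Type} (T F : A) (x : Option V) : A := x.elim F fun _ => T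

/-- The number of half-edges and legs at a vertex. -/
def legDeg (s : E → Option V) (α : Fin p → Option V) (x : Option V) : ℕ :=
  (idxAt s (fun _ => (0 : Fin 1)) x + idxAt α (fun _ => (0 : Fin 1)) x).card

theorem card_idxAt_add (s : E → Option V) (α : Fin p → Option V) (i : E → Fin n)
    (a : Fin p → Fin n) (x : Option V) : (idxAt s i x + idxAt α a x).card = legDeg s α x := by
  simp only [legDeg, Multiset.card_add, card_idxAt]

/-- Semistability of a graph with legs. -/
def LegSemistable (src tgt : E → Option V) (α : Fin p → Option V) (β : Fin q → Option V) : Prop :=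
  ∀ v : V, 1 ≤ legDeg tgt β (some v) ∧ 1 ≤ legDeg src α (some v) ∧
    3 ≤ legDeg tgt β (some v) + legDeg src α (some v)

/-- The contraction along a graph with legs, whose vertices carry the tensors `T` and `F`. -/
def legGev (src tgt : E → Option V) (α : Fin p → Option V) (β : Fin q → Option V)
    (w : Fin n → Fin n → ℂ) (T F : Multiset (Fin n) → Multiset (Fin n) → ℂ)
    (a : Fin p → Fin n) (b : Fin q → Fin n) : ℂ :=
  gev src tgt w fun x I J => optTensor T F x (I + idxAt α a x) (J + idxAt β b x)

/-- The tensor of a graph with legs. -/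
def legEval (src tgt : E → Option V) (α : Fin p → Option V) (β : Fin q → Option V) :
    LegTensor p q := fun _ X f z =>
  legGev src tgt α β (fun i j => X.gInv i j z) (fun I J => X.gJet I J z) (fun I J => fJet I J f z)

/-- The linear combinations of tensors of semistable graphs with legs. -/
inductive LegSpan (p q : ℕ) : LegTensor p q → Prop
  | zero {τ : LegTensor p q} (h : ∀ (n : ℕ) (X : KahlerChart n) f, ContDiffOn ℝ ∞ f X.U →
      ∀ z ∈ X.U, ∀ a b, τ n X f z a b = 0) : LegSpan p q τ
  | cons {τ σ : LegTensor p q} (c : ℂ) (V E : Type) [Fintype V] [DecidableEq V] [Fintype E]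
      [DecidableEq E] (src tgt : E → Option V) (α : Fin p → Option V) (β : Fin q → Option V)
      (hs : LegSemistable src tgt α β) (hσ : LegSpan p q σ)
      (h : ∀ (n : ℕ) (X : KahlerChart n) f, ContDiffOn ℝ ∞ f X.U →
        ∀ z ∈ X.U, ∀ a b, τ n X f z a b = c * legEval src tgt α β n X f z a b + σ n X f z a b) :
      LegSpan p q τ

theorem LegSpan.congr {τ τ' : LegTensor p q} (hτ : LegSpan p q τ)
    (h : ∀ (n : ℕ) (X : KahlerChart n) f, ContDiffOn ℝ ∞ f X.U →
      ∀ z ∈ X.U, ∀ a b, τ' n X f z a b = τ n X f z a b) : LegSpan p q τ' := by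
  cases hτ with
  | zero h0 => exact .zero fun n X f hf z hz a b => (h n X f hf z hz a b).trans (h0 n X f hf z hz a b)
  | cons c V E src tgt α β hs hσ h0 =>
    exact .cons c V E src tgt α β hs hσ fun n X f hf z hz a b =>
      (h n X f hf z hz a b).trans (h0 n X f hf z hz a b)

theorem LegSpan.add {τ σ : LegTensor p q} (hτ : LegSpan p q τ) (hσ : LegSpan p q σ) :
    LegSpan p q fun n X f z a b => τ n X f z a b + σ n X f z a b := by
  induction hτ with
  | zero h0 => exact hσ.congr fun n X f hf z hz a b => by rw [h0 n X f hf z hz, zero_add]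
  | cons c V E src tgt α β hs _ h0 ih =>
    exact .cons c V E src tgt α β hs ih fun n X f hf z hz a b => by
      rw [h0 n X f hf z hz, add_assoc]

theorem LegSpan.smul {τ : LegTensor p q} (hτ : LegSpan p q τ) (r : ℂ) :
    LegSpan p q fun n X f z a b => r * τ n X f z a b := by
  induction hτ with
  | zero h0 => exact .zero fun n X f hf z hz a b => by rw [h0 n X f hf z hz, mul_zero]
  | cons c V E src tgt α β hs _ h0 ih =>
    exact .cons (r * c) V E src tgt α β hs ih fun n X f hf z hz a b => by
      rw [h0 n X f hf z hz, mul_add, mul_assoc]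

theorem LegSpan.sum {κ : Type} (s : Finset κ) {τ : κ → LegTensor p q}
    (hτ : ∀ k ∈ s, LegSpan p q (τ k)) :
    LegSpan p q fun n X f z a b => ∑ k ∈ s, τ k n X f z a b := by
  classical
  induction s using Finset.induction_on with
  | empty => exact .zero fun n X f hf z hz a b => by simp
  | insert k s hk ih =>
    refine ((hτ k (by simp)).add (ih fun k hk => hτ k (by simp [hk]))).congr
      fun n X f hf z hz a b => ?_
    rw [Finset.sum_insert hk]

theorem LegSpan.of_legEval {src tgt : E → Option V} {α : Fin p → Option V} {β : Fin q → Option V}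
    (hs : LegSemistable src tgt α β) : LegSpan p q (legEval src tgt α β) :=
  .cons 1 V E src tgt α β hs (.zero (τ := fun _ _ _ _ _ _ => 0) fun _ _ _ _ _ _ _ _ => rfl)
    fun n X f hf z hz a b => by rw [one_mul, add_zero]

theorem contDiffOn_optTensor (X : KahlerChart n) {f : (Fin n → ℂ) → ℂ}
    (hf : ContDiffOn ℝ ∞ f X.U) (x : Option V) (I J : Multiset (Fin n)) :
    ContDiffOn ℝ ∞ (fun z => optTensor (fun I J => X.gJet I J z) (fun I J => fJet I J f z) x I J)
      X.U := by
  cases x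
  · exact contDiffOn_fJet X.isOpen hf I J
  · exact X.contDiffOn_gJet I J

theorem contDiffOn_legEval (src tgt : E → Option V) (α : Fin p → Option V) (β : Fin q → Option V)
    (X : KahlerChart n) {f : (Fin n → ℂ) → ℂ} (hf : ContDiffOn ℝ ∞ f X.U) (a : Fin p → Fin n)
    (b : Fin q → Fin n) : ContDiffOn ℝ ∞ (fun z => legEval src tgt α β n X f z a b) X.U :=
  ContDiffOn.sum fun _ _ => ContDiffOn.sum fun _ _ =>
    (contDiffOn_prod fun _ _ => X.contDiffOn_gInv _ _).mul
      (contDiffOn_prod fun _ _ => contDiffOn_optTensor X hf _ _ _)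

theorem LegSpan.contDiffOn {τ : LegTensor p q} (hτ : LegSpan p q τ) (X : KahlerChart n)
    {f : (Fin n → ℂ) → ℂ} (hf : ContDiffOn ℝ ∞ f X.U) (a : Fin p → Fin n) (b : Fin q → Fin n) :
    ContDiffOn ℝ ∞ (fun z => τ n X f z a b) X.U := by
  induction hτ with
  | zero h0 => exact (contDiffOn_const (c := 0)).congr fun z hz => h0 n X f hf z hz a b
  | cons c V E src tgt α β hs _ h0 ih =>
    exact ((contDiffOn_const.mul (contDiffOn_legEval src tgt α β X hf a b)).add ih).congr
      fun z hz => h0 n X f hf z hz a b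

/-! ### Conjugation -/

theorem conj_gInv (X : KahlerChart n) {z : Fin n → ℂ} (hz : z ∈ X.U) (i j : Fin n) :
    starRingEnd ℂ (X.gInv i j z) = X.gInv j i z :=
  (X.posDef z hz).isHermitian.inv.apply i j

theorem conj_legEval (src tgt : E → Option V) (α : Fin p → Option V) (β : Fin q → Option V)
    (X : KahlerChart n) {f : (Fin n → ℂ) → ℂ} (hf : ContDiffOn ℝ ∞ f X.U) {z : Fin n → ℂ}
    (hz : z ∈ X.U) (a : Fin p → Fin n) (b : Fin q → Fin n) :
    starRingEnd ℂ (legEval src tgt α β n X (fun w => starRingEnd ℂ (f w)) z a b) =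
      legEval tgt src β α n X f z b a := by
  unfold legEval legGev
  refine PointedGraph.conj_gev src tgt (w := fun i j => X.gInv i j z)
    (T' := fun x I J => optTensor (fun I J => X.gJet I J z) (fun I J => fJet I J f z) x
      (I + idxAt β b x) (J + idxAt α a x)) (fun i j => conj_gInv X hz i j) fun x I J => ?_
  cases x with
  | none =>
    simp only [optTensor, Option.elim]
    rw [fJet_conj X.isOpen hf _ _ hz]
    simp only [Complex.conj_conj]
  | some v =>
    simp only [optTensor, Option.elim, X.gJet_eq]
    exact (mJet_conj X.isOpen X.isClosedForm (fun z hz => (X.posDef z hz).isHermitian) _ _ hz).symm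

/-- Conjugating both the function and the value reverses the edges and exchanges the two kinds of
legs. In this way barred derivatives reduce to unbarred ones. -/
theorem LegSpan.conj {τ : LegTensor p q} (hτ : LegSpan p q τ) :
    LegSpan q p fun n X f z b a => starRingEnd ℂ (τ n X (fun w => starRingEnd ℂ (f w)) z a b) := by
  induction hτ with
  | zero h0 =>
    exact .zero fun n X f hf z hz a b => by rw [h0 n X _ (contDiffOn_conj hf) z hz, map_zero]
  | cons c V E src tgt α β hs _ h0 ih =>
    refine .cons (starRingEnd ℂ c) V E tgt src β α (fun v => ?_) ih fun n X f hf z hz b a => ?_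
    · have := hs v
      omega
    · rw [h0 n X _ (contDiffOn_conj hf) z hz, map_add, map_mul, conj_legEval src tgt α β X hf hz]

end legs

/-! ### Derivatives of the tensors of graphs with legs -/

section subdivide

variable {n : ℕ} {V E : Type} [Fintype V] [DecidableEq V] [Fintype E] [DecidableEq E]

theorem sum_option_elim (Φ : (Option E → Fin n) → ℂ) :
    ∑ i, Φ i = ∑ i : E → Fin n, ∑ r : Fin n, Φ (fun o => o.elim r i) := by
  rw [← Fintype.sum_prod_type']
  refine Fintype.sum_equiv ((Equiv.piOptionEquivProd (β := fun _ => Fin n)).trans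
    (Equiv.prodComm _ _)) _ _ fun i => ?_
  congr 1
  funext e
  cases e <;> rfl

/-- The tails when a new vertex `none` is inserted in the middle of the edge `e`. -/
def subdivideSrc (src : E → V) (e : E) (o : Option E) : Option V :=
  (Equiv.swap none (some e) o).elim none fun e => some (src e)

/-- The heads when a new vertex `none` is inserted in the middle of an edge. -/
def subdivideTgt (tgt : E → V) (o : Option E) : Option V := o.elim none fun e => some (tgt e)

theorem idxAt_subdivideSrc (src : E → V) (e : E) (i : E → Fin n) (r : Fin n) (v : Option V) :
    idxAt (subdivideSrc src e) (fun o => (Equiv.swap none (some e) o).elim r i) v =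
      v.elim {r} fun v => idxAt src i v := by
  have h := idxAt_reindex (Equiv.refl (Option V)) (Equiv.swap none (some e))
    (s := subdivideSrc src e) (s' := fun o => o.elim none fun e => some (src e)) (fun _ => rfl)
    (fun o => o.elim r i) v
  rw [← h, Equiv.refl_apply, idxAt_option]
  cases v with
  | none =>
    simp only [Option.elim, if_true]
    rw [idxAt_eq_zero (fun e => by simp), add_zero]
  | some v =>
    simp only [Option.elim, reduceCtorEq, if_false, zero_add]
    exact idxAt_comp (Option.some_injective V) src i v

theorem idxAt_subdivideTgt (tgt : E → V) (j : E → Fin n) (m : Fin n) (v : Option V) :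
    idxAt (subdivideTgt tgt) (fun o => o.elim m j) v = v.elim {m} fun v => idxAt tgt j v := by
  rw [idxAt_option]
  cases v with
  | none =>
    simp only [subdivideTgt, Option.elim, if_true]
    rw [idxAt_eq_zero (fun e => by simp), add_zero]
  | some v =>
    simp only [subdivideTgt, Option.elim, reduceCtorEq, if_false, zero_add]
    exact idxAt_comp (Option.some_injective V) tgt j v

/-- Inserting a vertex with the tensor `A` in the middle of an edge. -/
theorem gev_subdivide (src tgt : E → V) (w : Fin n → Fin n → ℂ)
    (T : V → Multiset (Fin n) → Multiset (Fin n) → ℂ)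
    (A : Multiset (Fin n) → Multiset (Fin n) → ℂ) (e : E) :
    gev (subdivideSrc src e) (subdivideTgt tgt) w (fun v => v.elim A T) =
      ∑ i : E → Fin n, ∑ j : E → Fin n,
        ((∑ r, ∑ m, w (i e) m * A {r} {m} * w r (j e)) *
          ∏ e' ∈ Finset.univ.erase e, w (i e') (j e')) *
        ∏ v, T v (idxAt src i v) (idxAt tgt j v) := by
  -- The new edge `none` runs from the old tail of `e` to the inserted vertex, and `some e` from
  -- there to the old head. The tail indices are therefore read through this swap.
  set σ : Equiv.Perm (Option E) := Equiv.swap none (some e) with hσ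
  have hterm : ∀ (i j : E → Fin n) (r m : Fin n),
      (∏ o : Option E, w ((σ o).elim r i) (o.elim m j)) *
        ∏ v : Option V, (v.elim A T : Multiset (Fin n) → Multiset (Fin n) → ℂ)
          (idxAt (subdivideSrc src e) (fun o => (σ o).elim r i) v)
          (idxAt (subdivideTgt tgt) (fun o => o.elim m j) v) =
      w (i e) m * A {r} {m} * w r (j e) * (∏ e' ∈ Finset.univ.erase e, w (i e') (j e')) *
        ∏ v, T v (idxAt src i v) (idxAt tgt j v) := by
    intro i j r m
    have h1 : ∏ e' ∈ Finset.univ.erase e, w ((σ (some e')).elim r i) (j e') =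
        ∏ e' ∈ Finset.univ.erase e, w (i e') (j e') :=
      Finset.prod_congr rfl fun e' he' => by
        rw [hσ, Equiv.swap_apply_of_ne_of_ne (by simp) (by simpa using he')]
        rfl
    have h2 : σ none = some e := Equiv.swap_apply_left _ _
    have h3 : σ (some e) = none := Equiv.swap_apply_right _ _
    rw [Fintype.prod_option, Fintype.prod_option]
    simp only [hσ, idxAt_subdivideSrc, idxAt_subdivideTgt]
    rw [← hσ]
    simp only [Option.elim]
    rw [← Finset.mul_prod_erase Finset.univ _ (Finset.mem_univ e)]
    simp only [Option.elim] at h1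
    rw [h1, h2, h3]
    ring
  unfold gev
  rw [← Equiv.sum_comp (Equiv.arrowCongr σ.symm (Equiv.refl (Fin n)))]
  rw [sum_option_elim]
  refine Finset.sum_congr rfl fun i _ => ?_
  simp only [sum_option_elim (fun j => _ * _)]
  rw [Finset.sum_comm]
  refine Finset.sum_congr rfl fun j _ => ?_
  simp only [Finset.sum_mul]
  refine Finset.sum_congr rfl fun r _ => Finset.sum_congr rfl fun m _ => ?_
  exact hterm i j r m

end subdivide

section legDerivative

variable {n p q : ℕ} {V E : Type} [Fintype V] [DecidableEq V] [Fintype E] [DecidableEq E]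

theorem sum_rotate {κ ι ι' : Type} [Fintype κ] [Fintype ι] [Fintype ι'] (F : κ → ι → ι' → ℂ) :
    ∑ x, ∑ i, ∑ j, F x i j = ∑ i, ∑ j, ∑ x, F x i j := by
  rw [Finset.sum_comm]
  exact Finset.sum_congr rfl fun i _ => Finset.sum_comm

/-- The derivative of the inverse metric on an edge is minus the insertion of a vertex with two
unbarred indices and one barred index in that edge. -/
theorem dz_gInv (X : KahlerChart n) {z : Fin n → ℂ} (hz : z ∈ X.U) (k i j : Fin n) :
    dz k (X.gInv i j) z =
      -∑ r, ∑ m, X.gInv i m z * X.gJet (k ::ₘ {r}) {m} z * X.gInv r j z := by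
  have h1 : ∀ r m, X.gJet (k ::ₘ {r}) {m} z = dz k (fun w => X.g w r m) z := fun r m => by
    rw [X.gJet_eq, mJet_cons_left X.isOpen X.isClosedForm k (by simp) (by simp) hz]
    congr 1
    funext w
    exact mJet_singleton r m w
  simp only [h1]
  rw [dz_eq_wirt]
  refine (wirt_matrix_inv X.isOpen X.smooth_g (fun z hz => (X.posDef z hz).det_pos.ne')
    (-Complex.I) k j i hz).trans ?_
  congr 1
  refine Finset.sum_congr rfl fun r _ => Finset.sum_congr rfl fun m _ => ?_
  simp only [KahlerChart.gInv]
  ring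

/-- The vertex map after the insertion of a new ordinary vertex. -/
def newVertex : Equiv.Perm (Option (Option V)) := Equiv.swap none (some none)

theorem newVertex_none : newVertex (V := V) none = some none := Equiv.swap_apply_left _ _

theorem newVertex_some_none : newVertex (V := V) (some none) = none := Equiv.swap_apply_right _ _

theorem newVertex_some_some (v : V) : newVertex (some (some v)) = some (some v) :=
  Equiv.swap_apply_of_ne_of_ne (by simp) (by simp)

theorem idxAt_cons (x : V) (α : Fin p → V) (k : Fin n) (a : Fin p → Fin n) (y : V) :
    idxAt (Fin.cons x α : Fin (p + 1) → V) (Fin.cons k a) y =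
      (if x = y then {k} else 0) + idxAt α a y := by
  rw [idxAt_fin_succ]
  simp

/-- Tails, heads and legs after the insertion of a vertex in the edge `e`. -/
def insSrc (src : E → Option V) (e : E) (o : Option E) : Option (Option V) :=
  newVertex (subdivideSrc src e o)

def insTgt (tgt : E → Option V) (o : Option E) : Option (Option V) :=
  newVertex (subdivideTgt tgt o)

def insLeg (α : Fin p → Option V) (e : Fin p) : Option (Option V) := newVertex (some (α e))

/-- The differentiation index becomes a new leg at the inserted vertex. The value `newVertex none`
is ordinary because the swap returns the label `none` to the distinguished vertex. -/
def insLegs (α : Fin p → Option V) : Fin (p + 1) → Option (Option V) :=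
  Fin.cons (newVertex none) (insLeg α)

theorem idxAt_insLeg (α : Fin p → Option V) (a : Fin p → Fin n) (y : Option (Option V)) :
    idxAt (insLeg α) a (newVertex y) = y.elim 0 fun y => idxAt α a y := by
  have h := idxAt_reindex newVertex (Equiv.refl (Fin p)) (s := fun e => some (α e))
    (s' := insLeg α) (fun _ => rfl) a y
  rw [h]
  cases y with
  | none => exact idxAt_eq_zero (fun e => by simp) _
  | some y => exact idxAt_comp (Option.some_injective _) α a y

theorem idxAt_insLegs (α : Fin p → Option V) (k : Fin n) (a : Fin p → Fin n)
    (y : Option (Option V)) :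
    idxAt (insLegs α) (Fin.cons k a) (newVertex y) = y.elim {k} fun y => idxAt α a y := by
  unfold insLegs
  rw [idxAt_cons, idxAt_insLeg]
  cases y <;> simp

theorem idxAt_insSrc (src : E → Option V) (e : E) (i : E → Fin n) (r : Fin n)
    (y : Option (Option V)) :
    idxAt (insSrc src e) (fun o => (Equiv.swap none (some e) o).elim r i) (newVertex y) =
      y.elim {r} fun y => idxAt src i y := by
  rw [← idxAt_subdivideSrc src e i r y]
  exact idxAt_reindex newVertex (Equiv.refl _) (s := subdivideSrc src e) (s' := insSrc src e)
    (fun _ => rfl) _ y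

theorem idxAt_insTgt (tgt : E → Option V) (j : E → Fin n) (m : Fin n) (y : Option (Option V)) :
    idxAt (insTgt tgt) (fun o => o.elim m j) (newVertex y) =
      y.elim {m} fun y => idxAt tgt j y := by
  rw [← idxAt_subdivideTgt tgt j m y]
  exact idxAt_reindex newVertex (Equiv.refl _) (s := subdivideTgt tgt) (s' := insTgt tgt)
    (fun _ => rfl) _ y

/-- The inserted vertex has one inward edge, one outward edge and the new outward leg, which is just
enough; all other vertices keep their degrees. -/
theorem legSemistable_ins {src tgt : E → Option V} {α : Fin p → Option V} {β : Fin q → Option V}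
    (hs : LegSemistable src tgt α β) (e : E) :
    LegSemistable (insSrc src e) (insTgt tgt) (insLegs α) (insLeg β) := by
  have h1 : ∀ y, legDeg (insSrc src e) (insLegs α) (newVertex y) =
      y.elim 2 fun y => legDeg src α y := fun y => by
    rw [← card_idxAt_add (insSrc src e) (insLegs α)
      (fun o => (Equiv.swap none (some e) o).elim (0 : Fin 1) fun _ => 0)
      (Fin.cons 0 fun _ => 0), idxAt_insSrc, idxAt_insLegs]
    cases y <;> rfl
  have h2 : ∀ y, legDeg (insTgt tgt) (insLeg β) (newVertex y) =
      y.elim 1 fun y => legDeg tgt β y := fun y => by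
    rw [← card_idxAt_add (insTgt tgt) (insLeg β) (fun o => o.elim (0 : Fin 1) fun _ => 0)
      (fun _ => 0), idxAt_insTgt, idxAt_insLeg]
    cases y <;> rfl
  intro v
  cases v with
  | none =>
    have h1 := h1 none
    have h2 := h2 none
    rw [newVertex_none] at h1 h2
    simp only [Option.elim] at h1 h2
    omega
  | some v =>
    have h1 := h1 (some (some v))
    have h2 := h2 (some (some v))
    rw [newVertex_some_some] at h1 h2
    simp only [Option.elim] at h1 h2
    have := hs v
    omega

theorem legSemistable_cons {src tgt : E → Option V} {α : Fin p → Option V} {β : Fin q → Option V}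
    (hs : LegSemistable src tgt α β) (x : Option V) :
    LegSemistable src tgt (Fin.cons x α : Fin (p + 1) → Option V) β := by
  have h1 : ∀ y, legDeg src α y ≤ legDeg src (Fin.cons x α : Fin (p + 1) → Option V) y := fun y => by
    rw [← card_idxAt_add src (Fin.cons x α : Fin (p + 1) → Option V) (fun _ => (0 : Fin 1))
      (Fin.cons 0 fun _ => 0), idxAt_cons, legDeg]
    simp only [Multiset.card_add]
    omega
  intro v
  have := hs v
  have := h1 (some v)
  omega

theorem legEval_ins (src tgt : E → Option V) (α : Fin p → Option V) (β : Fin q → Option V) (e : E)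
    (X : KahlerChart n) (f : (Fin n → ℂ) → ℂ) (z : Fin n → ℂ) (k : Fin n) (a : Fin p → Fin n)
    (b : Fin q → Fin n) :
    legEval (insSrc src e) (insTgt tgt) (insLegs α) (insLeg β) n X f z (Fin.cons k a) b =
      ∑ i : E → Fin n, ∑ j : E → Fin n,
        ((∑ r, ∑ m, X.gInv (i e) m z * X.gJet (k ::ₘ {r}) {m} z * X.gInv r (j e) z) *
          ∏ e' ∈ Finset.univ.erase e, X.gInv (i e') (j e') z) *
        ∏ x, optTensor (fun I J => X.gJet I J z) (fun I J => fJet I J f z) x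
          (idxAt src i x + idxAt α a x) (idxAt tgt j x + idxAt β b x) := by
  have h := gev_subdivide src tgt (fun i j => X.gInv i j z)
    (fun x I J => optTensor (fun I J => X.gJet I J z) (fun I J => fJet I J f z) x
      (I + idxAt α a x) (J + idxAt β b x)) (fun I J => X.gJet (k ::ₘ I) J z) e
  rw [← h]
  unfold legEval legGev
  refine gev_reindex newVertex (Equiv.refl _) (src := subdivideSrc src e)
    (src' := insSrc src e) (tgt := subdivideTgt tgt) (tgt' := insTgt tgt) (fun _ => rfl)
    (fun _ => rfl) _ fun y => ?_
  funext I J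
  rw [idxAt_insLegs, idxAt_insLeg]
  cases y with
  | none =>
    rw [newVertex_none]
    simp only [Option.elim, optTensor, add_zero]
    rw [Multiset.add_comm, Multiset.singleton_add]
  | some y =>
    cases y with
    | none =>
      rw [newVertex_some_none]
      rfl
    | some v =>
      rw [newVertex_some_some]
      rfl

theorem legEval_cons (src tgt : E → Option V) (α : Fin p → Option V) (β : Fin q → Option V)
    (x : Option V) (X : KahlerChart n) (f : (Fin n → ℂ) → ℂ) (z : Fin n → ℂ) (k : Fin n)
    (a : Fin p → Fin n) (b : Fin q → Fin n) :
    legEval src tgt (Fin.cons x α : Fin (p + 1) → Option V) β n X f z (Fin.cons k a) b =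
      ∑ i : E → Fin n, ∑ j : E → Fin n, (∏ e, X.gInv (i e) (j e) z) *
        (optTensor (fun I J => X.gJet I J z) (fun I J => fJet I J f z) x
          (k ::ₘ (idxAt src i x + idxAt α a x)) (idxAt tgt j x + idxAt β b x) *
        ∏ y ∈ Finset.univ.erase x,
          optTensor (fun I J => X.gJet I J z) (fun I J => fJet I J f z) y
            (idxAt src i y + idxAt α a y) (idxAt tgt j y + idxAt β b y)) := by
  unfold legEval legGev gev
  refine Finset.sum_congr rfl fun i _ => Finset.sum_congr rfl fun j _ => ?_
  congr 1
  rw [← Finset.mul_prod_erase Finset.univ _ (Finset.mem_univ x)]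
  congr 1
  · beta_reduce
    rw [idxAt_cons, if_pos rfl, Multiset.singleton_add, Multiset.add_cons]
  · refine Finset.prod_congr rfl fun y hy => ?_
    beta_reduce
    rw [idxAt_cons, if_neg (Finset.ne_of_mem_erase hy).symm, zero_add]

/-- The product rule: a derivative of a vertex attaches a leg to it, and a derivative of an inverse
metric inserts a vertex with a minus sign. Semistability ensures that no ordinary vertex has an
empty multiset of indices, for which the default value of the jet would break the rule. -/
theorem dz_legEval {src tgt : E → Option V} {α : Fin p → Option V} {β : Fin q → Option V}
    (hs : LegSemistable src tgt α β) (X : KahlerChart n) {f : (Fin n → ℂ) → ℂ}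
    (hf : ContDiffOn ℝ ∞ f X.U) {z : Fin n → ℂ} (hz : z ∈ X.U) (k : Fin n) (a : Fin p → Fin n)
    (b : Fin q → Fin n) :
    dz k (fun w => legEval src tgt α β n X f w a b) z =
      ∑ x, legEval src tgt (Fin.cons x α : Fin (p + 1) → Option V) β n X f z (Fin.cons k a) b +
      ∑ e, -legEval (insSrc src e) (insTgt tgt) (insLegs α) (insLeg β) n X f z (Fin.cons k a) b := by
  have h1 : dz k (fun w => legEval src tgt α β n X f w a b) z = dgev src tgt
      (fun i j => X.gInv i j z) (fun i j => dz k (X.gInv i j) z)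
      (fun x I J => optTensor (fun I J => X.gJet I J z) (fun I J => fJet I J f z) x
        (I + idxAt α a x) (J + idxAt β b x))
      (fun x I J => dz k (fun z => optTensor (fun I J => X.gJet I J z) (fun I J => fJet I J f z) x
        (I + idxAt α a x) (J + idxAt β b x)) z) := by
    rw [dz_eq_wirt]
    exact PointedGraph.wirt_gev (-Complex.I) k src tgt (w := fun z i j => X.gInv i j z)
      (T := fun z x I J => optTensor (fun I J => X.gJet I J z) (fun I J => fJet I J f z) x
        (I + idxAt α a x) (J + idxAt β b x))
      (fun i j => diffAt_of_smooth X.isOpen (X.contDiffOn_gInv i j) hz)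
      (fun x I J => diffAt_of_smooth X.isOpen (contDiffOn_optTensor X hf x _ _) hz)
  have h2 : ∀ (i j : E → Fin n) (x : Option V),
      dz k (fun z => optTensor (fun I J => X.gJet I J z) (fun I J => fJet I J f z) x
        (idxAt src i x + idxAt α a x) (idxAt tgt j x + idxAt β b x)) z =
      optTensor (fun I J => X.gJet I J z) (fun I J => fJet I J f z) x
        (k ::ₘ (idxAt src i x + idxAt α a x)) (idxAt tgt j x + idxAt β b x) := by
    intro i j x
    cases x with
    | none => exact (fJet_cons_left X.isOpen hf k _ _ hz).symm
    | some v =>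
      have hv := hs v
      refine (mJet_cons_left X.isOpen X.isClosedForm k ?_ ?_ hz).symm
      · rw [← Multiset.card_pos, card_idxAt_add]
        omega
      · rw [← Multiset.card_pos, card_idxAt_add]
        omega
  rw [h1]
  unfold dgev
  simp only [h2, legEval_cons, legEval_ins, dz_gInv X hz, Finset.sum_add_distrib]
  rw [add_comm]
  congr 1
  · rw [sum_rotate]
    simp only [Finset.mul_sum]
  · simp only [← Finset.sum_neg_distrib]
    rw [sum_rotate]
    refine Finset.sum_congr rfl fun i _ => Finset.sum_congr rfl fun j _ => ?_
    rw [Finset.sum_mul]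
    refine Finset.sum_congr rfl fun e _ => ?_
    simp only [Finset.sum_neg_distrib, neg_mul]

theorem LegSpan.dz {τ : LegTensor p q} (hτ : LegSpan p q τ) :
    LegSpan (p + 1) q fun n X f z a b => dz (a 0) (fun w => τ n X f w (fun e => a e.succ) b) z := by
  induction hτ with
  | zero h0 =>
    refine .zero fun n X f hf z hz a b => ?_
    rw [dz_eq_wirt, wirt_eqOn X.isOpen (h' := fun _ => 0) (fun w hw => h0 n X f hf w hw _ b) hz,
      wirt_const]
  | cons c V E src tgt α β hs hσ h0 ih =>
    refine (((LegSpan.sum Finset.univ fun x _ => LegSpan.of_legEval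
      (legSemistable_cons hs x)).add (LegSpan.sum Finset.univ fun e _ =>
        (LegSpan.of_legEval (legSemistable_ins hs e)).smul (-1))).smul c |>.add ih).congr
      fun n X f hf z hz a b => ?_
    have ha : (Fin.cons (a 0) (fun e => a e.succ) : Fin (_ + 1) → Fin n) = a := Fin.cons_self_tail a
    have h1 := dz_legEval hs X hf hz (a 0) (fun e => a e.succ) b
    rw [ha] at h1
    simp only [neg_one_mul]
    rw [← h1, dz_eq_wirt, wirt_eqOn X.isOpen (fun w hw => h0 n X f hf w hw _ b) hz,
      wirt_add (diffAt_of_smooth X.isOpen (contDiffOn_const.mul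
        (contDiffOn_legEval src tgt α β X hf _ b)) hz)
        (diffAt_of_smooth X.isOpen (hσ.contDiffOn X hf _ b) hz),
      wirt_const_mul _ (diffAt_of_smooth X.isOpen (contDiffOn_legEval src tgt α β X hf _ b) hz)]

theorem LegSpan.dzbar {τ : LegTensor p q} (hτ : LegSpan p q τ) :
    LegSpan p (q + 1) fun n X f z a b =>
      dzbar (b 0) (fun w => τ n X f w a (fun e => b e.succ)) z := by
  refine hτ.conj.dz.conj.congr fun n X f hf z hz a b => ?_
  simp only [Complex.conj_conj]
  rw [dz_conj (diffAt_of_smooth X.isOpen (hτ.contDiffOn X hf _ _) hz), Complex.conj_conj]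

theorem univ_val_map_succ {A : Type} (a : Fin (p + 1) → A) :
    (Finset.univ : Finset (Fin (p + 1))).val.map a =
      a 0 ::ₘ (Finset.univ : Finset (Fin p)).val.map fun e => a e.succ := by
  rw [Fin.univ_val_map, Fin.univ_val_map, List.ofFn_succ, ← Multiset.cons_coe]

/-- The derivatives of the expression encoded by a semistable graph are linear combinations of
tensors of semistable graphs with legs. -/
theorem legSpan_fJet_eval {G : PointedGraph} (hG : G.IsSemistable) (p q : ℕ) :
    LegSpan p q fun _ X f z a b =>
      fJet (Finset.univ.val.map a) (Finset.univ.val.map b) (G.eval X f) z := by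
  induction p with
  | zero =>
    induction q with
    | zero =>
      have hs : LegSemistable G.src G.tgt (Fin.elim0 : Fin 0 → Option (Fin G.nV))
          (Fin.elim0 : Fin 0 → Option (Fin G.nV)) := fun v => by
        have h : ∀ (s : Fin G.nE → Option (Fin G.nV)) x,
            legDeg s (Fin.elim0 : Fin 0 → Option (Fin G.nV)) x = (edgesAt s x).card := fun s x => by
          rw [legDeg, Multiset.card_add, card_idxAt, card_idxAt]
          rfl
        rw [h, h]
        exact hG v
      refine (LegSpan.of_legEval hs).congr fun n X f hf z hz a b => ?_
      have h0 : ∀ (a : Fin 0 → Fin n), (Finset.univ : Finset (Fin 0)).val.map a = 0 := fun a => rfl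
      have h1 : ∀ (a : Fin 0 → Fin n) x,
        idxAt (Fin.elim0 : Fin 0 → Option (Fin G.nV)) a x = 0 := fun a x => rfl
      rw [h0, h0, fJet_zero, PointedGraph.eval_eq_gev]
      unfold legEval legGev
      simp only [h1, add_zero]
      rfl
    | succ q ih =>
      refine ih.dzbar.congr fun n X f hf z hz a b => ?_
      rw [univ_val_map_succ b, fJet_cons_right X.isOpen (G.contDiffOn_eval X hf) _ _ _ hz]
  | succ p ih =>
    refine ih.dz.congr fun n X f hf z hz a b => ?_
    rw [univ_val_map_succ a, fJet_cons_left X.isOpen (G.contDiffOn_eval X hf) _ _ _ hz]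

end legDerivative

/-! ## Composition of the operators of pointed graphs -/

section glue

variable {n p q : ℕ} {V₁ E₁ V E : Type} [Fintype V₁] [DecidableEq V₁] [Fintype E₁]
  [DecidableEq E₁] [Fintype V] [DecidableEq V] [Fintype E] [DecidableEq E]

/-- The end points of the edges after the insertion of a graph with legs at the distinguished
vertex of another graph. -/
def glueEnd (s₁ : E₁ → Option V₁) (ε : Fin p ↪ E₁) (s : E → Option V) (α : Fin p → Option V) :
    E₁ ⊕ E → Option (V₁ ⊕ V) :=
  Sum.elim (Function.extend ε (fun k => (α k).map Sum.inr) fun e => (s₁ e).map Sum.inl)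
    fun e => (s e).map Sum.inr

variable {s₁ t₁ : E₁ → Option V₁} {ε : Fin p ↪ E₁} {δ : Fin q ↪ E₁}

theorem idxAt_glueEnd_inl (hε : ∀ e, s₁ e = none ↔ e ∈ Set.range ε) (s : E → Option V)
    (α : Fin p → Option V) (i : E₁ ⊕ E → Fin n) (v : V₁) :
    idxAt (glueEnd s₁ ε s α) i (some (Sum.inl v)) = idxAt s₁ (fun e => i (Sum.inl e)) (some v) := by
  have h : edgesAt (fun e => glueEnd s₁ ε s α (Sum.inl e)) (some (Sum.inl v)) =
      edgesAt s₁ (some v) := by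
    ext e
    simp only [mem_edgesAt, glueEnd, Sum.elim_inl]
    by_cases he : e ∈ Set.range ε
    · have h1 := (hε e).2 he
      obtain ⟨k, rfl⟩ := he
      rw [ε.injective.extend_apply, h1]
      cases α k <;> simp
    · rw [Function.extend_apply' _ _ _ he]
      cases s₁ e <;> simp
  have h' : idxAt (fun e => glueEnd s₁ ε s α (Sum.inr e)) (fun e => i (Sum.inr e))
      (some (Sum.inl v)) = 0 := idxAt_eq_zero (fun e => by
    simp only [glueEnd, Sum.elim_inr]
    cases s e <;> simp) _
  rw [idxAt_sum, h', add_zero]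
  unfold idxAt
  rw [h]

theorem idxAt_glueEnd_inr (hε : ∀ e, s₁ e = none ↔ e ∈ Set.range ε) (s : E → Option V)
    (α : Fin p → Option V) (i : E₁ ⊕ E → Fin n) (x : Option V) :
    idxAt (glueEnd s₁ ε s α) i (x.map Sum.inr) =
      idxAt s (fun e => i (Sum.inr e)) x + idxAt α (fun k => i (Sum.inl (ε k))) x := by
  have hinj : Function.Injective (Option.map (Sum.inr : V → V₁ ⊕ V)) :=
    Option.map_injective Sum.inr_injective
  have h : edgesAt (fun e => glueEnd s₁ ε s α (Sum.inl e)) (x.map Sum.inr) =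
      (edgesAt α x).map ε := by
    ext e
    simp only [mem_edgesAt, glueEnd, Sum.elim_inl, Finset.mem_map]
    by_cases he : e ∈ Set.range ε
    · obtain ⟨k, rfl⟩ := he
      rw [ε.injective.extend_apply, hinj.eq_iff]
      simp
    · rw [Function.extend_apply' _ _ _ he]
      have h1 : s₁ e ≠ none := fun h => he ((hε e).1 h)
      constructor
      · intro h2
        cases h3 : s₁ e with
        | none => exact absurd h3 h1
        | some v =>
          rw [h3] at h2
          cases x <;> simp at h2
      · rintro ⟨k, -, rfl⟩
        exact absurd ⟨k, rfl⟩ he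
  have h' : idxAt (fun e => glueEnd s₁ ε s α (Sum.inr e)) (fun e => i (Sum.inr e))
      (x.map Sum.inr) = idxAt s (fun e => i (Sum.inr e)) x := idxAt_comp hinj s _ x
  rw [idxAt_sum, h', add_comm]
  congr 1
  unfold idxAt
  rw [h, Finset.map_val, Multiset.map_map]
  rfl

/-- The half-edges of the outer graph at its distinguished vertex are reattached to the leg
positions of the inner graph. Summing over the indices of the inner edges first gives the inner
tensor, evaluated at the indices of those half-edges. -/
theorem gev_glueEnd (hε : ∀ e, s₁ e = none ↔ e ∈ Set.range ε)
    (hδ : ∀ e, t₁ e = none ↔ e ∈ Set.range δ) (src tgt : E → Option V) (α : Fin p → Option V)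
    (β : Fin q → Option V) (w : Fin n → Fin n → ℂ)
    (T F : Multiset (Fin n) → Multiset (Fin n) → ℂ) :
    gev (glueEnd s₁ ε src α) (glueEnd t₁ δ tgt β) w (optTensor T F) =
      ∑ i : E₁ → Fin n, ∑ j : E₁ → Fin n, (∏ e, w (i e) (j e)) *
        (∏ v : V₁, T (idxAt s₁ i (some v)) (idxAt t₁ j (some v))) *
        legGev src tgt α β w T F (fun k => i (ε k)) (fun k => j (δ k)) := by
  have hsum : ∀ Φ : (E₁ ⊕ E → Fin n) → ℂ, ∑ i, Φ i =
      ∑ i : E₁ → Fin n, ∑ i' : E → Fin n, Φ (Sum.elim i i') := fun Φ => by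
    rw [← Fintype.sum_prod_type']
    refine Fintype.sum_equiv (Equiv.sumArrowEquivProdArrow E₁ E (Fin n)) _ _ fun i => ?_
    congr 1
    exact (Sum.elim_comp_inl_inr i).symm
  have hterm : ∀ (i j : E₁ → Fin n) (i' j' : E → Fin n),
      (∏ e, w (Sum.elim i i' e) (Sum.elim j j' e)) * ∏ v, optTensor T F v
        (idxAt (glueEnd s₁ ε src α) (Sum.elim i i') v)
        (idxAt (glueEnd t₁ δ tgt β) (Sum.elim j j') v) =
      (∏ e, w (i e) (j e)) * (∏ v : V₁, T (idxAt s₁ i (some v)) (idxAt t₁ j (some v))) *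
        ((∏ e, w (i' e) (j' e)) * ∏ x, optTensor T F x
          (idxAt src i' x + idxAt α (fun k => i (ε k)) x)
          (idxAt tgt j' x + idxAt β (fun k => j (δ k)) x)) := by
    intro i j i' j'
    have h1 := idxAt_glueEnd_inr hε src α (Sum.elim i i')
    have h2 := idxAt_glueEnd_inr hδ tgt β (Sum.elim j j')
    have h10 := h1 none
    have h20 := h2 none
    have h1s := fun v => h1 (some v)
    have h2s := fun v => h2 (some v)
    simp only [Option.map] at h10 h20 h1s h2s
    rw [Fintype.prod_sum_type, Fintype.prod_option, Fintype.prod_sum_type, Fintype.prod_option]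
    simp only [h10, h20, h1s, h2s, idxAt_glueEnd_inl hε, idxAt_glueEnd_inl hδ, Sum.elim_inl,
      Sum.elim_inr, optTensor, Option.elim]
    ring
  unfold legGev gev
  rw [hsum]
  refine Finset.sum_congr rfl fun i _ => ?_
  simp only [hsum (fun j => _ * _), hterm]
  rw [Finset.sum_comm]
  refine Finset.sum_congr rfl fun j _ => ?_
  simp only [Finset.mul_sum]

theorem exists_pointedGraph_eval (src tgt : E → Option V)
    (hs : ∀ v : V, 1 ≤ (edgesAt tgt (some v)).card ∧ 1 ≤ (edgesAt src (some v)).card ∧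
      3 ≤ (edgesAt tgt (some v)).card + (edgesAt src (some v)).card) :
    ∃ G : PointedGraph, G.IsSemistable ∧ ∀ (n : ℕ) (X : KahlerChart n) f z,
      G.eval X f z = gev src tgt (fun i j => X.gInv i j z)
        (optTensor (fun I J => X.gJet I J z) fun I J => fJet I J f z) := by
  set P : Option V ≃ Option (Fin (Fintype.card V)) := Equiv.optionCongr (Fintype.equivFin V)
  set Q : E ≃ Fin (Fintype.card E) := Fintype.equivFin E
  refine ⟨⟨Fintype.card V, Fintype.card E, fun e => P (src (Q.symm e)),
    fun e => P (tgt (Q.symm e))⟩, fun v => ?_, fun n X f z => ?_⟩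
  · obtain ⟨v, rfl⟩ := (Fintype.equivFin V).surjective v
    have h : ∀ s : E → Option V, (edgesAt (fun e => P (s (Q.symm e))) (P (some v))).card =
        (edgesAt s (some v)).card := fun s => by
      rw [← card_idxAt (fun e => P (s (Q.symm e))) (fun _ => (0 : Fin 1)),
        idxAt_reindex P Q (s := s) (fun e => by simp), card_idxAt]
    have := hs v
    rw [← h src, ← h tgt] at this
    exact this
  · rw [PointedGraph.eval_eq_gev]
    refine gev_reindex P Q (fun e => by simp) (fun e => by simp) _ fun x => ?_
    cases x <;> rfl

theorem op_mem_span {G : PointedGraph} (hG : G.IsSemistable) :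
    G.op ∈ Submodule.span ℂ (PGraph.op '' {Z | Z.IsSemistable}) :=
  Submodule.subset_span ⟨⟦G⟧, hG.of_iso (PointedGraph.Iso.nonempty_symm
    (PointedGraph.out_mk G)).some, PointedGraph.op_of_iso (PointedGraph.out_mk G)⟩

/-- Gluing is linear in the inner tensor. In a glued graph the vertices of `G` keep their degrees
and those of the inner graph count their legs as half-edges, so semistability is inherited. -/
theorem LegSpan.exists_glue {G : PointedGraph} (hG : G.IsSemistable) {ε : Fin p ↪ Fin G.nE}
    {δ : Fin q ↪ Fin G.nE} (hε : ∀ e, G.src e = none ↔ e ∈ Set.range ε)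
    (hδ : ∀ e, G.tgt e = none ↔ e ∈ Set.range δ) {τ : LegTensor p q} (hτ : LegSpan p q τ) :
    ∃ P ∈ Submodule.span ℂ (PGraph.op '' {Z | Z.IsSemistable}),
      ∀ (n : ℕ) (X : KahlerChart n) (f : X.smooth), ∀ z ∈ X.U, (P n X f).1 z =
        ∑ i : Fin G.nE → Fin n, ∑ j : Fin G.nE → Fin n, (∏ e, X.gInv (i e) (j e) z) *
        (∏ v : Fin G.nV, X.gJet (idxAt G.src i (some v)) (idxAt G.tgt j (some v)) z) *
        τ n X f.1 z (fun k => i (ε k)) (fun k => j (δ k)) := by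
  induction hτ with
  | zero h0 =>
    refine ⟨0, zero_mem _, fun n X f z hz => ?_⟩
    simp only [h0 n X f.1 f.2.1 z hz, mul_zero, Finset.sum_const_zero]
    rfl
  | cons c V E src tgt α β hs hσ h0 ih =>
    obtain ⟨P, hP, hPe⟩ := ih
    have hdeg : ∀ (p : ℕ) (s₁ : Fin G.nE → Option (Fin G.nV)) (ε : Fin p ↪ Fin G.nE)
        (hε : ∀ e, s₁ e = none ↔ e ∈ Set.range ε) (s : E → Option V) (α : Fin p → Option V),
        (∀ v, (edgesAt (glueEnd s₁ ε s α) (some (Sum.inl v))).card =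
          (edgesAt s₁ (some v)).card) ∧
        ∀ v, (edgesAt (glueEnd s₁ ε s α) (some (Sum.inr v))).card = legDeg s α (some v) := by
      intro p s₁ ε hε s α
      constructor
      · intro v
        rw [← card_idxAt _ (fun _ => (0 : Fin 1)), idxAt_glueEnd_inl hε, card_idxAt]
      · intro v
        rw [← card_idxAt _ (fun _ => (0 : Fin 1))]
        exact (congrArg _ (idxAt_glueEnd_inr hε s α (fun _ => (0 : Fin 1)) (some v))).trans
          (card_idxAt_add _ _ _ _ _)
    obtain ⟨H, hH, hHe⟩ := exists_pointedGraph_eval (glueEnd G.src ε src α)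
      (glueEnd G.tgt δ tgt β) (fun v => by
        cases v with
        | inl v =>
          rw [(hdeg _ _ ε hε src α).1, (hdeg _ _ δ hδ tgt β).1]
          exact hG v
        | inr v =>
          rw [(hdeg _ _ ε hε src α).2, (hdeg _ _ δ hδ tgt β).2]
          exact hs v)
    refine ⟨c • H.op + P, add_mem (Submodule.smul_mem _ c (op_mem_span hH)) hP,
      fun n X f z hz => ?_⟩
    have h1 : ((c • H.op + P : Op) n X f).1 z = c * (H.op n X f).1 z + (P n X f).1 z := rfl
    rw [h1, H.op_apply X f hz, hHe, hPe n X f z hz, gev_glueEnd hε hδ, Finset.mul_sum,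
      ← Finset.sum_add_distrib]
    refine Finset.sum_congr rfl fun i _ => ?_
    rw [Finset.mul_sum, ← Finset.sum_add_distrib]
    refine Finset.sum_congr rfl fun j _ => ?_
    rw [h0 n X f.1 f.2.1 z hz, legEval]
    ring

theorem exists_enum (s : E₁ → Option V₁) :
    ∃ (p : ℕ) (ε : Fin p ↪ E₁), (∀ e, s e = none ↔ e ∈ Set.range ε) ∧
      ∀ {n : ℕ} (i : E₁ → Fin n), (Finset.univ.val.map fun k => i (ε k)) = idxAt s i none := by
  set A := edgesAt s none
  refine ⟨A.card, A.equivFin.symm.toEmbedding.trans (Function.Embedding.subtype _),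
    fun e => ?_, fun i => ?_⟩
  · constructor
    · intro h
      exact ⟨A.equivFin ⟨e, mem_edgesAt.2 h⟩, by simp⟩
    · rintro ⟨k, rfl⟩
      exact mem_edgesAt.1 (A.equivFin.symm k).2
  · have h : (Finset.univ : Finset (Fin A.card)).map
        (A.equivFin.symm.toEmbedding.trans (Function.Embedding.subtype _)) = A := by
      ext e
      simp only [Finset.mem_map, Finset.mem_univ, true_and]
      constructor
      · rintro ⟨k, rfl⟩
        exact (A.equivFin.symm k).2
      · intro h
        exact ⟨A.equivFin ⟨e, h⟩, by simp⟩
    have h2 := congrArg (fun B : Finset E₁ => B.val.map i) h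
    simp only [Finset.map_val, Multiset.map_map] at h2
    exact h2

/-- In the composite the distinguished vertex of `G` carries a jet of the expression of `H`. By
`legSpan_fJet_eval` this jet is a combination of semistable graphs with legs, which are glued in. -/
theorem op_mul_op_mem_span {G H : PointedGraph} (hG : G.IsSemistable) (hH : H.IsSemistable) :
    G.op * H.op ∈ Submodule.span ℂ (PGraph.op '' {Z | Z.IsSemistable}) := by
  obtain ⟨p, ε, hε, hε'⟩ := exists_enum G.src
  obtain ⟨q, δ, hδ, hδ'⟩ := exists_enum G.tgt
  obtain ⟨P, hP, hPe⟩ := (legSpan_fJet_eval hH p q).exists_glue hG hε hδ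
  convert hP using 1
  funext n X
  refine LinearMap.ext fun f => Subtype.ext (funext fun z => ?_)
  by_cases hz : z ∈ X.U
  · rw [hPe n X f z hz]
    change (G.op n X (H.op n X f)).1 z = _
    rw [G.op_apply X _ hz]
    unfold PointedGraph.eval
    refine Finset.sum_congr rfl fun i _ => Finset.sum_congr rfl fun j _ => ?_
    congr 1
    rw [hε', hδ']
    exact fJet_eqOn X.isOpen (fun w hw => H.op_apply X f hw) _ _ hz
  · rw [(P n X f).2.2 z hz]
    exact ((G.op * H.op : Op) n X f).2.2 z hz

theorem mul_mem_span_op {P Q : Op} (hP : P ∈ Submodule.span ℂ (PGraph.op '' {Z | Z.IsSemistable}))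
    (hQ : Q ∈ Submodule.span ℂ (PGraph.op '' {Z | Z.IsSemistable})) :
    P * Q ∈ Submodule.span ℂ (PGraph.op '' {Z | Z.IsSemistable}) := by
  refine Submodule.span_induction₂ (p := fun P Q _ _ =>
    P * Q ∈ Submodule.span ℂ (PGraph.op '' {Z | Z.IsSemistable})) ?_ ?_ ?_ ?_ ?_ ?_ ?_ hP hQ
  · rintro _ _ ⟨Z, hZ, rfl⟩ ⟨Z', hZ', rfl⟩
    exact op_mul_op_mem_span hZ hZ'
  · intro Q _
    rw [zero_mul]
    exact zero_mem _
  · intro P _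
    rw [mul_zero]
    exact zero_mem _
  · intro P P' Q _ _ _ h h'
    rw [add_mul]
    exact add_mem h h'
  · intro P Q Q' _ _ _ h h'
    rw [mul_add]
    exact add_mem h h'
  · intro r P Q _ _ h
    rw [smul_mul_assoc]
    exact Submodule.smul_mem _ r h
  · intro r P Q _ _ h
    rw [mul_smul_comm]
    exact Submodule.smul_mem _ r h

end glue

/-! ## Coefficients with respect to semistable graphs -/

/-- Semistable pointed graphs, up to isomorphism. -/
abbrev SemistableGraph : Type := {Z : PGraph // Z.IsSemistable}

/-- The coefficient of a graph in its signed operator. -/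
def PGraph.sign (Z : PGraph) : ℂ := (-1) ^ Z.numV / (Z.autCard : ℂ)

theorem PGraph.sign_ne_zero (Z : PGraph) : Z.sign ≠ 0 := by
  have h : (Z.autCard : ℂ) ≠ 0 := Nat.cast_ne_zero.2 (PointedGraph.autCard_pos _).ne'
  exact div_ne_zero (pow_ne_zero _ (by norm_num)) h

theorem PGraph.StabilizesTo.unique {Z Γ Γ' : PGraph} (hZ : Z.IsSemistable)
    (h : Z.StabilizesTo Γ) (h' : Z.StabilizesTo Γ') : Γ = Γ' :=
  Quotient.out_equiv_out.1 (PointedGraph.StabilizesTo.unique hZ h h')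

theorem PGraph.IsStable.isSemistable {Z : PGraph} (h : Z.IsStable) : Z.IsSemistable :=
  PointedGraph.IsStable.isSemistable h

theorem PGraph.IsStable.stabilizesTo {Z : PGraph} (h : Z.IsStable) : Z.StabilizesTo Z :=
  PointedGraph.StabilizesTo.refl h

def StableGraph.toStabilizable (Γ : StableGraph) : StabilizableGraph :=
  ⟨Γ.1, Γ.2.isSemistable, Γ.1, Γ.2.stabilizesTo⟩

def StabilizableGraph.toSemistable (Z : StabilizableGraph) : SemistableGraph := ⟨Z.1, Z.2.1⟩

theorem StabilizableGraph.toSemistable_injective :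
    Function.Injective StabilizableGraph.toSemistable := fun _ _ h =>
  Subtype.ext (congrArg (fun Z : SemistableGraph => Z.1) h)

theorem StableGraph.toStabilizable_injective :
    Function.Injective StableGraph.toStabilizable := fun _ _ h =>
  Subtype.ext (congrArg (fun Z : StabilizableGraph => Z.1) h)

/-- The linear combination of the operators of semistable graphs with given coefficients. -/
def ofCoeff : (SemistableGraph →₀ ℂ) →ₗ[ℂ] Op :=
  Finsupp.linearCombination ℂ fun Z : SemistableGraph => Z.1.op

theorem ofCoeff_injective : Function.Injective ofCoeff := linearIndependent_op

theorem ofCoeff_single (Z : SemistableGraph) (x : ℂ) :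
    ofCoeff (Finsupp.single Z x) = x • Z.1.op := Finsupp.linearCombination_single _ _ _

/-- The coefficients of a linear combination of signed operators. -/
def signedCoeff : (StabilizableGraph →₀ ℂ) →ₗ[ℂ] (SemistableGraph →₀ ℂ) :=
  Finsupp.linearCombination ℂ fun Z : StabilizableGraph => Finsupp.single Z.toSemistable Z.1.sign

theorem ofCoeff_signedCoeff (c : StabilizableGraph →₀ ℂ) : ofCoeff (signedCoeff c) = graphSum c := by
  rw [graphSum_eq, signedCoeff, Finsupp.linearCombination_apply, Finsupp.sum, map_sum]
  refine Finset.sum_congr rfl fun Z _ => ?_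
  rw [map_smul, ofCoeff_single]
  rfl

theorem signedCoeff_apply (c : StabilizableGraph →₀ ℂ) (Z : StabilizableGraph) :
    signedCoeff c Z.toSemistable = c Z * Z.1.sign := by
  induction c using Finsupp.induction_linear with
  | zero => simp
  | add c c' h h' => rw [map_add, Finsupp.add_apply, h, h', Finsupp.add_apply, add_mul]
  | single Z' x =>
    classical
    rw [signedCoeff, Finsupp.linearCombination_single, Finsupp.smul_apply, Finsupp.single_apply,
      Finsupp.single_apply]
    by_cases h : Z' = Z
    · rw [if_pos h, if_pos (congrArg _ h), h, smul_eq_mul]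
    · rw [if_neg h, if_neg fun h' => h (StabilizableGraph.toSemistable_injective h'), smul_zero,
        zero_mul]

/-- The normalization of `stableOp`. -/
def StableGraph.norm (Γ : StableGraph) : ℂ := (-1) ^ Γ.1.numV * (Γ.1.autCard : ℂ)

/-- In other words, the coefficient of `Γ` in its own operator `stableOp Γ` is 1. -/
theorem StableGraph.norm_mul_sign (Γ : StableGraph) : Γ.norm * Γ.1.sign = 1 := by
  have h : (Γ.1.autCard : ℂ) ≠ 0 := Nat.cast_ne_zero.2 (PointedGraph.autCard_pos _).ne'
  have h2 : ((-1 : ℂ) ^ Γ.1.numV) * (-1) ^ Γ.1.numV = 1 := by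
    rw [← mul_pow]
    norm_num
  rw [StableGraph.norm, PGraph.sign, mul_assoc, mul_div_cancel₀ _ h, h2]

/-- The coefficients on the stabilizable graphs of a linear combination of the `stableOp Γ`,
up to signs and automorphisms. -/
def fiberCoeff : (StableGraph →₀ ℂ) →ₗ[ℂ] (StabilizableGraph →₀ ℂ) :=
  Finsupp.linearCombination ℂ fun Γ : StableGraph =>
    ∑ Z ∈ (finite_stabFiber Γ).toFinset, Finsupp.single Z Γ.norm

/-- The stabilization is unique, so only one term of the combination reaches `Z`. -/
theorem fiberCoeff_apply (a : StableGraph →₀ ℂ) {Z : StabilizableGraph} {Γ : StableGraph}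
    (hZ : Z ∈ stabFiber Γ) : fiberCoeff a Z = a Γ * Γ.norm := by
  induction a using Finsupp.induction_linear with
  | zero => simp
  | add c c' h h' => rw [map_add, Finsupp.add_apply, h, h', Finsupp.add_apply, add_mul]
  | single Γ' x =>
    classical
    rw [fiberCoeff, Finsupp.linearCombination_single, Finsupp.smul_apply, Finsupp.finsetSum_apply]
    simp only [Finsupp.single_apply, Finset.sum_ite_eq', Set.Finite.mem_toFinset, smul_eq_mul]
    by_cases h : Γ' = Γ
    · rw [if_pos h, h, if_pos hZ]
    · rw [if_neg h, if_neg, mul_zero, zero_mul]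
      exact fun h' => h (Subtype.ext (PGraph.StabilizesTo.unique Z.2.1 h' hZ))

theorem ofCoeff_fiberCoeff (a : StableGraph →₀ ℂ) :
    ofCoeff (signedCoeff (fiberCoeff a)) = Finsupp.linearCombination ℂ stableOp a := by
  induction a using Finsupp.induction_linear with
  | zero => simp
  | add c c' h h' => rw [map_add, map_add, map_add, h, h', map_add]
  | single Γ x =>
    rw [Finsupp.linearCombination_single, fiberCoeff, Finsupp.linearCombination_single, map_smul,
      map_smul, stableOp_eq, map_sum, map_sum]
    refine congrArg (x • ·) ?_
    rw [Finset.smul_sum]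
    refine Finset.sum_congr rfl fun Z _ => ?_
    rw [signedCoeff, Finsupp.linearCombination_single, map_smul, ofCoeff_single]
    rfl

/-! ## The algebra of covariant operators -/

theorem IsCovariant.mul {P Q : Op} (hP : IsCovariant P) (hQ : IsCovariant Q) :
    IsCovariant (P * Q) := fun n X Y φ ψ H f h hh z hz =>
  hP n X Y φ ψ H (Q n Y f) (Q n X h) (fun w hw => hQ n X Y φ ψ H f h hh w hw) z hz

theorem isCovariant_one : IsCovariant 1 := fun _ _ _ _ _ _ _ _ hh z hz => hh z hz

/-- The identity is the operator of the graph with the distinguished vertex only and no edges. -/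
theorem one_mem_span_op : (1 : Op) ∈ Submodule.span ℂ (PGraph.op '' {Z | Z.IsSemistable}) := by
  have h := op_mem_span (G := ⟨0, 0, Fin.elim0, Fin.elim0⟩) fun v => v.elim0
  convert h using 1
  funext n X
  refine LinearMap.ext fun f => Subtype.ext (funext fun z => ?_)
  by_cases hz : z ∈ X.U
  · rw [PointedGraph.op_apply _ X f hz]
    change f.1 z = _
    simp [PointedGraph.eval, PointedGraph.outIdx, PointedGraph.inIdx]
  · exact (f.2.2 z hz).trans ((PointedGraph.op _ n X f).2.2 z hz).symm

/-- The algebra of covariant differential operators. -/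
def covariantAlgebra : Subalgebra ℂ Op :=
  covariantOps.toSubalgebra ⟨one_mem_span_op, isCovariant_one⟩
    fun _ _ hP hQ => ⟨mul_mem_span_op hP.1 hQ.1, hP.2.mul hQ.2⟩

theorem ofCoeff_mem_span (m : SemistableGraph →₀ ℂ) :
    ofCoeff m ∈ Submodule.span ℂ (PGraph.op '' {Z | Z.IsSemistable}) := by
  rw [ofCoeff, Finsupp.linearCombination_apply]
  exact Submodule.sum_mem _ fun Z _ => Submodule.smul_mem _ _
    (Submodule.subset_span ⟨Z.1, Z.2, rfl⟩)

theorem exists_ofCoeff {P : Op} (hP : P ∈ Submodule.span ℂ (PGraph.op '' {Z | Z.IsSemistable})) :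
    ∃ m, ofCoeff m = P := by
  induction hP using Submodule.span_induction with
  | mem P hP =>
    obtain ⟨Z, hZ, rfl⟩ := hP
    exact ⟨Finsupp.single ⟨Z, hZ⟩ 1, by rw [ofCoeff_single, one_smul]⟩
  | zero => exact ⟨0, map_zero _⟩
  | add P Q _ _ h h' =>
    obtain ⟨m, rfl⟩ := h
    obtain ⟨m', rfl⟩ := h'
    exact ⟨m + m', map_add _ _ _⟩
  | smul r P _ h =>
    obtain ⟨m, rfl⟩ := h
    exact ⟨r • m, map_smul _ _ _⟩

theorem stableOp_mem_covariantOps (Γ : StableGraph) : stableOp Γ ∈ covariantOps := by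
  refine ⟨?_, isCovariant_stableOp Γ⟩
  have h := ofCoeff_fiberCoeff (Finsupp.single Γ 1)
  rw [Finsupp.linearCombination_single, one_smul] at h
  rw [← h]
  exact ofCoeff_mem_span _

theorem linearCombination_stableOp_mem (a : StableGraph →₀ ℂ) :
    Finsupp.linearCombination ℂ stableOp a ∈ covariantOps := by
  rw [Finsupp.linearCombination_apply]
  exact Submodule.sum_mem _ fun Γ _ => Submodule.smul_mem _ _ (stableOp_mem_covariantOps Γ)

/-- A covariant operator is determined by its coefficients on the stable graphs. -/
theorem eq_zero_of_isCovariant_ofCoeff {m : SemistableGraph →₀ ℂ} (h : IsCovariant (ofCoeff m))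
    (hm : ∀ Z : SemistableGraph, Z.1.IsStable → m Z = 0) : ofCoeff m = 0 := by
  funext n X
  refine LinearMap.ext fun f => Subtype.ext (funext fun z => ?_)
  by_cases hz : z ∈ X.U
  · have h1 := eval_eq_zero_of_isCovariant h m.support m
      (Finsupp.linearCombination_apply _ _) (fun Z _ hZ => hm Z hZ) X f hz
    have h2 : evalOp X f z (ofCoeff m) = 0 := by
      rw [← h1, ofCoeff, Finsupp.linearCombination_apply, Finsupp.sum, map_sum]
      refine Finset.sum_congr rfl fun Z _ => ?_
      rw [map_smul, smul_eq_mul]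
      exact congrArg _ (PointedGraph.op_apply _ X f hz)
    exact h2
  · exact (ofCoeff m n X f).2.2 z hz

/-- The coefficients are those of `P` on the stable graphs. The difference is covariant and has no
stable terms, hence vanishes. -/
theorem exists_linearCombination_stableOp {P : Op} (hP : P ∈ covariantOps) :
    ∃ a, Finsupp.linearCombination ℂ stableOp a = P := by
  obtain ⟨m, rfl⟩ := exists_ofCoeff hP.1
  have hinj : Function.Injective fun Γ : StableGraph => Γ.toStabilizable.toSemistable :=
    StabilizableGraph.toSemistable_injective.comp StableGraph.toStabilizable_injective
  set a : StableGraph →₀ ℂ := Finsupp.comapDomain _ m hinj.injOn with ha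
  refine ⟨a, ?_⟩
  have h1 : ofCoeff (m + (-1 : ℂ) • signedCoeff (fiberCoeff a)) =
      ofCoeff m + (-1 : ℂ) • Finsupp.linearCombination ℂ stableOp a := by
    rw [← ofCoeff_fiberCoeff, map_add, map_smul]
  have h2 := covariantOps.add_mem hP
    (covariantOps.smul_mem (-1) (linearCombination_stableOp_mem a))
  rw [← h1] at h2
  have h3 := eq_zero_of_isCovariant_ofCoeff h2.2 fun Z hZ => by
    have h4 := signedCoeff_apply (fiberCoeff a) (StableGraph.toStabilizable ⟨Z.1, hZ⟩)
    rw [fiberCoeff_apply a (Γ := ⟨Z.1, hZ⟩) hZ.stabilizesTo, mul_assoc] at h4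
    have h5 : signedCoeff (fiberCoeff a) Z = m Z :=
      h4.trans ((congrArg _ (StableGraph.norm_mul_sign ⟨Z.1, hZ⟩)).trans (mul_one _))
    rw [Finsupp.add_apply, Finsupp.smul_apply, h5, neg_one_smul, add_neg_cancel]
  rw [h1] at h3
  funext n X
  refine LinearMap.ext fun f => Subtype.ext (funext fun z => ?_)
  have h4 : (ofCoeff m n X f).1 z +
      (-1) * (Finsupp.linearCombination ℂ stableOp a n X f).1 z = 0 :=
    congrArg (evalOp X f z) h3
  linear_combination -h4

theorem linearCombination_stableOp_injective :
    Function.Injective (Finsupp.linearCombination ℂ stableOp) := by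
  intro a a' h
  rw [← ofCoeff_fiberCoeff, ← ofCoeff_fiberCoeff] at h
  have h1 := ofCoeff_injective h
  have key : ∀ (a : StableGraph →₀ ℂ) (Γ : StableGraph),
      signedCoeff (fiberCoeff a) Γ.toStabilizable.toSemistable = a Γ := fun a Γ => by
    rw [signedCoeff_apply, fiberCoeff_apply a (Γ := Γ) Γ.2.stabilizesTo, mul_assoc]
    exact (congrArg _ Γ.norm_mul_sign).trans (mul_one _)
  ext Γ
  rw [← key a, ← key a', h1]

/-- A covariant sum is a combination of the `stableOp Γ`, and by linear independence of the graph
operators its coefficients can be compared one by one. Conversely, a function constant on the fibres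
comes from its values on the stable graphs. -/
theorem isCovariant_graphSum_iff (c : StabilizableGraph →₀ ℂ) :
    IsCovariant (graphSum c) ↔ ∀ Z₁ Z₂ : StabilizableGraph,
      (∃ Γ : StableGraph, Z₁ ∈ stabFiber Γ ∧ Z₂ ∈ stabFiber Γ) → c Z₁ = c Z₂ := by
  constructor
  · rintro h Z₁ Z₂ ⟨Γ, h₁, h₂⟩
    obtain ⟨a, ha⟩ := exists_linearCombination_stableOp (P := graphSum c)
      ⟨by rw [← ofCoeff_signedCoeff]; exact ofCoeff_mem_span _, h⟩
    rw [← ofCoeff_fiberCoeff, ← ofCoeff_signedCoeff] at ha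
    have h1 := ofCoeff_injective ha
    have h2 : ∀ Z ∈ stabFiber Γ, c Z = a Γ * Γ.norm := fun Z hZ => by
      have h3 := DFunLike.congr_fun h1 Z.toSemistable
      rw [signedCoeff_apply, signedCoeff_apply, fiberCoeff_apply a hZ] at h3
      exact (mul_right_cancel₀ (PGraph.sign_ne_zero Z.1) h3).symm
    rw [h2 _ h₁, h2 _ h₂]
  · intro h
    have hfib : ∀ Z : StabilizableGraph, ∃ Γ : StableGraph, Z ∈ stabFiber Γ := fun Z => by
      obtain ⟨Γ, hΓ⟩ := Z.2.2
      exact ⟨⟨Γ, hΓ.1⟩, hΓ⟩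
    have h1 : ∃ a : StableGraph →₀ ℂ, fiberCoeff a = c := by
      classical
      -- A stable graph lies in its own fibre, so the coefficient of `stableOp Γ` is read off at `Γ`
      -- itself, and finiteness of the support is inherited from `c`.
      refine ⟨Finsupp.onFinset ((Finsupp.comapDomain StableGraph.toStabilizable c
        StableGraph.toStabilizable_injective.injOn).support)
        (fun Γ => c Γ.toStabilizable * Γ.1.sign) (fun Γ hΓ => ?_), ?_⟩
      · rw [Finsupp.mem_support_iff, Finsupp.comapDomain_apply]
        exact left_ne_zero_of_mul hΓ
      · ext Z
        obtain ⟨Γ, hΓ⟩ := hfib Z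
        rw [fiberCoeff_apply _ hΓ, Finsupp.onFinset_apply, mul_assoc, mul_comm (PGraph.sign _),
          StableGraph.norm_mul_sign, mul_one]
        exact h _ _ ⟨Γ, Γ.2.stabilizesTo, hΓ⟩
    obtain ⟨a, rfl⟩ := h1
    rw [← ofCoeff_signedCoeff, ofCoeff_fiberCoeff]
    exact (linearCombination_stableOp_mem a).2

/-- The operators of the stable graphs as elements of the algebra of covariant operators. -/
def stableOpHom : (StableGraph →₀ ℂ) →ₗ[ℂ] covariantAlgebra :=
  (Finsupp.linearCombination ℂ stableOp).codRestrict (Subalgebra.toSubmodule covariantAlgebra)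
    linearCombination_stableOp_mem

/-- The basis of the algebra of covariant operators. -/
def stableBasis : Module.Basis StableGraph ℂ covariantAlgebra :=
  .ofRepr (LinearEquiv.ofBijective stableOpHom
    ⟨fun _ _ h => linearCombination_stableOp_injective (congrArg Subtype.val h), fun P => by
      obtain ⟨a, ha⟩ := exists_linearCombination_stableOp P.2
      exact ⟨a, Subtype.ext ha⟩⟩).symm

theorem coe_stableBasis (Γ : StableGraph) : (stableBasis Γ : Op) = stableOp Γ := by
  rw [stableBasis, Module.Basis.coe_ofRepr]
  change Finsupp.linearCombination ℂ stableOp (Finsupp.single Γ 1) = _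
  rw [Finsupp.linearCombination_single, one_smul]

end

theorem corollary4p7 :
    (∀ c : StabilizableGraph →₀ ℂ,
      IsCovariant (graphSum c) ↔
        ∀ Z₁ Z₂ : StabilizableGraph,
          (∃ Γ : StableGraph, Z₁ ∈ stabFiber Γ ∧ Z₂ ∈ stabFiber Γ) → c Z₁ = c Z₂) ∧
    (∀ Γ : StableGraph, (stabFiber Γ).Finite) ∧
    ∃ R : Subalgebra ℂ Op, Subalgebra.toSubmodule R = covariantOps ∧
      ∃ b : Module.Basis StableGraph ℂ R, ∀ Γ : StableGraph, (b Γ : Op) = stableOp Γ :=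
  ⟨isCovariant_graphSum_iff, finite_stabFiber, covariantAlgebra,
    Submodule.toSubalgebra_toSubmodule _ _ _, stableBasis, coe_stableBasis⟩
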